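/- **Lemma (estimate for $A_{2,T}$).** There is a constant $C>0$ such that the following holds for every $T>0$. Consider on $[0,T]\times\mathbb R^2$ the system $$ \begin{cases} \partial_t\psi+v\cdot\nabla\psi+v_2=0,\\ \partial_t v_1+v\cdot\nabla v_1-\Delta v_1+\partial_1p+\partial_1\partial_2\psi=-\operatorname{div}(\partial_1\psi\,\nabla\psi),\\ \partial_t v_2+v\cdot\nabla v_2-\Delta v_2+\partial_2p+(\Delta+\partial_2^2)\psi=-\operatorname{div}(\partial_2\psi\,\nabla\psi),\\ \operatorname{div}v=0,\qquad (\psi,v)|_{t=0}=(\psi_0,v_0), \end{cases} $$ for real-valued $\psi,p$ and $v=(v_1,v_2)$. Let $(\psi,v,p)$ be a classical solution that is sufficiently smooth in the following sense: the $x$-derivatives of $\psi,v$ up to order $3$ and of $p$ up to order $2$ exist and are continuous on $[0,T]\times\mathbb R^2$, $\partial_t\psi$ and $\partial_t v$ exist at all points of $(0,T)\times\mathbb R^2$, where the evolution equations hold pointwise. Assume that $(\psi,v,\nabla p)\in E^2_T$, that is, $$ \nabla\psi,\,v\in C([0,T];H^2),\quad \nabla p\in C([0,T];H^1),\quad \partial_1\nabla\psi\in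 L^2([0,T];H^1),\quad \nabla v\in L^2([0,T];H^2),\quad \widehat v,\ \widehat{\partial_1\psi}\in L^2([0,T];L^1_\xi). $$ Here $\widehat f(\xi)=\int e^{-ix\cdot\xi}f(x)\,dx$ (extended to $L^2$) and $\|f\|_{H^n}^2=\sum_{|\alpha|\le n}\|\partial^\alpha f\|_{L^2}^2$. Then $$ A_{2,T}\le C\,A_{2,0}+C\,A_{1,T}+C\,A_T^2, $$ where $A_T=A_{1,T}+A_{2,T}$ and $$ A_{1,T}=\|v\|_{L^\infty([0,T];H^2)}+\|\nabla\psi\|_{L^\infty([0,T];H^2)}+\|\nabla v\|_{L^2([0,T];H^2)}+\|\partial_1\nabla\psi\|_{L^2([0,T];H^1)}, $$ $$ A_{2,T}=\|\widehat v\|_{L^2([0,T];L^1_\xi)}+\|\widehat{\partial_1\psi}\|_{L^2([0,T];L^1_\xi)}, $$ $$ A_{2,0}=\|e^{-|\xi|^2t}\,\widehat{\nabla\psi_0}\|_{L^2([0,\infty);L^1_\xi)}+\|e^{-|\xi|^2t}\,\widehat{v_0}\|_{L^2([0,\infty);L^1_\xi)}\in[0,\infty]. $$ In particular $C$ does not depend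 on $T$, on the solution or on the data. -/

import Mathlib

open MeasureTheory Filter Topology
open scoped ENNReal NNReal FourierTransform

noncomputable section

namespace MHD

/-- The plane `ℝ²`; the coordinates `x₁, x₂` are `x 0, x 1`. -/
abbrev Plane : Type := EuclideanSpace ℝ (Fin 2)

/-- The classical partial derivative `∂ᵢ f` (`i = 0` is `∂₁`, `i = 1` is `∂₂`). -/
def pd (i : Fin 2) (f : Plane → ℝ) : Plane → ℝ :=
  fun x => fderiv ℝ f x (EuclideanSpace.single i 1)

/-- The derivative `∂₁ᵃ ∂₂ᵇ f` for the multi-index `α = (a, b)`. -/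
def pdMulti (α : ℕ × ℕ) (f : Plane → ℝ) : Plane → ℝ :=
  (pd 0)^[α.1] ((pd 1)^[α.2] f)

/-- The gradient, as the family of its components. -/
def grad (f : Plane → ℝ) : Fin 2 → Plane → ℝ := fun i => pd i f

/-- The divergence. -/
def divergence (F : Fin 2 → Plane → ℝ) : Plane → ℝ := fun x => ∑ j, pd j (F j) x

/-- The Laplacian. -/
def laplace (f : Plane → ℝ) : Plane → ℝ := fun x => ∑ j, pd j (pd j f) x

/-- The transport term `v · ∇ f`. -/
def advect (v : Fin 2 → Plane → ℝ) (f : Plane → ℝ) : Plane → ℝ :=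
  fun x => ∑ j, v j x * pd j f x

/-- `‖F‖_{Hⁿ} = (∑_{k ≤ n} ∑_{|α| = k} ‖∂^α F‖²_{L²})^{1/2}` for a finite family `F` of `Cⁿ`
functions (a vector or a matrix of functions), with value `∞` if some `∂^α F` is not in `L²`. -/
def sobolevNorm {ι : Type} [Fintype ι] (n : ℕ) (F : ι → Plane → ℝ) : ℝ≥0∞ :=
  (∑ i, ∑ k ∈ Finset.range (n + 1), ∑ α ∈ Finset.HasAntidiagonal.antidiagonal k,
    eLpNorm (pdMulti α (F i)) 2 volume ^ 2) ^ (1 / 2 : ℝ)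

/-- The Fourier transform of a real function in `L²(ℝ²)`, in the normalization
`f̂(ξ) = ∫ e^{-i x·ξ} f(x) dx` (Mathlib's has the kernel `e^{-2π i x·ξ}`), as a function that is
determined up to a null set. -/
def hat (f : Plane → ℝ) : Plane → ℂ :=
  open Classical in
  if h : MemLp (fun x => (f x : ℂ)) 2 (volume : Measure Plane) then
    fun ξ => (𝓕 (h.toLp (fun x => (f x : ℂ))) : Lp ℂ 2 (volume : Measure Plane))
      ((2 * Real.pi)⁻¹ • ξ)
  else 0

/-- `‖w F̂‖_{L¹_ξ}` for a family `F` of functions and a weight `w ≥ 0`, where `|F̂(ξ)|` is the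
Euclidean length of the vector of Fourier transforms. -/
def fourierL1 {ι : Type} [Fintype ι] (w : Plane → ℝ) (F : ι → Plane → ℝ) : ℝ≥0∞ :=
  ∫⁻ ξ, ENNReal.ofReal (w ξ) * (∑ i, ‖hat (F i) ξ‖ₑ ^ 2) ^ (1 / 2 : ℝ)

/-- The norm in `Lᵖ([0,T])` of a `[0,∞]`-valued function of time. -/
def timeNorm (p : ℝ≥0∞) (T : ℝ) (N : ℝ → ℝ≥0∞) : ℝ≥0∞ :=
  eLpNorm N p (volume.restrict (Set.Icc 0 T))

/-- `F ∈ C([0,T]; Hⁿ)`, for families of functions that are `Cⁿ` in space. -/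
def ContSobolev {ι : Type} [Fintype ι] (n : ℕ) (T : ℝ) (F : ℝ → ι → Plane → ℝ) : Prop :=
  ∀ t ∈ Set.Icc (0 : ℝ) T, sobolevNorm n (F t) < ∞ ∧
    Tendsto (fun s => sobolevNorm n (fun i x => F s i x - F t i x)) (𝓝[Set.Icc 0 T] t) (𝓝 0)

/-- On `[0,T] × ℝ²`, the function `f` has classical derivatives up to order `k` in `x`,
and they are continuous in `(t,x)`. -/
def SpaceSmooth (k : ℕ) (T : ℝ) (f : ℝ → Plane → ℝ) : Prop :=
  (∀ t ∈ Set.Icc (0 : ℝ) T, ContDiff ℝ k (f t)) ∧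
    ∀ α : ℕ × ℕ, α.1 + α.2 ≤ k →
      ContinuousOn (fun z : ℝ × Plane => pdMulti α (f z.1) z.2) (Set.Icc 0 T ×ˢ Set.univ)

/-- `(ψ, v, p)` is a classical solution on `[0,T]`, with initial data `(ψ₀, v₀)`, of
`∂ₜψ + v·∇ψ + v₂ = 0`,
`∂ₜv₁ + v·∇v₁ - Δv₁ + ∂₁p + ∂₁∂₂ψ = -div(∂₁ψ ∇ψ)`,
`∂ₜv₂ + v·∇v₂ - Δv₂ + ∂₂p + (Δ + ∂₂²)ψ = -div(∂₂ψ ∇ψ)`, `div v = 0`. -/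
structure IsSolution (T : ℝ) (ψ₀ : Plane → ℝ) (v₀ : Fin 2 → Plane → ℝ)
    (ψ : ℝ → Plane → ℝ) (v : ℝ → Fin 2 → Plane → ℝ) (p : ℝ → Plane → ℝ) : Prop where
  smooth_psi : SpaceSmooth 3 T ψ
  smooth_v : ∀ i, SpaceSmooth 3 T (fun t => v t i)
  smooth_p : SpaceSmooth 2 T p
  eq_psi : ∀ t ∈ Set.Ioo 0 T, ∀ x, ∃ dψ : ℝ, HasDerivAt (fun s => ψ s x) dψ t ∧
    dψ + advect (v t) (ψ t) x + v t 1 x = 0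
  eq_v1 : ∀ t ∈ Set.Ioo 0 T, ∀ x, ∃ dv : ℝ, HasDerivAt (fun s => v s 0 x) dv t ∧
    dv + advect (v t) (v t 0) x - laplace (v t 0) x + pd 0 (p t) x + pd 0 (pd 1 (ψ t)) x
      = - divergence (fun j y => pd 0 (ψ t) y * pd j (ψ t) y) x
  eq_v2 : ∀ t ∈ Set.Ioo 0 T, ∀ x, ∃ dv : ℝ, HasDerivAt (fun s => v s 1 x) dv t ∧
    dv + advect (v t) (v t 1) x - laplace (v t 1) x + pd 1 (p t) x
        + (laplace (ψ t) x + pd 1 (pd 1 (ψ t)) x)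
      = - divergence (fun j y => pd 1 (ψ t) y * pd j (ψ t) y) x
  div_free : ∀ t ∈ Set.Icc 0 T, ∀ x, divergence (v t) x = 0
  init_psi : ψ 0 = ψ₀
  init_v : v 0 = v₀

/-- The matrix `∇v`, as a family of functions. -/
def gradVec (v : Fin 2 → Plane → ℝ) : Fin 2 × Fin 2 → Plane → ℝ := fun ij => pd ij.1 (v ij.2)

/-- The space `E²_T` for `(ψ, v, ∇p)`. -/
structure MemE2 (T : ℝ) (ψ : ℝ → Plane → ℝ) (v : ℝ → Fin 2 → Plane → ℝ)
    (p : ℝ → Plane → ℝ) : Prop where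
  cont_grad_psi : ContSobolev 2 T (fun t => grad (ψ t))
  cont_v : ContSobolev 2 T v
  cont_grad_p : ContSobolev 1 T (fun t => grad (p t))
  sq_psi : timeNorm 2 T (fun t => sobolevNorm 1 (grad (pd 0 (ψ t)))) < ∞
  sq_v : timeNorm 2 T (fun t => sobolevNorm 2 (gradVec (v t))) < ∞
  fourier_v : timeNorm 2 T (fun t => fourierL1 (fun _ => 1) (v t)) < ∞
  fourier_psi : timeNorm 2 T
    (fun t => fourierL1 (fun _ => 1) (fun _ : Unit => pd 0 (ψ t))) < ∞

/-- `A_{1,T}`. -/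
def A1 (T : ℝ) (ψ : ℝ → Plane → ℝ) (v : ℝ → Fin 2 → Plane → ℝ) : ℝ≥0∞ :=
  timeNorm ∞ T (fun t => sobolevNorm 2 (v t))
    + timeNorm ∞ T (fun t => sobolevNorm 2 (grad (ψ t)))
    + timeNorm 2 T (fun t => sobolevNorm 2 (gradVec (v t)))
    + timeNorm 2 T (fun t => sobolevNorm 1 (grad (pd 0 (ψ t))))

/-- `A_{2,T}`. -/
def A2 (T : ℝ) (ψ : ℝ → Plane → ℝ) (v : ℝ → Fin 2 → Plane → ℝ) : ℝ≥0∞ :=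
  timeNorm 2 T (fun t => fourierL1 (fun _ => 1) (v t))
    + timeNorm 2 T (fun t => fourierL1 (fun _ => 1) (fun _ : Unit => pd 0 (ψ t)))

/-- `A_T = A_{1,T} + A_{2,T}`. -/
def AT (T : ℝ) (ψ : ℝ → Plane → ℝ) (v : ℝ → Fin 2 → Plane → ℝ) : ℝ≥0∞ :=
  A1 T ψ v + A2 T ψ v

/-- `A_{2,0}`: the norms of `e^{-|ξ|²t} ∇ψ₀^` and `e^{-|ξ|²t} v₀^` in `L²([0,∞); L¹_ξ)`. -/
def A20 (ψ₀ : Plane → ℝ) (v₀ : Fin 2 → Plane → ℝ) : ℝ≥0∞ :=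
  eLpNorm (fun t : ℝ => fourierL1 (fun ξ => Real.exp (-(‖ξ‖ ^ 2 * t))) (grad ψ₀)) 2
      (volume.restrict (Set.Ici 0))
    + eLpNorm (fun t : ℝ => fourierL1 (fun ξ => Real.exp (-(‖ξ‖ ^ 2 * t))) v₀) 2
      (volume.restrict (Set.Ici 0))

end MHD

end

/-! Write a = ∂₁ψ and q = ∂₂ψ; in the code the coordinates are numbered 0 and 1, so the velocity is
(v0, v1). If A₁ ≥ 1, then A₂ ≤ A_T ≤ A_T² and nothing is to be shown. So let A₁ ≤ 1, which lets
cubic terms be treated as quadratic ones. The frequency plane is cut along |ξ|² = |ξ₁|; `lowRegion`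
is the side |ξ|² ≤ |ξ₁|.

High frequencies. On the complement of `lowRegion` the weight (|ξ| + |ξ|²)⁻² is integrable: near the
origin that set is thin, whereas over a full disc the integral diverges logarithmically.
Cauchy–Schwarz bounds the L¹ norms of the transforms there by first and second derivatives in L²,
hence by A₁ after integration in time (`lintegral_high_le`).

Low frequencies. The linearized system for a and the vorticity has eigenvalues λ± with real part
-|ξ|²/2, modulus |ξ₁| and gap at least |ξ₁|. The obstruction is the source ∂₁∂₂(q²) of the vorticity
equation: A₁ gives no square integrability in time for q, only for ∂₁q = ∂₂a. A change of unknown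
removes it: adding ξ₁ξ₂|ξ|⁻¹ times the transform of q² to |ξ|â absorbs the term into the linear part
(`diag_identity`) at the price of ∂ₜ(q²). By div v = 0 and ∂₁q = ∂₂a, that time derivative is a sum
of divergences and of products with two decaying factors (`GlobalSolution.sq_eq`).

Division by |ξ₁|, which recovers v and a (`diag_recover`), leaves two kinds of source. The first is
|ξ| times products of one factor bounded in time and one square integrable in time; with weight
|ξ|⁻¹ these lie in L²ₜL¹ (`bilinear_estimate`, where only the ∂₁ derivative of the second factor
enters), and an L² maximal regularity estimate handles them (`maximal_regularity`). The second
consists of products with two decaying factors; with weight |ξ|⁻¹ these lie in L¹ₜL¹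
(`bilinear_estimate_deriv`), and Minkowski's inequality suffices, since the heat kernel at frequency
ξ has L²ₜ norm at most |ξ|⁻¹ (`eLpNorm_duhamel_le`). The data enter through e^{-|ξ|²t/2}, which a
dilation of time turns into A_{2,0}. The outcome is `LowSystem.timeNorm_lowPart_le`.

Duhamel's formula is justified weakly: the equations are tested in frequency against bounded
functions supported in `lowRegion`, where |λ±| ≤ 1, and uniqueness follows by Picard iteration
(`ae_eq_duhamel`, `weak_duhamel`). -/

noncomputable section
namespace MHD

/-! ### The Fourier transform on L²: pairing, derivatives, products -/

/-- The bilinear pairing `∫ f g` on `L²`. -/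
def pairL2 : Lp ℂ 2 (volume : Measure Plane) →L[ℂ] Lp ℂ 2 (volume : Measure Plane) →L[ℂ] ℂ :=
  (ContinuousLinearMap.mul ℂ ℂ).lpPairing volume 2 2

lemma pairL2_apply (f g : Lp ℂ 2 (volume : Measure Plane)) : pairL2 f g = ∫ x, f x * g x := by
  simp [pairL2, ContinuousLinearMap.lpPairing_eq_integral]

lemma denseRange_schwartz :
    DenseRange (SchwartzMap.toLpCLM ℝ ℂ 2 (volume : Measure Plane)) :=
  SchwartzMap.denseRange_toLpCLM ENNReal.ofNat_ne_top

lemma continuous_fourier_L2 :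
    Continuous (fun f : Lp ℂ 2 (volume : Measure Plane) => (𝓕 f : Lp ℂ 2 (volume : Measure Plane))) :=
  (Lp.fourierTransformₗᵢ Plane ℂ).continuous

/-- Both sides are continuous in g, and for Schwartz g the identity is the definition of the
transform of a tempered distribution. -/
lemma pairL2_fourier (f g : Lp ℂ 2 (volume : Measure Plane)) :
    pairL2 (𝓕 f) g = pairL2 f (𝓕 g) := by
  refine denseRange_schwartz.induction_on (p := fun g => pairL2 (𝓕 f) g = pairL2 f (𝓕 g)) g ?_ ?_
  · exact isClosed_eq (by fun_prop) ((pairL2 f).continuous.comp continuous_fourier_L2)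
  · intro g
    have h := congrArg (fun T => T g) (Lp.fourier_toTemperedDistribution_eq f)
    simp only [TemperedDistribution.fourier_apply, Lp.toTemperedDistribution_apply] at h
    rw [SchwartzMap.toLpCLM_apply, SchwartzMap.toLp_fourier_eq, pairL2_apply, pairL2_apply]
    have e1 : ∫ x, (𝓕 f : Lp ℂ 2 (volume : Measure Plane)) x * (g.toLp 2 volume) x
        = ∫ x, g x • (𝓕 f : Lp ℂ 2 (volume : Measure Plane)) x := by
      apply integral_congr_ae
      filter_upwards [g.coeFn_toLp 2 volume] with x hx
      rw [hx, smul_eq_mul, mul_comm]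
    have e2 : ∫ x, f x * ((𝓕 g).toLp 2 volume) x = ∫ x, (𝓕 g) x • f x := by
      apply integral_congr_ae
      filter_upwards [(𝓕 g).coeFn_toLp 2 volume] with x hx
      rw [hx, smul_eq_mul, mul_comm]
    rw [e1, e2, h]

/-- The `L²` Fourier transform as a function. -/
def fourierL2 (f : Plane → ℂ) (hf : MemLp f 2 (volume : Measure Plane)) : Plane → ℂ :=
  (𝓕 (hf.toLp f) : Lp ℂ 2 (volume : Measure Plane))

lemma memLp_fourierL2 {f : Plane → ℂ} (hf : MemLp f 2 (volume : Measure Plane)) :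
    MemLp (fourierL2 f hf) 2 volume := Lp.memLp _

lemma eLpNorm_fourierL2 {f : Plane → ℂ} (hf : MemLp f 2 (volume : Measure Plane)) :
    eLpNorm (fourierL2 f hf) 2 volume = eLpNorm f 2 volume := by
  have h := Lp.norm_fourier_eq (hf.toLp f)
  rw [Lp.norm_def, Lp.norm_def, ENNReal.toReal_eq_toReal_iff' (Lp.eLpNorm_ne_top _)
    (Lp.eLpNorm_ne_top _)] at h
  rw [fourierL2, h]
  exact eLpNorm_congr_ae hf.coeFn_toLp

lemma integral_fourierL2_mul {f g : Plane → ℂ} (hf : MemLp f 2 (volume : Measure Plane))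
    (hg : MemLp g 2 (volume : Measure Plane)) :
    ∫ x, fourierL2 f hf x * g x = ∫ x, f x * fourierL2 g hg x := by
  have h := pairL2_fourier (hf.toLp f) (hg.toLp g)
  rw [pairL2_apply, pairL2_apply] at h
  rw [show ∫ x, fourierL2 f hf x * g x = ∫ x, fourierL2 f hf x * (hg.toLp g) x from
    integral_congr_ae (by filter_upwards [hg.coeFn_toLp] with x hx; rw [hx])]
  rw [show ∫ x, f x * fourierL2 g hg x = ∫ x, (hf.toLp f) x * fourierL2 g hg x from
    integral_congr_ae (by filter_upwards [hf.coeFn_toLp] with x hx; rw [hx])]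
  exact h

lemma integral_fourier_mul_of_integrable {f g : Plane → ℂ} (hf : Integrable f) (hg : Integrable g) :
    ∫ x, 𝓕 f x * g x = ∫ x, f x * 𝓕 g x := by
  have := VectorFourier.integral_fourierIntegral_smul_eq_flip (L := innerₗ Plane)
    (e := Real.fourierChar) (μ := volume) (ν := volume) Real.continuous_fourierChar
    continuous_inner hf hg
  rw [flip_innerₗ] at this
  exact this

lemma fourierL2_schwartz (g : SchwartzMap Plane ℂ) :
    fourierL2 g (g.memLp 2 volume) =ᵐ[volume] (𝓕 g : SchwartzMap Plane ℂ) := by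
  have : (g.memLp 2 volume).toLp g = g.toLp 2 volume := rfl
  rw [fourierL2, this, SchwartzMap.toLp_fourier_eq]
  exact (𝓕 g).coeFn_toLp 2 volume

/-- Two locally integrable functions with the same integrals against Schwartz functions agree. -/
lemma ae_eq_of_schwartz {f g : Plane → ℂ} (hf : LocallyIntegrable f) (hg : LocallyIntegrable g)
    (h : ∀ φ : SchwartzMap Plane ℂ, ∫ x, f x * φ x = ∫ x, g x * φ x) : f =ᵐ[volume] g := by
  refine ae_eq_of_integral_contDiff_smul_eq hf hg fun φ hφ hs => ?_
  have h1 : HasCompactSupport (fun x => (φ x : ℂ)) := hs.comp_left (g := fun r : ℝ => (r : ℂ)) rfl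
  have h2 : ContDiff ℝ ((⊤ : ℕ∞) : WithTop ℕ∞) (fun x => (φ x : ℂ)) :=
    Complex.ofRealCLM.contDiff.comp hφ
  have := h (h1.toSchwartzMap h2)
  simp only [HasCompactSupport.toSchwartzMap_toFun, Complex.real_smul] at this ⊢
  simpa [mul_comm] using this

lemma fourierL2_ae_eq {f : Plane → ℂ} (h1 : Integrable f) (hf : MemLp f 2 (volume : Measure Plane)) :
    fourierL2 f hf =ᵐ[volume] 𝓕 f := by
  refine ae_eq_of_schwartz ((memLp_fourierL2 hf).locallyIntegrable (by norm_num)) ?_ fun φ => ?_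
  · exact (VectorFourier.fourierIntegral_continuous Real.continuous_fourierChar
      (L := innerₗ Plane) continuous_inner h1).locallyIntegrable
  · rw [integral_fourierL2_mul hf (φ.memLp 2 volume), integral_fourier_mul_of_integrable h1
      φ.integrable]
    apply integral_congr_ae
    filter_upwards [fourierL2_schwartz φ] with x hx
    rw [hx]; rfl

-- Tested against a Schwartz function φ, the claim is an integration by parts of f against 𝓕φ. It
-- needs only integrability of the products, which holds because all factors lie in L²; no decay of
-- f is required. The minus sign from parts cancels the one in the derivative of 𝓕φ.
open LineDeriv in
lemma fourierL2_fderiv {f f' : Plane → ℂ} (m : Plane)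
    (hf : MemLp f 2 (volume : Measure Plane))
    (hf' : MemLp f' 2 (volume : Measure Plane)) (hd : Differentiable ℝ f)
    (hff' : ∀ x, fderiv ℝ f x m = f' x) :
    fourierL2 f' hf' =ᵐ[volume]
      fun η => (2 * Real.pi * Complex.I * (inner ℝ η m : ℝ)) * fourierL2 f hf η := by
  have hF := memLp_fourierL2 hf
  refine ae_eq_of_schwartz ((memLp_fourierL2 hf').locallyIntegrable (by norm_num)) ?_ fun φ => ?_
  · have h1 := hF.locallyIntegrable (by norm_num)
    have h2 : Continuous fun η : Plane => (2 * Real.pi * Complex.I * (inner ℝ η m : ℝ) : ℂ) := by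
      fun_prop
    rw [locallyIntegrable_iff] at h1 ⊢
    exact fun K hK => (h1 K hK).continuousOn_mul h2.continuousOn hK
  have hg : (inner ℝ · m : Plane → ℝ).HasTemperateGrowth :=
    ((innerSL ℝ).flip m).hasTemperateGrowth
  set θ : SchwartzMap Plane ℂ :=
    (2 * Real.pi * Complex.I) • SchwartzMap.smulLeftCLM ℂ (inner ℝ · m : Plane → ℝ) φ with hθ
  have hθx : ∀ x, θ x = (2 * Real.pi * Complex.I * (inner ℝ x m : ℝ)) * φ x := by
    intro x
    simp [hθ, SchwartzMap.smulLeftCLM_apply_apply hg]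
    ring
  have key : ∀ x, fderiv ℝ (𝓕 φ : SchwartzMap Plane ℂ) x m = -(𝓕 θ : SchwartzMap Plane ℂ) x := by
    intro x
    have h := SchwartzMap.lineDerivOp_fourier_eq φ m
    have h3 : 𝓕 (-(2 * Real.pi * Complex.I) • SchwartzMap.smulLeftCLM ℂ (inner ℝ · m : Plane → ℝ) φ)
      = -(𝓕 θ : SchwartzMap Plane ℂ) := by
      rw [neg_smul, ← hθ]
      exact map_neg (SchwartzMap.fourierTransformCLM ℂ) θ
    rw [h3] at h
    rw [← neg_apply, ← h]
    rfl
  have hφ := (𝓕 φ).memLp 2 (volume : Measure Plane)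
  have hφ' := (𝓕 θ).memLp 2 (volume : Measure Plane)
  have ibp := integral_mul_fderiv_eq_neg_fderiv_mul_of_integrable (μ := (volume : Measure Plane))
    (𝕜 := ℂ) (f := f) (g := (𝓕 φ : SchwartzMap Plane ℂ)) (v := m)
    (by simp only [hff']; exact hf'.integrable_mul hφ)
    (by simp only [key]; exact hf.integrable_mul hφ'.neg)
    (hf.integrable_mul hφ) (fun x _ => hd x) (fun x _ => (𝓕 φ).differentiable x)
  simp only [hff', key] at ibp
  calc ∫ x, fourierL2 f' hf' x * φ x = ∫ x, f' x * (𝓕 φ : SchwartzMap Plane ℂ) x := by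
        rw [integral_fourierL2_mul hf' (φ.memLp 2 volume)]
        apply integral_congr_ae
        filter_upwards [fourierL2_schwartz φ] with x hx
        rw [hx]
    _ = ∫ x, f x * (𝓕 θ : SchwartzMap Plane ℂ) x := by
        rw [eq_neg_of_add_eq_zero_left (neg_eq_iff_add_eq_zero.1 ibp.symm)]
        rw [← integral_neg]; simp
    _ = ∫ x, fourierL2 f hf x * θ x := by
        rw [integral_fourierL2_mul hf (θ.memLp 2 volume)]
        apply integral_congr_ae
        filter_upwards [fourierL2_schwartz θ] with x hx
        rw [hx]
    _ = _ := by
        apply integral_congr_ae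
        filter_upwards with x
        rw [hθx]; ring

/-- A function in `L²` with integrable Fourier transform is almost everywhere bounded. -/
lemma norm_le_integral_fourierL2 {f : Plane → ℂ} (hf : MemLp f 2 (volume : Measure Plane))
    (hi : Integrable (fourierL2 f hf)) :
    ∀ᵐ x, ‖f x‖ ≤ ∫ η, ‖fourierL2 f hf η‖ := by
  -- Every Schwartz function is of the form 𝓕θ, so Fourier inversion for f can be checked by testing
  -- against such functions and moving the transform onto f.
  have h : f =ᵐ[volume] 𝓕⁻ (fourierL2 f hf) := by
    have hc : Continuous (𝓕 (fourierL2 f hf)) := VectorFourier.fourierIntegral_continuous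
      Real.continuous_fourierChar (L := innerₗ Plane) continuous_inner hi
    have hinv : ∀ g : Plane → ℂ, 𝓕⁻ g = fun x => 𝓕 g (-x) := fun g => by
      ext x; exact Real.fourierInv_eq_fourier_neg g x
    refine ae_eq_of_schwartz (hf.locallyIntegrable (by norm_num)) ?_ fun φ => ?_
    · rw [hinv]; exact (hc.comp continuous_neg).locallyIntegrable
    obtain ⟨θ, rfl⟩ : ∃ θ : SchwartzMap Plane ℂ, 𝓕 θ = φ :=
      ⟨𝓕⁻ φ, FourierTransform.fourier_fourierInv_eq φ⟩
    have h1 : ∫ x, f x * (𝓕 θ : SchwartzMap Plane ℂ) x = ∫ x, fourierL2 f hf x * θ x := by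
      rw [integral_fourierL2_mul hf (θ.memLp 2 volume)]
      apply integral_congr_ae
      filter_upwards [fourierL2_schwartz θ] with x hx
      rw [hx]
    rw [h1, hinv]
    have h2 := integral_fourier_mul_of_integrable hi ((𝓕 θ).integrable.comp_neg (μ := volume))
    have h3 : ∀ x, 𝓕 (fun x => (𝓕 θ : SchwartzMap Plane ℂ) (-x)) x = θ x := by
      intro x
      have h4 : (𝓕⁻ (𝓕 θ) : SchwartzMap Plane ℂ) = θ := FourierTransform.fourierInv_fourier_eq θ
      have h5 : 𝓕⁻ ((𝓕 θ : SchwartzMap Plane ℂ) : Plane → ℂ) x = θ x := by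
        rw [← SchwartzMap.fourierInv_coe, h4]
      rw [Real.fourierInv_eq_fourier_comp_neg] at h5
      exact h5
    simp only [h3] at h2
    rw [← h2, ← integral_neg_eq_self]
    simp
  filter_upwards [h] with x hx
  rw [hx, Real.fourierInv_eq]
  refine (norm_integral_le_integral_norm _).trans_eq ?_
  simp

/-- This is Fourier inversion after a reflection and a translation by ξ; the translation produces
the character that makes up the kernel of the transform at ξ in the convolution formula. -/
lemma fourier_fourier_sub (g : SchwartzMap Plane ℂ) (ξ x : Plane) :
    𝓕 (fun η => (𝓕 g : SchwartzMap Plane ℂ) (ξ - η)) x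
      = (Real.fourierChar (-inner ℝ x ξ) : ℂ) * g x := by
  have h4 : (𝓕⁻ (𝓕 g) : SchwartzMap Plane ℂ) = g := FourierTransform.fourierInv_fourier_eq g
  have h5 : 𝓕⁻ ((𝓕 g : SchwartzMap Plane ℂ) : Plane → ℂ) x = g x := by
    rw [← SchwartzMap.fourierInv_coe, h4]
  rw [← h5, Real.fourier_eq, Real.fourierInv_eq, ← integral_const_mul,
    ← integral_sub_left_eq_self _ volume ξ]
  congr 1
  ext η
  rw [Circle.smul_def, Circle.smul_def, smul_eq_mul, smul_eq_mul, sub_sub_cancel, ← mul_assoc,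
    ← Circle.coe_mul, ← AddChar.map_add_eq_mul]
  congr 3
  rw [inner_sub_left, real_inner_comm x ξ]; ring

/-- The Fourier transform of a product of two functions in `L²` is a convolution. -/
lemma fourier_mul_eq {f g : Plane → ℂ} (hf : MemLp f 2 (volume : Measure Plane))
    (hg : MemLp g 2 (volume : Measure Plane)) (ξ : Plane) :
    𝓕 (fun x => f x * g x) ξ = ∫ η, fourierL2 f hf (ξ - η) * fourierL2 g hg η := by
  have hF := memLp_fourierL2 hf
  have hF2 : MemLp (fun η => fourierL2 f hf (ξ - η)) 2 volume :=
    hF.comp_measurePreserving (Measure.measurePreserving_sub_left volume ξ)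
  have hec : Continuous fun x : Plane => (Real.fourierChar (-inner ℝ x ξ) : ℂ) := by fun_prop
  have hF1 : MemLp (fun x => (Real.fourierChar (-inner ℝ x ξ) : ℂ) * f x) 2 volume := by
    refine hf.of_le (hec.aestronglyMeasurable.mul hf.1) (Eventually.of_forall fun x => ?_)
    rw [norm_mul, Circle.norm_coe, one_mul]
  -- The left side is the transform of f·g at ξ, written as a pairing of g with the modulated f.
  -- Continuity in g reduces the identity to Schwartz g, where `fourier_fourier_sub` turns
  -- modulation into translation.
  have key : ∀ g : Lp ℂ 2 (volume : Measure Plane),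
      pairL2 (hF1.toLp _) g = pairL2 (hF2.toLp _) (𝓕 g) := by
    intro g
    refine denseRange_schwartz.induction_on
      (p := fun g => pairL2 (hF1.toLp _) g = pairL2 (hF2.toLp _) (𝓕 g)) g ?_ ?_
    · exact isClosed_eq (by fun_prop)
        ((pairL2 (hF2.toLp _)).continuous.comp continuous_fourier_L2)
    · intro g
      rw [SchwartzMap.toLpCLM_apply, SchwartzMap.toLp_fourier_eq, pairL2_apply, pairL2_apply]
      have hθ : MemLp (fun η => (𝓕 g : SchwartzMap Plane ℂ) (ξ - η)) 2 volume :=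
        ((𝓕 g).memLp 2 volume).comp_measurePreserving (Measure.measurePreserving_sub_left volume ξ)
      have hθ1 : Integrable (fun η => (𝓕 g : SchwartzMap Plane ℂ) (ξ - η)) :=
        (𝓕 g).integrable.comp_sub_left ξ
      have e1 : ∫ x, (hF2.toLp _) x * ((𝓕 g).toLp 2 volume) x
          = ∫ η, fourierL2 f hf η * (𝓕 g : SchwartzMap Plane ℂ) (ξ - η) := by
        rw [← integral_sub_left_eq_self
          (fun η => fourierL2 f hf η * (𝓕 g : SchwartzMap Plane ℂ) (ξ - η)) volume ξ]
        apply integral_congr_ae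
        filter_upwards [(𝓕 g).coeFn_toLp 2 volume, hF2.coeFn_toLp] with x hx hx2
        rw [hx, hx2, sub_sub_cancel]
      rw [e1, integral_fourierL2_mul hf hθ]
      apply integral_congr_ae
      filter_upwards [hF1.coeFn_toLp, g.coeFn_toLp 2 volume, fourierL2_ae_eq hθ1 hθ]
        with x h1 h2 h3
      rw [h1, h2, h3, fourier_fourier_sub]
      ring
  have := key (hg.toLp g)
  rw [pairL2_apply, pairL2_apply] at this
  calc 𝓕 (fun x => f x * g x) ξ = ∫ x, (hF1.toLp _) x * (hg.toLp g) x := by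
        rw [Real.fourier_eq]
        apply integral_congr_ae
        filter_upwards [hF1.coeFn_toLp, hg.coeFn_toLp] with x h1 h2
        rw [h1, h2, Circle.smul_def, smul_eq_mul]; ring
    _ = _ := by
        rw [this]
        apply integral_congr_ae
        filter_upwards [hF2.coeFn_toLp] with x h1
        rw [h1]; rfl

/-! ### The rescaled transform `hat` and the classical transform `fourierInt` -/

lemma finrank_plane : Module.finrank ℝ Plane = 2 := by simp

lemma map_smul_volume {c : ℝ} (hc : c ≠ 0) :
    Measure.map (fun x : Plane => c • x) volume = ENNReal.ofReal ((c ^ 2)⁻¹) • volume := by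
  rw [Measure.map_addHaar_smul volume hc, finrank_plane, abs_of_nonneg (by positivity)]

lemma quasiMeasurePreserving_smul {c : ℝ} (hc : c ≠ 0) :
    Measure.QuasiMeasurePreserving (fun x : Plane => c • x) volume volume := by
  refine ⟨by fun_prop, ?_⟩
  rw [map_smul_volume hc]
  exact Measure.smul_absolutelyContinuous

lemma lintegral_comp_smul {c : ℝ} (hc : c ≠ 0) (f : Plane → ℝ≥0∞) :
    ∫⁻ x, f (c • x) = ENNReal.ofReal ((c ^ 2)⁻¹) * ∫⁻ x, f x := by
  rw [← smul_eq_mul, ← lintegral_smul_measure, ← map_smul_volume hc]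
  exact (lintegral_map_equiv f (Homeomorph.smulOfNeZero c hc).toMeasurableEquiv).symm

lemma two_pi_ne_zero : (2 * Real.pi) ≠ 0 := by positivity

lemma two_pi_inv_ne_zero : (2 * Real.pi)⁻¹ ≠ 0 := by positivity

lemma one_le_two_pi : 1 ≤ 2 * Real.pi := by linarith [Real.pi_gt_three]

lemma eLpNorm_comp_smul {c : ℝ} (hc : 0 < c) (f : Plane → ℂ) :
    eLpNorm (fun x => f (c • x)) 2 volume = ENNReal.ofReal c⁻¹ * eLpNorm f 2 volume := by
  rw [eLpNorm_eq_lintegral_rpow_enorm_toReal (by norm_num) (by norm_num),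
    eLpNorm_eq_lintegral_rpow_enorm_toReal (by norm_num) (by norm_num),
    lintegral_comp_smul hc.ne' (fun x => ‖f x‖ₑ ^ (2 : ℝ≥0∞).toReal),
    ENNReal.mul_rpow_of_nonneg _ _ (by norm_num), ENNReal.ofReal_rpow_of_pos (by positivity)]
  congr 2
  rw [show (1 / ENNReal.toReal 2 : ℝ) = 1 / 2 by norm_num, ← Real.sqrt_eq_rpow,
    Real.sqrt_inv, Real.sqrt_sq hc.le]
  

lemma memLp_complex {f : Plane → ℝ} (hf : MemLp f 2 (volume : Measure Plane)) :
    MemLp (fun x => (f x : ℂ)) 2 (volume : Measure Plane) := hf.ofReal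

lemma integrable_complex {f : Plane → ℝ} (hf : Integrable f) :
    Integrable (fun x => (f x : ℂ)) := hf.ofReal

lemma hat_eq {f : Plane → ℝ} (hf : MemLp f 2 (volume : Measure Plane)) :
    hat f = fun ξ => fourierL2 (fun x => (f x : ℂ)) (memLp_complex hf) ((2 * Real.pi)⁻¹ • ξ) := by
  unfold hat
  rw [dif_pos (memLp_complex hf)]
  rfl

lemma aestronglyMeasurable_hat (f : Plane → ℝ) : AEStronglyMeasurable (hat f) volume := by
  unfold hat
  split_ifs with h
  · exact (Lp.aestronglyMeasurable _).comp_quasiMeasurePreserving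
      (quasiMeasurePreserving_smul two_pi_inv_ne_zero)
  · exact aestronglyMeasurable_zero

lemma eLpNorm_hat {f : Plane → ℝ} (hf : MemLp f 2 (volume : Measure Plane)) :
    eLpNorm (hat f) 2 volume = ENNReal.ofReal (2 * Real.pi) * eLpNorm f 2 volume := by
  rw [hat_eq hf, eLpNorm_comp_smul (by positivity) (fourierL2 _ (memLp_complex hf)), eLpNorm_fourierL2,
    inv_inv]
  congr 1
  exact eLpNorm_congr_norm_ae (by filter_upwards with x; simp)

lemma memLp_hat {f : Plane → ℝ} (hf : MemLp f 2 (volume : Measure Plane)) :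
    MemLp (hat f) 2 volume :=
  ⟨aestronglyMeasurable_hat f, by
    rw [eLpNorm_hat hf]; exact ENNReal.mul_lt_top ENNReal.ofReal_lt_top hf.2⟩

lemma hat_add {f g : Plane → ℝ} (hf : MemLp f 2 (volume : Measure Plane))
    (hg : MemLp g 2 (volume : Measure Plane)) :
    hat (fun x => f x + g x) =ᵐ[volume] fun ξ => hat f ξ + hat g ξ := by
  have hfg : MemLp (fun x => f x + g x) 2 (volume : Measure Plane) := hf.add hg
  have h : (memLp_complex hfg).toLp (fun x => ((f x + g x : ℝ) : ℂ))
      = (memLp_complex hf).toLp _ + (memLp_complex hg).toLp _ := by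
    rw [← MemLp.toLp_add]
    congr 1
    ext x; simp
  rw [hat_eq hf, hat_eq hg, hat_eq hfg]
  have h2 : fourierL2 _ (memLp_complex hfg) =ᵐ[volume]
      fun ξ => fourierL2 _ (memLp_complex hf) ξ + fourierL2 _ (memLp_complex hg) ξ := by
    unfold fourierL2
    rw [h, FourierTransform.fourier_add]
    exact Lp.coeFn_add _ _
  exact (quasiMeasurePreserving_smul two_pi_inv_ne_zero).ae h2

lemma hat_const_mul {f : Plane → ℝ} (c : ℝ) (hf : MemLp f 2 (volume : Measure Plane)) :
    hat (fun x => c * f x) =ᵐ[volume] fun ξ => c * hat f ξ := by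
  have hcf : MemLp (fun x => c * f x) 2 (volume : Measure Plane) := hf.const_mul c
  have h : (memLp_complex hcf).toLp (fun x => ((c * f x : ℝ) : ℂ))
      = (c : ℂ) • (memLp_complex hf).toLp _ := by
    rw [← MemLp.toLp_const_smul]
    congr 1
    ext x; simp
  rw [hat_eq hf, hat_eq hcf]
  have h2 : fourierL2 _ (memLp_complex hcf) =ᵐ[volume]
      fun ξ => (c : ℂ) * fourierL2 _ (memLp_complex hf) ξ := by
    unfold fourierL2
    rw [h, FourierTransform.fourier_smul]
    exact Lp.coeFn_smul _ _
  exact (quasiMeasurePreserving_smul two_pi_inv_ne_zero).ae h2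

lemma hat_neg {f : Plane → ℝ} (hf : MemLp f 2 (volume : Measure Plane)) :
    hat (fun x => -f x) =ᵐ[volume] fun ξ => -hat f ξ := by
  have := hat_const_mul (-1) hf
  simpa using this

lemma hat_sub {f g : Plane → ℝ} (hf : MemLp f 2 (volume : Measure Plane))
    (hg : MemLp g 2 (volume : Measure Plane)) :
    hat (fun x => f x - g x) =ᵐ[volume] fun ξ => hat f ξ - hat g ξ := by
  have h := hat_add hf hg.neg
  have h2 := hat_neg hg
  simp only [Pi.neg_apply, ← sub_eq_add_neg] at h
  filter_upwards [h, h2] with ξ h h2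
  rw [h, sub_eq_add_neg, ← h2]; rfl

lemma fderiv_ofReal_apply {f : Plane → ℝ} {x : Plane} (hd : DifferentiableAt ℝ f x) (m : Plane) :
    fderiv ℝ (fun x => (f x : ℂ)) x m = (fderiv ℝ f x m : ℝ) := by
  have := (Complex.ofRealCLM.hasFDerivAt (x := f x)).comp x hd.hasFDerivAt
  have h2 : HasFDerivAt (fun x => (f x : ℂ)) (Complex.ofRealCLM.comp (fderiv ℝ f x)) x := this
  rw [h2.fderiv]; rfl

lemma hat_pd {f : Plane → ℝ} (i : Fin 2) (hd : Differentiable ℝ f)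
    (hf : MemLp f 2 (volume : Measure Plane)) (hf' : MemLp (pd i f) 2 (volume : Measure Plane)) :
    hat (pd i f) =ᵐ[volume] fun ξ => Complex.I * (ξ i : ℝ) * hat f ξ := by
  rw [hat_eq hf, hat_eq hf']
  have h := fourierL2_fderiv (EuclideanSpace.single i 1) (memLp_complex hf) (memLp_complex hf')
    (Complex.ofRealCLM.differentiable.comp hd) (fun x => fderiv_ofReal_apply (hd x) _)
  filter_upwards [(quasiMeasurePreserving_smul two_pi_inv_ne_zero).ae h] with ξ hξ
  rw [hξ]
  simp [EuclideanSpace.inner_single_right]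
  have : (Real.pi : ℂ) ≠ 0 := by exact_mod_cast Real.pi_ne_zero
  field_simp
  exact Or.inl trivial

/-- The classical Fourier transform, with the kernel `e^{-i x·ξ}`. -/
def fourierInt (f : Plane → ℂ) (ξ : Plane) : ℂ := 𝓕 f ((2 * Real.pi)⁻¹ • ξ)

lemma continuous_fourierInt {f : Plane → ℂ} (hf : Integrable f) : Continuous (fourierInt f) := by
  have : Continuous (𝓕 f) := VectorFourier.fourierIntegral_continuous
      Real.continuous_fourierChar (L := innerₗ Plane) continuous_inner hf
  exact this.comp (continuous_const_smul _)

lemma fourierInt_eq (f : Plane → ℂ) (ξ : Plane) :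
    fourierInt f ξ = ∫ x, Complex.exp (-Complex.I * (inner ℝ x ξ : ℝ)) * f x := by
  rw [fourierInt, Real.fourier_eq']
  congr 1; ext x
  rw [smul_eq_mul]; congr 2
  rw [inner_smul_right]; push_cast
  have : (Real.pi : ℂ) ≠ 0 := by exact_mod_cast Real.pi_ne_zero
  field_simp

lemma enorm_fourierInt_le (f : Plane → ℂ) (ξ : Plane) : ‖fourierInt f ξ‖ₑ ≤ ∫⁻ x, ‖f x‖ₑ := by
  rw [fourierInt_eq]
  refine (enorm_integral_le_lintegral_enorm _).trans (lintegral_mono fun x => ?_)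
  rw [enorm_mul, show Complex.exp (-Complex.I * (inner ℝ x ξ : ℝ))
    = Complex.exp ((-(inner ℝ x ξ) : ℝ) * Complex.I) by push_cast; ring_nf]
  rw [← ofReal_norm, Complex.norm_exp_ofReal_mul_I]; simp

lemma hat_ae_eq_fourierInt {f : Plane → ℝ} (h1 : Integrable f)
    (hf : MemLp f 2 (volume : Measure Plane)) :
    hat f =ᵐ[volume] fourierInt (fun x => (f x : ℂ)) := by
  rw [hat_eq hf]
  exact (quasiMeasurePreserving_smul two_pi_inv_ne_zero).ae (fourierL2_ae_eq (integrable_complex h1) (memLp_complex hf))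

lemma memLp_fourierInt {θ : Plane → ℂ} (h1 : Integrable θ) (h2 : MemLp θ 2 volume) :
    MemLp (fourierInt θ) 2 volume := by
  refine ⟨(continuous_fourierInt h1).aestronglyMeasurable, ?_⟩
  unfold fourierInt
  rw [eLpNorm_comp_smul (by positivity) (𝓕 θ), ← eLpNorm_congr_ae (fourierL2_ae_eq h1 h2)]
  exact ENNReal.mul_lt_top ENNReal.ofReal_lt_top (memLp_fourierL2 h2).2

lemma integral_hat_mul {f : Plane → ℝ} (hf : MemLp f 2 (volume : Measure Plane))
    {θ : Plane → ℂ} (h1 : Integrable θ) (hθ : MemLp θ 2 volume) :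
    ∫ ξ, hat f ξ * θ ξ = ∫ x, f x * fourierInt θ x := by
  have h2 : Integrable (fun η => θ ((2 * Real.pi) • η)) := h1.comp_smul two_pi_ne_zero
  have h3 : MemLp (fun η => θ ((2 * Real.pi) • η)) 2 volume := by
    refine ⟨hθ.1.comp_quasiMeasurePreserving (quasiMeasurePreserving_smul two_pi_ne_zero), ?_⟩
    rw [eLpNorm_comp_smul (by positivity) θ]
    exact ENNReal.mul_lt_top ENNReal.ofReal_lt_top hθ.2
  have h := integral_fourierL2_mul (memLp_complex hf) h3
  have e0 := fourierL2_ae_eq h2 h3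
  have e1 : ∀ x, 𝓕 (fun η => θ ((2 * Real.pi) • η)) x
      = (((2 * Real.pi) ^ 2)⁻¹ : ℝ) * fourierInt θ x := by
    intro x
    rw [fourierInt_eq, Real.fourier_eq']
    have := Measure.integral_comp_smul (volume : Measure Plane)
      (fun ξ => Complex.exp (-Complex.I * (inner ℝ ξ x : ℝ)) * θ ξ) (2 * Real.pi)
    rw [finrank_plane, abs_of_nonneg (by positivity), Complex.real_smul] at this
    rw [← this]
    congr 1; ext η
    rw [inner_smul_left, smul_eq_mul]
    congr 2
    simp; ring
  have e2 := Measure.integral_comp_smul (volume : Measure Plane)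
      (fun ξ => hat f ξ * θ ξ) (2 * Real.pi)
  rw [finrank_plane, abs_of_nonneg (by positivity), Complex.real_smul] at e2
  have e3 : ∀ η, hat f ((2 * Real.pi) • η) = fourierL2 _ (memLp_complex hf) η := by
    intro η
    simp only [hat_eq hf, smul_smul, inv_mul_cancel₀ two_pi_ne_zero, one_smul]
  simp only [e3, h] at e2
  have hne : ((((2 * Real.pi) ^ 2)⁻¹ : ℝ) : ℂ) ≠ 0 := by
    exact_mod_cast inv_ne_zero (pow_ne_zero 2 two_pi_ne_zero)
  apply mul_left_cancel₀ hne
  rw [← e2, ← integral_const_mul]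
  apply integral_congr_ae
  filter_upwards [e0] with x hx
  rw [hx, e1]; ring

/-- The change of variables between the two normalizations has Jacobian (2π)² ≥ 1, which is simply
discarded. -/
lemma lintegral_hat_comp {f : Plane → ℝ} (hf : MemLp f 2 (volume : Measure Plane)) :
    ∫⁻ ξ, ‖fourierL2 _ (memLp_complex hf) ξ‖ₑ ≤ ∫⁻ ξ, ‖hat f ξ‖ₑ := by
  rw [hat_eq hf]
  simp only
  rw [lintegral_comp_smul two_pi_inv_ne_zero (fun η => ‖fourierL2 _ (memLp_complex hf) η‖ₑ)]
  refine le_mul_of_one_le_left' ?_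
  rw [ENNReal.one_le_ofReal, inv_pow, inv_inv]
  nlinarith [one_le_two_pi]

/-- The convolution formula in the present normalization carries a factor (2π)⁻² ≤ 1, which is
dropped. The bound is available at every ξ, since a product of L² functions is integrable and has a
continuous transform. -/
lemma enorm_fourierInt_mul_le {f g : Plane → ℝ} (hf : MemLp f 2 (volume : Measure Plane))
    (hg : MemLp g 2 (volume : Measure Plane)) (ξ : Plane) :
    ‖fourierInt (fun x => ((f x * g x : ℝ) : ℂ)) ξ‖ₑ ≤ ∫⁻ η, ‖hat f (ξ - η)‖ₑ * ‖hat g η‖ₑ := by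
  have h := fourier_mul_eq (memLp_complex hf) (memLp_complex hg) ((2 * Real.pi)⁻¹ • ξ)
  have e : (fun x => ((f x * g x : ℝ) : ℂ)) = fun x => (f x : ℂ) * (g x : ℂ) := by
    ext x; push_cast; rfl
  rw [fourierInt, e, h]
  refine (enorm_integral_le_lintegral_enorm _).trans ?_
  have h2 := lintegral_comp_smul two_pi_inv_ne_zero (fun η =>
    ‖fourierL2 _ (memLp_complex hf) ((2 * Real.pi)⁻¹ • ξ - η)‖ₑ
      * ‖fourierL2 _ (memLp_complex hg) η‖ₑ)
  simp only [hat_eq hf, hat_eq hg, smul_sub, enorm_mul]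
  rw [h2]
  refine le_mul_of_one_le_left' ?_
  rw [ENNReal.one_le_ofReal, inv_pow, inv_inv]
  nlinarith [one_le_two_pi]

/-- Inversion gives the bound almost everywhere; the set where it holds is closed by continuity of f
and dense, hence everything. -/
lemma enorm_le_lintegral_hat {f : Plane → ℝ} (hc : Continuous f)
    (hf : MemLp f 2 (volume : Measure Plane)) (x : Plane) : ‖f x‖ₑ ≤ ∫⁻ ξ, ‖hat f ξ‖ₑ := by
  by_cases htop : ∫⁻ ξ, ‖hat f ξ‖ₑ = ∞
  · rw [htop]; exact le_top
  have hle := lintegral_hat_comp hf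
  have hi : Integrable (fourierL2 _ (memLp_complex hf)) :=
    ⟨(memLp_fourierL2 _).1, lt_of_le_of_lt hle (lt_top_iff_ne_top.2 htop)⟩
  have h := norm_le_integral_fourierL2 (memLp_complex hf) hi
  have h2 : ∀ x, ‖(f x : ℂ)‖ ≤ ∫ η, ‖fourierL2 _ (memLp_complex hf) η‖ := by
    have hd : Dense {x | ‖(f x : ℂ)‖ ≤ ∫ η, ‖fourierL2 _ (memLp_complex hf) η‖} :=
      Measure.dense_of_ae h
    have hcl : IsClosed {x | ‖(f x : ℂ)‖ ≤ ∫ η, ‖fourierL2 _ (memLp_complex hf) η‖} :=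
      isClosed_le (by fun_prop) continuous_const
    intro x
    have := hcl.closure_eq ▸ hd.closure_eq
    exact (this ▸ Set.mem_univ x : x ∈ {x | ‖(f x : ℂ)‖ ≤ _})
  refine le_trans ?_ hle
  rw [← ofReal_integral_norm_eq_lintegral_enorm hi, ← ofReal_norm]
  exact ENNReal.ofReal_le_ofReal (by simpa using h2 x)

/-! ### Radial and one-dimensional integrals -/

lemma lintegral_fun_norm {f : ℝ → ℝ≥0∞} (hf : Measurable f) :
    ∫⁻ x : Plane, f ‖x‖
      = ENNReal.ofReal (2 * Real.pi) * ∫⁻ r in Set.Ioi (0 : ℝ), ENNReal.ofReal r * f r := by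
  have hmp := (volume : Measure Plane).measurePreserving_homeomorphUnitSphereProd
  have hball : (volume : Measure Plane) (Metric.ball 0 1) = ENNReal.ofReal Real.pi := by
    rw [EuclideanSpace.volume_ball_fin_two]; simp
  calc ∫⁻ x : Plane, f ‖x‖
      = ∫⁻ x : ({(0)}ᶜ : Set Plane), f ‖(x : Plane)‖ ∂(volume.comap Subtype.val) := by
        rw [lintegral_subtype_comap (measurableSet_singleton _).compl (fun x : Plane => f ‖x‖),
          restrict_compl_singleton]
    _ = ∫⁻ x, f x.2 ∂(volume : Measure Plane).toSphere.prod
          (.volumeIoiPow (Module.finrank ℝ Plane - 1)) := by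
        rw [← hmp.lintegral_comp_emb (Homeomorph.measurableEmbedding _)]
        simp
    _ = (volume : Measure Plane).toSphere Set.univ *
          ∫⁻ x : Set.Ioi (0 : ℝ), f x ∂.volumeIoiPow (Module.finrank ℝ Plane - 1) := by
        rw [lintegral_prod _ (by fun_prop)]
        simp [mul_comm]
    _ = _ := by
        rw [Measure.toSphere_apply_univ, finrank_plane, hball, Measure.volumeIoiPow,
          lintegral_withDensity_eq_lintegral_mul _ (by fun_prop) (by fun_prop)]
        congr 1
        · rw [ENNReal.ofReal_mul (by norm_num)]; simp
        · simp only [Pi.mul_apply]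
          rw [lintegral_subtype_comap measurableSet_Ioi
            (fun r : ℝ => ENNReal.ofReal (r ^ (2 - 1)) * f r)]
          simp

lemma lintegral_inv_norm_ball (R : ℝ) :
    ∫⁻ x in {x : Plane | ‖x‖ < R}, ENNReal.ofReal ‖x‖⁻¹ = ENNReal.ofReal (2 * Real.pi * R) := by
  have hm : MeasurableSet {x : Plane | ‖x‖ < R} := measurableSet_lt (by fun_prop) (by fun_prop)
  rw [← lintegral_indicator hm]
  have h := lintegral_fun_norm (f := (Set.Iio R).indicator fun r => ENNReal.ofReal r⁻¹)
    ((by fun_prop : Measurable fun r : ℝ => ENNReal.ofReal r⁻¹).indicator measurableSet_Iio)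
  have e1 : ∀ x : Plane, {x : Plane | ‖x‖ < R}.indicator (fun x => ENNReal.ofReal ‖x‖⁻¹) x
      = (Set.Iio R).indicator (fun r => ENNReal.ofReal r⁻¹) ‖x‖ := by
    intro x; simp [Set.indicator]
  simp only [e1]
  rw [h, ENNReal.ofReal_mul (p := 2 * Real.pi) (by positivity)]
  congr 1
  rw [← lintegral_indicator measurableSet_Ioi]
  have e2 : ∀ r : ℝ, (Set.Ioi (0 : ℝ)).indicator (fun r => ENNReal.ofReal r *
      (Set.Iio R).indicator (fun r => ENNReal.ofReal r⁻¹) r) r = (Set.Ioo 0 R).indicator 1 r := by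
    intro r
    by_cases h0 : 0 < r <;> by_cases h1 : r < R <;> simp [Set.indicator, h0, h1]
    exact ENNReal.mul_inv_cancel (by simpa using h0) ENNReal.ofReal_ne_top
  simp only [e2]
  rw [lintegral_indicator_one measurableSet_Ioo, Real.volume_Ioo, sub_zero]

/-- The integrand is r^(-1/2)/R below R and r^(-3/2) above R, and each piece contributes 2R^(-1/2).
This is the integral that remains when a planar kernel restricted to a strip is integrated along the
strip, and also the radial one in `far_kernel_left`. -/
lemma lintegral_rpow_div_max {R : ℝ} (hR : 0 < R) :
    ∫⁻ r in Set.Ioi (0 : ℝ), ENNReal.ofReal (r ^ (-(1 / 2) : ℝ) * (max r R)⁻¹)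
      ≤ ENNReal.ofReal (4 * R ^ (-(1 / 2) : ℝ)) := by
  have hsplit : Set.Ioi (0 : ℝ) = Set.Ioc 0 R ∪ Set.Ioi R := (Set.Ioc_union_Ioi_eq_Ioi hR.le).symm
  rw [hsplit, lintegral_union measurableSet_Ioi
    (Set.disjoint_left.2 fun x hx hx' => not_lt.2 hx.2 hx')]
  have h1 : ∫⁻ r in Set.Ioc 0 R, ENNReal.ofReal (r ^ (-(1 / 2) : ℝ) * (max r R)⁻¹)
      = ENNReal.ofReal (2 * R ^ (-(1 / 2) : ℝ)) := by
    rw [setLIntegral_congr_fun (g := fun r => ENNReal.ofReal (r ^ (-(1 / 2) : ℝ) * R⁻¹))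
      measurableSet_Ioc (fun r hr => by simp only [max_eq_right hr.2])]
    have hi : IntegrableOn (fun r : ℝ => r ^ (-(1 / 2) : ℝ)) (Set.Ioc 0 R) :=
      (intervalIntegrable_iff_integrableOn_Ioc_of_le hR.le).1
        (intervalIntegral.intervalIntegrable_rpow' (by norm_num))
    rw [← ofReal_integral_eq_lintegral_ofReal (hi.mul_const _)
      ((ae_restrict_iff' measurableSet_Ioc).2 (Eventually.of_forall fun r hr => by
        have := hr.1; positivity)), integral_mul_const, ← intervalIntegral.integral_of_le hR.le,
      integral_rpow (Or.inl (by norm_num))]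
    congr 1
    rw [Real.zero_rpow (by norm_num), show (-(1 / 2) + 1 : ℝ) = -(1 / 2) + (1 : ℕ) by norm_num,
      Real.rpow_add_natCast hR.ne']
    field_simp; norm_num
  have h2 : ∫⁻ r in Set.Ioi R, ENNReal.ofReal (r ^ (-(1 / 2) : ℝ) * (max r R)⁻¹)
      = ENNReal.ofReal (2 * R ^ (-(1 / 2) : ℝ)) := by
    rw [setLIntegral_congr_fun (g := fun r => ENNReal.ofReal (r ^ (-(3 / 2) : ℝ)))
      measurableSet_Ioi (fun r hr => by
        have hr0 : 0 < r := hR.trans hr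
        simp only [max_eq_left (le_of_lt (Set.mem_Ioi.1 hr))]
        rw [← Real.rpow_neg_one, ← Real.rpow_add hr0]; norm_num)]
    rw [← ofReal_integral_eq_lintegral_ofReal (integrableOn_Ioi_rpow_of_lt (by norm_num) hR)
      ((ae_restrict_iff' measurableSet_Ioi).2 (Eventually.of_forall fun r hr => by
        have := hR.trans hr; positivity)), integral_Ioi_rpow_of_lt (by norm_num) hR]
    congr 1
    norm_num
    ring
  rw [h1, h2, ← ENNReal.ofReal_add (by positivity) (by positivity)]
  apply ENNReal.ofReal_le_ofReal
  linarith

lemma lintegral_abs_rpow_div_max {R : ℝ} (hR : 0 < R) :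
    ∫⁻ r : ℝ, ENNReal.ofReal (|r| ^ (-(1 / 2) : ℝ) * (max |r| R)⁻¹)
      ≤ ENNReal.ofReal (8 * R ^ (-(1 / 2) : ℝ)) := by
  have h := lintegral_rpow_div_max hR
  have hpos : ∫⁻ r in Set.Ioi (0 : ℝ), ENNReal.ofReal (|r| ^ (-(1 / 2) : ℝ) * (max |r| R)⁻¹)
      = ∫⁻ r in Set.Ioi (0 : ℝ), ENNReal.ofReal (r ^ (-(1 / 2) : ℝ) * (max r R)⁻¹) :=
    setLIntegral_congr_fun measurableSet_Ioi fun r hr => by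
      simp only [abs_of_pos (Set.mem_Ioi.1 hr)]
  have hneg : ∫⁻ r in Set.Iic (0 : ℝ), ENNReal.ofReal (|r| ^ (-(1 / 2) : ℝ) * (max |r| R)⁻¹)
      = ∫⁻ r in Set.Ioi (0 : ℝ), ENNReal.ofReal (|r| ^ (-(1 / 2) : ℝ) * (max |r| R)⁻¹) := by
    rw [setLIntegral_congr Iio_ae_eq_Iic.symm, ← lintegral_indicator measurableSet_Iio,
      ← lintegral_indicator measurableSet_Ioi, ← lintegral_neg_eq_self]
    congr 1; ext r
    simp [Set.indicator]
  rw [← lintegral_add_compl _ measurableSet_Ioi, Set.compl_Ioi, hneg, hpos]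
  calc _ ≤ ENNReal.ofReal (4 * R ^ (-(1 / 2) : ℝ)) + ENNReal.ofReal (4 * R ^ (-(1 / 2) : ℝ)) :=
        add_le_add h h
    _ = _ := by
        rw [← ENNReal.ofReal_add (by positivity) (by positivity)]; congr 1; ring

lemma lintegral_plane (f : ℝ → ℝ → ℝ≥0∞) (hf : Measurable (Function.uncurry f)) :
    ∫⁻ x : Plane, f (x 0) (x 1) = ∫⁻ a : ℝ, ∫⁻ b : ℝ, f a b := by
  have h1 := (volume_preserving_finTwoArrow ℝ).comp (PiLp.volume_preserving_ofLp (Fin 2))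
  have h2 := h1.lintegral_comp hf
  have h3 := lintegral_prod (μ := (volume : Measure ℝ)) (ν := (volume : Measure ℝ))
    (Function.uncurry f) hf.aemeasurable
  rw [← Measure.volume_eq_prod, ← h2] at h3
  exact h3

/-! ### Bilinear estimates with weight |ξ|⁻¹, by Schur's test -/

lemma ae_plane_ne_zero : ∀ᵐ x : Plane, x ≠ 0 :=
  compl_mem_ae_iff.2 (measure_singleton 0)

/-- Schur's test, with the kernel dominated by the geometric mean of two kernels. -/
lemma schur_test {k k1 k2 : Plane → Plane → ℝ≥0∞} {f g : Plane → ℝ≥0∞} {A B : ℝ≥0∞}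
    (hk1 : Measurable (Function.uncurry k1)) (hk2 : Measurable (Function.uncurry k2))
    (hf : Measurable f) (hg : Measurable g)
    (hk : ∀ x y, x ≠ 0 → y ≠ 0 → k x y ^ 2 ≤ k1 x y * k2 x y)
    (h1 : ∀ x, x ≠ 0 → ∫⁻ y, k1 x y ≤ A) (h2 : ∀ y, y ≠ 0 → ∫⁻ x, k2 x y ≤ B) :
    ∫⁻ x, ∫⁻ y, k x y * (f x * g y)
      ≤ (A * B) ^ (1 / 2 : ℝ) * ((∫⁻ x, f x ^ 2) ^ (1 / 2 : ℝ) * (∫⁻ y, g y ^ 2) ^ (1 / 2 : ℝ)) := by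
  -- Cauchy–Schwarz on the product of two planes, with k dominated by k1^(1/2) k2^(1/2): the square
  -- of each factor is first integrated in the variable that its function does not contain.
  set F : Plane × Plane → ℝ≥0∞ := fun z => (k1 z.1 z.2) ^ (1 / 2 : ℝ) * f z.1
  set G : Plane × Plane → ℝ≥0∞ := fun z => (k2 z.1 z.2) ^ (1 / 2 : ℝ) * g z.2
  have hk1' : Measurable fun z : Plane × Plane => k1 z.1 z.2 := hk1
  have hk2' : Measurable fun z : Plane × Plane => k2 z.1 z.2 := hk2
  have hF : Measurable F := by fun_prop
  have hG : Measurable G := by fun_prop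
  have sq : ∀ a : ℝ≥0∞, (a ^ (1 / 2 : ℝ)) ^ 2 = a := fun a => by
    rw [← ENNReal.rpow_natCast, ← ENNReal.rpow_mul]; norm_num
  have key : ∫⁻ x, ∫⁻ y, k x y * (f x * g y) ≤ ∫⁻ x, ∫⁻ y, F (x, y) * G (x, y) := by
    refine lintegral_mono_ae ?_
    filter_upwards [ae_plane_ne_zero] with x hx
    refine lintegral_mono_ae ?_
    filter_upwards [ae_plane_ne_zero] with y hy
    have h3 : k x y ≤ (k1 x y) ^ (1 / 2 : ℝ) * (k2 x y) ^ (1 / 2 : ℝ) := by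
      rw [← ENNReal.mul_rpow_of_nonneg _ _ (by norm_num),
        ← ENNReal.pow_le_pow_left_iff (n := 2) (by norm_num), sq]
      exact hk x y hx hy
    calc k x y * (f x * g y) ≤ (k1 x y) ^ (1 / 2 : ℝ) * (k2 x y) ^ (1 / 2 : ℝ) * (f x * g y) := by
          gcongr
      _ = _ := by simp only [F, G]; ring
  refine key.trans ?_
  rw [← lintegral_prod (fun z : Plane × Plane => F z * G z) (hF.mul hG).aemeasurable]
  have hol := ENNReal.lintegral_mul_le_Lp_mul_Lq (volume.prod volume) (p := 2) (q := 2)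
    Real.HolderConjugate.two_two hF.aemeasurable hG.aemeasurable
  refine hol.trans ?_
  have eF : ∫⁻ z, F z ^ (2 : ℝ) ∂(volume.prod volume) ≤ A * ∫⁻ x, f x ^ 2 := by
    rw [lintegral_prod _ (by fun_prop), ← lintegral_const_mul _ (by fun_prop)]
    refine lintegral_mono_ae ?_
    filter_upwards [ae_plane_ne_zero] with x hx
    have : ∀ y, F (x, y) ^ (2 : ℝ) = f x ^ 2 * k1 x y := fun y => by
      simp only [F, ENNReal.rpow_two, mul_pow, sq]; ring
    simp only [this]
    rw [lintegral_const_mul _ (by fun_prop), mul_comm]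
    gcongr
    exact h1 x hx
  have eG : ∫⁻ z, G z ^ (2 : ℝ) ∂(volume.prod volume) ≤ B * ∫⁻ x, g x ^ 2 := by
    rw [lintegral_prod_symm _ (by fun_prop), ← lintegral_const_mul _ (by fun_prop)]
    refine lintegral_mono_ae ?_
    filter_upwards [ae_plane_ne_zero] with y hy
    have : ∀ x, G (x, y) ^ (2 : ℝ) = g y ^ 2 * k2 x y := fun y => by
      simp only [G, ENNReal.rpow_two, mul_pow, sq]; ring
    simp only [this]
    rw [lintegral_const_mul _ (by fun_prop), mul_comm]
    gcongr
    exact h2 y hy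
  calc _ ≤ (A * ∫⁻ x, f x ^ 2) ^ (1 / 2 : ℝ) * (B * ∫⁻ x, g x ^ 2) ^ (1 / 2 : ℝ) := by gcongr
    _ = _ := by
      rw [ENNReal.mul_rpow_of_nonneg _ _ (by norm_num), ENNReal.mul_rpow_of_nonneg _ _ (by norm_num),
        ENNReal.mul_rpow_of_nonneg _ _ (by norm_num)]; ring

/-- The `L²` norm of a `[0,∞]`-valued function on the plane. -/
def l2 (f : Plane → ℝ≥0∞) : ℝ≥0∞ := (∫⁻ x, f x ^ 2) ^ (1 / 2 : ℝ)

lemma rpow_half_mul_self (a : ℝ≥0∞) : (a * a) ^ (1 / 2 : ℝ) = a := by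
  rw [← pow_two, ← ENNReal.rpow_natCast, ← ENNReal.rpow_mul]; norm_num

lemma ae_coord_ne_zero (i : Fin 2) : ∀ᵐ x : Plane, x i ≠ 0 := by
  have h := (Measure.quasiMeasurePreserving_eval (fun _ : Fin 2 => (volume : Measure ℝ)) i).comp
    (PiLp.volume_preserving_ofLp (Fin 2)).quasiMeasurePreserving
  exact h.ae (compl_mem_ae_iff.2 (measure_singleton (0 : ℝ)))

lemma measurable_indicator_kernel {s : Set (Plane × Plane)} (hs : MeasurableSet s)
    {φ : Plane × Plane → ℝ} (hφ : Measurable φ) :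
    Measurable (s.indicator fun z => ENNReal.ofReal (φ z)) :=
  (by fun_prop : Measurable fun z => ENNReal.ofReal (φ z)).indicator hs

/-- This is the case where the output frequency ζ + η is small compared with η. Then ‖ζ‖ > ‖η‖/2 and
‖ζ + η‖ < ‖ζ‖, so both Schur integrals reduce to that of ‖x‖⁻¹ over a disc, which is proportional to
the radius: the disc of radius ‖ζ‖ in one variable, of radius ‖η‖/2 in the other. -/
lemma near_kernel {f g : Plane → ℝ≥0∞} (hf : Measurable f) (hg : Measurable g) :
    ∫⁻ ζ, ∫⁻ η, {z : Plane × Plane | 2 * ‖z.1 + z.2‖ < ‖z.2‖}.indicator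
        (fun z => ENNReal.ofReal (‖z.1 + z.2‖⁻¹ * ‖z.1‖⁻¹)) (ζ, η) * (f ζ * g η)
      ≤ ENNReal.ofReal (2 * Real.pi) * (l2 f * l2 g) := by
  set s : Set (Plane × Plane) := {z | 2 * ‖z.1 + z.2‖ < ‖z.2‖} with hs
  have hsm : MeasurableSet s := measurableSet_lt (by fun_prop) (by fun_prop)
  set k : Plane → Plane → ℝ≥0∞ := fun ζ η =>
    s.indicator (fun z => ENNReal.ofReal (‖z.1 + z.2‖⁻¹ * ‖z.1‖⁻¹)) (ζ, η) with hk
  have hkm : Measurable (Function.uncurry k) := measurable_indicator_kernel hsm (by fun_prop)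
  rw [← rpow_half_mul_self (ENNReal.ofReal (2 * Real.pi))]
  refine schur_test hkm hkm hf hg (fun x y _ _ => (pow_two _).le) ?_ ?_
  · intro ζ hζ
    have hζ' : 0 < ‖ζ‖ := norm_pos_iff.2 hζ
    calc ∫⁻ η, k ζ η ≤ ∫⁻ η, ENNReal.ofReal ‖ζ‖⁻¹ *
          {x : Plane | ‖x‖ < ‖ζ‖}.indicator (fun x => ENNReal.ofReal ‖x‖⁻¹) (ζ + η) := by
          refine lintegral_mono fun η => ?_
          simp only [hk, Set.indicator, hs, Set.mem_ofPred_eq]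
          split_ifs with h1 h2
          · rw [mul_comm, ENNReal.ofReal_mul (by positivity)]
          · exfalso; apply h2
            have : ‖η‖ ≤ ‖ζ + η‖ + ‖ζ‖ := by
              calc ‖η‖ = ‖(ζ + η) - ζ‖ := by congr 1; abel
                _ ≤ _ := norm_sub_le _ _
            linarith
          · exact zero_le
          · exact zero_le
      _ = ENNReal.ofReal (2 * Real.pi) := by
          rw [lintegral_const_mul _ (by
            have : MeasurableSet {x : Plane | ‖x‖ < ‖ζ‖} :=
              measurableSet_lt (by fun_prop) (by fun_prop)
            exact ((by fun_prop : Measurable fun x : Plane => ENNReal.ofReal ‖x‖⁻¹).indicator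
              this).comp (by fun_prop)),
            lintegral_add_left_eq_self (fun y => {x : Plane | ‖x‖ < ‖ζ‖}.indicator
              (fun x => ENNReal.ofReal ‖x‖⁻¹) y) ζ,
            lintegral_indicator (measurableSet_lt (by fun_prop) (by fun_prop)),
            lintegral_inv_norm_ball, ← ENNReal.ofReal_mul (by positivity)]
          congr 1; field_simp
      _ ≤ _ := le_rfl
  · intro η hη
    have hη' : 0 < ‖η‖ := norm_pos_iff.2 hη
    calc ∫⁻ ζ, k ζ η ≤ ∫⁻ ζ, ENNReal.ofReal (2 * ‖η‖⁻¹) *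
          {x : Plane | ‖x‖ < ‖η‖ / 2}.indicator (fun x => ENNReal.ofReal ‖x‖⁻¹) (ζ + η) := by
          refine lintegral_mono fun ζ => ?_
          simp only [hk, Set.indicator, hs, Set.mem_ofPred_eq]
          split_ifs with h1 h2
          · rw [← ENNReal.ofReal_mul (by positivity), mul_comm]
            apply ENNReal.ofReal_le_ofReal
            gcongr
            have : ‖η‖ ≤ ‖ζ + η‖ + ‖ζ‖ := by
              calc ‖η‖ = ‖(ζ + η) - ζ‖ := by congr 1; abel
                _ ≤ _ := norm_sub_le _ _
            rw [show 2 * ‖η‖⁻¹ = (‖η‖ / 2)⁻¹ by field_simp]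
            exact inv_anti₀ (by positivity) (by linarith)
          · exfalso; apply h2; linarith
          · exact zero_le
          · exact zero_le
      _ = ENNReal.ofReal (2 * Real.pi) := by
          rw [lintegral_const_mul _ (by
            have : MeasurableSet {x : Plane | ‖x‖ < ‖η‖ / 2} :=
              measurableSet_lt (by fun_prop) (by fun_prop)
            exact ((by fun_prop : Measurable fun x : Plane => ENNReal.ofReal ‖x‖⁻¹).indicator
              this).comp (by fun_prop)),
            lintegral_add_right_eq_self (fun y => {x : Plane | ‖x‖ < ‖η‖ / 2}.indicator
              (fun x => ENNReal.ofReal ‖x‖⁻¹) y) η,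
            lintegral_indicator (measurableSet_lt (by fun_prop) (by fun_prop)),
            lintegral_inv_norm_ball, ← ENNReal.ofReal_mul (by positivity)]
          congr 1; field_simp
      _ ≤ _ := le_rfl

/-- Interaction of a high frequency in the first factor with the second factor. -/
lemma far_kernel_left {f g : Plane → ℝ≥0∞} (hf : Measurable f) (hg : Measurable g) :
    ∫⁻ ζ, ∫⁻ η, {z : Plane × Plane | |z.2 0| ≤ ‖z.1‖}.indicator
        (fun z => ENNReal.ofReal ((max ‖z.1‖ ‖z.2‖)⁻¹ * ‖z.1‖⁻¹)) (ζ, η) * (f ζ * g η)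
      ≤ ENNReal.ofReal 24 * (l2 f * l2 g) := by
  set s : Set (Plane × Plane) := {z | |z.2 0| ≤ ‖z.1‖} with hs
  have hsm : MeasurableSet s := measurableSet_le (by fun_prop) (by fun_prop)
  -- The powers of ‖ζ‖ and ‖η‖ in k1 and k2 are balanced so that their product is the square of the
  -- kernel. The integral of k1 in η converges only because of the strip |η 0| ≤ ‖ζ‖: over the whole
  -- plane ‖η‖^(-3/2) is not integrable at infinity. The strip has width 2‖ζ‖, which gives 2·8 = 16;
  -- k2 is integrated in polar coordinates, which gives 2π·4 = 8π.
  set k1 : Plane → Plane → ℝ≥0∞ := fun ζ η =>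
    s.indicator (fun z => ENNReal.ofReal ((max ‖z.1‖ ‖z.2‖)⁻¹ *
      (‖z.1‖ ^ (-(1 / 2) : ℝ) * ‖z.2‖ ^ (-(1 / 2) : ℝ)))) (ζ, η) with hk1
  set k2 : Plane → Plane → ℝ≥0∞ := fun ζ η =>
    s.indicator (fun z => ENNReal.ofReal ((max ‖z.1‖ ‖z.2‖)⁻¹ *
      (‖z.1‖ ^ (-(3 / 2) : ℝ) * ‖z.2‖ ^ (1 / 2 : ℝ)))) (ζ, η) with hk2
  have hkm1 : Measurable (Function.uncurry k1) := measurable_indicator_kernel hsm (by fun_prop)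
  have hkm2 : Measurable (Function.uncurry k2) := measurable_indicator_kernel hsm (by fun_prop)
  have hconst : (ENNReal.ofReal 16 * ENNReal.ofReal (8 * Real.pi)) ^ (1 / 2 : ℝ)
      ≤ ENNReal.ofReal 24 := by
    rw [← rpow_half_mul_self (ENNReal.ofReal 24)]
    apply ENNReal.rpow_le_rpow _ (by norm_num)
    rw [← ENNReal.ofReal_mul (by norm_num), ← ENNReal.ofReal_mul (by norm_num)]
    apply ENNReal.ofReal_le_ofReal
    linarith [Real.pi_lt_four]
  refine le_trans (schur_test hkm1 hkm2 hf hg (A := ENNReal.ofReal 16)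
    (B := ENNReal.ofReal (8 * Real.pi)) ?_ ?_ ?_) (by unfold l2; gcongr)
  · intro ζ η hζ hη
    have hζ' : 0 < ‖ζ‖ := norm_pos_iff.2 hζ
    have hη' : 0 < ‖η‖ := norm_pos_iff.2 hη
    simp only [hk1, hk2, Set.indicator]
    split_ifs
    · rw [← ENNReal.ofReal_pow (by positivity), ← ENNReal.ofReal_mul (by positivity)]
      apply ENNReal.ofReal_le_ofReal
      have e1 : ‖ζ‖ ^ (-(1 / 2) : ℝ) * ‖ζ‖ ^ (-(3 / 2) : ℝ) = ‖ζ‖⁻¹ ^ 2 := by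
        rw [← Real.rpow_add hζ', inv_pow, ← Real.rpow_natCast, ← Real.rpow_neg hζ'.le]; norm_num
      have e2 : ‖η‖ ^ (-(1 / 2) : ℝ) * ‖η‖ ^ (1 / 2 : ℝ) = 1 := by
        rw [← Real.rpow_add hη']; norm_num
      apply le_of_eq
      symm
      calc _ = (max ‖ζ‖ ‖η‖)⁻¹ ^ 2 * ((‖ζ‖ ^ (-(1 / 2) : ℝ) * ‖ζ‖ ^ (-(3 / 2) : ℝ)) *
            (‖η‖ ^ (-(1 / 2) : ℝ) * ‖η‖ ^ (1 / 2 : ℝ))) := by ring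
        _ = _ := by rw [e1, e2]; ring
    · simp
  · intro ζ hζ
    have hζ' : 0 < ‖ζ‖ := norm_pos_iff.2 hζ
    have hm : Measurable (Function.uncurry fun a b : ℝ => (Set.Icc (-‖ζ‖) ‖ζ‖).indicator
        (fun _ => ENNReal.ofReal (‖ζ‖ ^ (-(1 / 2) : ℝ))) a *
          ENNReal.ofReal (|b| ^ (-(1 / 2) : ℝ) * (max |b| ‖ζ‖)⁻¹)) := by
      refine Measurable.mul ?_ (by fun_prop)
      exact (measurable_const.indicator measurableSet_Icc).comp measurable_fst
    calc ∫⁻ η, k1 ζ η ≤ ∫⁻ η : Plane, (Set.Icc (-‖ζ‖) ‖ζ‖).indicator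
          (fun _ => ENNReal.ofReal (‖ζ‖ ^ (-(1 / 2) : ℝ))) (η 0) *
          ENNReal.ofReal (|η 1| ^ (-(1 / 2) : ℝ) * (max |η 1| ‖ζ‖)⁻¹) := by
          refine lintegral_mono_ae ?_
          filter_upwards [ae_coord_ne_zero 1] with η h1
          have hη1 : |η 1| ≤ ‖η‖ := PiLp.norm_apply_le η 1
          have hη1' : 0 < |η 1| := abs_pos.2 h1
          simp only [hk1, Set.indicator, hs, Set.mem_ofPred_eq, Set.mem_Icc, ← abs_le]
          split_ifs
          · rw [← ENNReal.ofReal_mul (by positivity)]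
            apply ENNReal.ofReal_le_ofReal
            have i1 : (max ‖ζ‖ ‖η‖)⁻¹ ≤ (max |η 1| ‖ζ‖)⁻¹ := by
              apply inv_anti₀ (by positivity)
              rw [max_comm]; exact max_le_max le_rfl hη1
            have i2 : ‖η‖ ^ (-(1 / 2) : ℝ) ≤ |η 1| ^ (-(1 / 2) : ℝ) :=
              Real.rpow_le_rpow_of_nonpos hη1' hη1 (by norm_num)
            calc _ ≤ (max |η 1| ‖ζ‖)⁻¹ * (‖ζ‖ ^ (-(1 / 2) : ℝ) * |η 1| ^ (-(1 / 2) : ℝ)) := by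
                  gcongr
              _ = _ := by ring
          · exact zero_le
      _ = ∫⁻ a : ℝ, (Set.Icc (-‖ζ‖) ‖ζ‖).indicator
            (fun _ => ENNReal.ofReal (‖ζ‖ ^ (-(1 / 2) : ℝ))) a *
          ∫⁻ b : ℝ, ENNReal.ofReal (|b| ^ (-(1 / 2) : ℝ) * (max |b| ‖ζ‖)⁻¹) := by
          rw [lintegral_plane _ hm]
          congr 1; ext a
          rw [lintegral_const_mul _ (by fun_prop)]
      _ ≤ ∫⁻ a : ℝ, (Set.Icc (-‖ζ‖) ‖ζ‖).indicator
            (fun _ => ENNReal.ofReal (‖ζ‖ ^ (-(1 / 2) : ℝ))) a *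
              ENNReal.ofReal (8 * ‖ζ‖ ^ (-(1 / 2) : ℝ)) := by
          gcongr
          exact lintegral_abs_rpow_div_max hζ'
      _ = ENNReal.ofReal 16 := by
          rw [lintegral_mul_const _ (measurable_const.indicator measurableSet_Icc),
            lintegral_indicator_const measurableSet_Icc, Real.volume_Icc, sub_neg_eq_add,
            ← ENNReal.ofReal_mul (by positivity), ← ENNReal.ofReal_mul (by positivity)]
          congr 1
          have e1 : ‖ζ‖ ^ (-(1 / 2) : ℝ) * ‖ζ‖ ^ (-(1 / 2) : ℝ) = ‖ζ‖⁻¹ := by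
            rw [← Real.rpow_add hζ', ← Real.rpow_neg_one]; norm_num
          calc _ = (‖ζ‖ ^ (-(1 / 2) : ℝ) * ‖ζ‖ ^ (-(1 / 2) : ℝ)) * ‖ζ‖ * 16 := by ring
            _ = _ := by rw [e1]; field_simp
  · intro η hη
    have hη' : 0 < ‖η‖ := norm_pos_iff.2 hη
    calc ∫⁻ ζ, k2 ζ η ≤ ∫⁻ ζ : Plane, ENNReal.ofReal ((max ‖ζ‖ ‖η‖)⁻¹ *
      (‖ζ‖ ^ (-(3 / 2) : ℝ) * ‖η‖ ^ (1 / 2 : ℝ))) := lintegral_mono fun ζ => Set.indicator_le_self _ _ _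
      _ = ENNReal.ofReal (2 * Real.pi) * ∫⁻ r in Set.Ioi (0 : ℝ), ENNReal.ofReal r *
          ENNReal.ofReal ((max r ‖η‖)⁻¹ * (r ^ (-(3 / 2) : ℝ) * ‖η‖ ^ (1 / 2 : ℝ))) :=
          lintegral_fun_norm (f := fun r => ENNReal.ofReal ((max r ‖η‖)⁻¹ *
            (r ^ (-(3 / 2) : ℝ) * ‖η‖ ^ (1 / 2 : ℝ)))) (by fun_prop)
      _ = ENNReal.ofReal (2 * Real.pi) * ∫⁻ r in Set.Ioi (0 : ℝ), ENNReal.ofReal (‖η‖ ^ (1 / 2 : ℝ)) *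
          ENNReal.ofReal (r ^ (-(1 / 2) : ℝ) * (max r ‖η‖)⁻¹) := by
          congr 1
          refine setLIntegral_congr_fun measurableSet_Ioi fun r hr => ?_
          have hr' : 0 < r := hr
          rw [← ENNReal.ofReal_mul hr'.le, ← ENNReal.ofReal_mul (by positivity)]
          congr 1
          have : r * r ^ (-(3 / 2) : ℝ) = r ^ (-(1 / 2) : ℝ) := by
            rw [← Real.rpow_one_add' hr'.le (by norm_num)]; norm_num
          rw [← this]; ring
      _ ≤ ENNReal.ofReal (2 * Real.pi) * (ENNReal.ofReal (‖η‖ ^ (1 / 2 : ℝ)) *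
            ENNReal.ofReal (4 * ‖η‖ ^ (-(1 / 2) : ℝ))) := by
          rw [lintegral_const_mul _ (by fun_prop)]
          gcongr
          exact lintegral_rpow_div_max hη'
      _ = _ := by
          rw [← ENNReal.ofReal_mul (by positivity), ← ENNReal.ofReal_mul (by positivity)]
          congr 1
          have e2 : ‖η‖ ^ (1 / 2 : ℝ) * ‖η‖ ^ (-(1 / 2) : ℝ) = 1 := by
            rw [← Real.rpow_add hη']; norm_num
          calc _ = 8 * Real.pi * (‖η‖ ^ (1 / 2 : ℝ) * ‖η‖ ^ (-(1 / 2) : ℝ)) := by ring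
            _ = _ := by rw [e2, mul_one]

/-- Interaction of a low frequency in the first factor with the second factor. -/
lemma far_kernel_right {f g : Plane → ℝ≥0∞} (hf : Measurable f) (hg : Measurable g) :
    ∫⁻ ζ, ∫⁻ η, {z : Plane × Plane | ‖z.1‖ < |z.2 0|}.indicator
        (fun z => ENNReal.ofReal (‖z.2‖⁻¹ * |z.2 0|⁻¹)) (ζ, η) * (f ζ * g η)
      ≤ ENNReal.ofReal 12 * (l2 f * l2 g) := by
  set s : Set (Plane × Plane) := {z | ‖z.1‖ < |z.2 0|} with hs
  have hsm : MeasurableSet s := measurableSet_lt (by fun_prop) (by fun_prop)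
  -- Here k2 is integrated in ζ over the disc of radius |η 0|, which gives 2π. For k1 the factor
  -- ‖η‖⁻² is distributed as max(|η 0|,|η 1|)⁻¹ |η 0|^(-1/2) |η 1|^(-1/2); integration in η 1 leaves
  -- 8‖ζ‖ |η 0|⁻² on |η 0| > ‖ζ‖, with total mass 16.
  set k1 : Plane → Plane → ℝ≥0∞ := fun ζ η =>
    s.indicator (fun z => ENNReal.ofReal (‖z.1‖ * (‖z.2‖⁻¹ ^ 2 * |z.2 0|⁻¹))) (ζ, η) with hk1
  set k2 : Plane → Plane → ℝ≥0∞ := fun ζ η =>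
    s.indicator (fun z => ENNReal.ofReal (|z.2 0|⁻¹ * ‖z.1‖⁻¹)) (ζ, η) with hk2
  have hkm1 : Measurable (Function.uncurry k1) := measurable_indicator_kernel hsm (by fun_prop)
  have hkm2 : Measurable (Function.uncurry k2) := measurable_indicator_kernel hsm (by fun_prop)
  have hconst : (ENNReal.ofReal 16 * ENNReal.ofReal (2 * Real.pi)) ^ (1 / 2 : ℝ)
      ≤ ENNReal.ofReal 12 := by
    rw [← rpow_half_mul_self (ENNReal.ofReal 12)]
    apply ENNReal.rpow_le_rpow _ (by norm_num)
    rw [← ENNReal.ofReal_mul (by norm_num), ← ENNReal.ofReal_mul (by norm_num)]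
    apply ENNReal.ofReal_le_ofReal
    linarith [Real.pi_lt_four]
  refine le_trans (schur_test hkm1 hkm2 hf hg (A := ENNReal.ofReal 16)
    (B := ENNReal.ofReal (2 * Real.pi)) ?_ ?_ ?_) (by unfold l2; gcongr)
  · intro ζ η hζ hη
    have hζ' : 0 < ‖ζ‖ := norm_pos_iff.2 hζ
    simp only [hk1, hk2, Set.indicator]
    split_ifs
    · rw [← ENNReal.ofReal_pow (by positivity), ← ENNReal.ofReal_mul (by positivity)]
      apply ENNReal.ofReal_le_ofReal
      apply le_of_eq
      field_simp
    · simp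
  · intro ζ hζ
    have hζ' : 0 < ‖ζ‖ := norm_pos_iff.2 hζ
    have hm : Measurable (Function.uncurry fun a b : ℝ => {a : ℝ | ‖ζ‖ < |a|}.indicator
        (fun a => ENNReal.ofReal (‖ζ‖ * |a| ^ (-(3 / 2) : ℝ))) a *
          ENNReal.ofReal (|b| ^ (-(1 / 2) : ℝ) * (max |b| |a|)⁻¹)) := by
      refine Measurable.mul ?_ (by fun_prop)
      exact ((by fun_prop : Measurable fun a => ENNReal.ofReal (‖ζ‖ * |a| ^ (-(3 / 2) : ℝ))).indicator
        (measurableSet_lt (by fun_prop) (by fun_prop))).comp measurable_fst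
    have hS : {a : ℝ | ‖ζ‖ < |a|} = Set.Ioi ‖ζ‖ ∪ Set.Iio (-‖ζ‖) := by
      ext a; simp [lt_abs, lt_neg]
    have hi : ∫⁻ a in Set.Ioi ‖ζ‖, ENNReal.ofReal (8 * ‖ζ‖ * |a| ^ (-2 : ℝ))
        = ENNReal.ofReal 8 := by
      rw [setLIntegral_congr_fun (g := fun a => ENNReal.ofReal (8 * ‖ζ‖ * a ^ (-2 : ℝ)))
        measurableSet_Ioi (fun a ha => by simp only [abs_of_pos (hζ'.trans ha)]),
        ← ofReal_integral_eq_lintegral_ofReal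
          ((integrableOn_Ioi_rpow_of_lt (by norm_num) hζ').const_mul _)
          ((ae_restrict_iff' measurableSet_Ioi).2 (Eventually.of_forall fun r hr => by
            have := hζ'.trans hr; positivity)), integral_const_mul,
        integral_Ioi_rpow_of_lt (by norm_num) hζ']
      congr 1
      rw [show (-2 + 1 : ℝ) = -1 by norm_num, Real.rpow_neg_one]
      field_simp
    have hi' : ∫⁻ a in Set.Iio (-‖ζ‖), ENNReal.ofReal (8 * ‖ζ‖ * |a| ^ (-2 : ℝ))
        = ENNReal.ofReal 8 := by
      rw [← hi, ← lintegral_indicator measurableSet_Iio, ← lintegral_indicator measurableSet_Ioi,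
        ← lintegral_neg_eq_self]
      congr 1; ext r
      simp [Set.indicator]
    calc ∫⁻ η, k1 ζ η ≤ ∫⁻ η : Plane, {a : ℝ | ‖ζ‖ < |a|}.indicator
          (fun a => ENNReal.ofReal (‖ζ‖ * |a| ^ (-(3 / 2) : ℝ))) (η 0) *
          ENNReal.ofReal (|η 1| ^ (-(1 / 2) : ℝ) * (max |η 1| |η 0|)⁻¹) := by
          refine lintegral_mono_ae ?_
          filter_upwards [ae_coord_ne_zero 1] with η h1
          have hη0 : |η 0| ≤ ‖η‖ := PiLp.norm_apply_le η 0
          have hη1 : |η 1| ≤ ‖η‖ := PiLp.norm_apply_le η 1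
          have hη1' : 0 < |η 1| := abs_pos.2 h1
          simp only [hk1, Set.indicator, hs, Set.mem_ofPred_eq]
          split_ifs with h
          · have ha : 0 < |η 0| := hζ'.trans h
            have hη : 0 < ‖η‖ := ha.trans_le hη0
            rw [← ENNReal.ofReal_mul (by positivity)]
            apply ENNReal.ofReal_le_ofReal
            have i1 : ‖η‖⁻¹ ≤ (max |η 1| |η 0|)⁻¹ := by
              apply inv_anti₀ (by positivity)
              exact max_le hη1 hη0
            have i2 : ‖η‖ ^ (-(1 / 2) : ℝ) ≤ |η 1| ^ (-(1 / 2) : ℝ) :=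
              Real.rpow_le_rpow_of_nonpos hη1' hη1 (by norm_num)
            have i3 : ‖η‖ ^ (-(1 / 2) : ℝ) ≤ |η 0| ^ (-(1 / 2) : ℝ) :=
              Real.rpow_le_rpow_of_nonpos ha hη0 (by norm_num)
            have e1 : ‖η‖⁻¹ ^ 2 = ‖η‖⁻¹ * (‖η‖ ^ (-(1 / 2) : ℝ) * ‖η‖ ^ (-(1 / 2) : ℝ)) := by
              rw [← Real.rpow_add hη, pow_two]
              congr 1; rw [← Real.rpow_neg_one]; norm_num
            have e2 : |η 0| ^ (-(1 / 2) : ℝ) * |η 0|⁻¹ = |η 0| ^ (-(3 / 2) : ℝ) := by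
              rw [← Real.rpow_neg_one |η 0|, ← Real.rpow_add ha]; norm_num
            rw [e1]
            calc _ ≤ ‖ζ‖ * ((max |η 1| |η 0|)⁻¹ * (|η 1| ^ (-(1 / 2) : ℝ) * |η 0| ^ (-(1 / 2) : ℝ))
                  * |η 0|⁻¹) := by gcongr
              _ = ‖ζ‖ * (|η 0| ^ (-(1 / 2) : ℝ) * |η 0|⁻¹) *
                  (|η 1| ^ (-(1 / 2) : ℝ) * (max |η 1| |η 0|)⁻¹) := by ring
              _ = _ := by rw [e2]
          · exact zero_le
      _ = ∫⁻ a : ℝ, {a : ℝ | ‖ζ‖ < |a|}.indicator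
            (fun a => ENNReal.ofReal (‖ζ‖ * |a| ^ (-(3 / 2) : ℝ))) a *
          ∫⁻ b : ℝ, ENNReal.ofReal (|b| ^ (-(1 / 2) : ℝ) * (max |b| |a|)⁻¹) := by
          rw [lintegral_plane _ hm]
          congr 1; ext a
          rw [lintegral_const_mul _ (by fun_prop)]
      _ ≤ ∫⁻ a : ℝ, {a : ℝ | ‖ζ‖ < |a|}.indicator
            (fun a => ENNReal.ofReal (8 * ‖ζ‖ * |a| ^ (-2 : ℝ))) a := by
          refine lintegral_mono fun a => ?_
          simp only [Set.indicator, Set.mem_ofPred_eq]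
          split_ifs with h
          · have ha : 0 < |a| := hζ'.trans h
            calc _ ≤ ENNReal.ofReal (‖ζ‖ * |a| ^ (-(3 / 2) : ℝ)) *
                  ENNReal.ofReal (8 * |a| ^ (-(1 / 2) : ℝ)) := by
                  gcongr; exact lintegral_abs_rpow_div_max ha
              _ = _ := by
                rw [← ENNReal.ofReal_mul (by positivity)]
                congr 1
                rw [show (-2 : ℝ) = -(3 / 2) + -(1 / 2) by norm_num, Real.rpow_add ha]; ring
          · simp
      _ = ENNReal.ofReal 16 := by
          rw [lintegral_indicator (measurableSet_lt (by fun_prop) (by fun_prop)), hS,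
            lintegral_union measurableSet_Iio, hi, hi', ← ENNReal.ofReal_add (by norm_num) (by norm_num)]
          · norm_num
          · exact Set.disjoint_left.2 fun a h1 h2 => by
              simp only [Set.mem_Ioi, Set.mem_Iio] at h1 h2; linarith
  · intro η hη
    have hm : MeasurableSet {x : Plane | ‖x‖ < |η 0|} := measurableSet_lt (by fun_prop) (by fun_prop)
    calc ∫⁻ ζ, k2 ζ η = ∫⁻ ζ : Plane, ENNReal.ofReal |η 0|⁻¹ *
          {x : Plane | ‖x‖ < |η 0|}.indicator (fun x => ENNReal.ofReal ‖x‖⁻¹) ζ := by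
          congr 1; ext ζ
          simp only [hk2, Set.indicator, hs, Set.mem_ofPred_eq]
          split_ifs
          · rw [ENNReal.ofReal_mul (by positivity)]
          · simp
      _ = ENNReal.ofReal (|η 0|⁻¹ * (2 * Real.pi * |η 0|)) := by
          rw [lintegral_const_mul _
            ((by fun_prop : Measurable fun x : Plane => ENNReal.ofReal ‖x‖⁻¹).indicator hm),
            lintegral_indicator hm, lintegral_inv_norm_ball, ← ENNReal.ofReal_mul (by positivity)]
      _ ≤ _ := by
          apply ENNReal.ofReal_le_ofReal
          calc _ = 2 * Real.pi * (|η 0|⁻¹ * |η 0|) := by ring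
            _ ≤ 2 * Real.pi * 1 := by
              gcongr; exact inv_mul_le_one
            _ = _ := mul_one _

lemma lintegral_weight_conv {w f g : Plane → ℝ≥0∞} (hw : Measurable w) (hf : Measurable f)
    (hg : Measurable g) :
    ∫⁻ ξ, w ξ * ∫⁻ η, f (ξ - η) * g η = ∫⁻ ζ, ∫⁻ η, w (ζ + η) * (f ζ * g η) := by
  calc ∫⁻ ξ, w ξ * ∫⁻ η, f (ξ - η) * g η = ∫⁻ ξ, ∫⁻ η, w ξ * (f (ξ - η) * g η) := by
        congr 1; ext ξ; rw [lintegral_const_mul _ (by fun_prop)]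
    _ = ∫⁻ η, ∫⁻ ξ, w ξ * (f (ξ - η) * g η) := lintegral_lintegral_swap (by fun_prop)
    _ = ∫⁻ η, ∫⁻ ζ, w (ζ + η) * (f ζ * g η) := by
        congr 1; ext η
        rw [← lintegral_add_right_eq_self _ η]
        simp
    _ = _ := lintegral_lintegral_swap (by fun_prop)

lemma norm_le_norm_add_add (ζ η : Plane) : ‖ζ‖ ≤ ‖ζ + η‖ + ‖η‖ := by
  calc ‖ζ‖ = ‖(ζ + η) - η‖ := by congr 1; abel
    _ ≤ _ := norm_sub_le _ _

lemma conv_congr {f f' g g' : Plane → ℝ≥0∞} (hf : f =ᵐ[volume] f') (hg : g =ᵐ[volume] g')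
    (ξ : Plane) : ∫⁻ η, f (ξ - η) * g η = ∫⁻ η, f' (ξ - η) * g' η := by
  apply lintegral_congr_ae
  filter_upwards [(Measure.measurePreserving_sub_left volume ξ).quasiMeasurePreserving.ae hf, hg]
    with η h1 h2
  rw [h1, h2]

lemma l2_congr {f f' : Plane → ℝ≥0∞} (hf : f =ᵐ[volume] f') : l2 f = l2 f' := by
  unfold l2
  congr 1
  exact lintegral_congr_ae (by filter_upwards [hf] with x hx; rw [hx])

lemma inv_norm_mul_le {x y : Plane} (hy : 0 < ‖y‖) (a : ℝ≥0∞) :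
    ENNReal.ofReal ‖x‖⁻¹ * a = ENNReal.ofReal (‖x‖⁻¹ * ‖y‖⁻¹) * (‖y‖ₑ * a) := by
  rw [← ofReal_norm y, ← mul_assoc, ← ENNReal.ofReal_mul (by positivity), mul_assoc ‖x‖⁻¹,
    inv_mul_cancel₀ hy.ne', mul_one]

lemma ofReal_mul_le_three {c m r : ℝ} (hr : 0 < r) (hm : 0 ≤ m) (h : c ≤ 3 * m) (a : ℝ≥0∞) :
    ENNReal.ofReal c * a ≤ 3 * (ENNReal.ofReal (m * r⁻¹) * (ENNReal.ofReal r * a)) := by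
  rw [← mul_assoc (ENNReal.ofReal (m * r⁻¹)), ← ENNReal.ofReal_mul (by positivity),
    mul_assoc m, inv_mul_cancel₀ hr.ne', mul_one, ← mul_assoc]
  gcongr
  rw [← ENNReal.ofReal_ofNat, ← ENNReal.ofReal_mul (by norm_num)]
  exact ENNReal.ofReal_le_ofReal h

/-- The norm in `L¹` with weight `|ξ|⁻¹` of a convolution, under square integrability. -/
lemma bilinear_estimate {f g : Plane → ℝ≥0∞} (hf : AEMeasurable f) (hg : AEMeasurable g) :
    ∫⁻ ξ, ENNReal.ofReal ‖ξ‖⁻¹ * ∫⁻ η, f (ξ - η) * g η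
      ≤ 100 * (l2 (fun ζ => ‖ζ‖ₑ * f ζ) * l2 g + l2 f * l2 (fun η => ‖η 0‖ₑ * g η)) := by
  wlog h : Measurable f ∧ Measurable g generalizing f g with H
  · have := H hf.measurable_mk.aemeasurable hg.measurable_mk.aemeasurable
      ⟨hf.measurable_mk, hg.measurable_mk⟩
    rw [l2_congr hf.ae_eq_mk, l2_congr hg.ae_eq_mk,
      l2_congr (f := fun ζ => ‖ζ‖ₑ * f ζ) (f' := fun ζ => ‖ζ‖ₑ * hf.mk f ζ)
        (by filter_upwards [hf.ae_eq_mk] with x hx; rw [hx]),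
      l2_congr (f := fun η => ‖η 0‖ₑ * g η) (f' := fun η => ‖η 0‖ₑ * hg.mk g η)
        (by filter_upwards [hg.ae_eq_mk] with x hx; rw [hx])]
    simpa only [conv_congr hf.ae_eq_mk hg.ae_eq_mk] using this
  obtain ⟨hf, hg⟩ := h
  have hf1 : Measurable fun ζ : Plane => ‖ζ‖ₑ * f ζ := by fun_prop
  have hg1 : Measurable fun η : Plane => ‖η 0‖ₑ * g η := by fun_prop
  have b1 := near_kernel hf1 hg
  have b2 := far_kernel_left hf1 hg
  have b3 := far_kernel_right hf hg1
  set K1 : Plane × Plane → ℝ≥0∞ := {z : Plane × Plane | 2 * ‖z.1 + z.2‖ < ‖z.2‖}.indicator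
        (fun z => ENNReal.ofReal (‖z.1 + z.2‖⁻¹ * ‖z.1‖⁻¹)) with hK1
  set K2 : Plane × Plane → ℝ≥0∞ := {z : Plane × Plane | |z.2 0| ≤ ‖z.1‖}.indicator
        (fun z => ENNReal.ofReal ((max ‖z.1‖ ‖z.2‖)⁻¹ * ‖z.1‖⁻¹)) with hK2
  set K3 : Plane × Plane → ℝ≥0∞ := {z : Plane × Plane | ‖z.1‖ < |z.2 0|}.indicator
        (fun z => ENNReal.ofReal (‖z.2‖⁻¹ * |z.2 0|⁻¹)) with hK3
  have m1 : Measurable K1 := measurable_indicator_kernel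
    (measurableSet_lt (by fun_prop) (by fun_prop)) (by fun_prop)
  have m2 : Measurable K2 := measurable_indicator_kernel
    (measurableSet_le (by fun_prop) (by fun_prop)) (by fun_prop)
  have m3 : Measurable K3 := measurable_indicator_kernel
    (measurableSet_lt (by fun_prop) (by fun_prop)) (by fun_prop)
  rw [lintegral_weight_conv (by fun_prop) hf hg]
  have key : ∫⁻ ζ, ∫⁻ η, ENNReal.ofReal ‖ζ + η‖⁻¹ * (f ζ * g η) ≤ ∫⁻ ζ, ∫⁻ η,
      (K1 (ζ, η) * (‖ζ‖ₑ * f ζ * g η) + (3 * (K2 (ζ, η) * (‖ζ‖ₑ * f ζ * g η)) +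
        3 * (K3 (ζ, η) * (f ζ * (‖η 0‖ₑ * g η))))) := by
    refine lintegral_mono_ae ?_
    filter_upwards [ae_plane_ne_zero] with ζ hζ
    refine lintegral_mono_ae ?_
    filter_upwards [ae_plane_ne_zero] with η hη
    have hζ' : 0 < ‖ζ‖ := norm_pos_iff.2 hζ
    have hη' : 0 < ‖η‖ := norm_pos_iff.2 hη
    -- Three cases: small output frequency; comparable frequencies with |η 0| ≤ ‖ζ‖, where the
    -- derivative is placed on f; and |η 0| > ‖ζ‖, where the first-coordinate derivative is placed
    -- on g. No other derivative of g is ever needed.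
    by_cases h1 : 2 * ‖ζ + η‖ < ‖η‖
    · refine le_trans ?_ le_self_add
      have : K1 (ζ, η) = ENNReal.ofReal (‖ζ + η‖⁻¹ * ‖ζ‖⁻¹) := by
        simp only [hK1, Set.indicator, Set.mem_ofPred_eq, if_pos h1]
      rw [this]
      rw [mul_assoc, ← inv_norm_mul_le hζ']
    · refine le_trans ?_ le_add_self
      push Not at h1
      have h2 := norm_le_norm_add_add ζ η
      have hpos : 0 < ‖ζ + η‖ := by linarith
      -- From ‖η‖ ≤ 2‖ζ + η‖ the triangle inequality gives ‖ζ‖ ≤ 3‖ζ + η‖.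
      have h3 : ‖ζ + η‖⁻¹ ≤ 3 * (max ‖ζ‖ ‖η‖)⁻¹ := by
        rw [← div_eq_mul_inv, inv_eq_one_div, div_le_div_iff₀ hpos (by positivity), one_mul]
        exact max_le (by linarith) (by linarith)
      by_cases h4 : |η 0| ≤ ‖ζ‖
      · refine le_trans ?_ le_self_add
        have : K2 (ζ, η) = ENNReal.ofReal ((max ‖ζ‖ ‖η‖)⁻¹ * ‖ζ‖⁻¹) := by
          simp only [hK2, Set.indicator, Set.mem_ofPred_eq, if_pos h4]
        rw [this]
        rw [mul_assoc ‖ζ‖ₑ, ← ofReal_norm ζ]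
        exact ofReal_mul_le_three hζ' (by positivity) h3 _
      · refine le_trans ?_ le_add_self
        push Not at h4
        have hη0 : 0 < |η 0| := hζ'.trans h4
        have : K3 (ζ, η) = ENNReal.ofReal (‖η‖⁻¹ * |η 0|⁻¹) := by
          simp only [hK3, Set.indicator, Set.mem_ofPred_eq, if_pos h4]
        rw [this]
        have h5 : (max ‖ζ‖ ‖η‖)⁻¹ ≤ ‖η‖⁻¹ := inv_anti₀ hη' (le_max_right _ _)
        rw [mul_left_comm (f ζ), ← ofReal_norm (η 0), Real.norm_eq_abs]
        exact ofReal_mul_le_three hη0 (by positivity) (h3.trans (by gcongr)) _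
  refine key.trans ?_
  have split : ∀ ζ, ∫⁻ η, (K1 (ζ, η) * (‖ζ‖ₑ * f ζ * g η) + (3 * (K2 (ζ, η) * (‖ζ‖ₑ * f ζ * g η)) +
        3 * (K3 (ζ, η) * (f ζ * (‖η 0‖ₑ * g η)))))
      = (∫⁻ η, K1 (ζ, η) * (‖ζ‖ₑ * f ζ * g η)) + (3 * (∫⁻ η, K2 (ζ, η) * (‖ζ‖ₑ * f ζ * g η)) +
        3 * ∫⁻ η, K3 (ζ, η) * (f ζ * (‖η 0‖ₑ * g η))) := fun ζ => by
    rw [lintegral_add_left (by fun_prop), lintegral_add_left (by fun_prop),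
      lintegral_const_mul _ (by fun_prop), lintegral_const_mul _ (by fun_prop)]
  simp only [split]
  rw [lintegral_add_left (by fun_prop), lintegral_add_left (by fun_prop),
      lintegral_const_mul _ (by fun_prop), lintegral_const_mul _ (by fun_prop)]
  set X := l2 (fun ζ => ‖ζ‖ₑ * f ζ) * l2 g
  set Y := l2 f * l2 (fun η => ‖η 0‖ₑ * g η)
  calc _ ≤ ENNReal.ofReal (2 * Real.pi) * X + (3 * (ENNReal.ofReal 24 * X) +
        3 * (ENNReal.ofReal 12 * Y)) := by gcongr
    _ ≤ ENNReal.ofReal 8 * X + (3 * (ENNReal.ofReal 24 * X) + 3 * (ENNReal.ofReal 12 * Y)) := by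
        gcongr; linarith [Real.pi_lt_four]
    _ = 80 * X + 36 * Y := by
        simp only [ENNReal.ofReal_ofNat]; ring
    _ ≤ 100 * X + 100 * Y := by gcongr <;> norm_num
    _ = _ := by ring

/-- The norm in `L¹` with weight `|ξ|⁻¹` of the convolution with a derivative. -/
lemma bilinear_estimate_deriv {f g : Plane → ℝ≥0∞} (hf : AEMeasurable f) (hg : AEMeasurable g) :
    ∫⁻ ξ, ENNReal.ofReal ‖ξ‖⁻¹ * ∫⁻ η, f (ξ - η) * (‖η‖ₑ * g η)
      ≤ 100 * ((∫⁻ ζ, f ζ) * (∫⁻ η, g η)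
        + l2 (fun ζ => ‖ζ‖ₑ * f ζ) * l2 (fun η => ‖η‖ₑ * g η)) := by
  wlog h : Measurable f ∧ Measurable g generalizing f g with H
  · have := H hf.measurable_mk.aemeasurable hg.measurable_mk.aemeasurable
      ⟨hf.measurable_mk, hg.measurable_mk⟩
    have e : (fun η => ‖η‖ₑ * g η) =ᵐ[volume] (fun η => ‖η‖ₑ * hg.mk g η) := by
      filter_upwards [hg.ae_eq_mk] with x hx; rw [hx]
    rw [lintegral_congr_ae hf.ae_eq_mk, lintegral_congr_ae hg.ae_eq_mk, l2_congr e,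
      l2_congr (f := fun ζ => ‖ζ‖ₑ * f ζ) (f' := fun ζ => ‖ζ‖ₑ * hf.mk f ζ)
        (by filter_upwards [hf.ae_eq_mk] with x hx; rw [hx])]
    simpa only [conv_congr hf.ae_eq_mk e] using this
  obtain ⟨hf, hg⟩ := h
  have hf1 : Measurable fun ζ : Plane => ‖ζ‖ₑ * f ζ := by fun_prop
  have hg1 : Measurable fun η : Plane => ‖η‖ₑ * g η := by fun_prop
  have b1 := near_kernel hf1 hg1
  set K1 : Plane × Plane → ℝ≥0∞ := {z : Plane × Plane | 2 * ‖z.1 + z.2‖ < ‖z.2‖}.indicator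
        (fun z => ENNReal.ofReal (‖z.1 + z.2‖⁻¹ * ‖z.1‖⁻¹)) with hK1
  have m1 : Measurable K1 := measurable_indicator_kernel
    (measurableSet_lt (by fun_prop) (by fun_prop)) (by fun_prop)
  rw [lintegral_weight_conv (by fun_prop) hf hg1]
  have key : ∫⁻ ζ, ∫⁻ η, ENNReal.ofReal ‖ζ + η‖⁻¹ * (f ζ * (‖η‖ₑ * g η)) ≤ ∫⁻ ζ, ∫⁻ η,
      (2 * (f ζ * g η) + K1 (ζ, η) * (‖ζ‖ₑ * f ζ * (‖η‖ₑ * g η))) := by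
    refine lintegral_mono fun ζ => lintegral_mono fun η => ?_
    simp only
    -- Unless the output frequency is small, ‖η‖/‖ζ + η‖ ≤ 2, so that the weight absorbs the
    -- derivative and L¹ norms suffice. The remaining case is `near_kernel` with both functions
    -- multiplied by their frequency.
    by_cases h1 : 2 * ‖ζ + η‖ < ‖η‖
    · refine le_trans ?_ le_add_self
      have : K1 (ζ, η) = ENNReal.ofReal (‖ζ + η‖⁻¹ * ‖ζ‖⁻¹) := by
        simp only [hK1, Set.indicator, Set.mem_ofPred_eq, if_pos h1]
      have h2 := norm_le_norm_add_add η ζ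
      rw [add_comm η ζ] at h2
      have hζ' : 0 < ‖ζ‖ := by linarith [norm_nonneg (ζ + η)]
      rw [this]
      rw [mul_assoc, ← inv_norm_mul_le hζ']
    · refine le_trans ?_ le_self_add
      push Not at h1
      calc _ = ENNReal.ofReal (‖ζ + η‖⁻¹ * ‖η‖) * (f ζ * g η) := by
            rw [ENNReal.ofReal_mul (by positivity), ofReal_norm, mul_left_comm (f ζ), mul_assoc]
        _ ≤ ENNReal.ofReal 2 * (f ζ * g η) := by
            gcongr
            rw [inv_mul_eq_div]
            exact div_le_of_le_mul₀ (norm_nonneg _) (by norm_num) h1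
        _ = _ := by rw [ENNReal.ofReal_ofNat]
  refine key.trans ?_
  have split : ∀ ζ, ∫⁻ η, (2 * (f ζ * g η) + K1 (ζ, η) * (‖ζ‖ₑ * f ζ * (‖η‖ₑ * g η)))
      = 2 * (f ζ * ∫⁻ η, g η) + ∫⁻ η, K1 (ζ, η) * (‖ζ‖ₑ * f ζ * (‖η‖ₑ * g η)) := fun ζ => by
    rw [lintegral_add_left (by fun_prop), lintegral_const_mul _ (by fun_prop),
      lintegral_const_mul _ (by fun_prop)]
  simp only [split]
  rw [lintegral_add_left (by fun_prop), lintegral_const_mul _ (by fun_prop),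
      lintegral_mul_const _ (by fun_prop)]
  set X := (∫⁻ ζ, f ζ) * (∫⁻ η, g η)
  set Y := l2 (fun ζ => ‖ζ‖ₑ * f ζ) * l2 (fun η => ‖η‖ₑ * g η)
  calc _ ≤ 2 * X + ENNReal.ofReal (2 * Real.pi) * Y := by gcongr
    _ ≤ 2 * X + ENNReal.ofReal 8 * Y := by gcongr; linarith [Real.pi_lt_four]
    _ = 2 * X + 8 * Y := by simp only [ENNReal.ofReal_ofNat]
    _ ≤ 100 * X + 100 * Y := by gcongr <;> norm_num
    _ = _ := by ring

/-! ### Square integrability in time: Cauchy–Schwarz, Minkowski, superpositions -/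

section Time
variable {α β : Type*} [MeasurableSpace α] [MeasurableSpace β]

lemma eLpNorm_two_eq (μ : Measure α) (f : α → ℝ≥0∞) :
    eLpNorm f 2 μ = (∫⁻ x, f x ^ 2 ∂μ) ^ (1 / 2 : ℝ) := by
  rw [eLpNorm_eq_lintegral_rpow_enorm_toReal (by norm_num) (by norm_num)]
  simp

lemma sq_rpow_half (a : ℝ≥0∞) : (a ^ (1 / 2 : ℝ)) ^ 2 = a := by
  rw [← ENNReal.rpow_natCast, ← ENNReal.rpow_mul]; norm_num

lemma rpow_half_sq (a : ℝ≥0∞) : (a ^ 2) ^ (1 / 2 : ℝ) = a := by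
  rw [pow_two, rpow_half_mul_self]

lemma eLpNorm_two_sq (μ : Measure α) (f : α → ℝ≥0∞) :
    eLpNorm f 2 μ ^ 2 = ∫⁻ x, f x ^ 2 ∂μ := by
  rw [eLpNorm_two_eq, sq_rpow_half]

lemma lintegral_mul_le_eLpNorm (μ : Measure α) {f g : α → ℝ≥0∞} (hf : AEMeasurable f μ)
    (hg : AEMeasurable g μ) :
    ∫⁻ x, f x * g x ∂μ ≤ eLpNorm f 2 μ * eLpNorm g 2 μ := by
  have := ENNReal.lintegral_mul_le_Lp_mul_Lq μ (p := 2) (q := 2)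
    Real.HolderConjugate.two_two hf hg
  rw [eLpNorm_two_eq, eLpNorm_two_eq]
  simpa using this

/-- The square of an integral, integrated in a parameter. -/
lemma lintegral_sq_lintegral (m : Measure α) (ν : Measure β) [SFinite m] [SFinite ν]
    {k : α → β → ℝ≥0∞} (hk : Measurable (Function.uncurry k)) :
    ∫⁻ t, (∫⁻ x, k t x ∂ν) ^ 2 ∂m = ∫⁻ x, ∫⁻ y, ∫⁻ t, k t x * k t y ∂m ∂ν ∂ν := by
  calc ∫⁻ t, (∫⁻ x, k t x ∂ν) ^ 2 ∂m
      = ∫⁻ t, ∫⁻ x, ∫⁻ y, k t x * k t y ∂ν ∂ν ∂m := by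
        congr 1; ext t
        have h1 : Measurable (k t) := hk.comp measurable_prodMk_left
        rw [pow_two, ← lintegral_mul_const _ h1]
        congr 1; ext x
        rw [lintegral_const_mul _ h1]
    _ = ∫⁻ x, ∫⁻ t, ∫⁻ y, k t x * k t y ∂ν ∂m ∂ν := by
        refine lintegral_lintegral_swap (Measurable.aemeasurable ?_)
        refine Measurable.lintegral_prod_right'
          (f := fun z : (α × β) × β => k z.1.1 z.1.2 * k z.1.1 z.2) ?_
        exact (hk.comp (measurable_fst : Measurable fun z : (α × β) × β => z.1)).mul
          (hk.comp (by fun_prop : Measurable fun z : (α × β) × β => (z.1.1, z.2)))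
    _ = _ := by
        congr 1; ext x
        refine lintegral_lintegral_swap (Measurable.aemeasurable ?_)
        exact (hk.comp (by fun_prop : Measurable fun z : α × β => (z.1, x))).mul hk

/-- Minkowski's integral inequality in `L²`. -/
lemma eLpNorm_lintegral_le (m : Measure α) (ν : Measure β) [SFinite m] [SFinite ν]
    {k : α → β → ℝ≥0∞} (hk : Measurable (Function.uncurry k)) :
    eLpNorm (fun t => ∫⁻ x, k t x ∂ν) 2 m ≤ ∫⁻ x, eLpNorm (fun t => k t x) 2 m ∂ν := by
  have hk' : ∀ x, Measurable fun t => k t x := fun x => hk.comp measurable_prodMk_right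
  have hm : Measurable fun x => eLpNorm (fun t => k t x) 2 m := by
    simp_rw [eLpNorm_two_eq]
    refine Measurable.pow_const ?_ _
    exact Measurable.lintegral_prod_right'
      (f := fun z : β × α => k z.2 z.1 ^ 2) ((hk.comp measurable_swap).pow_const 2)
  -- The squared norm is a double integral over the parameter of correlations in time, and
  -- Cauchy–Schwarz bounds each correlation by the product of two norms.
  rw [eLpNorm_two_eq, lintegral_sq_lintegral m ν hk, ← rpow_half_sq (∫⁻ x, eLpNorm (fun t => k t x) 2 m ∂ν)]
  refine ENNReal.rpow_le_rpow ?_ (by norm_num)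
  calc ∫⁻ x, ∫⁻ y, ∫⁻ t, k t x * k t y ∂m ∂ν ∂ν
      ≤ ∫⁻ x, ∫⁻ y, eLpNorm (fun t => k t x) 2 m * eLpNorm (fun t => k t y) 2 m ∂ν ∂ν := by
        gcongr with x y
        exact lintegral_mul_le_eLpNorm m (hk' x).aemeasurable (hk' y).aemeasurable
    _ = _ := by
        simp_rw [lintegral_const_mul _ hm]
        rw [lintegral_mul_const _ hm, pow_two]

/-- A quadratic inequality for superpositions of relaxation kernels. -/
lemma lintegral_sq_superposition_le (m : Measure α) (ν : Measure β) [SFinite m] [SFinite ν]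
    {k : α → β → ℝ≥0∞} (hk : Measurable (Function.uncurry k)) {b : β → ℝ≥0∞} (hb : Measurable b)
    {τ : β → α} (hτ : Measurable τ)
    (h : ∀ x y, ∫⁻ t, k t x * k t y ∂m ≤ k (τ y) x + k (τ x) y) :
    ∫⁻ t, (∫⁻ x, k t x * b x ∂ν) ^ 2 ∂m ≤ 2 * ∫⁻ y, b y * ∫⁻ x, k (τ y) x * b x ∂ν ∂ν := by
  have hkb : Measurable (Function.uncurry fun t x => k t x * b x) :=
    hk.mul (hb.comp measurable_snd)
  have hm1 : Measurable fun z : β × β => k (τ z.2) z.1 * b z.1 * b z.2 :=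
    ((hk.comp (by fun_prop : Measurable fun z : β × β => (τ z.2, z.1))).mul
      (hb.comp measurable_fst)).mul (hb.comp measurable_snd)
  have hm2 : Measurable fun z : β × β => k (τ z.1) z.2 * b z.2 * b z.1 :=
    hm1.comp measurable_swap
  have e2 : ∫⁻ x, ∫⁻ y, k (τ x) y * b y * b x ∂ν ∂ν = ∫⁻ y, b y * ∫⁻ x, k (τ y) x * b x ∂ν ∂ν := by
    congr 1; ext x
    have : Measurable fun y => k (τ x) y * b y := (hk.comp measurable_prodMk_left).mul hb
    rw [lintegral_mul_const _ this, mul_comm]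
  rw [lintegral_sq_lintegral m ν hkb]
  -- With Y(t) the superposition, the square of Y expands into correlations of pairs of kernels. By
  -- hypothesis each is bounded by one kernel evaluated at the starting time of the other, so that
  -- ∫Y² is at most 2∫ b(y) Y(τ y), which is linear in Y. By symmetry the two terms contribute
  -- equally.
  calc _ ≤ ∫⁻ x, ∫⁻ y, (k (τ y) x * b x * b y + k (τ x) y * b y * b x) ∂ν ∂ν := by
        gcongr with x y
        have e : ∀ t, k t x * b x * (k t y * b y) = (k t x * k t y) * (b x * b y) := fun t => by
          rw [mul_mul_mul_comm]
        have hxy : Measurable fun t => k t x * k t y :=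
          (hk.comp measurable_prodMk_right).mul (hk.comp measurable_prodMk_right)
        simp_rw [e]
        rw [lintegral_mul_const _ hxy]
        calc _ ≤ (k (τ y) x + k (τ x) y) * (b x * b y) := by gcongr; exact h x y
          _ = _ := by rw [add_mul, mul_assoc, mul_assoc, mul_comm (b y) (b x)]
    _ = ∫⁻ x, ∫⁻ y, k (τ y) x * b x * b y ∂ν ∂ν + ∫⁻ x, ∫⁻ y, k (τ x) y * b y * b x ∂ν ∂ν := by
        have h1 : Measurable fun x => ∫⁻ y, k (τ y) x * b x * b y ∂ν :=
          Measurable.lintegral_prod_right' hm1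
        rw [← lintegral_add_left h1]
        congr 1; ext x
        have h2 : Measurable fun y => k (τ y) x * b x * b y := hm1.comp measurable_prodMk_left
        rw [lintegral_add_left h2]
    _ = _ := by
        rw [lintegral_lintegral_swap hm1.aemeasurable, e2, two_mul]

end Time

/-! ### The heat kernel in frequency and maximal regularity -/

lemma lintegral_exp_Ioi {c r : ℝ} (hc : 0 < c) :
    ∫⁻ t in Set.Ici r, ENNReal.ofReal (Real.exp (-(c * (t - r)))) = ENNReal.ofReal c⁻¹ := by
  rw [setLIntegral_congr Ioi_ae_eq_Ici.symm]
  have e : ∀ t, Real.exp (-(c * (t - r))) = Real.exp (c * r) * Real.exp (-c * t) := fun t => by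
    rw [← Real.exp_add]; congr 1; ring
  simp_rw [e]
  rw [← ofReal_integral_eq_lintegral_ofReal ((integrableOn_exp_mul_Ioi (by linarith) r).const_mul _)
    (Eventually.of_forall fun t => by positivity), integral_const_mul,
    integral_exp_mul_Ioi (by linarith)]
  congr 1
  have : Real.exp (c * r) * Real.exp (-c * r) = 1 := by rw [← Real.exp_add]; simp
  rw [neg_div_neg_eq, mul_div_assoc', this, one_div]

/-- The causal heat kernel at frequency `ξ`. -/
def heat (c : ℝ) (t s : ℝ) (ξ : Plane) : ℝ≥0∞ :=
  (Set.Ici s).indicator (fun t => ENNReal.ofReal (Real.exp (-(c * ‖ξ‖ ^ 2 * (t - s))))) t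

lemma measurable_heat (c : ℝ) : Measurable fun z : ℝ × ℝ × Plane => heat c z.1 z.2.1 z.2.2 := by
  have : MeasurableSet {z : ℝ × ℝ × Plane | z.2.1 ≤ z.1} :=
    measurableSet_le (by fun_prop) (by fun_prop)
  exact (by fun_prop : Measurable fun z : ℝ × ℝ × Plane =>
    ENNReal.ofReal (Real.exp (-(c * ‖z.2.2‖ ^ 2 * (z.1 - z.2.1))))).indicator this

lemma heat_le_one {c : ℝ} (hc : 0 ≤ c) (t s : ℝ) (ξ : Plane) : heat c t s ξ ≤ 1 := by
  simp only [heat, Set.indicator, Set.mem_Ici]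
  split_ifs with h
  · rw [← ENNReal.ofReal_one]
    apply ENNReal.ofReal_le_ofReal
    rw [Real.exp_le_one_iff]
    have := sub_nonneg.2 h
    have : 0 ≤ c * ‖ξ‖ ^ 2 * (t - s) := by positivity
    linarith
  · exact zero_le

/-- The square of the kernel with rate ‖ξ‖²/2 decays with rate ‖ξ‖² and has integral ‖ξ‖⁻². Combined
with Minkowski's inequality, this is the origin of the weight |ξ|⁻¹ in all estimates. -/
lemma eLpNorm_heat_le (m : Measure ℝ) (hm : m ≤ volume) (s : ℝ) {ξ : Plane} (hξ : ξ ≠ 0) :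
    eLpNorm (fun t => heat 2⁻¹ t s ξ) 2 m ≤ ENNReal.ofReal ‖ξ‖⁻¹ := by
  have hξ' : 0 < ‖ξ‖ := norm_pos_iff.2 hξ
  refine (eLpNorm_mono_measure _ hm).trans ?_
  rw [eLpNorm_two_eq, ← rpow_half_sq (ENNReal.ofReal _)]
  gcongr
  calc ∫⁻ t, heat 2⁻¹ t s ξ ^ 2 = ∫⁻ t in Set.Ici s,
        ENNReal.ofReal (Real.exp (-(‖ξ‖ ^ 2 * (t - s)))) := by
        rw [← lintegral_indicator measurableSet_Ici]
        congr 1; ext t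
        simp only [heat, Set.indicator]
        split_ifs
        · rw [← ENNReal.ofReal_pow (by positivity), ← Real.exp_nat_mul]
          congr 2; push_cast; ring
        · simp
    _ = _ := by
        rw [lintegral_exp_Ioi (by positivity), ← ENNReal.ofReal_pow (by positivity), inv_pow]
    _ ≤ _ := le_rfl

/-- Duhamel integrals of sources with the weight `|ξ|⁻¹`. -/
lemma eLpNorm_duhamel_le (T : ℝ) (I : Set Plane) {f : ℝ → Plane → ℝ≥0∞}
    (hf : Measurable (Function.uncurry f)) :
    timeNorm 2 T (fun t => ∫⁻ z : ℝ × Plane, heat 2⁻¹ t z.1 z.2 * f z.1 z.2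
        ∂((volume.restrict (Set.Icc 0 T)).prod (volume.restrict I)))
      ≤ ∫⁻ s in Set.Icc 0 T, ∫⁻ ξ in I, ENNReal.ofReal ‖ξ‖⁻¹ * f s ξ := by
  have hk : Measurable (Function.uncurry fun (t : ℝ) (z : ℝ × Plane) =>
      heat 2⁻¹ t z.1 z.2 * f z.1 z.2) := (measurable_heat 2⁻¹).mul (hf.comp measurable_snd)
  refine (eLpNorm_lintegral_le _ _ hk).trans ?_
  have hm : Measurable fun z : ℝ × Plane => ENNReal.ofReal ‖z.2‖⁻¹ * f z.1 z.2 :=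
    (by fun_prop : Measurable fun z : ℝ × Plane => ENNReal.ofReal ‖z.2‖⁻¹).mul hf
  rw [← lintegral_prod (fun z : ℝ × Plane => ENNReal.ofReal ‖z.2‖⁻¹ * f z.1 z.2)
    hm.aemeasurable]
  refine lintegral_mono_ae ?_
  have h0 : ∀ᵐ z : ℝ × Plane ∂((volume.restrict (Set.Icc 0 T)).prod (volume.restrict I)),
      z.2 ≠ 0 := Measure.quasiMeasurePreserving_snd.ae (ae_restrict_of_ae ae_plane_ne_zero)
  filter_upwards [h0] with z hz
  have hc : (fun t => heat 2⁻¹ t z.1 z.2 * f z.1 z.2) = fun t => f z.1 z.2 * heat 2⁻¹ t z.1 z.2 := by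
    ext t; rw [mul_comm]
  have hmz : Measurable fun t => heat 2⁻¹ t z.1 z.2 :=
    (measurable_heat 2⁻¹).comp (by fun_prop : Measurable fun t : ℝ => (t, z.1, z.2))
  calc eLpNorm (fun t => heat 2⁻¹ t z.1 z.2 * f z.1 z.2) 2 (volume.restrict (Set.Icc 0 T))
      = eLpNorm (fun t => heat 2⁻¹ t z.1 z.2) 2 (volume.restrict (Set.Icc 0 T)) * f z.1 z.2 := by
        rw [eLpNorm_two_eq, eLpNorm_two_eq]
        simp_rw [mul_pow]
        rw [lintegral_mul_const _ (hmz.pow_const 2), ENNReal.mul_rpow_of_nonneg _ _ (by norm_num),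
          rpow_half_sq]
    _ ≤ _ := by gcongr; exact eLpNorm_heat_le _ Measure.restrict_le_self _ hz

/-- The relaxation kernel of heat type, normalized in `L¹` in time. -/
lemma heat_mul_heat_le (m : Measure ℝ) (hm : m ≤ volume) (s s' : ℝ) (ξ ξ' : Plane) :
    ∫⁻ t, (‖ξ‖ₑ ^ 2 * heat 2⁻¹ t s ξ) * (‖ξ'‖ₑ ^ 2 * heat 2⁻¹ t s' ξ') ∂m
      ≤ 2 * (‖ξ‖ₑ ^ 2 * heat 2⁻¹ s' s ξ) + 2 * (‖ξ'‖ₑ ^ 2 * heat 2⁻¹ s s' ξ') := by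
  wlog h : s ≤ s' generalizing s s' ξ ξ' with H
  · have := H s' s ξ' ξ (le_of_not_ge h)
    rw [add_comm]
    refine le_trans (le_of_eq ?_) this
    congr 1; ext t; rw [mul_comm]
  rcases eq_or_ne ξ' 0 with rfl | hξ
  · simp
  have hξ' : 0 < ‖ξ'‖ := norm_pos_iff.2 hξ
  refine le_trans ?_ le_self_add
  -- With s ≤ s', both kernels are present only for t ≥ s', where the earlier one is at most its
  -- value at s'. It is pulled out, and the later one integrates to 2‖ξ'‖⁻².
  have e : ∀ t, (‖ξ‖ₑ ^ 2 * heat 2⁻¹ t s ξ) * (‖ξ'‖ₑ ^ 2 * heat 2⁻¹ t s' ξ') ≤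
      (‖ξ‖ₑ ^ 2 * heat 2⁻¹ s' s ξ * ‖ξ'‖ₑ ^ 2) * (Set.Ici s').indicator
        (fun t => ENNReal.ofReal (Real.exp (-((2⁻¹ * ‖ξ'‖ ^ 2) * (t - s'))))) t := fun t => by
    rw [mul_assoc, mul_assoc, mul_assoc]
    gcongr _ * ?_
    rw [mul_left_comm, mul_left_comm (heat 2⁻¹ s' s ξ)]
    gcongr _ * ?_
    simp only [heat, Set.indicator, Set.mem_Ici]
    by_cases h1 : s' ≤ t
    · rw [if_pos h1, if_pos (h.trans h1), if_pos h]
      gcongr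
    · simp [h1]
  refine (lintegral_mono' hm e).trans ?_
  rw [lintegral_const_mul _ ((by fun_prop : Measurable fun t => ENNReal.ofReal
    (Real.exp (-((2⁻¹ * ‖ξ'‖ ^ 2) * (t - s'))))).indicator measurableSet_Ici),
    lintegral_indicator measurableSet_Ici, lintegral_exp_Ioi (by positivity),
    ← ofReal_norm ξ', mul_assoc, ← ENNReal.ofReal_pow (by positivity),
    ← ENNReal.ofReal_mul (by positivity), mul_comm 2]
  gcongr
  apply ENNReal.ofReal_le_of_le_toReal
  apply le_of_eq
  simp only [ENNReal.toReal_ofNat]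
  field_simp

/-- `L²` maximal regularity, for Duhamel integrals at bounded frequencies. -/
lemma maximal_regularity (T : ℝ) {I : Set Plane} (hI : MeasurableSet I) (hI1 : ∀ ξ ∈ I, ‖ξ‖ ≤ 1)
    {f : ℝ → Plane → ℝ≥0∞} (hf : Measurable (Function.uncurry f)) :
    timeNorm 2 T (fun t => ∫⁻ z : ℝ × Plane, heat 2⁻¹ t z.1 z.2 * (‖z.2‖ₑ * f z.1 z.2)
        ∂((volume.restrict (Set.Icc 0 T)).prod (volume.restrict I)))
      ≤ 4 * timeNorm 2 T (fun s => ∫⁻ ξ in I, ENNReal.ofReal ‖ξ‖⁻¹ * f s ξ) := by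
  set m := (volume.restrict (Set.Icc 0 T) : Measure ℝ) with hm
  set ν := m.prod (volume.restrict I : Measure Plane) with hν
  set b : ℝ × Plane → ℝ≥0∞ := fun z => ENNReal.ofReal ‖z.2‖⁻¹ * f z.1 z.2 with hb
  have hbm : Measurable b :=
    (by fun_prop : Measurable fun z : ℝ × Plane => ENNReal.ofReal ‖z.2‖⁻¹).mul hf
  -- The factor ‖ξ‖²/2 gives the kernel unit mass in time for ξ ≠ 0. The source ‖ξ‖f is accordingly
  -- rewritten as ‖ξ‖² times b, up to the factor 2 restored at the end.
  set k : ℝ → ℝ × Plane → ℝ≥0∞ := fun t z => 2⁻¹ * (‖z.2‖ₑ ^ 2 * heat 2⁻¹ t z.1 z.2) with hk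
  have hkm : Measurable (Function.uncurry k) :=
    ((by fun_prop : Measurable fun z : ℝ × ℝ × Plane => ‖z.2.2‖ₑ ^ 2).mul
      (measurable_heat 2⁻¹)).const_mul _
  set q : ℝ → ℝ≥0∞ := fun s => ∫⁻ ξ in I, ENNReal.ofReal ‖ξ‖⁻¹ * f s ξ with hq
  have hqm : Measurable q := Measurable.lintegral_prod_right' hbm
  have hkb : ∀ t z, k t z * b z = 2⁻¹ * (‖z.2‖ₑ * (heat 2⁻¹ t z.1 z.2 * f z.1 z.2)) := by
    intro t z
    rcases eq_or_ne z.2 0 with h0 | h0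
    · simp [hk, h0]
    have h0' : 0 < ‖z.2‖ := norm_pos_iff.2 h0
    have : ‖z.2‖ₑ ^ 2 * ENNReal.ofReal ‖z.2‖⁻¹ = ‖z.2‖ₑ := by
      rw [← ofReal_norm, ← ENNReal.ofReal_pow (by positivity), ← ENNReal.ofReal_mul (by positivity)]
      congr 1; field_simp
    calc k t z * b z = 2⁻¹ * ((‖z.2‖ₑ ^ 2 * ENNReal.ofReal ‖z.2‖⁻¹) *
          (heat 2⁻¹ t z.1 z.2 * f z.1 z.2)) := by
          simp only [hk, hb, mul_assoc]; congr 2; rw [mul_left_comm]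
      _ = _ := by rw [this]
  set y : ℝ → ℝ≥0∞ := fun t => ∫⁻ z, k t z * b z ∂ν with hy
  have hym : Measurable y := Measurable.lintegral_prod_right'
    (f := fun z : ℝ × ℝ × Plane => k z.1 z.2 * b z.2) (hkm.mul (hbm.comp measurable_snd))
  have hgoal : ∀ t, ∫⁻ z, heat 2⁻¹ t z.1 z.2 * (‖z.2‖ₑ * f z.1 z.2) ∂ν = 2 * y t := fun t => by
    have hmz : Measurable fun z => k t z * b z := (hkm.comp measurable_prodMk_left).mul hbm
    rw [hy, ← lintegral_const_mul _ hmz]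
    congr 1; ext z
    rw [hkb, ← mul_assoc 2, ENNReal.mul_inv_cancel (by norm_num) (by norm_num), one_mul,
      mul_left_comm]
  have hbq : ∀ w : ℝ → ℝ≥0∞, Measurable w → ∫⁻ z, b z * w z.1 ∂ν = ∫⁻ s, q s * w s ∂m := by
    intro w hw
    rw [hν, lintegral_prod (fun z => b z * w z.1) (hbm.mul (hw.comp measurable_fst)).aemeasurable]
    congr 1; ext s
    have hbs : Measurable fun ξ => b (s, ξ) := hbm.comp measurable_prodMk_left
    exact lintegral_mul_const (w s) hbs
  -- The superposition inequality reads ‖y‖² ≤ 2⟨q, y⟩ ≤ 2‖q‖‖y‖, whence ‖y‖ ≤ 2‖q‖ as soon as ‖y‖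
  -- is known to be finite.
  have quad : eLpNorm y 2 m ^ 2 ≤ 2 * (eLpNorm q 2 m * eLpNorm y 2 m) := by
    rw [eLpNorm_two_sq]
    refine (lintegral_sq_superposition_le m ν hkm hbm (τ := Prod.fst) measurable_fst ?_).trans ?_
    · intro x x'
      have := heat_mul_heat_le m Measure.restrict_le_self x.1 x'.1 x.2 x'.2
      have hmt : Measurable fun t => (‖x.2‖ₑ ^ 2 * heat 2⁻¹ t x.1 x.2) *
          (‖x'.2‖ₑ ^ 2 * heat 2⁻¹ t x'.1 x'.2) :=
        (((measurable_heat 2⁻¹).comp (by fun_prop : Measurable fun t : ℝ => (t, x.1, x.2))).const_mul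
          _).mul (((measurable_heat 2⁻¹).comp
            (by fun_prop : Measurable fun t : ℝ => (t, x'.1, x'.2))).const_mul _)
      have h4 : (2⁻¹ : ℝ≥0∞) * 2⁻¹ * 2 = 2⁻¹ := by
        rw [mul_assoc, ENNReal.inv_mul_cancel (by norm_num) (by norm_num), mul_one]
      calc _ = (2⁻¹ * 2⁻¹) * ∫⁻ t, (‖x.2‖ₑ ^ 2 * heat 2⁻¹ t x.1 x.2) *
            (‖x'.2‖ₑ ^ 2 * heat 2⁻¹ t x'.1 x'.2) ∂m := by
            rw [← lintegral_const_mul _ hmt]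
            congr 1; ext t
            simp only [hk]; rw [mul_mul_mul_comm]
        _ ≤ (2⁻¹ * 2⁻¹) * (2 * (‖x.2‖ₑ ^ 2 * heat 2⁻¹ x'.1 x.1 x.2) +
            2 * (‖x'.2‖ₑ ^ 2 * heat 2⁻¹ x.1 x'.1 x'.2)) := by gcongr
        _ = _ := by
            rw [mul_add, ← mul_assoc (2⁻¹ * 2⁻¹) 2, ← mul_assoc (2⁻¹ * 2⁻¹) 2, h4]
    · gcongr
      rw [hbq y hym]
      exact lintegral_mul_le_eLpNorm m hqm.aemeasurable hym.aemeasurable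
  have hq1 : (4 : ℝ≥0∞) * eLpNorm q 2 m = 2 * (2 * eLpNorm q 2 m) := by
    rw [← mul_assoc]; norm_num
  have hm2 : timeNorm 2 T (fun t => ∫⁻ z : ℝ × Plane, heat 2⁻¹ t z.1 z.2 * (‖z.2‖ₑ * f z.1 z.2) ∂ν)
      = 2 * eLpNorm y 2 m := by
    unfold timeNorm
    simp_rw [hgoal]
    rw [eLpNorm_two_eq, eLpNorm_two_eq]
    simp_rw [mul_pow]
    rw [lintegral_const_mul _ (hym.pow_const 2), ENNReal.mul_rpow_of_nonneg _ _ (by norm_num),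
      rpow_half_sq]
  rw [hm2, show timeNorm 2 T q = eLpNorm q 2 m from rfl, hq1]
  gcongr 2 * ?_
  by_cases hqi : eLpNorm q 2 m = ∞
  · simp [hqi]
  have hI' : ∀ᵐ z ∂ν, z.2 ∈ I :=
    Measure.quasiMeasurePreserving_snd.ae (ae_restrict_mem hI)
  have hfin : m Set.univ < ∞ := by simp [hm]
  -- A crude bound, used only to make the cancellation of ‖y‖ legitimate: on I the kernel is at most
  -- 1 because ‖ξ‖ ≤ 1, and the time interval has finite length.
  have hyb : ∀ t, y t ≤ eLpNorm q 2 m * eLpNorm (fun _ => (1 : ℝ≥0∞)) 2 m := fun t => by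
    calc y t ≤ ∫⁻ z, b z * 1 ∂ν := by
          refine lintegral_mono_ae ?_
          filter_upwards [hI'] with z hz
          rw [mul_comm]
          gcongr
          have h1 : ‖z.2‖ₑ ≤ 1 := by
            rw [← ofReal_norm, ← ENNReal.ofReal_one]; exact ENNReal.ofReal_le_ofReal (hI1 _ hz)
          calc k t z ≤ 1 * (1 ^ 2 * 1) := by
                simp only [hk]
                gcongr
                · exact ENNReal.inv_le_one.2 (by norm_num)
                · exact heat_le_one (by norm_num) _ _ _
            _ = 1 := by simp
      _ = ∫⁻ s, q s * 1 ∂m := hbq (fun _ => 1) measurable_const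
      _ ≤ _ := lintegral_mul_le_eLpNorm m hqm.aemeasurable aemeasurable_const
  have hone : eLpNorm (fun _ => (1 : ℝ≥0∞)) 2 m < ∞ := by
    rw [eLpNorm_two_eq]
    exact ENNReal.rpow_lt_top_of_nonneg (by norm_num) (by simp [hm])
  have hyf : eLpNorm y 2 m ≠ ∞ := by
    rw [eLpNorm_two_eq]
    refine (ENNReal.rpow_lt_top_of_nonneg (by norm_num) (ne_of_lt ?_)).ne
    calc ∫⁻ t, y t ^ 2 ∂m ≤ ∫⁻ _, (eLpNorm q 2 m * eLpNorm (fun _ => (1 : ℝ≥0∞)) 2 m) ^ 2 ∂m := by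
          gcongr with t; exact hyb t
      _ < ∞ := by
          rw [lintegral_const]
          exact ENNReal.mul_lt_top (ENNReal.pow_lt_top (ENNReal.mul_lt_top (lt_top_iff_ne_top.2 hqi)
            hone)) hfin
  rcases eq_or_ne (eLpNorm y 2 m) 0 with h0 | h0
  · rw [h0]; exact zero_le
  rw [pow_two, ← mul_assoc] at quad
  exact (ENNReal.mul_le_mul_iff_left h0 hyf).1 quad

/-! ### Duhamel's formula and uniqueness of weak solutions -/

lemma integral_exp_sub (c : ℂ) {r t : ℝ} (h : r ≤ t) :
    ∫ s in Set.Ioc r t, c * Complex.exp (c * (s - r : ℝ)) = Complex.exp (c * (t - r : ℝ)) - 1 := by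
  rw [← intervalIntegral.integral_of_le h]
  have hd : ∀ s : ℝ, HasDerivAt (fun s : ℝ => Complex.exp (c * (s - r : ℝ)))
      (c * Complex.exp (c * (s - r : ℝ))) s := fun s => by
    have h1 : HasDerivAt (fun s : ℝ => ((s - r : ℝ) : ℂ)) 1 s := by
      simpa using ((hasDerivAt_id s).sub_const r).ofReal_comp
    have := (h1.const_mul c).cexp
    simpa [mul_comm] using this
  rw [intervalIntegral.integral_eq_sub_of_hasDerivAt (fun s _ => hd s)
    ((by fun_prop : Continuous fun s : ℝ => c * Complex.exp (c * (s - r : ℝ))).intervalIntegrable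
      _ _)]
  simp

/-- The solution of `z' = c z + R`, `z(0) = z₀`. -/
def duhamel (c z₀ : ℂ) (R : ℝ → ℂ) (t : ℝ) : ℂ :=
  Complex.exp (c * t) * z₀ + ∫ r in Set.Ioc 0 t, Complex.exp (c * (t - r : ℝ)) * R r

lemma norm_exp_mul_le {c : ℂ} (hc : c.re ≤ 0) {s : ℝ} (hs : 0 ≤ s) :
    ‖Complex.exp (c * s)‖ ≤ 1 := by
  rw [Complex.norm_exp, Real.exp_le_one_iff]
  simp only [Complex.re_mul_ofReal]
  exact mul_nonpos_of_nonpos_of_nonneg hc hs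

lemma norm_duhamel_le {c z₀ : ℂ} {R : ℝ → ℂ} (hc : c.re ≤ 0) {M t : ℝ} (ht : 0 ≤ t)
    (hR : ∀ s ∈ Set.Ioc 0 t, ‖R s‖ ≤ M) : ‖duhamel c z₀ R t‖ ≤ ‖z₀‖ + M * t := by
  refine (norm_add_le _ _).trans (add_le_add ?_ ?_)
  · rw [norm_mul]
    exact mul_le_of_le_one_left (norm_nonneg _) (norm_exp_mul_le hc ht)
  · refine (norm_setIntegral_le_of_norm_le_const (C := M) (by simp) ?_).trans ?_
    · intro r hr
      rw [norm_mul]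
      exact (mul_le_of_le_one_left (norm_nonneg _)
        (norm_exp_mul_le hc (sub_nonneg.2 hr.2))).trans (hR r hr)
    · simp [ht]

/-- The source is only integrable in time, so the differential equation is stated in integrated
form; Fubini on the triangle r ≤ s ≤ t replaces differentiation. -/
lemma duhamel_eq (c z₀ : ℂ) {R : ℝ → ℂ} {t : ℝ} (ht : 0 ≤ t) (hR : IntegrableOn R (Set.Ioc 0 t)) :
    duhamel c z₀ R t = z₀ + ∫ s in Set.Ioc 0 t, (c * duhamel c z₀ R s + R s) := by
  set m := (volume.restrict (Set.Ioc 0 t) : Measure ℝ) with hm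
  set F : ℝ → ℝ → ℂ := fun s r => (Set.Iic s).indicator
    (fun r => c * Complex.exp (c * (s - r : ℝ)) * R r) r with hF
  have hFi : Integrable (Function.uncurry F) (m.prod m) := by
    have h1 : Integrable (fun z : ℝ × ℝ => R z.2) (m.prod m) := hR.comp_snd m
    have hbd : ∀ᵐ z ∂(m.prod m), ‖c * Complex.exp (c * (z.1 - z.2 : ℝ))‖
        ≤ ‖c‖ * Real.exp (‖c‖ * t) := by
      have a1 : ∀ᵐ z ∂(m.prod m), z.1 ∈ Set.Ioc 0 t :=
        Measure.quasiMeasurePreserving_fst.ae (ae_restrict_mem measurableSet_Ioc)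
      have a2 : ∀ᵐ z ∂(m.prod m), z.2 ∈ Set.Ioc 0 t :=
        Measure.quasiMeasurePreserving_snd.ae (ae_restrict_mem measurableSet_Ioc)
      filter_upwards [a1, a2] with z h1 h2
      rw [norm_mul, Complex.norm_exp]
      gcongr
      refine (Complex.re_le_norm _).trans ?_
      rw [norm_mul, Complex.norm_real, Real.norm_eq_abs]
      gcongr
      rw [abs_le]; constructor <;> linarith [h1.1, h1.2, h2.1, h2.2]
    have h2 := h1.bdd_mul (by fun_prop : Continuous fun z : ℝ × ℝ =>
      c * Complex.exp (c * (z.1 - z.2 : ℝ))).aestronglyMeasurable hbd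
    exact h2.indicator (s := {z : ℝ × ℝ | z.2 ≤ z.1}) (measurableSet_le (by fun_prop) (by fun_prop))
  have e1 : ∀ s ∈ Set.Ioc 0 t, ∫ r, F s r ∂m = c * ∫ r in Set.Ioc 0 s,
      Complex.exp (c * (s - r : ℝ)) * R r := fun s hs => by
    rw [hF, integral_indicator measurableSet_Iic, hm, Measure.restrict_restrict measurableSet_Iic,
      ← integral_const_mul]
    have : Set.Iic s ∩ Set.Ioc 0 t = Set.Ioc 0 s := by
      ext r; simp only [Set.mem_inter_iff, Set.mem_Iic, Set.mem_Ioc]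
      constructor
      · rintro ⟨h1, h2, h3⟩; exact ⟨h2, h1⟩
      · rintro ⟨h1, h2⟩; exact ⟨h2, h1, h2.trans hs.2⟩
    rw [this]
    simp_rw [mul_assoc]
  have e2 : ∀ r ∈ Set.Ioc 0 t, ∫ s, F s r ∂m = Complex.exp (c * (t - r : ℝ)) * R r - R r :=
    fun r hr => by
    have : ∀ s, F s r = (Set.Ici r).indicator
        (fun s => c * Complex.exp (c * (s - r : ℝ)) * R r) s := fun s => by
      simp [hF, Set.indicator]
    simp_rw [this]
    rw [integral_indicator measurableSet_Ici, hm, Measure.restrict_restrict measurableSet_Ici,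
      integral_mul_const]
    have : Set.Ici r ∩ Set.Ioc 0 t = Set.Icc r t := by
      ext s; simp only [Set.mem_inter_iff, Set.mem_Ici, Set.mem_Ioc, Set.mem_Icc]
      constructor
      · rintro ⟨h1, h2, h3⟩; exact ⟨h1, h3⟩
      · rintro ⟨h1, h2⟩; exact ⟨h1, hr.1.trans_le h1, h2⟩
    rw [this, integral_Icc_eq_integral_Ioc, integral_exp_sub c hr.2, sub_mul, one_mul]
  have swap := integral_integral_swap hFi
  have hI1 : Integrable (fun r => Complex.exp (c * (t - r : ℝ)) * R r) m := by
    refine Integrable.bdd_mul hR (c := Real.exp (‖c‖ * t))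
      (by fun_prop : Continuous fun r : ℝ => Complex.exp (c * (t - r : ℝ))).aestronglyMeasurable ?_
    filter_upwards [ae_restrict_mem measurableSet_Ioc] with r hr
    rw [Complex.norm_exp]
    gcongr
    refine (Complex.re_le_norm _).trans ?_
    rw [norm_mul, Complex.norm_real, Real.norm_eq_abs]
    gcongr
    rw [abs_le]; constructor <;> linarith [hr.1, hr.2]
  have hI2 : Integrable (fun s => ∫ r, F s r ∂m) m := hFi.integral_prod_left
  have hI3 : Integrable (fun s : ℝ => c * (Complex.exp (c * s) * z₀)) m :=
    (by fun_prop : Continuous fun s : ℝ => c * (Complex.exp (c * s) * z₀)).integrableOn_Ioc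
  have hI4 : ∫ s, c * (Complex.exp (c * s) * z₀) ∂m = (Complex.exp (c * t) - 1) * z₀ := by
    have := integral_exp_sub c ht
    simp only [sub_zero] at this
    rw [← this, ← integral_mul_const]
    simp_rw [mul_assoc]
    rfl
  have hsum : ∫ s, (c * duhamel c z₀ R s + R s) ∂m
      = ∫ s, (c * (Complex.exp (c * s) * z₀) + ∫ r, F s r ∂m + R s) ∂m := by
    refine integral_congr_ae ?_
    filter_upwards [ae_restrict_mem measurableSet_Ioc] with s hs
    rw [e1 s hs, duhamel, mul_add]
  have h5 : ∫ s, ∫ r, F s r ∂m ∂m = (∫ r, Complex.exp (c * (t - r : ℝ)) * R r ∂m) - ∫ r, R r ∂m := by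
    rw [swap, ← integral_sub hI1 hR]
    refine integral_congr_ae ?_
    filter_upwards [ae_restrict_mem measurableSet_Ioc] with r hr
    exact e2 r hr
  have hI5 : Integrable (fun s : ℝ => c * (Complex.exp (c * s) * z₀) + ∫ r, F s r ∂m) m :=
    hI3.add hI2
  rw [hsum, integral_add hI5 hR, integral_add hI3 hI2, hI4, h5, duhamel]
  ring

lemma stronglyMeasurable_duhamel {c z₀ : Plane → ℂ} (hc : Measurable c) (hz : Measurable z₀)
    {R : ℝ → Plane → ℂ} (hR : Measurable (Function.uncurry R)) :
    StronglyMeasurable fun z : ℝ × Plane => duhamel (c z.2) (z₀ z.2) (fun s => R s z.2) z.1 := by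
  unfold duhamel
  refine StronglyMeasurable.add (Measurable.stronglyMeasurable (by fun_prop)) ?_
  have e : ∀ z : ℝ × Plane, ∫ r in Set.Ioc 0 z.1, Complex.exp (c z.2 * (z.1 - r : ℝ)) * R r z.2
      = ∫ r, {w : (ℝ × Plane) × ℝ | 0 < w.2 ∧ w.2 ≤ w.1.1}.indicator
        (fun w => Complex.exp (c w.1.2 * (w.1.1 - w.2 : ℝ)) * R w.2 w.1.2) (z, r) := fun z => by
    rw [← integral_indicator measurableSet_Ioc]
    congr 1
  simp_rw [e]
  refine StronglyMeasurable.integral_prod_right'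
    (f := {w : (ℝ × Plane) × ℝ | 0 < w.2 ∧ w.2 ≤ w.1.1}.indicator
        (fun w => Complex.exp (c w.1.2 * (w.1.1 - w.2 : ℝ)) * R w.2 w.1.2)) ?_
  refine Measurable.stronglyMeasurable (Measurable.indicator ?_ ?_)
  · exact (by fun_prop : Measurable fun w : (ℝ × Plane) × ℝ =>
      Complex.exp (c w.1.2 * (w.1.1 - w.2 : ℝ))).mul
      (hR.comp (by fun_prop : Measurable fun w : (ℝ × Plane) × ℝ => (w.2, w.1.2)))
  · have h1 : MeasurableSet {w : (ℝ × Plane) × ℝ | 0 < w.2} :=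
      measurableSet_lt (by fun_prop) (by fun_prop)
    have h2 : MeasurableSet {w : (ℝ × Plane) × ℝ | w.2 ≤ w.1.1} :=
      measurableSet_le (by fun_prop) (by fun_prop)
    exact h1.inter h2

section
variable {ρ : Measure Plane} [IsFiniteMeasure ρ] {T : ℝ} {c z₀ : Plane → ℂ} {R : ℝ → Plane → ℂ}
  {M : ℝ}

lemma integrable_duhamel (hc : Measurable c) (hc0 : ∀ ξ, (c ξ).re ≤ 0) (hz : Measurable z₀)
    (hzi : Integrable z₀ ρ) (hR : Measurable (Function.uncurry R))
    (hRb : ∀ s ∈ Set.Icc 0 T, ∀ ξ, ‖R s ξ‖ ≤ M) {t : ℝ} (ht : t ∈ Set.Icc 0 T) :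
    Integrable (fun ξ => duhamel (c ξ) (z₀ ξ) (fun s => R s ξ) t) ρ := by
  refine (hzi.norm.add (integrable_const (M * t))).mono' ?_ (Eventually.of_forall fun ξ => ?_)
  · exact ((stronglyMeasurable_duhamel hc hz hR).comp_measurable
      measurable_prodMk_left).aestronglyMeasurable
  · exact norm_duhamel_le (hc0 ξ) ht.1 fun s hs => hRb s ⟨hs.1.le, hs.2.trans ht.2⟩ ξ

/-- The Duhamel formula solves the evolution equation in the weak sense. -/
lemma integral_duhamel (hc : Measurable c) (hc0 : ∀ ξ, (c ξ).re ≤ 0) (hc1 : ∀ ξ, ‖c ξ‖ ≤ 1)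
    (hz : Measurable z₀) (hzi : Integrable z₀ ρ) (hR : Measurable (Function.uncurry R))
    (hRb : ∀ s ∈ Set.Icc 0 T, ∀ ξ, ‖R s ξ‖ ≤ M) {t : ℝ} (ht : t ∈ Set.Icc 0 T) {θ : Plane → ℂ}
    (hθ : Measurable θ) {b : ℝ} (hb : ∀ ξ, ‖θ ξ‖ ≤ b) :
    ∫ ξ, duhamel (c ξ) (z₀ ξ) (fun s => R s ξ) t * θ ξ ∂ρ
      = ∫ ξ, z₀ ξ * θ ξ ∂ρ
        + (∫ s in Set.Ioc 0 t, ∫ ξ, duhamel (c ξ) (z₀ ξ) (fun s => R s ξ) s * (c ξ * θ ξ) ∂ρ)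
        + ∫ s in Set.Ioc 0 t, ∫ ξ, R s ξ * θ ξ ∂ρ := by
  set m := (volume.restrict (Set.Ioc 0 t) : Measure ℝ) with hm
  have hsub : ∀ s ∈ Set.Ioc 0 t, s ∈ Set.Icc 0 T := fun s hs => ⟨hs.1.le, hs.2.trans ht.2⟩
  have hRi : ∀ ξ, IntegrableOn (fun s => R s ξ) (Set.Ioc 0 t) := fun ξ => by
    refine Measure.integrableOn_of_bounded (M := M) (by simp)
      (hR.comp measurable_prodMk_right).aestronglyMeasurable ?_
    filter_upwards [ae_restrict_mem measurableSet_Ioc] with s hs using hRb s (hsub s hs) ξ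
  have hfst : ∀ᵐ w ∂(m.prod ρ), w.1 ∈ Set.Ioc 0 t :=
    Measure.quasiMeasurePreserving_fst.ae (ae_restrict_mem measurableSet_Ioc)
  have i1 : Integrable (fun w : ℝ × Plane =>
      duhamel (c w.2) (z₀ w.2) (fun s => R s w.2) w.1 * (c w.2 * θ w.2)) (m.prod ρ) := by
    refine ((((hzi.norm.comp_snd m).add (integrable_const (M * t))).mul_const b)).mono' ?_ ?_
    · exact ((stronglyMeasurable_duhamel hc hz hR).mul
        (Measurable.stronglyMeasurable (by fun_prop))).aestronglyMeasurable
    · filter_upwards [hfst] with w hw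
      have h1 : ‖duhamel (c w.2) (z₀ w.2) (fun s => R s w.2) w.1‖ ≤ ‖z₀ w.2‖ + M * t := by
        refine (norm_duhamel_le (hc0 _) hw.1.le fun s hs =>
          hRb s (hsub s ⟨hs.1, hs.2.trans hw.2⟩) _).trans ?_
        have : 0 ≤ M := (norm_nonneg _).trans (hRb w.1 (hsub _ hw) w.2)
        gcongr; exact hw.2
      rw [norm_mul, norm_mul]
      simp only [Pi.add_apply]
      have h2 : ‖c w.2‖ * ‖θ w.2‖ ≤ b :=
        (mul_le_of_le_one_left (norm_nonneg _) (hc1 _)).trans (hb _)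
      exact mul_le_mul h1 h2 (by positivity) ((norm_nonneg _).trans h1)
  have i2 : Integrable (fun w : ℝ × Plane => R w.1 w.2 * θ w.2) (m.prod ρ) := by
    refine (integrable_const (M * b)).mono' (hR.mul (hθ.comp measurable_snd)).aestronglyMeasurable ?_
    filter_upwards [hfst] with w hw
    rw [norm_mul]
    exact mul_le_mul (hRb _ (hsub _ hw) _) (hb _) (norm_nonneg _)
      ((norm_nonneg _).trans (hRb _ (hsub _ hw) w.2))
  have hzθ : Integrable (fun ξ => z₀ ξ * θ ξ) ρ :=
    hzi.mul_bdd hθ.aestronglyMeasurable (Eventually.of_forall hb)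
  -- At fixed frequency this is the integrated scalar equation; what follows is the exchange of the
  -- integrals in time and frequency.
  have pt : ∀ ξ, duhamel (c ξ) (z₀ ξ) (fun s => R s ξ) t * θ ξ = z₀ ξ * θ ξ +
      ∫ s, (duhamel (c ξ) (z₀ ξ) (fun s => R s ξ) s * (c ξ * θ ξ) + R s ξ * θ ξ) ∂m := fun ξ => by
    rw [duhamel_eq _ _ ht.1 (hRi ξ), add_mul, ← integral_mul_const]
    congr 1
    congr 1; ext s; ring
  have i3 : Integrable (fun w : ℝ × Plane => duhamel (c w.2) (z₀ w.2) (fun s => R s w.2) w.1 *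
      (c w.2 * θ w.2) + R w.1 w.2 * θ w.2) (m.prod ρ) := i1.add i2
  have i4 : Integrable (fun ξ => ∫ s, (duhamel (c ξ) (z₀ ξ) (fun s => R s ξ) s * (c ξ * θ ξ)
      + R s ξ * θ ξ) ∂m) ρ := i3.integral_prod_right
  have sw := integral_integral_swap (f := fun s ξ =>
    duhamel (c ξ) (z₀ ξ) (fun s => R s ξ) s * (c ξ * θ ξ) + R s ξ * θ ξ) i3
  simp_rw [pt]
  rw [integral_add hzθ i4, ← sw, add_assoc]
  congr 1
  rw [← integral_add i1.integral_prod_left i2.integral_prod_left]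
  refine integral_congr_ae ?_
  filter_upwards [i1.prod_right_ae, i2.prod_right_ae] with s h1 h2
  exact integral_add h1 h2

/-- A weak solution of `z' = c z + R` is given by the Duhamel formula. -/
lemma ae_eq_duhamel (hc : Measurable c) (hc0 : ∀ ξ, (c ξ).re ≤ 0) (hc1 : ∀ ξ, ‖c ξ‖ ≤ 1)
    (hz : Measurable z₀) (hzi : Integrable z₀ ρ) (hR : Measurable (Function.uncurry R))
    (hRb : ∀ s ∈ Set.Icc 0 T, ∀ ξ, ‖R s ξ‖ ≤ M) {z : ℝ → Plane → ℂ} {K : ℝ}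
    (hzt : ∀ t ∈ Set.Icc 0 T, Integrable (z t) ρ) (hK : ∀ t ∈ Set.Icc 0 T, ∫ ξ, ‖z t ξ‖ ∂ρ ≤ K)
    (hmeas : ∀ θ : Plane → ℂ, Measurable θ → ∀ b : ℝ, (∀ ξ, ‖θ ξ‖ ≤ b) →
      AEStronglyMeasurable (fun s => ∫ ξ, z s ξ * θ ξ ∂ρ) (volume.restrict (Set.Icc 0 T)))
    (heq : ∀ θ : Plane → ℂ, Measurable θ → ∀ b : ℝ, (∀ ξ, ‖θ ξ‖ ≤ b) → ∀ t ∈ Set.Icc 0 T,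
      ∫ ξ, z t ξ * θ ξ ∂ρ = ∫ ξ, z₀ ξ * θ ξ ∂ρ
        + (∫ s in Set.Ioc 0 t, ∫ ξ, z s ξ * (c ξ * θ ξ) ∂ρ)
        + ∫ s in Set.Ioc 0 t, ∫ ξ, R s ξ * θ ξ ∂ρ) {t : ℝ} (ht : t ∈ Set.Icc 0 T) :
    z t =ᵐ[ρ] fun ξ => duhamel (c ξ) (z₀ ξ) (fun s => R s ξ) t := by
  set y : ℝ → Plane → ℂ := fun t ξ => duhamel (c ξ) (z₀ ξ) (fun s => R s ξ) t with hy
  have hyi : ∀ t ∈ Set.Icc 0 T, Integrable (y t) ρ := fun t ht =>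
    integrable_duhamel hc hc0 hz hzi hR hRb ht
  have hyj := stronglyMeasurable_duhamel hc hz hR
  set K' : ℝ := K + ∫ ξ, (‖z₀ ξ‖ + M * T) ∂ρ with hK'
  have hyK : ∀ t ∈ Set.Icc 0 T, ∫ ξ, ‖z t ξ - y t ξ‖ ∂ρ ≤ K' := fun t ht => by
    calc ∫ ξ, ‖z t ξ - y t ξ‖ ∂ρ ≤ ∫ ξ, (‖z t ξ‖ + ‖y t ξ‖) ∂ρ :=
          integral_mono ((hzt t ht).sub (hyi t ht)).norm ((hzt t ht).norm.add (hyi t ht).norm)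
            fun ξ => norm_sub_le _ _
      _ = ∫ ξ, ‖z t ξ‖ ∂ρ + ∫ ξ, ‖y t ξ‖ ∂ρ := integral_add (hzt t ht).norm (hyi t ht).norm
      _ ≤ _ := by
        refine add_le_add (hK t ht) (integral_mono (hyi t ht).norm
          (hzi.norm.add (integrable_const _)) fun ξ => ?_)
        refine (norm_duhamel_le (hc0 ξ) ht.1 fun s hs =>
          hRb s ⟨hs.1.le, hs.2.trans ht.2⟩ ξ).trans ?_
        have : 0 ≤ M := (norm_nonneg _).trans (hRb t ht ξ)
        gcongr; exact ht.2
  have hbd : ∀ θ : Plane → ℂ, Measurable θ → ∀ b : ℝ, (∀ ξ, ‖θ ξ‖ ≤ b) → ∀ t ∈ Set.Icc 0 T,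
      ‖∫ ξ, (z t ξ - y t ξ) * θ ξ ∂ρ‖ ≤ b * K' := by
    intro θ hθ b hb t ht
    have hb0 : 0 ≤ b := (norm_nonneg _).trans (hb 0)
    refine (norm_integral_le_of_norm_le (((hzt t ht).sub (hyi t ht)).norm.const_mul b)
      (Eventually.of_forall fun ξ => ?_)).trans ?_
    · rw [norm_mul, mul_comm]; exact mul_le_mul_of_nonneg_right (hb ξ) (norm_nonneg _)
    · rw [integral_const_mul]; gcongr; exact hyK t ht
  have hsubI : ∀ θ : Plane → ℂ, Measurable θ → ∀ b : ℝ, (∀ ξ, ‖θ ξ‖ ≤ b) → ∀ t ∈ Set.Icc 0 T,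
      ∫ ξ, (z t ξ - y t ξ) * θ ξ ∂ρ = ∫ ξ, z t ξ * θ ξ ∂ρ - ∫ ξ, y t ξ * θ ξ ∂ρ := by
    intro θ hθ b hb t ht
    rw [← integral_sub ((hzt t ht).mul_bdd hθ.aestronglyMeasurable (Eventually.of_forall hb))
      ((hyi t ht).mul_bdd hθ.aestronglyMeasurable (Eventually.of_forall hb))]
    simp_rw [sub_mul]
  have hcb : ∀ θ : Plane → ℂ, ∀ b : ℝ, (∀ ξ, ‖θ ξ‖ ≤ b) → ∀ ξ, ‖c ξ * θ ξ‖ ≤ b := by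
    intro θ b hb ξ
    rw [norm_mul]
    exact (mul_le_of_le_one_left (norm_nonneg _) (hc1 _)).trans (hb _)
  have hym : ∀ θ : Plane → ℂ, Measurable θ →
      StronglyMeasurable (fun s => ∫ ξ, y s ξ * θ ξ ∂ρ) := fun θ hθ =>
    StronglyMeasurable.integral_prod_right'
      (f := fun w : ℝ × Plane => y w.1 w.2 * θ w.2)
      (hyj.mul (Measurable.stronglyMeasurable (by fun_prop)))
  -- The source and the data cancel in the difference z - y, and c is moved onto the test function.
  -- Since ‖c‖ ≤ 1, the new test function obeys the same bound b, so the identity can be iterated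
  -- without loss.
  have rec' : ∀ θ : Plane → ℂ, Measurable θ → ∀ b : ℝ, (∀ ξ, ‖θ ξ‖ ≤ b) → ∀ t ∈ Set.Icc 0 T,
      ∫ ξ, (z t ξ - y t ξ) * θ ξ ∂ρ
        = ∫ s in Set.Ioc 0 t, ∫ ξ, (z s ξ - y s ξ) * (c ξ * θ ξ) ∂ρ := by
    intro θ hθ b hb t ht
    have hcm : Measurable fun ξ => c ξ * θ ξ := hc.mul hθ
    have hst : Set.Ioc 0 t ⊆ Set.Icc 0 T := fun s hs => ⟨hs.1.le, hs.2.trans ht.2⟩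
    have j2 : IntegrableOn (fun s => ∫ ξ, y s ξ * (c ξ * θ ξ) ∂ρ) (Set.Ioc 0 t) := by
      refine Measure.integrableOn_of_bounded (M := b * ∫ ξ, (‖z₀ ξ‖ + M * T) ∂ρ) (by simp)
        (hym _ hcm).aestronglyMeasurable ?_
      filter_upwards [ae_restrict_mem measurableSet_Ioc] with s hs
      have hs' := hst hs
      have hb0 : 0 ≤ b := (norm_nonneg _).trans (hb 0)
      rw [← integral_const_mul]
      refine norm_integral_le_of_norm_le ((hzi.norm.add (integrable_const _)).const_mul b)
        (Eventually.of_forall fun ξ => ?_)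
      rw [norm_mul, mul_comm]
      refine mul_le_mul (hcb θ b hb ξ) ?_ (norm_nonneg _) hb0
      refine (norm_duhamel_le (hc0 ξ) hs'.1 fun r hr =>
          hRb r ⟨hr.1.le, hr.2.trans hs'.2⟩ ξ).trans ?_
      have : 0 ≤ M := (norm_nonneg _).trans (hRb s hs' ξ)
      gcongr; exact hs'.2
    have j1 : IntegrableOn (fun s => ∫ ξ, z s ξ * (c ξ * θ ξ) ∂ρ) (Set.Ioc 0 t) := by
      refine (integrable_const (b * K)).mono' ((hmeas _ hcm b (hcb θ b hb)).mono_set hst) ?_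
      filter_upwards [ae_restrict_mem measurableSet_Ioc] with s hs
      have hs' := hst hs
      have hb0 : 0 ≤ b := (norm_nonneg _).trans (hb 0)
      refine (norm_integral_le_of_norm_le ((hzt s hs').norm.const_mul b)
        (Eventually.of_forall fun ξ => ?_)).trans ?_
      · rw [norm_mul, mul_comm]; gcongr; exact hcb θ b hb ξ
      · rw [integral_const_mul]; gcongr; exact hK s hs'
    rw [hsubI θ hθ b hb t ht, heq θ hθ b hb t ht,
      integral_duhamel hc hc0 hc1 hz hzi hR hRb ht hθ hb, add_sub_add_right_eq_sub,
      add_sub_add_left_eq_sub, ← integral_sub j1 j2]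
    refine setIntegral_congr_fun measurableSet_Ioc fun s hs => ?_
    exact (hsubI _ hcm b (hcb θ b hb) s (hst hs)).symm
  -- Picard iteration: each use of the identity integrates the previous bound once more in time, so
  -- that n uses gain tⁿ/n!, which tends to zero.
  have iter : ∀ n : ℕ, ∀ θ : Plane → ℂ, Measurable θ → ∀ b : ℝ, (∀ ξ, ‖θ ξ‖ ≤ b) →
      ∀ t ∈ Set.Icc 0 T, ‖∫ ξ, (z t ξ - y t ξ) * θ ξ ∂ρ‖ ≤ b * K' * (t ^ n / n.factorial) := by
    intro n
    induction n with
    | zero => intro θ hθ b hb t ht; simpa using hbd θ hθ b hb t ht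
    | succ n ih =>
      intro θ hθ b hb t ht
      rw [rec' θ hθ b hb t ht]
      have hst : Set.Ioc 0 t ⊆ Set.Icc 0 T := fun s hs => ⟨hs.1.le, hs.2.trans ht.2⟩
      refine (norm_integral_le_of_norm_le (g := fun s => b * K' * (s ^ n / n.factorial)) ?_ ?_).trans
        ?_
      · exact (by fun_prop : Continuous fun s : ℝ => b * K' * (s ^ n / n.factorial)).integrableOn_Ioc
      · filter_upwards [ae_restrict_mem measurableSet_Ioc] with s hs
        exact ih _ (hc.mul hθ) b (hcb θ b hb) s (hst hs)
      · rw [integral_const_mul, integral_div, ← intervalIntegral.integral_of_le ht.1, integral_pow]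
        apply le_of_eq
        rw [Nat.factorial_succ]
        push_cast
        simp only [ne_eq, Nat.succ_ne_zero, not_false_eq_true, zero_pow, sub_zero]
        rw [div_div]
  have zero : ∀ θ : Plane → ℂ, Measurable θ → ∀ b : ℝ, (∀ ξ, ‖θ ξ‖ ≤ b) →
      ∫ ξ, (z t ξ - y t ξ) * θ ξ ∂ρ = 0 := by
    intro θ hθ b hb
    rw [← norm_le_zero_iff]
    have lim : Tendsto (fun n : ℕ => b * K' * (t ^ n / n.factorial)) atTop (𝓝 (b * K' * 0)) :=
      (FloorSemiring.tendsto_pow_div_factorial_atTop t).const_mul _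
    rw [mul_zero] at lim
    exact ge_of_tendsto' lim fun n => iter n θ hθ b hb t ht
  -- Indicators of measurable sets are admissible tests, so all set integrals of the difference
  -- vanish.
  have := ((hzt t ht).sub (hyi t ht)).ae_eq_zero_of_forall_setIntegral_eq_zero fun s hs _ => by
    have := zero (s.indicator 1) (measurable_one.indicator hs) 1 fun ξ => by
      simp only [Set.indicator]; split_ifs <;> simp
    rw [← integral_indicator hs, ← this]
    congr 1; ext ξ
    simp [Set.indicator]
  filter_upwards [this] with ξ h
  exact sub_eq_zero.1 h

end

/-! ### Weighted Cauchy–Schwarz and the division into low and high frequencies -/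

lemma l2_eq (f : Plane → ℝ≥0∞) : l2 f = eLpNorm f 2 volume := (eLpNorm_two_eq _ _).symm

lemma l2_mono {f g : Plane → ℝ≥0∞} (h : ∀ᵐ x, f x ≤ g x) : l2 f ≤ l2 g := by
  unfold l2
  refine ENNReal.rpow_le_rpow (lintegral_mono_ae ?_) (by norm_num)
  filter_upwards [h] with x hx
  gcongr

lemma l2_add_le {f g : Plane → ℝ≥0∞} (hf : AEMeasurable f) (hg : AEMeasurable g) :
    l2 (fun x => f x + g x) ≤ l2 f + l2 g := by
  have := ENNReal.lintegral_Lp_add_le (μ := (volume : Measure Plane)) (p := 2) hf hg (by norm_num)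
  simpa [l2] using this

lemma lintegral_le_weight (s : Set Plane) {w : Plane → ℝ} (hw : Measurable w)
    (hpos : ∀ ξ, ξ ≠ 0 → 0 < w ξ) {f : Plane → ℝ≥0∞} (hf : AEMeasurable f) :
    ∫⁻ ξ in s, f ξ ≤ (∫⁻ ξ in s, ENNReal.ofReal ((w ξ)⁻¹ ^ 2)) ^ (1 / 2 : ℝ) *
      l2 (fun ξ => ENNReal.ofReal (w ξ) * f ξ) := by
  calc ∫⁻ ξ in s, f ξ ≤ ∫⁻ ξ in s, ENNReal.ofReal (w ξ)⁻¹ * (ENNReal.ofReal (w ξ) * f ξ) := by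
        refine lintegral_mono_ae ?_
        filter_upwards [ae_restrict_of_ae ae_plane_ne_zero] with ξ hξ
        have h := hpos ξ hξ
        rw [← mul_assoc, ← ENNReal.ofReal_mul (by positivity), inv_mul_cancel₀ h.ne',
          ENNReal.ofReal_one, one_mul]
    _ ≤ eLpNorm (fun ξ => ENNReal.ofReal (w ξ)⁻¹) 2 (volume.restrict s) *
        eLpNorm (fun ξ => ENNReal.ofReal (w ξ) * f ξ) 2 (volume.restrict s) :=
        lintegral_mul_le_eLpNorm _ (by fun_prop)
          (AEMeasurable.mul (by fun_prop) (hf.mono_measure Measure.restrict_le_self))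
    _ ≤ _ := by
        refine mul_le_mul' (le_of_eq ?_) ?_
        · rw [eLpNorm_two_eq]
          congr 1
          refine lintegral_congr_ae ?_
          filter_upwards [ae_restrict_of_ae ae_plane_ne_zero] with ξ hξ
          rw [ENNReal.ofReal_pow (inv_nonneg.2 (hpos ξ hξ).le)]
        · rw [l2_eq]
          exact eLpNorm_mono_measure _ Measure.restrict_le_self

lemma lintegral_bracket_lt_top : ∫⁻ ξ : Plane, ENNReal.ofReal ((1 + ‖ξ‖ ^ 2)⁻¹ ^ 2) < ∞ := by
  have h : Integrable (fun x : Plane => ((1 : ℝ) + ‖x‖ ^ 2) ^ (-(4 : ℝ) / 2)) :=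
    integrable_rpow_neg_one_add_norm_sq (by simp; norm_num)
  have h2 := h.lintegral_lt_top
  refine lt_of_le_of_lt (lintegral_mono fun x => ENNReal.ofReal_le_ofReal (le_of_eq ?_)) h2
  rw [show (-(4 : ℝ) / 2) = -((2 : ℕ) : ℝ) by norm_num, Real.rpow_neg (by positivity),
    Real.rpow_natCast, inv_pow]

/-- The low frequencies, where the linearized system is not parabolic of heat type. -/
def lowRegion : Set Plane := {ξ | ‖ξ‖ ^ 2 ≤ |ξ 0|}

lemma measurableSet_lowRegion : MeasurableSet lowRegion :=
  measurableSet_le (by fun_prop) (by fun_prop)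

lemma norm_le_one_of_mem {ξ : Plane} (h : ξ ∈ lowRegion) : ‖ξ‖ ≤ 1 := by
  have h1 : ‖ξ‖ ^ 2 ≤ |ξ 0| := h
  have h2 : |ξ 0| ≤ ‖ξ‖ := PiLp.norm_apply_le ξ 0
  by_contra h3
  push Not at h3
  nlinarith

lemma lintegral_abs_rpow_lt_top {a : ℝ} (ha : -1 < a) :
    ∫⁻ x in Set.Icc (-1 : ℝ) 1, ENNReal.ofReal (|x| ^ a) < ∞ := by
  have h0 : ∫⁻ x in Set.Ioc (0 : ℝ) 1, ENNReal.ofReal (|x| ^ a) < ∞ := by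
    have h := (intervalIntegral.intervalIntegrable_rpow' (a := 0) (b := 1) ha).1
    refine lt_of_le_of_lt (le_of_eq ?_) h.lintegral_lt_top
    refine setLIntegral_congr_fun measurableSet_Ioc fun x hx => ?_
    simp only [abs_of_pos hx.1]
  have h1 : ∫⁻ x in Set.Ico (-1 : ℝ) 0, ENNReal.ofReal (|x| ^ a) < ∞ := by
    refine lt_of_le_of_lt (le_of_eq ?_) h0
    rw [← lintegral_indicator measurableSet_Ico, ← lintegral_indicator measurableSet_Ioc,
      ← lintegral_neg_eq_self]
    congr 1; ext x
    simp only [Set.indicator, Set.mem_Ico, Set.mem_Ioc, abs_neg]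
    have : (-1 ≤ -x ∧ -x < 0) ↔ (0 < x ∧ x ≤ 1) := by
      constructor <;> rintro ⟨h1, h2⟩ <;> constructor <;> linarith
    simp only [this]
  have hs : Set.Icc (-1 : ℝ) 1 ⊆ Set.Ico (-1 : ℝ) 0 ∪ (Set.Ioc (0 : ℝ) 1 ∪ {0}) := by
    intro x hx
    rcases lt_trichotomy x 0 with h | h | h
    · exact Or.inl ⟨hx.1, h⟩
    · exact Or.inr (Or.inr h)
    · exact Or.inr (Or.inl ⟨h, hx.2⟩)
  refine lt_of_le_of_lt (lintegral_mono_set hs) (lt_of_le_of_lt (lintegral_union_le _ _ _) ?_)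
  refine ENNReal.add_lt_top.2 ⟨h1, lt_of_le_of_lt (lintegral_union_le _ _ _) ?_⟩
  refine ENNReal.add_lt_top.2 ⟨h0, ?_⟩
  rw [setLIntegral_measure_zero _ _ (measure_singleton 0)]
  exact ENNReal.zero_lt_top

/-- For ‖ξ‖ > 1 the integrand is at most 4(1 + ‖ξ‖²)⁻². For ‖ξ‖ ≤ 1 the condition |ξ 0| < ‖ξ‖² is
essential: writing ‖ξ‖⁻² = (‖ξ‖²)^(-3/4) ‖ξ‖^(-1/2), it gives the bound |ξ 0|^(-3/4) |ξ 1|^(-1/2), a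
product of integrable functions of one variable. -/
lemma lintegral_high_lt_top :
    ∫⁻ ξ in lowRegionᶜ, ENNReal.ofReal ((‖ξ‖ + ‖ξ‖ ^ 2)⁻¹ ^ 2) < ∞ := by
  set F : ℝ → ℝ → ℝ≥0∞ := fun a b => (Set.Icc (-1 : ℝ) 1).indicator
    (fun x => ENNReal.ofReal (|x| ^ (-(3 / 4) : ℝ))) a * (Set.Icc (-1 : ℝ) 1).indicator
    (fun x => ENNReal.ofReal (|x| ^ (-(1 / 2) : ℝ))) b with hF
  have m1 : Measurable ((Set.Icc (-1 : ℝ) 1).indicator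
    (fun x => ENNReal.ofReal (|x| ^ (-(3 / 4) : ℝ)))) :=
    Measurable.indicator (by fun_prop) measurableSet_Icc
  have m2 : Measurable ((Set.Icc (-1 : ℝ) 1).indicator
    (fun x => ENNReal.ofReal (|x| ^ (-(1 / 2) : ℝ)))) :=
    Measurable.indicator (by fun_prop) measurableSet_Icc
  have hFm : Measurable (Function.uncurry F) := (m1.comp measurable_fst).mul (m2.comp measurable_snd)
  have hF1 : ∫⁻ ξ : Plane, F (ξ 0) (ξ 1) < ∞ := by
    rw [lintegral_plane F hFm]
    simp_rw [hF, lintegral_const_mul _ m2]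
    rw [lintegral_mul_const _ m1, lintegral_indicator measurableSet_Icc,
      lintegral_indicator measurableSet_Icc]
    exact ENNReal.mul_lt_top (lintegral_abs_rpow_lt_top (by norm_num))
      (lintegral_abs_rpow_lt_top (by norm_num))
  have hle : ∀ᵐ ξ : Plane, ξ ∈ lowRegionᶜ → ENNReal.ofReal ((‖ξ‖ + ‖ξ‖ ^ 2)⁻¹ ^ 2) ≤
      F (ξ 0) (ξ 1) + 4 * ENNReal.ofReal ((1 + ‖ξ‖ ^ 2)⁻¹ ^ 2) := by
    filter_upwards [ae_coord_ne_zero 0, ae_coord_ne_zero 1] with ξ h0 h1 hξ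
    have hξ' : |ξ 0| < ‖ξ‖ ^ 2 := not_le.1 hξ
    have a0 : 0 < |ξ 0| := abs_pos.2 h0
    have a1 : 0 < |ξ 1| := abs_pos.2 h1
    have b0 : |ξ 0| ≤ ‖ξ‖ := PiLp.norm_apply_le ξ 0
    have b1 : |ξ 1| ≤ ‖ξ‖ := PiLp.norm_apply_le ξ 1
    have hpos : 0 < ‖ξ‖ := a0.trans_le b0
    by_cases hle : ‖ξ‖ ≤ 1
    · refine le_trans ?_ le_self_add
      have i0 : ξ 0 ∈ Set.Icc (-1 : ℝ) 1 := abs_le.1 (b0.trans hle)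
      have i1 : ξ 1 ∈ Set.Icc (-1 : ℝ) 1 := abs_le.1 (b1.trans hle)
      simp only [hF, Set.indicator_of_mem i0, Set.indicator_of_mem i1]
      rw [← ENNReal.ofReal_mul (by positivity)]
      apply ENNReal.ofReal_le_ofReal
      calc (‖ξ‖ + ‖ξ‖ ^ 2)⁻¹ ^ 2 ≤ ‖ξ‖⁻¹ ^ 2 := by
            gcongr; nlinarith
        _ = (‖ξ‖ ^ 2) ^ (-(3 / 4) : ℝ) * ‖ξ‖ ^ (-(1 / 2) : ℝ) := by
            rw [← Real.rpow_natCast ‖ξ‖ 2, ← Real.rpow_mul hpos.le, ← Real.rpow_add hpos, inv_pow,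
              ← Real.rpow_natCast ‖ξ‖ 2, ← Real.rpow_neg hpos.le]
            norm_num
        _ ≤ _ := by
            refine mul_le_mul (Real.rpow_le_rpow_of_nonpos a0 hξ'.le (by norm_num))
              (Real.rpow_le_rpow_of_nonpos a1 b1 (by norm_num)) (by positivity) (by positivity)
    · refine le_trans ?_ le_add_self
      push Not at hle
      apply ENNReal.ofReal_le_of_le_toReal
      rw [ENNReal.toReal_mul, ENNReal.toReal_ofReal (by positivity)]
      simp only [ENNReal.toReal_ofNat]
      rw [inv_pow, inv_pow, ← div_eq_mul_inv, inv_eq_one_div,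
        div_le_div_iff₀ (by positivity) (by positivity)]
      nlinarith [sq_nonneg ‖ξ‖, mul_pos hpos hpos, mul_pos (mul_pos hpos hpos) hpos]
  refine lt_of_le_of_lt (setLIntegral_mono_ae' measurableSet_lowRegion.compl hle) ?_
  refine lt_of_le_of_lt (setLIntegral_le_lintegral _ _) ?_
  have hFm' : Measurable fun ξ : Plane => F (ξ 0) (ξ 1) :=
    hFm.comp (by fun_prop : Measurable fun ξ : Plane => (ξ 0, ξ 1))
  rw [lintegral_add_left hFm', lintegral_const_mul _ (by fun_prop)]
  exact ENNReal.add_lt_top.2 ⟨hF1, ENNReal.mul_lt_top (by norm_num) lintegral_bracket_lt_top⟩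

/-- The constant of the embedding `H² ⊂ 𝓕L¹`. -/
def cSob : ℝ≥0∞ := (∫⁻ ξ : Plane, ENNReal.ofReal ((1 + ‖ξ‖ ^ 2)⁻¹ ^ 2)) ^ (1 / 2 : ℝ)

/-- The constant of the embedding of `Ḣ¹ ∩ Ḣ²` into `𝓕L¹` away from the low frequencies. -/
def cHigh : ℝ≥0∞ :=
  (∫⁻ ξ in lowRegionᶜ, ENNReal.ofReal ((‖ξ‖ + ‖ξ‖ ^ 2)⁻¹ ^ 2)) ^ (1 / 2 : ℝ)

lemma cSob_lt_top : cSob < ∞ :=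
  ENNReal.rpow_lt_top_of_nonneg (by norm_num) lintegral_bracket_lt_top.ne

lemma cHigh_lt_top : cHigh < ∞ :=
  ENNReal.rpow_lt_top_of_nonneg (by norm_num) lintegral_high_lt_top.ne

lemma norm_sq_plane (ξ : Plane) : ‖ξ‖ ^ 2 = ξ 0 ^ 2 + ξ 1 ^ 2 := by
  rw [EuclideanSpace.norm_sq_eq]; simp

lemma norm_le_abs_add (ξ : Plane) : ‖ξ‖ ≤ |ξ 0| + |ξ 1| := by
  rw [← abs_of_nonneg (norm_nonneg ξ), ← abs_of_nonneg (add_nonneg (abs_nonneg (ξ 0)) (abs_nonneg (ξ 1))),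
    ← sq_le_sq, norm_sq_plane]
  nlinarith [sq_abs (ξ 0), sq_abs (ξ 1), mul_nonneg (abs_nonneg (ξ 0)) (abs_nonneg (ξ 1))]

lemma enorm_le_add (ξ : Plane) : ‖ξ‖ₑ ≤ ‖ξ 0‖ₑ + ‖ξ 1‖ₑ := by
  rw [← ofReal_norm, ← ofReal_norm, ← ofReal_norm, ← ENNReal.ofReal_add (by positivity) (by positivity)]
  exact ENNReal.ofReal_le_ofReal (norm_le_abs_add ξ)

lemma lintegral_inv_norm_lowRegion_le :
    ∫⁻ ξ in lowRegion, ENNReal.ofReal ‖ξ‖⁻¹ ≤ ENNReal.ofReal (4 * Real.pi) := by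
  calc _ ≤ ∫⁻ x in {x : Plane | ‖x‖ < 2}, ENNReal.ofReal ‖x‖⁻¹ :=
        lintegral_mono_set fun ξ hξ => lt_of_le_of_lt (norm_le_one_of_mem hξ) (by norm_num)
    _ = _ := by rw [lintegral_inv_norm_ball]; congr 1; ring

/-! ### The Wiener norm: product estimates and Sobolev embeddings -/

/-- The norm of `f` in `𝓕L¹`. -/
def wiener (f : Plane → ℝ) : ℝ≥0∞ := ∫⁻ ξ, ‖hat f ξ‖ₑ

/-- The `L²` norm of the gradient, as a sum over components. -/
def gradNorm (f : Plane → ℝ) : ℝ≥0∞ := eLpNorm (pd 0 f) 2 volume + eLpNorm (pd 1 f) 2 volume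

/-- `C¹` functions in `H¹ ∩ 𝓕L¹`. -/
structure Reg (f : Plane → ℝ) : Prop where
  contDiff : ContDiff ℝ 1 f
  memLp : MemLp f 2 (volume : Measure Plane)
  memLp_pd : ∀ i, MemLp (pd i f) 2 (volume : Measure Plane)
  wiener_lt : wiener f < ∞

lemma aemeasurable_hat (f : Plane → ℝ) : AEMeasurable (fun ξ => ‖hat f ξ‖ₑ) :=
  (aestronglyMeasurable_hat f).enorm

lemma l2_hat {f : Plane → ℝ} (hf : MemLp f 2 (volume : Measure Plane)) :
    l2 (fun ξ => ‖hat f ξ‖ₑ) = ENNReal.ofReal (2 * Real.pi) * eLpNorm f 2 volume := by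
  rw [l2_eq, ← eLpNorm_hat hf, eLpNorm_enorm]

lemma pd_mul {f g : Plane → ℝ} (hf : Differentiable ℝ f) (hg : Differentiable ℝ g) (i : Fin 2)
    (x : Plane) : pd i (fun x => f x * g x) x = f x * pd i g x + pd i f x * g x := by
  unfold pd
  rw [fderiv_fun_mul (hf x) (hg x)]
  simp [mul_comm]

lemma continuous_pd {f : Plane → ℝ} (hf : ContDiff ℝ 1 f) (i : Fin 2) : Continuous (pd i f) :=
  (hf.continuous_fderiv (by norm_num)).clm_apply continuous_const

lemma lintegral_conv {f g : Plane → ℝ≥0∞} (hf : AEMeasurable f) (hg : AEMeasurable g) :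
    ∫⁻ ξ, ∫⁻ η, f (ξ - η) * g η = (∫⁻ ξ, f ξ) * ∫⁻ η, g η := by
  have h := lintegral_weight_conv (w := fun _ => 1) measurable_const hf.measurable_mk
    hg.measurable_mk
  simp only [one_mul] at h
  simp_rw [conv_congr hf.ae_eq_mk hg.ae_eq_mk]
  rw [h, lintegral_congr_ae hf.ae_eq_mk, lintegral_congr_ae hg.ae_eq_mk,
    ← lintegral_mul_const _ hf.measurable_mk]
  congr 1; ext ζ
  rw [lintegral_const_mul _ hg.measurable_mk]

namespace Reg
variable {f g : Plane → ℝ}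

lemma differentiable (hf : Reg f) : Differentiable ℝ f := hf.contDiff.differentiable (by norm_num)

lemma continuous (hf : Reg f) : Continuous f := hf.contDiff.continuous

lemma enorm_le (hf : Reg f) (x : Plane) : ‖f x‖ₑ ≤ wiener f :=
  enorm_le_lintegral_hat hf.continuous hf.memLp x

lemma l2_coord (hf : Reg f) (i : Fin 2) :
    l2 (fun ξ => ‖ξ i‖ₑ * ‖hat f ξ‖ₑ) = ENNReal.ofReal (2 * Real.pi) * eLpNorm (pd i f) 2 volume := by
  rw [← l2_hat (hf.memLp_pd i)]
  refine l2_congr ?_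
  filter_upwards [hat_pd i hf.differentiable hf.memLp (hf.memLp_pd i)] with ξ h
  rw [h, enorm_mul, enorm_mul]
  simp [enorm_eq_nnnorm]

lemma l2_norm (hf : Reg f) :
    l2 (fun ξ => ‖ξ‖ₑ * ‖hat f ξ‖ₑ) ≤ ENNReal.ofReal (2 * Real.pi) * gradNorm f := by
  have hm : ∀ i : Fin 2, AEMeasurable fun ξ : Plane => ‖ξ i‖ₑ * ‖hat f ξ‖ₑ := fun i =>
    AEMeasurable.mul (by fun_prop) (aemeasurable_hat f)
  calc _ ≤ l2 (fun ξ => ‖ξ 0‖ₑ * ‖hat f ξ‖ₑ + ‖ξ 1‖ₑ * ‖hat f ξ‖ₑ) :=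
        l2_mono (Eventually.of_forall fun ξ => by
          rw [← add_mul]; gcongr; exact enorm_le_add ξ)
    _ ≤ _ := l2_add_le (hm 0) (hm 1)
    _ = _ := by rw [hf.l2_coord, hf.l2_coord, gradNorm, mul_add]

/-- The supremum of |f| is at most its Wiener norm, as f is continuous. -/
lemma eLpNorm_mul_le (hf : Reg f) (g : Plane → ℝ) :
    eLpNorm (fun x => f x * g x) 2 volume ≤ wiener f * eLpNorm g 2 volume := by
  have h := eLpNorm_le_nnreal_smul_eLpNorm_of_ae_le_mul (μ := (volume : Measure Plane))
    (f := fun x => f x * g x) (g := g) (c := (wiener f).toNNReal) (p := 2)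
    (Eventually.of_forall fun x => by
      rw [nnnorm_mul]
      gcongr
      rw [← ENNReal.coe_le_coe, ENNReal.coe_toNNReal hf.wiener_lt.ne]
      exact hf.enorm_le x)
  rwa [ENNReal.smul_def, ENNReal.coe_toNNReal hf.wiener_lt.ne, smul_eq_mul] at h

lemma memLp_mul (hf : Reg f) (hg : MemLp g 2 (volume : Measure Plane)) :
    MemLp (fun x => f x * g x) 2 (volume : Measure Plane) :=
  ⟨hf.continuous.aestronglyMeasurable.mul hg.1,
    lt_of_le_of_lt (hf.eLpNorm_mul_le g) (ENNReal.mul_lt_top hf.wiener_lt hg.2)⟩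

lemma _root_.MHD.integrable_mul_of_memLp (hf : MemLp f 2 (volume : Measure Plane))
    (hg : MemLp g 2 (volume : Measure Plane)) : Integrable (fun x => f x * g x) :=
  hf.integrable_mul hg

lemma wiener_mul_le (hf : Reg f) (hg : Reg g) :
    wiener (fun x => f x * g x) ≤ wiener f * wiener g := by
  unfold wiener
  rw [← lintegral_conv (aemeasurable_hat f) (aemeasurable_hat g)]
  refine lintegral_mono_ae ?_
  filter_upwards [hat_ae_eq_fourierInt (integrable_mul_of_memLp hf.memLp hg.memLp)
    (hf.memLp_mul hg.memLp)] with ξ h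
  rw [h]
  exact enorm_fourierInt_mul_le hf.memLp hg.memLp ξ

lemma eLpNorm_pd_mul_le (hf : Reg f) (hg : Reg g) (i : Fin 2) :
    eLpNorm (pd i fun x => f x * g x) 2 volume
      ≤ wiener f * eLpNorm (pd i g) 2 volume + wiener g * eLpNorm (pd i f) 2 volume := by
  have e : pd i (fun x => f x * g x) = (fun x => f x * pd i g x) + fun x => g x * pd i f x := by
    ext x
    rw [pd_mul hf.differentiable hg.differentiable, Pi.add_apply, mul_comm (pd i f x)]
  rw [e]
  refine (eLpNorm_add_le (hf.memLp_mul (hg.memLp_pd i)).1 (hg.memLp_mul (hf.memLp_pd i)).1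
    (by norm_num)).trans ?_
  gcongr
  · exact hf.eLpNorm_mul_le _
  · exact hg.eLpNorm_mul_le _

lemma gradNorm_mul_le (hf : Reg f) (hg : Reg g) :
    gradNorm (fun x => f x * g x) ≤ wiener f * gradNorm g + wiener g * gradNorm f := by
  unfold gradNorm
  calc _ ≤ _ := add_le_add (hf.eLpNorm_pd_mul_le hg 0) (hf.eLpNorm_pd_mul_le hg 1)
    _ = _ := by ring

lemma mul (hf : Reg f) (hg : Reg g) : Reg (fun x => f x * g x) where
  contDiff := hf.contDiff.mul hg.contDiff
  memLp := hf.memLp_mul hg.memLp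
  memLp_pd i := ⟨(continuous_pd (hf.contDiff.mul hg.contDiff) i).aestronglyMeasurable,
    lt_of_le_of_lt (hf.eLpNorm_pd_mul_le hg i) (ENNReal.add_lt_top.2
      ⟨ENNReal.mul_lt_top hf.wiener_lt (hg.memLp_pd i).2,
        ENNReal.mul_lt_top hg.wiener_lt (hf.memLp_pd i).2⟩)⟩
  wiener_lt := lt_of_le_of_lt (hf.wiener_mul_le hg) (ENNReal.mul_lt_top hf.wiener_lt hg.wiener_lt)

lemma ofReal_two_pi_mul_self_le : ENNReal.ofReal (2 * Real.pi) * ENNReal.ofReal (2 * Real.pi)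
    ≤ 64 := by
  rw [← ENNReal.ofReal_mul (by positivity)]
  apply ENNReal.ofReal_le_of_le_toReal
  simp only [ENNReal.toReal_ofNat]
  nlinarith [Real.pi_pos, Real.pi_lt_four]

/-- Products with a derivative in `L¹` with weight `|ξ|⁻¹`. -/
lemma low_mul_pd_le (hf : Reg f) (hg : Reg g) (i : Fin 2) :
    ∫⁻ ξ, ENNReal.ofReal ‖ξ‖⁻¹ * ‖fourierInt (fun x => ((f x * pd i g x : ℝ) : ℂ)) ξ‖ₑ
      ≤ 6400 * (wiener f * wiener g + gradNorm f * gradNorm g) := by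
  have hpt : ∀ ξ, ‖fourierInt (fun x => ((f x * pd i g x : ℝ) : ℂ)) ξ‖ₑ
      ≤ ∫⁻ η, ‖hat f (ξ - η)‖ₑ * (‖η‖ₑ * ‖hat g η‖ₑ) := fun ξ => by
    refine (enorm_fourierInt_mul_le hf.memLp (hg.memLp_pd i) ξ).trans ?_
    refine lintegral_mono_ae ?_
    filter_upwards [hat_pd i hg.differentiable hg.memLp (hg.memLp_pd i)] with η h
    gcongr
    rw [h, enorm_mul, enorm_mul]
    have h1 : ‖Complex.I‖ₑ = 1 := by simp [enorm_eq_nnnorm]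
    have h2 : ‖((η i : ℝ) : ℂ)‖ₑ ≤ ‖η‖ₑ := by
      rw [← ofReal_norm, ← ofReal_norm, Complex.norm_real]
      exact ENNReal.ofReal_le_ofReal (PiLp.norm_apply_le η i)
    rw [h1, one_mul]
    gcongr
  calc _ ≤ ∫⁻ ξ, ENNReal.ofReal ‖ξ‖⁻¹ * ∫⁻ η, ‖hat f (ξ - η)‖ₑ * (‖η‖ₑ * ‖hat g η‖ₑ) := by
        gcongr with ξ; exact hpt ξ
    _ ≤ 100 * (wiener f * wiener g + l2 (fun ζ => ‖ζ‖ₑ * ‖hat f ζ‖ₑ) *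
          l2 (fun η => ‖η‖ₑ * ‖hat g η‖ₑ)) :=
        bilinear_estimate_deriv (aemeasurable_hat f) (aemeasurable_hat g)
    _ ≤ 100 * (1 * (wiener f * wiener g) + ENNReal.ofReal (2 * Real.pi) * gradNorm f *
          (ENNReal.ofReal (2 * Real.pi) * gradNorm g)) := by
        rw [one_mul]
        gcongr
        · exact hf.l2_norm
        · exact hg.l2_norm
    _ ≤ 100 * (64 * (wiener f * wiener g) + 64 * (gradNorm f * gradNorm g)) := by
        rw [mul_mul_mul_comm]
        gcongr
        · norm_num
        · exact ofReal_two_pi_mul_self_le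
    _ = _ := by rw [← mul_add, ← mul_assoc]; norm_num

/-- Products in `L¹` with weight `|ξ|⁻¹`. -/
lemma low_mul_le (hf : Reg f) (hg : Reg g) :
    ∫⁻ ξ, ENNReal.ofReal ‖ξ‖⁻¹ * ‖fourierInt (fun x => ((f x * g x : ℝ) : ℂ)) ξ‖ₑ
      ≤ 6400 * (gradNorm f * eLpNorm g 2 volume + eLpNorm f 2 volume * eLpNorm (pd 0 g) 2 volume) := by
  calc _ ≤ ∫⁻ ξ, ENNReal.ofReal ‖ξ‖⁻¹ * ∫⁻ η, ‖hat f (ξ - η)‖ₑ * ‖hat g η‖ₑ := by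
        gcongr with ξ; exact enorm_fourierInt_mul_le hf.memLp hg.memLp ξ
    _ ≤ 100 * (l2 (fun ζ => ‖ζ‖ₑ * ‖hat f ζ‖ₑ) * l2 (fun η => ‖hat g η‖ₑ) +
          l2 (fun ζ => ‖hat f ζ‖ₑ) * l2 (fun η => ‖η 0‖ₑ * ‖hat g η‖ₑ)) :=
        bilinear_estimate (aemeasurable_hat f) (aemeasurable_hat g)
    _ ≤ 100 * (ENNReal.ofReal (2 * Real.pi) * gradNorm f *
          (ENNReal.ofReal (2 * Real.pi) * eLpNorm g 2 volume) +
          ENNReal.ofReal (2 * Real.pi) * eLpNorm f 2 volume *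
          (ENNReal.ofReal (2 * Real.pi) * eLpNorm (pd 0 g) 2 volume)) := by
        rw [l2_hat hf.memLp, l2_hat hg.memLp, hg.l2_coord]
        gcongr
        exact hf.l2_norm
    _ ≤ 100 * (64 * (gradNorm f * eLpNorm g 2 volume) +
          64 * (eLpNorm f 2 volume * eLpNorm (pd 0 g) 2 volume)) := by
        rw [mul_mul_mul_comm, mul_mul_mul_comm (ENNReal.ofReal (2 * Real.pi)) (eLpNorm f 2 volume)]
        gcongr <;> exact ofReal_two_pi_mul_self_le
    _ = _ := by rw [← mul_add, ← mul_assoc]; norm_num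

end Reg

section Sobolev
variable {f : Plane → ℝ}

/-- `l2` bound for a second derivative. -/
lemma l2_coord_sq (hf : ContDiff ℝ 2 f) (h0 : MemLp f 2 (volume : Measure Plane)) (i : Fin 2)
    (h1 : MemLp (pd i f) 2 (volume : Measure Plane))
    (h2 : MemLp (pd i (pd i f)) 2 (volume : Measure Plane)) :
    l2 (fun ξ => ‖ξ i‖ₑ ^ 2 * ‖hat f ξ‖ₑ)
      = ENNReal.ofReal (2 * Real.pi) * eLpNorm (pd i (pd i f)) 2 volume := by
  rw [← l2_hat h2]
  refine l2_congr ?_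
  have hd : Differentiable ℝ f := hf.differentiable (by norm_num)
  have hd' : Differentiable ℝ (pd i f) :=
    ((hf.fderiv_right (m := 1) (by norm_num)).clm_apply contDiff_const).differentiable (by norm_num)
  filter_upwards [hat_pd i hd h0 h1, hat_pd i hd' h1 h2] with ξ a b
  rw [b, a]
  simp only [enorm_mul, pow_two, mul_assoc]
  simp [enorm_eq_nnnorm]

lemma enorm_sq_plane (ξ : Plane) : ‖ξ‖ₑ ^ 2 = ‖ξ 0‖ₑ ^ 2 + ‖ξ 1‖ₑ ^ 2 := by
  simp only [← ofReal_norm, ← ENNReal.ofReal_pow (norm_nonneg _)]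
  rw [← ENNReal.ofReal_add (by positivity) (by positivity), norm_sq_plane]
  simp

lemma l2_norm_sq_le (hf : ContDiff ℝ 2 f) (h0 : MemLp f 2 (volume : Measure Plane))
    (h1 : ∀ i, MemLp (pd i f) 2 (volume : Measure Plane))
    (h2 : ∀ i, MemLp (pd i (pd i f)) 2 (volume : Measure Plane)) :
    l2 (fun ξ => ‖ξ‖ₑ ^ 2 * ‖hat f ξ‖ₑ) ≤ ENNReal.ofReal (2 * Real.pi) *
      (eLpNorm (pd 0 (pd 0 f)) 2 volume + eLpNorm (pd 1 (pd 1 f)) 2 volume) := by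
  have hm : ∀ i : Fin 2, AEMeasurable fun ξ : Plane => ‖ξ i‖ₑ ^ 2 * ‖hat f ξ‖ₑ := fun i =>
    AEMeasurable.mul (by fun_prop) (aemeasurable_hat f)
  simp_rw [enorm_sq_plane, add_mul]
  refine (l2_add_le (hm 0) (hm 1)).trans ?_
  rw [l2_coord_sq hf h0 0 (h1 0) (h2 0), l2_coord_sq hf h0 1 (h1 1) (h2 1), mul_add]

/-- The embedding `H² ⊂ 𝓕L¹`. -/
lemma wiener_le (hf : ContDiff ℝ 2 f) (h0 : MemLp f 2 (volume : Measure Plane))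
    (h1 : ∀ i, MemLp (pd i f) 2 (volume : Measure Plane))
    (h2 : ∀ i, MemLp (pd i (pd i f)) 2 (volume : Measure Plane)) :
    wiener f ≤ cSob * ENNReal.ofReal (2 * Real.pi) * (eLpNorm f 2 volume +
      eLpNorm (pd 0 (pd 0 f)) 2 volume + eLpNorm (pd 1 (pd 1 f)) 2 volume) := by
  have h := lintegral_le_weight Set.univ (w := fun ξ => 1 + ‖ξ‖ ^ 2) (by fun_prop)
    (fun ξ _ => by positivity) (aemeasurable_hat f)
  rw [setLIntegral_univ, setLIntegral_univ] at h
  refine h.trans ?_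
  rw [mul_assoc, show (∫⁻ ξ : Plane, ENNReal.ofReal ((1 + ‖ξ‖ ^ 2)⁻¹ ^ 2)) ^ (1 / 2 : ℝ) = cSob from rfl]
  gcongr cSob * ?_
  have e : ∀ ξ, ENNReal.ofReal (1 + ‖ξ‖ ^ 2) * ‖hat f ξ‖ₑ = ‖hat f ξ‖ₑ + ‖ξ‖ₑ ^ 2 * ‖hat f ξ‖ₑ :=
    fun ξ => by
    rw [ENNReal.ofReal_add (by norm_num) (by positivity), ENNReal.ofReal_one,
      ENNReal.ofReal_pow (norm_nonneg _), ofReal_norm, add_mul, one_mul]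
  simp_rw [e]
  refine (l2_add_le (aemeasurable_hat f)
    (AEMeasurable.mul (by fun_prop) (aemeasurable_hat f))).trans ?_
  rw [l2_hat h0, add_assoc, mul_add]
  gcongr
  exact l2_norm_sq_le hf h0 h1 h2

/-- High frequencies are controlled by first and second derivatives. -/
lemma lintegral_high_le (hf : ContDiff ℝ 2 f) (hr : Reg f)
    (h2 : ∀ i, MemLp (pd i (pd i f)) 2 (volume : Measure Plane)) :
    ∫⁻ ξ in lowRegionᶜ, ‖hat f ξ‖ₑ ≤ cHigh * ENNReal.ofReal (2 * Real.pi) * (gradNorm f +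
      (eLpNorm (pd 0 (pd 0 f)) 2 volume + eLpNorm (pd 1 (pd 1 f)) 2 volume)) := by
  have h := lintegral_le_weight lowRegionᶜ (w := fun ξ => ‖ξ‖ + ‖ξ‖ ^ 2) (by fun_prop)
    (fun ξ hξ => by have := norm_pos_iff.2 hξ; positivity) (aemeasurable_hat f)
  refine h.trans ?_
  rw [mul_assoc, show (∫⁻ ξ in lowRegionᶜ, ENNReal.ofReal ((‖ξ‖ + ‖ξ‖ ^ 2)⁻¹ ^ 2)) ^ (1 / 2 : ℝ)
    = cHigh from rfl]
  gcongr cHigh * ?_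
  have e : ∀ ξ, ENNReal.ofReal (‖ξ‖ + ‖ξ‖ ^ 2) * ‖hat f ξ‖ₑ
      = ‖ξ‖ₑ * ‖hat f ξ‖ₑ + ‖ξ‖ₑ ^ 2 * ‖hat f ξ‖ₑ :=
    fun ξ => by
    rw [ENNReal.ofReal_add (by positivity) (by positivity),
      ENNReal.ofReal_pow (norm_nonneg _), ofReal_norm, add_mul]
  simp_rw [e]
  refine (l2_add_le (AEMeasurable.mul (by fun_prop) (aemeasurable_hat f))
    (AEMeasurable.mul (by fun_prop) (aemeasurable_hat f))).trans ?_
  rw [mul_add]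
  exact add_le_add hr.l2_norm (l2_norm_sq_le hf hr.memLp hr.memLp_pd h2)

lemma eLpNorm_le_sobolevNorm {ι : Type} [Fintype ι] {n : ℕ} (F : ι → Plane → ℝ) (i : ι)
    (α : ℕ × ℕ) (hα : α.1 + α.2 ≤ n) :
    eLpNorm (pdMulti α (F i)) 2 volume ≤ sobolevNorm n F := by
  unfold sobolevNorm
  rw [← rpow_half_sq (eLpNorm _ 2 volume)]
  refine ENNReal.rpow_le_rpow ?_ (by norm_num)
  calc _ ≤ ∑ β ∈ Finset.HasAntidiagonal.antidiagonal (α.1 + α.2),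
        eLpNorm (pdMulti β (F i)) 2 volume ^ 2 :=
        Finset.single_le_sum (f := fun β => eLpNorm (pdMulti β (F i)) 2 volume ^ 2)
          (fun _ _ => zero_le) (by simp)
    _ ≤ ∑ k ∈ Finset.range (n + 1), ∑ β ∈ Finset.HasAntidiagonal.antidiagonal k,
        eLpNorm (pdMulti β (F i)) 2 volume ^ 2 :=
        Finset.single_le_sum (f := fun k => ∑ β ∈ Finset.HasAntidiagonal.antidiagonal k,
        eLpNorm (pdMulti β (F i)) 2 volume ^ 2) (fun _ _ => zero_le)
          (Finset.mem_range.2 (by omega))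
    _ ≤ _ := Finset.single_le_sum (f := fun i => ∑ k ∈ Finset.range (n + 1),
        ∑ β ∈ Finset.HasAntidiagonal.antidiagonal k, eLpNorm (pdMulti β (F i)) 2 volume ^ 2)
        (fun _ _ => zero_le) (Finset.mem_univ i)

end Sobolev

/-! ### Time-dependent fields and their pairings in frequency -/

/-- Families of `L²` functions, continuous in all variables and bounded in `L²`. -/
structure L2Field (f : ℝ → Plane → ℝ) : Prop where
  cont : Continuous (Function.uncurry f)
  bdd : ∃ M : ℝ≥0, ∀ t, eLpNorm (f t) 2 volume ≤ M

/-- Families of regular functions, with uniform bounds. -/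
structure RegField (f : ℝ → Plane → ℝ) : Prop where
  cont : Continuous (Function.uncurry f)
  cont_pd : ∀ i, Continuous (Function.uncurry fun t => pd i (f t))
  reg : ∀ t, Reg (f t)
  bdd : ∃ M : ℝ≥0, ∀ t, eLpNorm (f t) 2 volume ≤ M ∧ (∀ i, eLpNorm (pd i (f t)) 2 volume ≤ M) ∧
    wiener (f t) ≤ M

namespace L2Field
variable {f g : ℝ → Plane → ℝ}

lemma continuous_apply (hf : L2Field f) (t : ℝ) : Continuous (f t) :=
  hf.cont.comp (by fun_prop : Continuous fun x : Plane => (t, x))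

lemma memLp (hf : L2Field f) (t : ℝ) : MemLp (f t) 2 (volume : Measure Plane) := by
  obtain ⟨M, hM⟩ := hf.bdd
  exact ⟨(hf.continuous_apply t).aestronglyMeasurable, lt_of_le_of_lt (hM t) ENNReal.coe_lt_top⟩

lemma add (hf : L2Field f) (hg : L2Field g) : L2Field fun t x => f t x + g t x := by
  obtain ⟨M, hM⟩ := hf.bdd
  obtain ⟨N, hN⟩ := hg.bdd
  refine ⟨hf.cont.add hg.cont, M + N, fun t => ?_⟩
  refine (eLpNorm_add_le (hf.memLp t).1 (hg.memLp t).1 (by norm_num)).trans ?_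
  push_cast
  exact add_le_add (hM t) (hN t)

lemma const_mul (c : ℝ) (hf : L2Field f) : L2Field fun t x => c * f t x := by
  obtain ⟨M, hM⟩ := hf.bdd
  refine ⟨continuous_const.mul hf.cont, ‖c‖₊ * M, fun t => ?_⟩
  calc eLpNorm (c • f t) 2 volume ≤ ‖c‖ₑ * eLpNorm (f t) 2 volume := eLpNorm_const_smul_le
    _ ≤ _ := by push_cast; rw [← enorm_eq_nnnorm]; gcongr; exact hM t

lemma neg (hf : L2Field f) : L2Field fun t x => -f t x := by
  simpa using hf.const_mul (-1)

lemma sub (hf : L2Field f) (hg : L2Field g) : L2Field fun t x => f t x - g t x := by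
  simpa [sub_eq_add_neg] using hf.add hg.neg

end L2Field

namespace RegField
variable {f g : ℝ → Plane → ℝ}

lemma toL2 (hf : RegField f) : L2Field f :=
  ⟨hf.cont, hf.bdd.imp fun _ h t => (h t).1⟩

lemma toL2_pd (hf : RegField f) (i : Fin 2) : L2Field fun t => pd i (f t) :=
  ⟨hf.cont_pd i, hf.bdd.imp fun _ h t => (h t).2.1 i⟩

lemma mul (hf : RegField f) (hg : RegField g) : RegField fun t x => f t x * g t x := by
  obtain ⟨M, hM⟩ := hf.bdd
  obtain ⟨N, hN⟩ := hg.bdd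
  refine ⟨hf.cont.mul hg.cont, fun i => ?_, fun t => (hf.reg t).mul (hg.reg t),
    M * N + N * M, fun t => ⟨?_, fun i => ?_, ?_⟩⟩
  · have e : (Function.uncurry fun t => pd i fun x => f t x * g t x) = fun z : ℝ × Plane =>
        f z.1 z.2 * pd i (g z.1) z.2 + pd i (f z.1) z.2 * g z.1 z.2 := by
      ext z
      exact pd_mul (hf.reg z.1).differentiable (hg.reg z.1).differentiable i z.2
    rw [e]
    exact (hf.cont.mul (hg.cont_pd i)).add ((hf.cont_pd i).mul hg.cont)
  · refine ((hf.reg t).eLpNorm_mul_le _).trans ?_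
    push_cast
    refine le_trans ?_ le_self_add
    gcongr
    exacts [(hM t).2.2, (hN t).1]
  · refine ((hf.reg t).eLpNorm_pd_mul_le (hg.reg t) i).trans ?_
    push_cast
    gcongr
    exacts [(hM t).2.2, (hN t).2.1 i, (hN t).2.2, (hM t).2.1 i]
  · refine ((hf.reg t).wiener_mul_le (hg.reg t)).trans ?_
    push_cast
    refine le_trans ?_ le_self_add
    gcongr
    exacts [(hM t).2.2, (hN t).2.2]

lemma mul_L2 (hf : RegField f) (hg : L2Field g) : L2Field fun t x => f t x * g t x := by
  obtain ⟨M, hM⟩ := hf.bdd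
  obtain ⟨N, hN⟩ := hg.bdd
  refine ⟨hf.cont.mul hg.cont, M * N, fun t => ?_⟩
  refine ((hf.reg t).eLpNorm_mul_le _).trans ?_
  push_cast
  gcongr
  exacts [(hM t).2.2, hN t]

end RegField

lemma enorm_fourierInt_mul_le_eLpNorm {f g : Plane → ℝ} (hf : MemLp f 2 (volume : Measure Plane))
    (hg : MemLp g 2 (volume : Measure Plane)) (ξ : Plane) :
    ‖fourierInt (fun x => ((f x * g x : ℝ) : ℂ)) ξ‖ₑ ≤ eLpNorm f 2 volume * eLpNorm g 2 volume := by
  refine (enorm_fourierInt_le _ _).trans ?_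
  have := lintegral_mul_le_eLpNorm (volume : Measure Plane) hf.1.enorm hg.1.enorm
  rw [eLpNorm_enorm, eLpNorm_enorm] at this
  refine le_trans (le_of_eq ?_) this
  congr 1; ext x
  rw [← enorm_mul]
  simp [enorm_eq_nnnorm]

lemma measurable_fourierInt_param {f : ℝ → Plane → ℝ} (hf : Continuous (Function.uncurry f)) :
    Measurable (Function.uncurry fun s ξ => fourierInt (fun x => (f s x : ℂ)) ξ) := by
  have e : (Function.uncurry fun s ξ => fourierInt (fun x => (f s x : ℂ)) ξ)
      = fun z : ℝ × Plane => ∫ x, Complex.exp (-Complex.I * (inner ℝ x z.2 : ℝ)) * f z.1 x := by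
    ext z; exact fourierInt_eq _ _
  rw [e]
  refine (StronglyMeasurable.integral_prod_right'
    (f := fun w : (ℝ × Plane) × Plane =>
      Complex.exp (-Complex.I * (inner ℝ w.2 w.1.2 : ℝ)) * f w.1.1 w.2) ?_).measurable
  refine Continuous.stronglyMeasurable (Continuous.mul (by fun_prop) ?_)
  exact Complex.continuous_ofReal.comp (hf.comp
    (by fun_prop : Continuous fun w : (ℝ × Plane) × Plane => (w.1.1, w.2)))

/-- Jointly measurable functions of time and frequency, bounded at low frequencies. -/
def BddMeas (R : ℝ → Plane → ℂ) : Prop :=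
  Measurable (Function.uncurry R) ∧ ∃ M : ℝ, ∀ s, ∀ ξ ∈ lowRegion, ‖R s ξ‖ ≤ M

namespace BddMeas
variable {R S : ℝ → Plane → ℂ}

lemma add (hR : BddMeas R) (hS : BddMeas S) : BddMeas fun s ξ => R s ξ + S s ξ := by
  obtain ⟨h1, M, hM⟩ := hR
  obtain ⟨h2, N, hN⟩ := hS
  exact ⟨h1.add h2, M + N, fun s ξ h =>
    (norm_add_le _ _).trans (add_le_add (hM s ξ h) (hN s ξ h))⟩

lemma sub (hR : BddMeas R) (hS : BddMeas S) : BddMeas fun s ξ => R s ξ - S s ξ := by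
  obtain ⟨h1, M, hM⟩ := hR
  obtain ⟨h2, N, hN⟩ := hS
  exact ⟨h1.sub h2, M + N, fun s ξ h =>
    (norm_sub_le _ _).trans (add_le_add (hM s ξ h) (hN s ξ h))⟩

lemma mul (hR : BddMeas R) (hS : BddMeas S) : BddMeas fun s ξ => R s ξ * S s ξ := by
  obtain ⟨h1, M, hM⟩ := hR
  obtain ⟨h2, N, hN⟩ := hS
  refine ⟨h1.mul h2, M * N, fun s ξ h => ?_⟩
  rw [norm_mul]
  exact mul_le_mul (hM s ξ h) (hN s ξ h) (norm_nonneg _) ((norm_nonneg _).trans (hM s ξ h))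

lemma of_multiplier {m : Plane → ℂ} (hm : Measurable m) {b : ℝ} (hb : ∀ ξ ∈ lowRegion, ‖m ξ‖ ≤ b) :
    BddMeas fun _ ξ => m ξ := ⟨hm.comp measurable_snd, b, fun _ ξ => hb ξ⟩

lemma indicator (hR : BddMeas R) :
    Measurable (Function.uncurry fun s ξ => lowRegion.indicator (R s) ξ) ∧
      ∃ M : ℝ, ∀ s ξ, ‖lowRegion.indicator (R s) ξ‖ ≤ M := by
  obtain ⟨h1, M, hM⟩ := hR
  refine ⟨?_, |M|, fun s ξ => ?_⟩
  · exact h1.indicator (s := Prod.snd ⁻¹' lowRegion) (measurable_snd measurableSet_lowRegion)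
  · by_cases h : ξ ∈ lowRegion
    · rw [Set.indicator_of_mem h]; exact (hM s ξ h).trans (le_abs_self M)
    · rw [Set.indicator_of_notMem h, norm_zero]; exact abs_nonneg M

lemma fourierInt_mul {f g : ℝ → Plane → ℝ} (hf : L2Field f) (hg : L2Field g) :
    BddMeas fun s => fourierInt fun x => ((f s x * g s x : ℝ) : ℂ) := by
  refine ⟨measurable_fourierInt_param (f := fun s x => f s x * g s x) (hf.cont.mul hg.cont), ?_⟩
  obtain ⟨M, hM⟩ := hf.bdd
  obtain ⟨N, hN⟩ := hg.bdd
  refine ⟨(M * N : ℝ≥0), fun s ξ _ => ?_⟩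
  rw [← coe_nnnorm, NNReal.coe_le_coe, ← ENNReal.coe_le_coe, ← enorm_eq_nnnorm]
  refine (enorm_fourierInt_mul_le_eLpNorm (hf.memLp s) (hg.memLp s) ξ).trans ?_
  push_cast
  exact mul_le_mul' (hM s) (hN s)

end BddMeas

instance isFiniteMeasure_lowRegion : IsFiniteMeasure (volume.restrict lowRegion : Measure Plane) :=
  ⟨by
    have : volume lowRegion < ∞ := by
      refine lt_of_le_of_lt (measure_mono (t := Metric.closedBall 0 1) fun ξ hξ => ?_)
        measure_closedBall_lt_top
      simpa using norm_le_one_of_mem hξ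
    simpa using this⟩

/-- Bounded multipliers supported at low frequencies. -/
lemma integrable_lowRegion {θ : Plane → ℂ} (hθ : Measurable θ) {b : ℝ} (hb : ∀ ξ, ‖θ ξ‖ ≤ b)
    (hs : ∀ ξ ∉ lowRegion, θ ξ = 0) : Integrable θ ∧ MemLp θ 2 volume := by
  have e : lowRegion.indicator θ = θ := by
    ext ξ; by_cases h : ξ ∈ lowRegion
    · simp [h]
    · simp [h, hs ξ h]
  constructor
  · rw [← e, integrable_indicator_iff measurableSet_lowRegion]
    exact (integrable_const b).mono' hθ.aestronglyMeasurable (Eventually.of_forall hb)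
  · rw [← e, memLp_indicator_iff_restrict measurableSet_lowRegion]
    exact MemLp.of_bound hθ.aestronglyMeasurable b (Eventually.of_forall hb)

/-- The transform is moved from f to θ: the pairing becomes the integral of a jointly continuous
function of (s, x). Thus no joint measurability of (s, ξ) ↦ hat (f s) ξ is needed, which would be
unclear since `hat` is only defined up to null sets. -/
lemma stronglyMeasurable_pairing {f : ℝ → Plane → ℝ} (hf : L2Field f) {θ : Plane → ℂ}
    (h1 : Integrable θ) (h2 : MemLp θ 2 volume) :
    StronglyMeasurable fun s => ∫ ξ, hat (f s) ξ * θ ξ := by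
  have e : (fun s => ∫ ξ, hat (f s) ξ * θ ξ) = fun s => ∫ x, f s x * fourierInt θ x := by
    ext s; exact integral_hat_mul (hf.memLp s) h1 h2
  rw [e]
  refine StronglyMeasurable.integral_prod_right'
    (f := fun w : ℝ × Plane => (f w.1 w.2 : ℂ) * fourierInt θ w.2) ?_
  exact ((Complex.continuous_ofReal.comp hf.cont).mul
    ((continuous_fourierInt h1).comp continuous_snd)).stronglyMeasurable

lemma norm_pairing_le {f : Plane → ℝ} (hf : MemLp f 2 (volume : Measure Plane)) {θ : Plane → ℂ}
    (h2 : MemLp θ 2 volume) :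
    ‖∫ ξ, hat f ξ * θ ξ‖ₑ ≤ ENNReal.ofReal (2 * Real.pi) * eLpNorm f 2 volume * eLpNorm θ 2 volume := by
  refine (enorm_integral_le_lintegral_enorm _).trans ?_
  have := lintegral_mul_le_eLpNorm (volume : Measure Plane) (memLp_hat hf).1.enorm h2.1.enorm
  rw [eLpNorm_enorm, eLpNorm_enorm, eLpNorm_hat hf] at this
  refine le_trans (le_of_eq ?_) this
  congr 1; ext x
  rw [← enorm_mul]

lemma integrableOn_pairing {f : ℝ → Plane → ℝ} (hf : L2Field f) {θ : Plane → ℂ}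
    (h1 : Integrable θ) (h2 : MemLp θ 2 volume) (t : ℝ) :
    IntegrableOn (fun s => ∫ ξ, hat (f s) ξ * θ ξ) (Set.Ioc 0 t) := by
  obtain ⟨M, hM⟩ := hf.bdd
  set B : ℝ≥0∞ := ENNReal.ofReal (2 * Real.pi) * M * eLpNorm θ 2 volume with hB
  have hBf : B ≠ ∞ := (ENNReal.mul_lt_top (ENNReal.mul_lt_top ENNReal.ofReal_lt_top
    ENNReal.coe_lt_top) h2.2).ne
  refine Measure.integrableOn_of_bounded (M := B.toReal) (by simp)
    (stronglyMeasurable_pairing hf h1 h2).aestronglyMeasurable (Eventually.of_forall fun s => ?_)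
  rw [← toReal_enorm]
  refine ENNReal.toReal_mono hBf ((norm_pairing_le (hf.memLp s) h2).trans ?_)
  rw [hB]; gcongr; exact hM s

/-- Evolution equations, tested in frequency. -/
lemma pairing_evolution {f r : ℝ → Plane → ℝ} (hf : L2Field f) (hr : L2Field r) {T t : ℝ}
    (hev : ∀ t ∈ Set.Icc 0 T, ∀ x, f t x = f 0 x + ∫ s in Set.Ioc 0 t, r s x)
    (ht : t ∈ Set.Icc 0 T) {θ : Plane → ℂ} (h1 : Integrable θ) (h2 : MemLp θ 2 volume) :
    ∫ ξ, hat (f t) ξ * θ ξ = (∫ ξ, hat (f 0) ξ * θ ξ)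
      + ∫ s in Set.Ioc 0 t, ∫ ξ, hat (r s) ξ * θ ξ := by
  -- In physical space the evolution equation holds at every x and can be integrated against χ.
  -- Fubini applies because r is bounded in L² uniformly in time and χ lies in L².
  set χ := fourierInt θ with hχ
  have hχ2 : MemLp χ 2 volume := memLp_fourierInt h1 h2
  have hχc : Continuous χ := continuous_fourierInt h1
  have er : ∀ s, ∫ ξ, hat (r s) ξ * θ ξ = ∫ x, r s x * χ x := fun s =>
    integral_hat_mul (hr.memLp s) h1 h2
  have ef : ∀ s, ∫ ξ, hat (f s) ξ * θ ξ = ∫ x, f s x * χ x := fun s =>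
    integral_hat_mul (hf.memLp s) h1 h2
  rw [ef t, ef 0]
  simp_rw [er]
  set m := (volume.restrict (Set.Ioc 0 t) : Measure ℝ) with hm
  obtain ⟨M, hM⟩ := hr.bdd
  have hint : Integrable (fun w : ℝ × Plane => (r w.1 w.2 : ℂ) * χ w.2) (m.prod volume) := by
    have hc : Continuous fun w : ℝ × Plane => (r w.1 w.2 : ℂ) * χ w.2 :=
      (Complex.continuous_ofReal.comp hr.cont).mul (hχc.comp continuous_snd)
    refine ⟨hc.aestronglyMeasurable, ?_⟩
    rw [hasFiniteIntegral_iff_enorm, lintegral_prod _ hc.aestronglyMeasurable.enorm]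
    calc _ ≤ ∫⁻ _ : ℝ, M * eLpNorm χ 2 volume ∂m := by
          gcongr with s
          have := lintegral_mul_le_eLpNorm (volume : Measure Plane)
            (memLp_complex (hr.memLp s)).1.enorm hχ2.1.enorm
          rw [eLpNorm_enorm, eLpNorm_enorm] at this
          simp_rw [enorm_mul]
          refine this.trans ?_
          gcongr
          refine le_trans (le_of_eq ?_) (hM s)
          exact eLpNorm_congr_norm_ae (Eventually.of_forall fun x => by simp)
      _ < ∞ := by
          rw [lintegral_const]
          exact ENNReal.mul_lt_top (ENNReal.mul_lt_top ENNReal.coe_lt_top hχ2.2) (by simp [hm])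
  have h0 : Integrable (fun x => (f 0 x : ℂ) * χ x) := (memLp_complex (hf.memLp 0)).integrable_mul hχ2
  have e : ∀ x, (f t x : ℂ) * χ x = f 0 x * χ x + ∫ s, (r s x : ℂ) * χ x ∂m := fun x => by
    rw [hev t ht x, integral_mul_const, ← add_mul]
    congr 1
    push_cast
    rw [integral_complex_ofReal]
  simp_rw [e]
  rw [integral_add h0 hint.integral_prod_right]
  congr 1
  exact (integral_integral_swap (f := fun s x => (r s x : ℂ) * χ x) hint).symm

/-- The classical Fourier transform of a product of square integrable functions. -/
def prodHat (f g : Plane → ℝ) : Plane → ℂ := fourierInt fun x => ((f x * g x : ℝ) : ℂ)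

/-! ### Eigenvalues and diagonalization at low frequency -/

/-- The eigenvalues `(-|ξ|² ± i (4ξ₁² - |ξ|⁴)^{1/2}) / 2` of the linearized system at low frequency,
extended by zero. -/
def eigen (σ : ℝ) : Plane → ℂ := lowRegion.indicator fun ξ =>
  (-(‖ξ‖ : ℂ) ^ 2 + σ * Complex.I * (Real.sqrt (4 * ξ 0 ^ 2 - ‖ξ‖ ^ 4) : ℝ)) / 2

lemma measurable_eigen (σ : ℝ) : Measurable (eigen σ) :=
  Measurable.indicator (by fun_prop) measurableSet_lowRegion

lemma norm_pow_four_le {ξ : Plane} (h : ξ ∈ lowRegion) : ‖ξ‖ ^ 4 ≤ ξ 0 ^ 2 := by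
  have h1 : ‖ξ‖ ^ 2 ≤ |ξ 0| := h
  calc ‖ξ‖ ^ 4 = (‖ξ‖ ^ 2) ^ 2 := by ring
    _ ≤ |ξ 0| ^ 2 := by gcongr
    _ = _ := sq_abs _

lemma eigen_eq (σ : ℝ) {ξ : Plane} (h : ξ ∈ lowRegion) : eigen σ ξ =
    (-(‖ξ‖ : ℂ) ^ 2 + σ * Complex.I * (Real.sqrt (4 * ξ 0 ^ 2 - ‖ξ‖ ^ 4) : ℝ)) / 2 := by
  rw [eigen, Set.indicator_of_mem h]

lemma eigen_re (σ : ℝ) {ξ : Plane} (h : ξ ∈ lowRegion) : (eigen σ ξ).re = -(2⁻¹ * ‖ξ‖ ^ 2) := by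
  have : eigen σ ξ = ((-(2⁻¹ * ‖ξ‖ ^ 2) : ℝ) : ℂ) +
      ((σ * Real.sqrt (4 * ξ 0 ^ 2 - ‖ξ‖ ^ 4) / 2 : ℝ) : ℂ) * Complex.I := by
    rw [eigen_eq σ h]; push_cast; ring
  rw [this, Complex.add_re, Complex.ofReal_re, Complex.re_ofReal_mul, Complex.I_re, mul_zero,
    add_zero]

lemma eigen_im (σ : ℝ) {ξ : Plane} (h : ξ ∈ lowRegion) :
    (eigen σ ξ).im = σ * Real.sqrt (4 * ξ 0 ^ 2 - ‖ξ‖ ^ 4) / 2 := by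
  have : eigen σ ξ = ((-(2⁻¹ * ‖ξ‖ ^ 2) : ℝ) : ℂ) +
      ((σ * Real.sqrt (4 * ξ 0 ^ 2 - ‖ξ‖ ^ 4) / 2 : ℝ) : ℂ) * Complex.I := by
    rw [eigen_eq σ h]; push_cast; ring
  rw [this, Complex.add_im, Complex.ofReal_im, Complex.im_ofReal_mul, Complex.I_im, mul_one,
    zero_add]

lemma eigen_re_nonpos (σ : ℝ) (ξ : Plane) : (eigen σ ξ).re ≤ 0 := by
  by_cases h : ξ ∈ lowRegion
  · rw [eigen_re σ h]
    have : 0 ≤ 2⁻¹ * ‖ξ‖ ^ 2 := by positivity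
    linarith
  · simp [eigen, h]

lemma sq_sqrt_disc {ξ : Plane} (h : ξ ∈ lowRegion) :
    Real.sqrt (4 * ξ 0 ^ 2 - ‖ξ‖ ^ 4) ^ 2 = 4 * ξ 0 ^ 2 - ‖ξ‖ ^ 4 :=
  Real.sq_sqrt (by nlinarith [norm_pow_four_le h, sq_nonneg (ξ 0)])

/-- This is the characteristic equation of the linearized system for a and the vorticity;
`diag_identity` uses nothing else about the eigenvalue. -/
lemma eigen_quadratic {σ : ℝ} (hσ : σ ^ 2 = 1) {ξ : Plane} (h : ξ ∈ lowRegion) :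
    eigen σ ξ ^ 2 + (‖ξ‖ : ℂ) ^ 2 * eigen σ ξ + (ξ 0 : ℂ) ^ 2 = 0 := by
  rw [eigen_eq σ h]
  have h1 : ((Real.sqrt (4 * ξ 0 ^ 2 - ‖ξ‖ ^ 4) : ℝ) : ℂ) ^ 2 = 4 * (ξ 0 : ℂ) ^ 2 - (‖ξ‖ : ℂ) ^ 4 := by
    rw [← Complex.ofReal_pow, sq_sqrt_disc h]; push_cast; ring
  have h2 : (σ : ℂ) ^ 2 = 1 := by rw [← Complex.ofReal_pow, hσ, Complex.ofReal_one]
  linear_combination (σ ^ 2 * Complex.I ^ 2 / 4) * h1 + ((4 * (ξ 0 : ℂ) ^ 2 - (‖ξ‖ : ℂ) ^ 4) / 4) *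
    Complex.I ^ 2 * h2 + ((4 * (ξ 0 : ℂ) ^ 2 - (‖ξ‖ : ℂ) ^ 4) / 4) * Complex.I_sq

/-- In `lowRegion` the roots are complex conjugates, and their product is the constant coefficient
(ξ 0)². -/
lemma norm_eigen {σ : ℝ} (hσ : σ ^ 2 = 1) {ξ : Plane} (h : ξ ∈ lowRegion) :
    ‖eigen σ ξ‖ = |ξ 0| := by
  rw [← abs_of_nonneg (norm_nonneg (eigen σ ξ)), ← sq_eq_sq_iff_abs_eq_abs, Complex.sq_norm,
    Complex.normSq_apply, eigen_re σ h, eigen_im σ h]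
  have := sq_sqrt_disc h
  linear_combination (Real.sqrt (4 * ξ 0 ^ 2 - ‖ξ‖ ^ 4) ^ 2 / 4) * hσ + this / 4

lemma norm_eigen_le_one {σ : ℝ} (hσ : σ ^ 2 = 1) (ξ : Plane) : ‖eigen σ ξ‖ ≤ 1 := by
  by_cases h : ξ ∈ lowRegion
  · rw [norm_eigen hσ h]
    exact (PiLp.norm_apply_le ξ 0).trans (norm_le_one_of_mem h)
  · simp [eigen, h]

/-- In `lowRegion` one has ‖ξ‖⁴ ≤ (ξ 0)², so the discriminant 4(ξ 0)² - ‖ξ‖⁴ is at least 3(ξ 0)².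
This separation of the roots lets the unknowns be recovered with loss |ξ 0|⁻¹ only. -/
lemma le_norm_eigen_sub {ξ : Plane} (h : ξ ∈ lowRegion) : |ξ 0| ≤ ‖eigen 1 ξ - eigen (-1) ξ‖ := by
  have e : eigen 1 ξ - eigen (-1) ξ = Complex.I * (Real.sqrt (4 * ξ 0 ^ 2 - ‖ξ‖ ^ 4) : ℝ) := by
    rw [eigen_eq 1 h, eigen_eq (-1) h]; push_cast; ring
  rw [e, norm_mul, Complex.norm_I, one_mul, Complex.norm_real, Real.norm_eq_abs,
    abs_of_nonneg (Real.sqrt_nonneg _)]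
  apply Real.le_sqrt_of_sq_le
  rw [sq_abs]
  nlinarith [norm_pow_four_le h, sq_nonneg (ξ 0)]

section Snapshot
variable {a q v0 v1 : Plane → ℝ}

/-- The diagonalized unknown at fixed time. -/
def diagVar (σ : ℝ) (a q v0 v1 : Plane → ℝ) (ξ : Plane) : ℂ :=
  ‖ξ‖ * hat a ξ + (ξ 0 * ξ 1 * ‖ξ‖⁻¹ : ℝ) * hat (fun x => q x * q x) ξ
    + Complex.I * eigen σ ξ * (‖ξ‖⁻¹ : ℝ) * (ξ 0 * hat v1 ξ - ξ 1 * hat v0 ξ)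

/-- The Fourier transform of the time derivative of `(∂₂ψ)²`. -/
def sqSource (a q v0 v1 : Plane → ℝ) (ξ : Plane) : ℂ :=
  Complex.I * ξ 0 * prodHat v0 (fun x => q x * q x) ξ
    - Complex.I * ξ 1 * prodHat v1 (fun x => q x * q x) ξ
    + 2 * (Complex.I * ξ 0 * prodHat v0 q ξ)
    - 2 * prodHat (fun x => a x * q x) (pd 1 v0) ξ
    - 4 * prodHat (fun x => v0 x * q x) (pd 1 a) ξ
    - 2 * prodHat v0 (pd 1 a) ξ

/-- The quadratic source of the vorticity equation, without the contribution of `(∂₂ψ)²`. -/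
def curlSource (a q v0 v1 : Plane → ℝ) (ξ : Plane) : ℂ :=
  (ξ 0 ^ 2 - ξ 1 ^ 2) * (prodHat v0 v1 ξ + prodHat a q ξ)
    + ξ 0 * ξ 1 * (prodHat v1 v1 ξ - prodHat v0 v0 ξ - prodHat a a ξ)

/-- The source in the diagonalized equation. -/
def diagSource (σ : ℝ) (a q v0 v1 : Plane → ℝ) (ξ : Plane) : ℂ :=
  -Complex.I * ξ 0 * ‖ξ‖ * (prodHat v0 a ξ + prodHat v1 q ξ)
    + (ξ 0 * ξ 1 * ‖ξ‖⁻¹ : ℝ) * sqSource a q v0 v1 ξ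
    + eigen σ ξ * (‖ξ‖⁻¹ : ℝ) * curlSource a q v0 v1 ξ

lemma norm_sq_complex (ξ : Plane) : (‖ξ‖ : ℂ) ^ 2 = (ξ 0 : ℂ) ^ 2 + (ξ 1 : ℂ) ^ 2 := by
  rw [← Complex.ofReal_pow, norm_sq_plane]; push_cast; ring

/-- The diagonalization of the linearized system. -/
lemma diag_identity {σ : ℝ} (hσ : σ ^ 2 = 1) {ξ : Plane} (hξ : ξ ∈ lowRegion) (h0 : ξ ≠ 0)
    {ra rh r0 r1 : ℂ}
    (hdiv : (ξ 0 : ℂ) * hat v0 ξ + ξ 1 * hat v1 ξ = 0)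
    (hsq : hat (fun x => q x * q x) ξ = prodHat q q ξ)
    (ha : ra = -(Complex.I * ξ 0 * prodHat v0 a ξ + Complex.I * ξ 0 * prodHat v1 q ξ
      + Complex.I * ξ 0 * hat v1 ξ))
    (hh : rh = sqSource a q v0 v1 ξ)
    (hr : (ξ 0 : ℂ) * r1 - ξ 1 * r0 = -(‖ξ‖ : ℂ) ^ 2 * (ξ 0 * hat v1 ξ - ξ 1 * hat v0 ξ)
      - Complex.I * (‖ξ‖ : ℂ) ^ 2 * hat a ξ
      - Complex.I * (curlSource a q v0 v1 ξ + ξ 0 * ξ 1 * prodHat q q ξ)) :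
    ‖ξ‖ * ra + (ξ 0 * ξ 1 * ‖ξ‖⁻¹ : ℝ) * rh + Complex.I * eigen σ ξ * (‖ξ‖⁻¹ : ℝ) *
      (ξ 0 * r1 - ξ 1 * r0) = eigen σ ξ * diagVar σ a q v0 v1 ξ + diagSource σ a q v0 v1 ξ := by
  have hn : (‖ξ‖ : ℂ) * (‖ξ‖⁻¹ : ℝ) = 1 := by
    rw [← Complex.ofReal_mul, mul_inv_cancel₀ (norm_ne_zero_iff.2 h0), Complex.ofReal_one]
  -- With W = ξ₀v̂₁ - ξ₁v̂₀, the divergence condition gives v̂₁ = ξ₀W/‖ξ‖². The terms in W then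
  -- combine to λ times the W part of the diagonal unknown precisely by the characteristic equation.
  -- The terms in â match at once, and the source ξ₀ξ₁·(q²)^ of the vorticity becomes λ times the
  -- corrector that was added to ‖ξ‖â.
  have hq := eigen_quadratic hσ hξ
  have hV : hat v1 ξ * (‖ξ‖ : ℂ) ^ 2 = ξ 0 * (ξ 0 * hat v1 ξ - ξ 1 * hat v0 ξ) := by
    rw [norm_sq_complex]; linear_combination (ξ 1 : ℂ) * hdiv
  rw [hr, ha, hh, diagVar, diagSource, hsq]
  set n : ℂ := (‖ξ‖ : ℂ)
  set ni : ℂ := ((‖ξ‖⁻¹ : ℝ) : ℂ) with hni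
  have hxy : ((ξ 0 * ξ 1 * ‖ξ‖⁻¹ : ℝ) : ℂ) = ξ 0 * ξ 1 * ni := by push_cast [hni]; ring
  rw [hxy]
  set l := eigen σ ξ
  set x : ℂ := (ξ 0 : ℂ)
  set y : ℂ := (ξ 1 : ℂ)
  set W : ℂ := x * hat v1 ξ - y * hat v0 ξ with hW
  linear_combination (l * n * hat a ξ) * hn - Complex.I * ni * W * hq - Complex.I * ni * x * hV
    + Complex.I * x * n * hat v1 ξ * hn - l * ni * (n ^ 2 * hat a ξ + x * y * prodHat q q ξ
      + curlSource a q v0 v1 ξ) * Complex.I_sq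

/-- The unknowns in terms of the diagonalized unknowns. -/
lemma diag_recover {ξ : Plane} (hξ : ξ ∈ lowRegion) (hx : ξ 0 ≠ 0)
    (hdiv : (ξ 0 : ℂ) * hat v0 ξ + ξ 1 * hat v1 ξ = 0)
    (hsq : Complex.I * ξ 0 * hat (fun x => q x * q x) ξ = 2 * prodHat q (pd 1 a) ξ) :
    ‖hat v0 ξ‖ ≤ |ξ 0|⁻¹ * (‖diagVar 1 a q v0 v1 ξ‖ + ‖diagVar (-1) a q v0 v1 ξ‖) ∧
    ‖hat v1 ξ‖ ≤ |ξ 0|⁻¹ * (‖diagVar 1 a q v0 v1 ξ‖ + ‖diagVar (-1) a q v0 v1 ξ‖) ∧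
    ‖hat a ξ‖ ≤ |ξ 0|⁻¹ * (‖diagVar 1 a q v0 v1 ξ‖ + ‖diagVar (-1) a q v0 v1 ξ‖) +
      2 * (‖ξ‖⁻¹ * ‖prodHat q (pd 1 a) ξ‖) := by
  have hx' : 0 < |ξ 0| := abs_pos.2 hx
  have hxn : |ξ 0| ≤ ‖ξ‖ := PiLp.norm_apply_le ξ 0
  have hyn : |ξ 1| ≤ ‖ξ‖ := PiLp.norm_apply_le ξ 1
  have hn' : 0 < ‖ξ‖ := hx'.trans_le hxn
  have hn : (‖ξ‖ : ℂ) * (‖ξ‖⁻¹ : ℝ) = 1 := by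
    rw [← Complex.ofReal_mul, mul_inv_cancel₀ hn'.ne', Complex.ofReal_one]
  have hV1 : (‖ξ‖ : ℂ) ^ 2 * hat v1 ξ = ξ 0 * (ξ 0 * hat v1 ξ - ξ 1 * hat v0 ξ) := by
    rw [norm_sq_complex]; linear_combination (ξ 1 : ℂ) * hdiv
  have hV0 : (‖ξ‖ : ℂ) ^ 2 * hat v0 ξ = -(ξ 1 * (ξ 0 * hat v1 ξ - ξ 1 * hat v0 ξ)) := by
    rw [norm_sq_complex]; linear_combination (ξ 0 : ℂ) * hdiv
  set W : ℂ := ξ 0 * hat v1 ξ - ξ 1 * hat v0 ξ with hW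
  set zp := diagVar 1 a q v0 v1 ξ with hzp
  set zm := diagVar (-1) a q v0 v1 ξ with hzm
  set X : ℂ := ‖ξ‖ * hat a ξ + (ξ 0 * ξ 1 * ‖ξ‖⁻¹ : ℝ) * hat (fun x => q x * q x) ξ with hX
  have e1 : zp = X + Complex.I * eigen 1 ξ * (‖ξ‖⁻¹ : ℝ) * W := rfl
  have e2 : zm = X + Complex.I * eigen (-1) ξ * (‖ξ‖⁻¹ : ℝ) * W := rfl
  -- The corrected X is common to z₊ and z₋, so their difference isolates W with coefficient λ₊ -
  -- λ₋.
  have b1 : |ξ 0| * (‖ξ‖⁻¹ * ‖W‖) ≤ ‖zp‖ + ‖zm‖ := by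
    calc |ξ 0| * (‖ξ‖⁻¹ * ‖W‖) ≤ ‖eigen 1 ξ - eigen (-1) ξ‖ * (‖ξ‖⁻¹ * ‖W‖) := by
          gcongr; exact le_norm_eigen_sub hξ
      _ = ‖zp - zm‖ := by
          rw [show zp - zm = (eigen 1 ξ - eigen (-1) ξ) * (Complex.I * ((‖ξ‖⁻¹ : ℝ) * W)) by
            rw [e1, e2]; ring, norm_mul, norm_mul, norm_mul, Complex.norm_I, Complex.norm_real,
            norm_inv, norm_norm, one_mul]
      _ ≤ _ := norm_sub_le _ _
  -- The combination λ₊z₋ - λ₋z₊ eliminates W and equals (λ₊ - λ₋)X. Since |λ±| = |ξ 0| is no larger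
  -- than the gap, X is recovered without any loss.
  have b2 : ‖X‖ ≤ ‖zp‖ + ‖zm‖ := by
    have h1 : |ξ 0| * ‖X‖ ≤ |ξ 0| * (‖zp‖ + ‖zm‖) := by
      calc |ξ 0| * ‖X‖ ≤ ‖eigen 1 ξ - eigen (-1) ξ‖ * ‖X‖ := by
            gcongr; exact le_norm_eigen_sub hξ
        _ = ‖eigen 1 ξ * zm - eigen (-1) ξ * zp‖ := by
            rw [← norm_mul]; congr 1; rw [e1, e2]; ring
        _ ≤ ‖eigen 1 ξ * zm‖ + ‖eigen (-1) ξ * zp‖ := norm_sub_le _ _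
        _ = _ := by
            rw [norm_mul, norm_mul, norm_eigen (by norm_num) hξ, norm_eigen (by norm_num) hξ]; ring
    exact le_of_mul_le_mul_left h1 hx'
  have b3 : ‖ξ‖⁻¹ * ‖W‖ ≤ |ξ 0|⁻¹ * (‖zp‖ + ‖zm‖) := by
    rw [inv_mul_eq_div |ξ 0|, le_div_iff₀ hx', mul_comm]; exact b1
  have hsqn : ‖((‖ξ‖ : ℂ)) ^ 2‖ = ‖ξ‖ ^ 2 := by
    rw [norm_pow, Complex.norm_real, norm_norm]
  have b4 : ∀ (V c : ℂ), ‖c‖ ≤ ‖ξ‖ → (‖ξ‖ : ℂ) ^ 2 * V = c * W → ‖V‖ ≤ ‖ξ‖⁻¹ * ‖W‖ := by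
    intro V c hc h
    have h2 : ‖ξ‖ ^ 2 * ‖V‖ = ‖c‖ * ‖W‖ := by rw [← hsqn, ← norm_mul, h, norm_mul]
    rw [inv_mul_eq_div, le_div_iff₀ hn']
    have h3 : ‖ξ‖ * (‖V‖ * ‖ξ‖) ≤ ‖ξ‖ * ‖W‖ := by
      calc ‖ξ‖ * (‖V‖ * ‖ξ‖) = ‖ξ‖ ^ 2 * ‖V‖ := by ring
        _ = ‖c‖ * ‖W‖ := h2
        _ ≤ _ := by gcongr
    exact le_of_mul_le_mul_left h3 hn'
  refine ⟨(b4 _ (-(ξ 1 : ℂ)) ?_ (by rw [hV0]; ring)).trans b3,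
    (b4 _ (ξ 0 : ℂ) ?_ hV1).trans b3, ?_⟩
  · rw [norm_neg, Complex.norm_real]; exact hyn
  · rw [Complex.norm_real]; exact hxn
  -- The corrector must be taken away again. Its factor ξ₀ is a derivative ∂₁, and ∂₁(q²) = 2q∂₂a
  -- contains the decaying ∂₂a; one power ‖ξ‖⁻¹ remains, with ξ₁‖ξ‖⁻¹ bounded by 1.
  · have e3 : hat a ξ = (‖ξ‖⁻¹ : ℝ) * X + Complex.I * ξ 1 * ((‖ξ‖⁻¹ : ℝ) * ((‖ξ‖⁻¹ : ℝ) *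
        (2 * prodHat q (pd 1 a) ξ))) := by
      rw [← hsq, hX]
      push_cast at hn ⊢
      linear_combination (-hat a ξ) * hn - (ξ 1 * ξ 0 * (‖ξ‖ : ℂ)⁻¹ ^ 2 *
        hat (fun x => q x * q x) ξ) * Complex.I_sq
    rw [e3]
    refine (norm_add_le _ _).trans (add_le_add ?_ ?_)
    · rw [norm_mul, Complex.norm_real, norm_inv, norm_norm]
      exact mul_le_mul (inv_anti₀ hx' hxn) b2 (norm_nonneg _) (by positivity)
    · simp only [norm_mul, Complex.norm_I, Complex.norm_real, norm_inv, norm_norm, one_mul,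
        Complex.norm_ofNat]
      have h1 : ‖ξ 1‖ * ‖ξ‖⁻¹ ≤ 1 := by
        rw [← div_eq_mul_inv, div_le_one hn']; exact hyn
      calc _ = (‖ξ 1‖ * ‖ξ‖⁻¹) * (2 * (‖ξ‖⁻¹ * ‖prodHat q (pd 1 a) ξ‖)) := by ring
        _ ≤ 1 * (2 * (‖ξ‖⁻¹ * ‖prodHat q (pd 1 a) ξ‖)) := by gcongr
        _ = _ := one_mul _

lemma abs_mul_inv_le_one {x n : ℝ} (h : |x| ≤ n) : |x| * n⁻¹ ≤ 1 := by
  rw [← div_eq_mul_inv]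
  exact div_le_one_of_le₀ h ((abs_nonneg _).trans h)

/-- The initial value of the diagonalized unknown. -/
lemma norm_diagVar_le {σ : ℝ} (hσ : σ ^ 2 = 1) {ξ : Plane} (hξ : ξ ∈ lowRegion) (hx : ξ 0 ≠ 0)
    (hcurl : (ξ 1 : ℂ) * hat a ξ = ξ 0 * hat q ξ) :
    |ξ 0|⁻¹ * ‖diagVar σ a q v0 v1 ξ‖ ≤ ‖hat a ξ‖ + ‖hat q ξ‖ + ‖hat (fun x => q x * q x) ξ‖
      + (‖hat v1 ξ‖ + ‖hat v0 ξ‖) := by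
  have hx' : 0 < |ξ 0| := abs_pos.2 hx
  have hxn : |ξ 0| ≤ ‖ξ‖ := PiLp.norm_apply_le ξ 0
  have hyn : |ξ 1| ≤ ‖ξ‖ := PiLp.norm_apply_le ξ 1
  rw [inv_mul_le_iff₀ hx']
  -- Since ξ₁â = ξ₀q̂, the part |ξ 1||â| also carries a factor |ξ 0|. This is why the data must
  -- include the whole gradient of ψ₀ and not a alone.
  have h1 : ‖(‖ξ‖ : ℂ) * hat a ξ‖ ≤ |ξ 0| * (‖hat a ξ‖ + ‖hat q ξ‖) := by
    rw [norm_mul, Complex.norm_real, norm_norm]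
    calc ‖ξ‖ * ‖hat a ξ‖ ≤ (|ξ 0| + |ξ 1|) * ‖hat a ξ‖ := by gcongr; exact norm_le_abs_add ξ
      _ = |ξ 0| * ‖hat a ξ‖ + ‖(ξ 1 : ℂ) * hat a ξ‖ := by
          rw [norm_mul, Complex.norm_real, Real.norm_eq_abs]; ring
      _ = _ := by rw [hcurl, norm_mul, Complex.norm_real, Real.norm_eq_abs]; ring
  have h2 : ‖((ξ 0 * ξ 1 * ‖ξ‖⁻¹ : ℝ) : ℂ) * hat (fun x => q x * q x) ξ‖
      ≤ |ξ 0| * ‖hat (fun x => q x * q x) ξ‖ := by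
    rw [norm_mul, Complex.norm_real, Real.norm_eq_abs, abs_mul, abs_mul, abs_inv, abs_norm]
    gcongr
    calc |ξ 0| * |ξ 1| * ‖ξ‖⁻¹ = |ξ 0| * (|ξ 1| * ‖ξ‖⁻¹) := by ring
      _ ≤ |ξ 0| * 1 := by gcongr; exact abs_mul_inv_le_one hyn
      _ = _ := mul_one _
  have h3 : ‖Complex.I * eigen σ ξ * (‖ξ‖⁻¹ : ℝ) * (ξ 0 * hat v1 ξ - ξ 1 * hat v0 ξ)‖
      ≤ |ξ 0| * (‖hat v1 ξ‖ + ‖hat v0 ξ‖) := by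
    rw [norm_mul, norm_mul, norm_mul, Complex.norm_I, one_mul, norm_eigen hσ hξ, Complex.norm_real,
      norm_inv, norm_norm, mul_assoc]
    gcongr
    calc ‖ξ‖⁻¹ * ‖(ξ 0 : ℂ) * hat v1 ξ - ξ 1 * hat v0 ξ‖
        ≤ ‖ξ‖⁻¹ * (|ξ 0| * ‖hat v1 ξ‖ + |ξ 1| * ‖hat v0 ξ‖) := by
          gcongr
          refine (norm_sub_le _ _).trans ?_
          rw [norm_mul, norm_mul, Complex.norm_real, Complex.norm_real, Real.norm_eq_abs,
            Real.norm_eq_abs]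
      _ = (|ξ 0| * ‖ξ‖⁻¹) * ‖hat v1 ξ‖ + (|ξ 1| * ‖ξ‖⁻¹) * ‖hat v0 ξ‖ := by ring
      _ ≤ 1 * ‖hat v1 ξ‖ + 1 * ‖hat v0 ξ‖ := by
          gcongr
          exacts [abs_mul_inv_le_one hxn, abs_mul_inv_le_one hyn]
      _ = _ := by ring
  calc _ ≤ _ := norm_add₃_le
    _ ≤ _ := add_le_add (add_le_add h1 h2) h3
    _ = _ := by ring

/-- The part of the source in divergence form. -/
def divSource (a q v0 v1 : Plane → ℝ) (ξ : Plane) : ℝ :=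
  ‖prodHat v0 a ξ‖ + ‖prodHat v1 q ξ‖ + ‖prodHat v0 (fun x => q x * q x) ξ‖
    + ‖prodHat v1 (fun x => q x * q x) ξ‖ + 2 * ‖prodHat v0 q ξ‖ + ‖prodHat v0 v1 ξ‖
    + ‖prodHat a q ξ‖ + ‖prodHat v1 v1 ξ‖ + ‖prodHat v0 v0 ξ‖ + ‖prodHat a a ξ‖

/-- The part of the source which is not in divergence form. -/
def restSource (a q v0 : Plane → ℝ) (ξ : Plane) : ℝ :=
  2 * ‖prodHat (fun x => a x * q x) (pd 1 v0) ξ‖ + 4 * ‖prodHat (fun x => v0 x * q x) (pd 1 a) ξ‖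
    + 2 * ‖prodHat v0 (pd 1 a) ξ‖

/-- Each of the three groups of terms carries an explicit factor ξ₀: directly, through ξ₀ξ₁‖ξ‖⁻¹, or
through |λ| = |ξ 0|. It cancels |ξ 0|⁻¹. What is left is one further frequency factor for the
divergence terms and none for the products with two decaying factors. -/
lemma norm_diagSource_le {σ : ℝ} (hσ : σ ^ 2 = 1) {ξ : Plane} (hξ : ξ ∈ lowRegion) (hx : ξ 0 ≠ 0) :
    |ξ 0|⁻¹ * ‖diagSource σ a q v0 v1 ξ‖
      ≤ ‖ξ‖ * divSource a q v0 v1 ξ + restSource a q v0 ξ := by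
  have hx' : 0 < |ξ 0| := abs_pos.2 hx
  have hxn : |ξ 0| ≤ ‖ξ‖ := PiLp.norm_apply_le ξ 0
  have hyn : |ξ 1| ≤ ‖ξ‖ := PiLp.norm_apply_le ξ 1
  have hn' : 0 < ‖ξ‖ := hx'.trans_le hxn
  rw [inv_mul_le_iff₀ hx']
  have h1 : ‖-Complex.I * ξ 0 * ‖ξ‖ * (prodHat v0 a ξ + prodHat v1 q ξ)‖
      ≤ |ξ 0| * (‖ξ‖ * (‖prodHat v0 a ξ‖ + ‖prodHat v1 q ξ‖)) := by
    simp only [norm_mul, norm_neg, Complex.norm_I, Complex.norm_real, abs_norm, one_mul,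
      Real.norm_eq_abs]
    rw [mul_assoc]
    gcongr
    exact norm_add_le _ _
  have hI : ∀ (c : ℝ) (w : ℂ), |c| ≤ ‖ξ‖ → ‖Complex.I * c * w‖ ≤ ‖ξ‖ * ‖w‖ := by
    intro c w hc
    rw [norm_mul, norm_mul, Complex.norm_I, one_mul, Complex.norm_real, Real.norm_eq_abs]
    gcongr
  have hS : ‖sqSource a q v0 v1 ξ‖ ≤ ‖ξ‖ * (‖prodHat v0 (fun x => q x * q x) ξ‖
      + ‖prodHat v1 (fun x => q x * q x) ξ‖ + 2 * ‖prodHat v0 q ξ‖) + restSource a q v0 ξ := by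
    unfold sqSource restSource
    have k1 := hI (ξ 0) (prodHat v0 (fun x => q x * q x) ξ) hxn
    have k2 := hI (ξ 1) (prodHat v1 (fun x => q x * q x) ξ) hyn
    have k3 := hI (ξ 0) (prodHat v0 q ξ) hxn
    have n2 : ∀ w : ℂ, ‖2 * w‖ = 2 * ‖w‖ := fun w => by rw [norm_mul, Complex.norm_ofNat]
    have n4 : ∀ w : ℂ, ‖4 * w‖ = 4 * ‖w‖ := fun w => by rw [norm_mul, Complex.norm_ofNat]
    refine (norm_sub_le _ _).trans ?_
    refine (add_le_add_left (norm_sub_le _ _) _).trans ?_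
    refine (add_le_add_left (add_le_add_left (norm_sub_le _ _) _) _).trans ?_
    refine (add_le_add_left (add_le_add_left (add_le_add_left (norm_add_le _ _) _) _) _).trans ?_
    refine (add_le_add_left (add_le_add_left (add_le_add_left (add_le_add_left
      (norm_sub_le _ _) _) _) _) _).trans ?_
    rw [n2, n2, n2, n4]
    linarith
  have h2 : ‖((ξ 0 * ξ 1 * ‖ξ‖⁻¹ : ℝ) : ℂ) * sqSource a q v0 v1 ξ‖
      ≤ |ξ 0| * ‖sqSource a q v0 v1 ξ‖ := by
    rw [norm_mul, Complex.norm_real, Real.norm_eq_abs, abs_mul, abs_mul, abs_inv, abs_norm]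
    gcongr
    calc |ξ 0| * |ξ 1| * ‖ξ‖⁻¹ = |ξ 0| * (|ξ 1| * ‖ξ‖⁻¹) := by ring
      _ ≤ |ξ 0| * 1 := by gcongr; exact abs_mul_inv_le_one hyn
      _ = _ := mul_one _
  have hC : ‖curlSource a q v0 v1 ξ‖ ≤ ‖ξ‖ ^ 2 * (‖prodHat v0 v1 ξ‖ + ‖prodHat a q ξ‖
      + ‖prodHat v1 v1 ξ‖ + ‖prodHat v0 v0 ξ‖ + ‖prodHat a a ξ‖) := by
    unfold curlSource
    have c1 : ‖(ξ 0 : ℂ) ^ 2 - (ξ 1 : ℂ) ^ 2‖ ≤ ‖ξ‖ ^ 2 := by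
      rw [← Complex.ofReal_pow, ← Complex.ofReal_pow, ← Complex.ofReal_sub, Complex.norm_real,
        Real.norm_eq_abs, norm_sq_plane, abs_le]
      constructor <;> nlinarith [sq_nonneg (ξ 0), sq_nonneg (ξ 1)]
    have c2 : ‖(ξ 0 : ℂ) * (ξ 1 : ℂ)‖ ≤ ‖ξ‖ ^ 2 := by
      rw [norm_mul, Complex.norm_real, Complex.norm_real, Real.norm_eq_abs, Real.norm_eq_abs, pow_two]
      gcongr
    refine (norm_add_le _ _).trans ?_
    rw [norm_mul, norm_mul _ (_ - _ - _)]
    calc _ ≤ ‖ξ‖ ^ 2 * (‖prodHat v0 v1 ξ‖ + ‖prodHat a q ξ‖) +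
          ‖ξ‖ ^ 2 * (‖prodHat v1 v1 ξ‖ + ‖prodHat v0 v0 ξ‖ + ‖prodHat a a ξ‖) := by
          gcongr
          · exact norm_add_le _ _
          · exact (norm_sub_le _ _).trans (add_le_add_left (norm_sub_le _ _) _)
      _ = _ := by ring
  have h3 : ‖eigen σ ξ * (‖ξ‖⁻¹ : ℝ) * curlSource a q v0 v1 ξ‖ ≤ |ξ 0| * (‖ξ‖ *
      (‖prodHat v0 v1 ξ‖ + ‖prodHat a q ξ‖ + ‖prodHat v1 v1 ξ‖ + ‖prodHat v0 v0 ξ‖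
        + ‖prodHat a a ξ‖)) := by
    rw [norm_mul, norm_mul, norm_eigen hσ hξ, Complex.norm_real, norm_inv, norm_norm, mul_assoc]
    refine mul_le_mul_of_nonneg_left ?_ hx'.le
    rw [inv_mul_le_iff₀ hn', ← mul_assoc, ← pow_two]
    exact hC
  calc _ ≤ _ := norm_add₃_le
    _ ≤ _ := add_le_add (add_le_add h1 (h2.trans (mul_le_mul_of_nonneg_left hS hx'.le))) h3
    _ = _ := by unfold divSource; ring

end Snapshot

/-! ### Duhamel's formula for linear combinations of fields -/

/-- Linear combinations of weak solutions which satisfy a scalar equation at each frequency are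
given by the Duhamel formula. -/
lemma weak_duhamel {ι : Type} [Fintype ι] {f r : ι → ℝ → Plane → ℝ} {m : ι → Plane → ℂ} {T b : ℝ}
    (hf : ∀ k, L2Field (f k)) (hr : ∀ k, L2Field (r k))
    (hev : ∀ k, ∀ t ∈ Set.Icc 0 T, ∀ x, f k t x = f k 0 x + ∫ s in Set.Ioc 0 t, r k s x)
    (hm : ∀ k, Measurable (m k)) (hmb : ∀ k ξ, ‖m k ξ‖ ≤ b) (hms : ∀ k, ∀ ξ ∉ lowRegion, m k ξ = 0)
    {c : Plane → ℂ} (hc : Measurable c) (hc0 : ∀ ξ, (c ξ).re ≤ 0) (hc1 : ∀ ξ, ‖c ξ‖ ≤ 1)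
    {R : ℝ → Plane → ℂ} (hR : Measurable (Function.uncurry R)) {M : ℝ} (hRb : ∀ s ξ, ‖R s ξ‖ ≤ M)
    (heq : ∀ s ∈ Set.Icc 0 T, ∀ᵐ ξ ∂(volume.restrict lowRegion : Measure Plane),
      ∑ k, m k ξ * hat (r k s) ξ = c ξ * ∑ k, m k ξ * hat (f k s) ξ + R s ξ)
    {z₀ : Plane → ℂ} (hz₀ : Measurable z₀)
    (hz : (fun ξ => ∑ k, m k ξ * hat (f k 0) ξ) =ᵐ[volume.restrict lowRegion] z₀)
    {t : ℝ} (ht : t ∈ Set.Icc 0 T) :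
    (fun ξ => ∑ k, m k ξ * hat (f k t) ξ) =ᵐ[volume.restrict lowRegion]
      fun ξ => duhamel (c ξ) (z₀ ξ) (fun s => R s ξ) t := by
  set ρ := (volume.restrict lowRegion : Measure Plane) with hρ
  have hmθ : ∀ θ : Plane → ℂ, Measurable θ → ∀ d : ℝ, (∀ ξ, ‖θ ξ‖ ≤ d) → ∀ k,
      Integrable (fun ξ => m k ξ * θ ξ) ∧ MemLp (fun ξ => m k ξ * θ ξ) 2 volume :=
    fun θ hθ d hd k => integrable_lowRegion ((hm k).mul hθ) (b := b * d)
      (fun ξ => by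
        rw [norm_mul]
        exact mul_le_mul (hmb k ξ) (hd ξ) (norm_nonneg _) ((norm_nonneg _).trans (hmb k ξ)))
      (fun ξ h => by simp [hms k ξ h])
  have hint : ∀ θ : Plane → ℂ, Measurable θ → ∀ d : ℝ, (∀ ξ, ‖θ ξ‖ ≤ d) →
      ∀ g : ℝ → Plane → ℝ, L2Field g → ∀ s k,
      Integrable (fun ξ => hat (g s) ξ * (m k ξ * θ ξ)) := fun θ hθ d hd g hg s k =>
    (memLp_hat (hg.memLp s)).integrable_mul (hmθ θ hθ d hd k).2
  -- The multipliers vanish outside `lowRegion`, so integrals over that region are pairings over the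
  -- whole plane with test functions in L¹ ∩ L².
  have hexp : ∀ θ : Plane → ℂ, Measurable θ → ∀ d : ℝ, (∀ ξ, ‖θ ξ‖ ≤ d) →
      ∀ g : ι → ℝ → Plane → ℝ, (∀ k, L2Field (g k)) → ∀ s,
      ∫ ξ, (∑ k, m k ξ * hat (g k s) ξ) * θ ξ ∂ρ = ∑ k, ∫ ξ, hat (g k s) ξ * (m k ξ * θ ξ) := by
    intro θ hθ d hd g hg s
    rw [← integral_finsetSum _ fun k _ => hint θ hθ d hd (g k) (hg k) s k]
    rw [hρ, setIntegral_eq_integral_of_forall_compl_eq_zero]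
    · congr 1; ext ξ
      rw [Finset.sum_mul]
      exact Finset.sum_congr rfl fun k _ => by ring
    · intro ξ h; simp [hms _ ξ h]
  have hone : ∀ ξ : Plane, ‖(fun _ => (1 : ℂ)) ξ‖ ≤ (1 : ℝ) := fun ξ => by simp
  have hzint : ∀ s, Integrable (fun ξ => ∑ k, m k ξ * hat (f k s) ξ) ρ := fun s => by
    refine (integrable_finsetSum _ fun k _ => ?_).mono_measure Measure.restrict_le_self
    have := hint (fun _ => 1) measurable_const 1 hone (f k) (hf k) s k
    refine this.congr (Eventually.of_forall fun ξ => ?_)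
    simp only; ring
  choose B hB using fun k => (hf k).bdd
  set K : ℝ≥0∞ := ∑ k, ENNReal.ofReal (2 * Real.pi) * B k * eLpNorm (fun ξ => m k ξ * 1) 2 volume
    with hK
  have hKf : K ≠ ∞ := (ENNReal.sum_lt_top.2 fun k _ => ENNReal.mul_lt_top (ENNReal.mul_lt_top
    ENNReal.ofReal_lt_top ENNReal.coe_lt_top) (hmθ _ measurable_const 1 hone k).2.2).ne
  have hz0i : Integrable z₀ ρ := (hzint 0).congr hz
  refine ae_eq_duhamel (K := K.toReal) (z := fun s ξ => ∑ k, m k ξ * hat (f k s) ξ) hc hc0 hc1 hz₀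
    hz0i hR (fun s _ ξ => hRb s ξ) (fun s _ => hzint s) ?_ ?_ ?_ ht
  · intro s _
    rw [integral_norm_eq_lintegral_enorm (hzint s).1]
    refine ENNReal.toReal_mono hKf ?_
    calc ∫⁻ ξ, ‖∑ k, m k ξ * hat (f k s) ξ‖ₑ ∂ρ
        ≤ ∫⁻ ξ, ‖∑ k, m k ξ * hat (f k s) ξ‖ₑ := lintegral_mono' Measure.restrict_le_self le_rfl
      _ ≤ ∫⁻ ξ, ∑ k, ‖hat (f k s) ξ‖ₑ * ‖m k ξ * 1‖ₑ := by
          refine lintegral_mono fun ξ => (enorm_sum_le _ _).trans (Finset.sum_le_sum fun k _ => ?_)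
          rw [mul_one, enorm_mul, mul_comm]
      _ = ∑ k, ∫⁻ ξ, ‖hat (f k s) ξ‖ₑ * ‖m k ξ * 1‖ₑ :=
          lintegral_finsetSum' _ fun k _ => (aemeasurable_hat _).mul
            (hmθ _ measurable_const 1 hone k).2.1.enorm
      _ ≤ K := by
          refine Finset.sum_le_sum fun k _ => ?_
          have := lintegral_mul_le_eLpNorm (volume : Measure Plane)
            (memLp_hat ((hf k).memLp s)).1.enorm (hmθ _ measurable_const 1 hone k).2.1.enorm
          rw [eLpNorm_enorm, eLpNorm_enorm, eLpNorm_hat ((hf k).memLp s)] at this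
          refine this.trans ?_
          gcongr
          exact hB k s
  · intro θ hθ d hd
    simp_rw [hexp θ hθ d hd f hf]
    refine (StronglyMeasurable.aestronglyMeasurable ?_)
    exact Finset.stronglyMeasurable_fun_sum _ fun k _ => stronglyMeasurable_pairing (hf k)
      (hmθ θ hθ d hd k).1 (hmθ θ hθ d hd k).2
  · intro θ hθ d hd t ht
    have hcθ : Measurable fun ξ => c ξ * θ ξ := hc.mul hθ
    have hcd : ∀ ξ, ‖c ξ * θ ξ‖ ≤ d := fun ξ => by
      rw [norm_mul]; exact (mul_le_of_le_one_left (norm_nonneg _) (hc1 ξ)).trans (hd ξ)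
    have e0 : ∫ ξ, z₀ ξ * θ ξ ∂ρ = ∑ k, ∫ ξ, hat (f k 0) ξ * (m k ξ * θ ξ) := by
      rw [← hexp θ hθ d hd f hf 0]
      refine integral_congr_ae ?_
      filter_upwards [hz] with ξ h
      rw [h]
    have e1 : ∀ s ∈ Set.Icc 0 T, ∑ k, ∫ ξ, hat (r k s) ξ * (m k ξ * θ ξ)
        = ∫ ξ, (∑ k, m k ξ * hat (f k s) ξ) * (c ξ * θ ξ) ∂ρ + ∫ ξ, R s ξ * θ ξ ∂ρ := by
      intro s hs
      rw [← hexp θ hθ d hd r hr s, ← integral_add]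
      · refine integral_congr_ae ?_
        filter_upwards [heq s hs] with ξ h
        rw [h]; ring
      · exact (hzint s).mul_bdd hcθ.aestronglyMeasurable (Eventually.of_forall hcd)
      · refine (integrable_const (M * d)).mono'
          ((hR.comp measurable_prodMk_left).mul hθ).aestronglyMeasurable
          (Eventually.of_forall fun ξ => ?_)
        rw [norm_mul]
        exact mul_le_mul (hRb s ξ) (hd ξ) (norm_nonneg _) ((norm_nonneg _).trans (hRb s ξ))
    have i1 : IntegrableOn (fun s => ∫ ξ, (∑ k, m k ξ * hat (f k s) ξ) * (c ξ * θ ξ) ∂ρ)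
        (Set.Ioc 0 t) := by
      simp_rw [hexp _ hcθ d hcd f hf]
      exact integrable_finsetSum _ fun k _ => integrableOn_pairing (hf k)
        (hmθ _ hcθ d hcd k).1 (hmθ _ hcθ d hcd k).2 t
    have i2 : IntegrableOn (fun s => ∫ ξ, R s ξ * θ ξ ∂ρ) (Set.Ioc 0 t) := by
      refine Measure.integrableOn_of_bounded (M := ∫ _, M * d ∂ρ) (by simp) ?_
        (Eventually.of_forall fun s => ?_)
      · exact (StronglyMeasurable.integral_prod_right' (f := fun w : ℝ × Plane => R w.1 w.2 * θ w.2)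
          (hR.mul (hθ.comp measurable_snd)).stronglyMeasurable).aestronglyMeasurable
      · refine norm_integral_le_of_norm_le (integrable_const _) (Eventually.of_forall fun ξ => ?_)
        rw [norm_mul]
        exact mul_le_mul (hRb s ξ) (hd ξ) (norm_nonneg _) ((norm_nonneg _).trans (hRb s ξ))
    rw [hexp θ hθ d hd f hf t, e0, add_assoc, ← integral_add i1 i2]
    have e2 : ∫ s in Set.Ioc 0 t, (∫ ξ, (∑ k, m k ξ * hat (f k s) ξ) * (c ξ * θ ξ) ∂ρ
        + ∫ ξ, R s ξ * θ ξ ∂ρ) = ∫ s in Set.Ioc 0 t, ∑ k, ∫ ξ, hat (r k s) ξ * (m k ξ * θ ξ) :=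
      setIntegral_congr_fun measurableSet_Ioc fun s hs =>
        (e1 s ⟨hs.1.le, hs.2.trans ht.2⟩).symm
    rw [e2, integral_finsetSum _ fun k _ => integrableOn_pairing (hr k)
        (hmθ θ hθ d hd k).1 (hmθ θ hθ d hd k).2 t, ← Finset.sum_add_distrib]
    exact Finset.sum_congr rfl fun k _ => pairing_evolution (hf k) (hr k) (hev k) ht
      (hmθ θ hθ d hd k).1 (hmθ θ hθ d hd k).2

/-! ### The low-frequency system and its Duhamel estimate -/

section Rates
variable {a q v0 v1 f g : Plane → ℝ}

lemma hat_mul_ae (hf : Reg f) (hg : MemLp g 2 (volume : Measure Plane)) :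
    hat (fun x => f x * g x) =ᵐ[volume] prodHat f g :=
  hat_ae_eq_fourierInt (integrable_mul_of_memLp hf.memLp hg) (hf.memLp_mul hg)

lemma hat_pd_reg (hf : Reg f) (i : Fin 2) :
    hat (pd i f) =ᵐ[volume] fun ξ => Complex.I * (ξ i : ℝ) * hat f ξ :=
  hat_pd i hf.differentiable hf.memLp (hf.memLp_pd i)

lemma hat_pd_mul (hf : Reg f) (hg : Reg g) (i : Fin 2) :
    hat (pd i fun x => f x * g x) =ᵐ[volume] fun ξ => Complex.I * (ξ i : ℝ) * prodHat f g ξ := by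
  filter_upwards [hat_pd_reg (hf.mul hg) i, hat_mul_ae hf hg.memLp] with ξ h1 h2
  rw [h1, h2]

/-- The time derivative of `a = ∂₁ψ`. -/
def rateA (a q v0 v1 : Plane → ℝ) : Plane → ℝ := fun x =>
  -(pd 0 (fun y => v0 y * a y) x + pd 0 (fun y => v1 y * q y) x + pd 0 v1 x)

/-- The time derivative of `q²`, where `q = ∂₂ψ`. -/
def rateH (a q v0 v1 : Plane → ℝ) : Plane → ℝ := fun x =>
  pd 0 (fun y => v0 y * (q y * q y)) x - pd 1 (fun y => v1 y * (q y * q y)) x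
    + 2 * pd 0 (fun y => v0 y * q y) x - 2 * (a x * q x * pd 1 v0 x)
    - 4 * (v0 x * q x * pd 1 a x) - 2 * (v0 x * pd 1 a x)

lemma hat_rateA (ha : Reg a) (hq : Reg q) (h0 : Reg v0) (h1 : Reg v1) :
    hat (rateA a q v0 v1) =ᵐ[volume] fun ξ => -(Complex.I * (ξ 0 : ℝ) * prodHat v0 a ξ
      + Complex.I * (ξ 0 : ℝ) * prodHat v1 q ξ + Complex.I * (ξ 0 : ℝ) * hat v1 ξ) := by
  have m1 := (h0.mul ha).memLp_pd 0
  have m2 := (h1.mul hq).memLp_pd 0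
  have m3 := h1.memLp_pd 0
  filter_upwards [hat_neg ((m1.add m2).add m3), hat_add (m1.add m2) m3, hat_add m1 m2,
    hat_pd_mul h0 ha 0, hat_pd_mul h1 hq 0, hat_pd_reg h1 0] with ξ e1 e2 e3 e4 e5 e6
  rw [← e4, ← e5, ← e6, ← e3]
  exact e1.trans (congrArg Neg.neg e2)

lemma hat_rateH (ha : Reg a) (hq : Reg q) (h0 : Reg v0) (h1 : Reg v1) :
    hat (rateH a q v0 v1) =ᵐ[volume] sqSource a q v0 v1 := by
  have m1 := (h0.mul (hq.mul hq)).memLp_pd 0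
  have m2 := (h1.mul (hq.mul hq)).memLp_pd 1
  have m3 := (h0.mul hq).memLp_pd 0
  have m4 := (ha.mul hq).memLp_mul (h0.memLp_pd 1)
  have m5 := (h0.mul hq).memLp_mul (ha.memLp_pd 1)
  have m6 := h0.memLp_mul (ha.memLp_pd 1)
  have n3 := m3.const_mul 2
  have n4 := m4.const_mul 2
  have n5 := m5.const_mul 4
  have n6 := m6.const_mul 2
  filter_upwards [hat_sub ((((m1.sub m2).add n3).sub n4).sub n5) n6,
    hat_sub (((m1.sub m2).add n3).sub n4) n5, hat_sub ((m1.sub m2).add n3) n4,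
    hat_add (m1.sub m2) n3, hat_sub m1 m2, hat_const_mul 2 m3, hat_const_mul 2 m4,
    hat_const_mul 4 m5, hat_const_mul 2 m6, hat_pd_mul h0 (hq.mul hq) 0,
    hat_pd_mul h1 (hq.mul hq) 1, hat_pd_mul h0 hq 0, hat_mul_ae (ha.mul hq) (h0.memLp_pd 1),
    hat_mul_ae (h0.mul hq) (ha.memLp_pd 1), hat_mul_ae h0 (ha.memLp_pd 1)]
    with ξ e1 e2 e3 e4 e5 c3 c4 c5 c6 p1 p2 p3 p4 p5 p6
  refine e1.trans ?_
  rw [c6, p6]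
  unfold sqSource
  refine congrArg₂ (· - ·) (e2.trans ?_) (by push_cast; ring)
  rw [c5, p5]
  refine congrArg₂ (· - ·) (e3.trans ?_) (by push_cast; ring)
  rw [c4, p4]
  refine congrArg₂ (· - ·) (e4.trans ?_) (by push_cast; ring)
  rw [c3, p3]
  refine congrArg₂ (· + ·) (e5.trans ?_) (by push_cast; ring)
  rw [p1, p2]

end Rates

/-- The system for `a = ∂₁ψ`, `q = ∂₂ψ`, `v = (v0, v1)` on `[0,T]`, where `r0`, `r1` are the time
derivatives of `v0`, `v1`, and only the vorticity equation is retained. -/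
structure LowSystem (T : ℝ) (a q v0 v1 r0 r1 : ℝ → Plane → ℝ) : Prop where
  reg_a : RegField a
  reg_q : RegField q
  reg_v0 : RegField v0
  reg_v1 : RegField v1
  l2_r0 : L2Field r0
  l2_r1 : L2Field r1
  pd_comm : ∀ t, pd 1 (a t) = pd 0 (q t)
  div_free : ∀ t x, pd 0 (v0 t) x + pd 1 (v1 t) x = 0
  ev_a : ∀ t ∈ Set.Icc 0 T, ∀ x, a t x = a 0 x
    + ∫ s in Set.Ioc 0 t, rateA (a s) (q s) (v0 s) (v1 s) x
  ev_h : ∀ t ∈ Set.Icc 0 T, ∀ x, q t x * q t x = q 0 x * q 0 x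
    + ∫ s in Set.Ioc 0 t, rateH (a s) (q s) (v0 s) (v1 s) x
  ev_v0 : ∀ t ∈ Set.Icc 0 T, ∀ x, v0 t x = v0 0 x + ∫ s in Set.Ioc 0 t, r0 s x
  ev_v1 : ∀ t ∈ Set.Icc 0 T, ∀ x, v1 t x = v1 0 x + ∫ s in Set.Ioc 0 t, r1 s x
  curl : ∀ s ∈ Set.Icc 0 T, ∀ᵐ ξ : Plane, (ξ 0 : ℂ) * hat (r1 s) ξ - ξ 1 * hat (r0 s) ξ
    = -(‖ξ‖ : ℂ) ^ 2 * (ξ 0 * hat (v1 s) ξ - ξ 1 * hat (v0 s) ξ)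
      - Complex.I * (‖ξ‖ : ℂ) ^ 2 * hat (a s) ξ
      - Complex.I * (curlSource (a s) (q s) (v0 s) (v1 s) ξ
        + ξ 0 * ξ 1 * prodHat (q s) (q s) ξ)

lemma ae_mul_hat_comm {a q : Plane → ℝ} (ha : Reg a) (hq : Reg q) (h : pd 1 a = pd 0 q) :
    ∀ᵐ ξ : Plane, (ξ 1 : ℂ) * hat a ξ = ξ 0 * hat q ξ := by
  filter_upwards [hat_pd_reg ha 1, hat_pd_reg hq 0] with ξ h1 h2
  rw [h, h2, mul_assoc, mul_assoc] at h1
  exact (mul_left_cancel₀ Complex.I_ne_zero h1).symm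

lemma ae_div_hat {v0 v1 : Plane → ℝ} (h0 : Reg v0) (h1 : Reg v1)
    (h : ∀ x, pd 0 v0 x + pd 1 v1 x = 0) :
    ∀ᵐ ξ : Plane, (ξ 0 : ℂ) * hat v0 ξ + ξ 1 * hat v1 ξ = 0 := by
  have e : pd 0 v0 = fun x => -pd 1 v1 x := by ext x; linarith [h x]
  filter_upwards [hat_pd_reg h0 0, hat_pd_reg h1 1, hat_neg (h1.memLp_pd 1)] with ξ e0 e1 e2
  rw [e, e2, e1] at e0
  apply mul_left_cancel₀ Complex.I_ne_zero
  rw [mul_zero]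
  linear_combination -e0

/-- By ∂₁q = ∂₂a, the first derivative of q² is 2q∂₂a. This exchanges a quantity without decay for
one with a decaying factor. -/
lemma ae_hat_sq {a q : Plane → ℝ} (hq : Reg q) (h : pd 1 a = pd 0 q) :
    ∀ᵐ ξ : Plane, Complex.I * ξ 0 * hat (fun x => q x * q x) ξ = 2 * prodHat q (pd 1 a) ξ := by
  have e : pd 0 (fun x => q x * q x) = fun x => 2 * (q x * pd 1 a x) := by
    ext x; rw [pd_mul hq.differentiable hq.differentiable, h]; ring
  filter_upwards [hat_pd_reg (hq.mul hq) 0, hat_const_mul 2 (hq.memLp_mul (hq.memLp_pd 0)),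
    hat_mul_ae hq (hq.memLp_pd 0)] with ξ e0 e1 e2
  rw [e, h, e1, e2] at e0
  rw [← e0, h]; push_cast; ring

section Multipliers

/-- The multipliers of the diagonalized unknown. -/
def diagMult (σ : ℝ) : Fin 4 → Plane → ℂ := ![
  lowRegion.indicator fun ξ => (‖ξ‖ : ℂ),
  lowRegion.indicator fun ξ => ((ξ 0 * ξ 1 * ‖ξ‖⁻¹ : ℝ) : ℂ),
  lowRegion.indicator fun ξ => Complex.I * eigen σ ξ * (‖ξ‖⁻¹ : ℝ) * ξ 0,
  lowRegion.indicator fun ξ => -(Complex.I * eigen σ ξ * (‖ξ‖⁻¹ : ℝ) * ξ 1)]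

lemma measurable_diagMult (σ : ℝ) (k : Fin 4) : Measurable (diagMult σ k) := by
  have := measurable_eigen σ
  fin_cases k <;> exact Measurable.indicator (by fun_prop) measurableSet_lowRegion

lemma diagMult_eq_zero (σ : ℝ) (k : Fin 4) (ξ : Plane) (h : ξ ∉ lowRegion) :
    diagMult σ k ξ = 0 := by
  fin_cases k <;> simp [diagMult, h]

lemma norm_eigen_mul_le {σ : ℝ} (hσ : σ ^ 2 = 1) {ξ : Plane} (h : ξ ∈ lowRegion) :
    ‖eigen σ ξ * (‖ξ‖⁻¹ : ℝ)‖ ≤ 1 := by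
  rw [norm_mul, norm_eigen hσ h, Complex.norm_real, norm_inv, norm_norm]
  exact abs_mul_inv_le_one (PiLp.norm_apply_le ξ 0)

lemma norm_coord_le_one {ξ : Plane} (h : ξ ∈ lowRegion) (i : Fin 2) : ‖(ξ i : ℂ)‖ ≤ 1 := by
  rw [Complex.norm_real]
  exact (PiLp.norm_apply_le ξ i).trans (norm_le_one_of_mem h)

lemma norm_mixed_le {ξ : Plane} (h : ξ ∈ lowRegion) :
    ‖((ξ 0 * ξ 1 * ‖ξ‖⁻¹ : ℝ) : ℂ)‖ ≤ 1 := by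
  rw [Complex.norm_real, Real.norm_eq_abs, abs_mul, abs_mul, abs_inv, abs_norm]
  calc |ξ 0| * |ξ 1| * ‖ξ‖⁻¹ = |ξ 0| * (|ξ 1| * ‖ξ‖⁻¹) := by ring
    _ ≤ 1 * 1 := by
      gcongr
      · exact (PiLp.norm_apply_le ξ 0).trans (norm_le_one_of_mem h)
      · exact abs_mul_inv_le_one (PiLp.norm_apply_le ξ 1)
    _ = 1 := one_mul 1

lemma norm_diagMult_le {σ : ℝ} (hσ : σ ^ 2 = 1) (k : Fin 4) (ξ : Plane) :
    ‖diagMult σ k ξ‖ ≤ 1 := by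
  by_cases h : ξ ∈ lowRegion
  · have e : ∀ i, ‖Complex.I * eigen σ ξ * (‖ξ‖⁻¹ : ℝ) * ξ i‖ ≤ 1 := fun i => by
      rw [mul_assoc Complex.I, norm_mul, norm_mul, Complex.norm_I, one_mul]
      exact mul_le_one₀ (norm_eigen_mul_le hσ h) (norm_nonneg _) (norm_coord_le_one h i)
    fin_cases k
    · simpa [diagMult, h] using norm_le_one_of_mem h
    · simp only [diagMult, Fin.mk_one, Matrix.cons_val_one, Matrix.cons_val_zero,
        Set.indicator_of_mem h]
      exact norm_mixed_le h
    · simp only [diagMult, Fin.reduceFinMk, Matrix.cons_val, Set.indicator_of_mem h]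
      exact e 0
    · simp only [diagMult, Fin.reduceFinMk, Matrix.cons_val, Set.indicator_of_mem h, norm_neg]
      exact e 1
  · rw [diagMult_eq_zero σ k ξ h, norm_zero]; norm_num

lemma sum_diagMult (σ : ℝ) {ξ : Plane} (h : ξ ∈ lowRegion) (u : Fin 4 → ℂ) :
    ∑ k, diagMult σ k ξ * u k = ‖ξ‖ * u 0 + (ξ 0 * ξ 1 * ‖ξ‖⁻¹ : ℝ) * u 1
      + Complex.I * eigen σ ξ * (‖ξ‖⁻¹ : ℝ) * (ξ 0 * u 2 - ξ 1 * u 3) := by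
  simp only [Fin.sum_univ_four, diagMult, Matrix.cons_val, Set.indicator_of_mem h]
  ring

end Multipliers

lemma L2Field_rateA {a q v0 v1 : ℝ → Plane → ℝ} (ha : RegField a) (hq : RegField q)
    (h0 : RegField v0) (h1 : RegField v1) :
    L2Field fun s => rateA (a s) (q s) (v0 s) (v1 s) :=
  ((((h0.mul ha).toL2_pd 0).add ((h1.mul hq).toL2_pd 0)).add (h1.toL2_pd 0)).neg

lemma L2Field_rateH {a q v0 v1 : ℝ → Plane → ℝ} (ha : RegField a) (hq : RegField q)
    (h0 : RegField v0) (h1 : RegField v1) :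
    L2Field fun s => rateH (a s) (q s) (v0 s) (v1 s) :=
  ((((((h0.mul (hq.mul hq)).toL2_pd 0).sub ((h1.mul (hq.mul hq)).toL2_pd 1)).add
    (((h0.mul hq).toL2_pd 0).const_mul 2)).sub
    (((ha.mul hq).mul_L2 (h0.toL2_pd 1)).const_mul 2)).sub
    (((h0.mul hq).mul_L2 (ha.toL2_pd 1)).const_mul 4)).sub
    ((h0.mul_L2 (ha.toL2_pd 1)).const_mul 2)

lemma bddMeas_diagSource {σ : ℝ} (hσ : σ ^ 2 = 1) {a q v0 v1 : ℝ → Plane → ℝ} (ha : RegField a)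
    (hq : RegField q) (h0 : RegField v0) (h1 : RegField v1) :
    BddMeas fun s => diagSource σ (a s) (q s) (v0 s) (v1 s) := by
  have cst : ∀ c : ℂ, BddMeas fun _ _ => c := fun c =>
    BddMeas.of_multiplier measurable_const (b := ‖c‖) fun _ _ => le_rfl
  have mx : ∀ i : Fin 2, BddMeas fun _ ξ => (ξ i : ℂ) := fun i =>
    BddMeas.of_multiplier (by fun_prop) fun ξ h => norm_coord_le_one h i
  have mn : BddMeas fun _ ξ => (‖ξ‖ : ℂ) := BddMeas.of_multiplier (b := 1) (by fun_prop) fun ξ h => by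
    simpa using norm_le_one_of_mem h
  have mm : BddMeas fun _ ξ => ((ξ 0 * ξ 1 * ‖ξ‖⁻¹ : ℝ) : ℂ) :=
    BddMeas.of_multiplier (by fun_prop) fun ξ h => norm_mixed_le h
  have ml : BddMeas fun _ ξ => eigen σ ξ * (‖ξ‖⁻¹ : ℝ) :=
    BddMeas.of_multiplier ((measurable_eigen σ).mul (by fun_prop))
      fun ξ h => norm_eigen_mul_le hσ h
  have mx2 : BddMeas fun _ ξ => (ξ 0 : ℂ) ^ 2 - (ξ 1 : ℂ) ^ 2 := by
    simpa only [pow_two] using ((mx 0).mul (mx 0)).sub ((mx 1).mul (mx 1))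
  have P : ∀ {f g : ℝ → Plane → ℝ}, L2Field f → L2Field g → BddMeas fun s => prodHat (f s) (g s) :=
    fun hf hg => BddMeas.fourierInt_mul hf hg
  have hh := hq.mul hq
  have p1 := P h0.toL2 ha.toL2
  have p2 := P h1.toL2 hq.toL2
  have p3 := P h0.toL2 hh.toL2
  have p4 := P h1.toL2 hh.toL2
  have p5 := P h0.toL2 hq.toL2
  have p6 := P (ha.mul hq).toL2 (h0.toL2_pd 1)
  have p7 := P (h0.mul hq).toL2 (ha.toL2_pd 1)
  have p8 := P h0.toL2 (ha.toL2_pd 1)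
  have p9 := P h0.toL2 h1.toL2
  have p10 := P ha.toL2 hq.toL2
  have p11 := P h1.toL2 h1.toL2
  have p12 := P h0.toL2 h0.toL2
  have p13 := P ha.toL2 ha.toL2
  have mI := cst Complex.I
  have s1 : BddMeas fun s => sqSource (a s) (q s) (v0 s) (v1 s) :=
    (((((((mI.mul (mx 0)).mul p3).sub ((mI.mul (mx 1)).mul p4)).add
      ((cst 2).mul ((mI.mul (mx 0)).mul p5))).sub ((cst 2).mul p6)).sub ((cst 4).mul p7)).sub
      ((cst 2).mul p8))
  have s2 : BddMeas fun s => curlSource (a s) (q s) (v0 s) (v1 s) :=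
    (mx2.mul (p9.add p10)).add (((mx 0).mul (mx 1)).mul ((p11.sub p12).sub p13))
  exact ((((((cst (-Complex.I)).mul (mx 0)).mul mn).mul (p1.add p2)).add (mm.mul s1)).add
    (ml.mul s2))

namespace LowSystem
variable {T : ℝ} {a q v0 v1 r0 r1 : ℝ → Plane → ℝ}

/-- The Duhamel estimate for the diagonalized unknowns. -/
lemma enorm_diagVar_le (S : LowSystem T a q v0 v1 r0 r1) {σ : ℝ} (hσ : σ ^ 2 = 1) {t : ℝ}
    (ht : t ∈ Set.Icc 0 T) :
    ∀ᵐ ξ : Plane, ξ ∈ lowRegion → ‖diagVar σ (a t) (q t) (v0 t) (v1 t) ξ‖ₑ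
      ≤ heat 2⁻¹ t 0 ξ * ‖diagVar σ (a 0) (q 0) (v0 0) (v1 0) ξ‖ₑ
        + ∫⁻ s in Set.Icc 0 T, heat 2⁻¹ t s ξ * ‖diagSource σ (a s) (q s) (v0 s) (v1 s) ξ‖ₑ := by
  obtain ⟨hRm, M, hRb⟩ := (bddMeas_diagSource hσ S.reg_a S.reg_q S.reg_v0 S.reg_v1).indicator
  set R : ℝ → Plane → ℂ := fun s =>
    lowRegion.indicator (diagSource σ (a s) (q s) (v0 s) (v1 s)) with hR
  set f : Fin 4 → ℝ → Plane → ℝ := ![a, fun s x => q s x * q s x, v1, v0] with hf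
  set r : Fin 4 → ℝ → Plane → ℝ := ![fun s => rateA (a s) (q s) (v0 s) (v1 s),
    fun s => rateH (a s) (q s) (v0 s) (v1 s), r1, r0] with hr
  have hz : ∀ s, ∀ ξ ∈ lowRegion, ∑ k, diagMult σ k ξ * hat (f k s) ξ
      = diagVar σ (a s) (q s) (v0 s) (v1 s) ξ := fun s ξ h =>
    sum_diagMult σ h fun k => hat (f k s) ξ
  have hz0 : AEStronglyMeasurable (fun ξ => ∑ k, diagMult σ k ξ * hat (f k 0) ξ)
      (volume.restrict lowRegion) :=
    Finset.aestronglyMeasurable_fun_sum _ fun k _ =>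
      ((measurable_diagMult σ k).aestronglyMeasurable.mul
        (aestronglyMeasurable_hat _)).mono_measure Measure.restrict_le_self
  -- The four fields are a, q², v1, v0, in the order of `diagMult`. The transforms at time 0 are
  -- measurable only up to null sets, so a measurable representative serves as initial value.
  have key := weak_duhamel (f := f) (r := r) (m := diagMult σ) (T := T) (b := 1) (c := eigen σ)
    (R := R) (M := M) (z₀ := hz0.mk _) (t := t)
    (by
      intro k
      fin_cases k
      exacts [S.reg_a.toL2, (S.reg_q.mul S.reg_q).toL2, S.reg_v1.toL2, S.reg_v0.toL2])
    (by
      intro k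
      fin_cases k
      exacts [L2Field_rateA S.reg_a S.reg_q S.reg_v0 S.reg_v1,
        L2Field_rateH S.reg_a S.reg_q S.reg_v0 S.reg_v1, S.l2_r1, S.l2_r0])
    (by
      intro k
      fin_cases k
      exacts [S.ev_a, S.ev_h, S.ev_v1, S.ev_v0])
    (measurable_diagMult σ) (norm_diagMult_le hσ) (diagMult_eq_zero σ) (measurable_eigen σ)
    (eigen_re_nonpos σ) (norm_eigen_le_one hσ) hRm hRb
    (by
      intro s hs
      rw [ae_restrict_iff' measurableSet_lowRegion]
      filter_upwards [ae_plane_ne_zero, S.curl s hs,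
        ae_div_hat (S.reg_v0.reg s) (S.reg_v1.reg s) (S.div_free s),
        hat_mul_ae (S.reg_q.reg s) (S.reg_q.reg s).memLp,
        hat_rateA (S.reg_a.reg s) (S.reg_q.reg s) (S.reg_v0.reg s) (S.reg_v1.reg s),
        hat_rateH (S.reg_a.reg s) (S.reg_q.reg s) (S.reg_v0.reg s) (S.reg_v1.reg s)]
        with ξ h0 hc hd hsq hA hH hξ
      rw [hz s ξ hξ, sum_diagMult σ hξ fun k => hat (r k s) ξ]
      have e : R s ξ = diagSource σ (a s) (q s) (v0 s) (v1 s) ξ := Set.indicator_of_mem hξ _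
      rw [e]
      exact diag_identity hσ hξ h0 hd hsq hA hH hc)
    hz0.stronglyMeasurable_mk.measurable hz0.ae_eq_mk ht
  rw [Filter.EventuallyEq, ae_restrict_iff' measurableSet_lowRegion] at key
  have hmk := hz0.ae_eq_mk
  rw [Filter.EventuallyEq, ae_restrict_iff' measurableSet_lowRegion] at hmk
  filter_upwards [key, hmk] with ξ h1 h2 hξ
  have h1' := h1 hξ
  rw [hz t ξ hξ] at h1'
  rw [h1', ← h2 hξ, hz 0 ξ hξ, duhamel]
  -- Only the real part -‖ξ‖²/2 of the eigenvalue enters the modulus; the oscillation is not used.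
  have hexp : ∀ s, s ≤ t → ‖Complex.exp (eigen σ ξ * (t - s : ℝ))‖ₑ = heat 2⁻¹ t s ξ := fun s hs => by
    rw [← ofReal_norm, Complex.norm_exp, Complex.re_mul_ofReal, eigen_re σ hξ, heat,
      Set.indicator_of_mem (show t ∈ Set.Ici s from hs)]
    congr 2; ring
  refine (enorm_add_le _ _).trans (add_le_add ?_ ?_)
  · rw [enorm_mul]
    have := hexp 0 ht.1
    rw [sub_zero] at this
    rw [this]
  · refine (enorm_integral_le_lintegral_enorm _).trans ?_
    calc _ ≤ ∫⁻ s in Set.Ioc 0 t, heat 2⁻¹ t s ξ * ‖diagSource σ (a s) (q s) (v0 s) (v1 s) ξ‖ₑ := by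
          refine setLIntegral_mono' measurableSet_Ioc fun s hs => ?_
          rw [enorm_mul, hexp s hs.2]
          gcongr
          exact le_of_eq (congrArg _ (Set.indicator_of_mem hξ _))
      _ ≤ _ := lintegral_mono_set fun s (hs : s ∈ Set.Ioc 0 t) =>
          show s ∈ Set.Icc 0 T from ⟨hs.1.le, hs.2.trans ht.2⟩

end LowSystem

/-! ### Source estimates at fixed time -/

/-- The part of the norms of a regular function which is bounded in time. -/
structure BaseBound (κ α : ℝ≥0∞) (f : Plane → ℝ) : Prop where
  l2 : eLpNorm f 2 volume ≤ α
  pd : ∀ i, eLpNorm (pd i f) 2 volume ≤ α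
  wiener : wiener f ≤ κ * α

/-- The part of the norms of a regular function which is square integrable in time. -/
structure DecayBound (d F : ℝ≥0∞) (f : Plane → ℝ) : Prop where
  pd : ∀ i, eLpNorm (pd i f) 2 volume ≤ d
  wiener : wiener f ≤ F

/-- Bounds for the unknowns at fixed time. -/
structure SliceBound (κ α d F : ℝ≥0∞) (a q v0 v1 : Plane → ℝ) : Prop where
  one_le : 1 ≤ κ
  le_one : α ≤ 1
  base_a : BaseBound κ α a
  base_q : BaseBound κ α q
  base_v0 : BaseBound κ α v0
  base_v1 : BaseBound κ α v1
  decay_a : DecayBound d F a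
  decay_v0 : DecayBound d F v0
  decay_v1 : DecayBound d F v1

lemma BaseBound.gradNorm_le {κ α : ℝ≥0∞} {f : Plane → ℝ} (h : BaseBound κ α f) :
    gradNorm f ≤ 2 * α := by
  rw [two_mul]; exact add_le_add (h.pd 0) (h.pd 1)

lemma DecayBound.gradNorm_le {d F : ℝ≥0∞} {f : Plane → ℝ} (h : DecayBound d F f) :
    gradNorm f ≤ 2 * d := by
  rw [two_mul]; exact add_le_add (h.pd 0) (h.pd 1)

/-- The norm in `L¹` with weight `|ξ|⁻¹`. -/
def lowNorm (G : Plane → ℂ) : ℝ≥0∞ := ∫⁻ ξ, ENNReal.ofReal ‖ξ‖⁻¹ * ‖G ξ‖ₑ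

section Slice
variable {κ α d F : ℝ≥0∞} {a q v0 v1 f g : Plane → ℝ}

/-- The first factor must have a decaying full gradient, the second only a decaying ∂₁ derivative.
Hence q and q² may stand in the second place: ∂₁q = ∂₂a decays. -/
lemma lowNorm_mul_le (hf : Reg f) (hg : Reg g) (hf1 : eLpNorm f 2 volume ≤ α)
    (hf2 : gradNorm f ≤ 2 * d) (hg1 : eLpNorm g 2 volume ≤ κ * α)
    (hg2 : eLpNorm (pd 0 g) 2 volume ≤ 2 * (κ * d)) :
    lowNorm (prodHat f g) ≤ 25600 * (κ * (α * d)) := by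
  refine (hf.low_mul_le hg).trans ?_
  calc _ ≤ 6400 * (2 * d * (κ * α) + α * (2 * (κ * d))) := by gcongr
    _ = _ := by ring

lemma lowNorm_mul_pd_le (hf : Reg f) (hg : Reg g) (i : Fin 2) :
    lowNorm (prodHat f (pd i g)) ≤ 6400 * (wiener f * wiener g + gradNorm f * gradNorm g) :=
  hf.low_mul_pd_le hg i

lemma le_mul_of_one_le_left' {x : ℝ≥0∞} (h : 1 ≤ κ) : x ≤ κ * x := by
  calc x = 1 * x := (one_mul x).symm
    _ ≤ _ := by gcongr

namespace SliceBound

/-- The middle factor q is merely bounded. Its norms are at most multiples of κ because α ≤ 1, so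
the cubic term counts as a product of two decaying factors. -/
lemma lowNorm_cubic_le (S : SliceBound κ α d F a q v0 v1) (hf : Reg f) (hq : Reg q) (hg : Reg g)
    (bf : DecayBound d F f) (bg : DecayBound d F g) (i : Fin 2) :
    lowNorm (prodHat (fun x => f x * q x) (pd i g)) ≤ 32000 * (κ * (F + d) ^ 2) := by
  refine (lowNorm_mul_pd_le (hf.mul hq) hg i).trans ?_
  have h1 : wiener (fun x => f x * q x) ≤ κ * F := by
    refine (hf.wiener_mul_le hq).trans ?_
    calc _ ≤ F * (κ * 1) := by
          gcongr
          · exact bf.wiener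
          · exact S.base_q.wiener.trans (by gcongr; exact S.le_one)
      _ = _ := by ring
  have h2 : gradNorm (fun x => f x * q x) ≤ 2 * (κ * (F + d)) := by
    refine (hf.gradNorm_mul_le hq).trans ?_
    calc _ ≤ F * (2 * κ) + κ * 1 * (2 * d) := by
          gcongr
          · exact bf.wiener
          · exact S.base_q.gradNorm_le.trans (by gcongr; exact S.le_one.trans S.one_le)
          · exact S.base_q.wiener.trans (by gcongr; exact S.le_one)
          · exact bf.gradNorm_le
      _ = _ := by ring
  calc _ ≤ 6400 * (κ * F * F + 2 * (κ * (F + d)) * (2 * d)) := by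
        gcongr
        · exact bg.wiener
        · exact bg.gradNorm_le
    _ ≤ 6400 * (κ * (F + d) * (F + d) + 2 * (κ * (F + d)) * (2 * (F + d))) := by
        gcongr <;> first | exact le_self_add | exact le_add_self
    _ = _ := by ring

lemma lowNorm_quad_le (S : SliceBound κ α d F a q v0 v1) (hf : Reg f) (hg : Reg g)
    (bf : DecayBound d F f) (bg : DecayBound d F g) (i : Fin 2) :
    lowNorm (prodHat f (pd i g)) ≤ 32000 * (κ * (F + d) ^ 2) := by
  refine (lowNorm_mul_pd_le hf hg i).trans ?_
  calc _ ≤ 6400 * (F * F + (2 * d) * (2 * d)) := by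
        gcongr
        exacts [bf.wiener, bg.wiener, bf.gradNorm_le, bg.gradNorm_le]
    _ ≤ 6400 * ((F + d) * (F + d) + (2 * (F + d)) * (2 * (F + d))) := by
        gcongr <;> first | exact le_self_add | exact le_add_self
    _ = 32000 * (F + d) ^ 2 := by ring
    _ ≤ _ := by gcongr; exact le_mul_of_one_le_left' S.one_le

/-- This controls, at each time, the corrector that is subtracted when a is recovered: q is bounded
by α and ∂₂a is the decaying factor. -/
lemma lowNorm_correction_le (S : SliceBound κ α d F a q v0 v1) (ha : Reg a) (hq : Reg q) :
    lowNorm (prodHat q (pd 1 a)) ≤ 25600 * (κ * (α * (F + d))) := by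
  refine (lowNorm_mul_pd_le hq ha 1).trans ?_
  calc _ ≤ 6400 * (κ * α * F + (2 * α) * (2 * d)) := by
        gcongr
        exacts [S.base_q.wiener, S.decay_a.wiener, S.base_q.gradNorm_le, S.decay_a.gradNorm_le]
    _ ≤ 6400 * (4 * (κ * α * F) + (2 * (κ * α)) * (2 * d)) := by
        have h4 : κ * α * F ≤ 4 * (κ * α * F) := le_mul_of_one_le_left' (by norm_num)
        have h5 : α ≤ κ * α := le_mul_of_one_le_left' S.one_le
        exact mul_le_mul' le_rfl (add_le_add h4 (by gcongr))
    _ = _ := by ring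

variable (S : SliceBound κ α d F a q v0 v1) (ha : Reg a) (hq : Reg q) (h0 : Reg v0) (h1 : Reg v1)
  (hc : pd 1 a = pd 0 q)
include S ha hq h0 h1 hc

lemma lintegral_divSource_le :
    ∫⁻ ξ in lowRegion, ENNReal.ofReal ‖ξ‖⁻¹ * ENNReal.ofReal (divSource a q v0 v1 ξ)
      ≤ 281600 * (κ * (α * d)) := by
  have kd : ∀ x : ℝ≥0∞, x ≤ κ * x := fun x => le_mul_of_one_le_left' S.one_le
  have kd2 : ∀ x : ℝ≥0∞, x ≤ 2 * (κ * x) := fun x => (kd x).trans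
    (le_mul_of_one_le_left' (by norm_num))
  have lin : ∀ {g : Plane → ℝ}, BaseBound κ α g → eLpNorm g 2 volume ≤ κ * α := fun b =>
    b.l2.trans (kd α)
  have dec : ∀ {g : Plane → ℝ}, DecayBound d F g → eLpNorm (pd 0 g) 2 volume ≤ 2 * (κ * d) :=
    fun b => (b.pd 0).trans (kd2 d)
  -- The only derivative of q that is square integrable in time.
  have dq : eLpNorm (pd 0 q) 2 volume ≤ d := by rw [← hc]; exact S.decay_a.pd 1
  have dq' : eLpNorm (pd 0 q) 2 volume ≤ 2 * (κ * d) := dq.trans (kd2 d)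
  have hh1 : eLpNorm (fun x => q x * q x) 2 volume ≤ κ * α := by
    refine (hq.eLpNorm_mul_le q).trans ?_
    calc _ ≤ κ * 1 * α := by
          gcongr
          · exact S.base_q.wiener.trans (by gcongr; exact S.le_one)
          · exact S.base_q.l2
      _ = _ := by ring
  have hh2 : eLpNorm (pd 0 fun x => q x * q x) 2 volume ≤ 2 * (κ * d) := by
    refine (hq.eLpNorm_pd_mul_le hq 0).trans ?_
    calc _ ≤ κ * 1 * d + κ * 1 * d := by
          have := S.base_q.wiener.trans (mul_le_mul_right S.le_one κ)
          gcongr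
      _ = _ := by ring
  have n1 := lowNorm_mul_le h0 ha S.base_v0.l2 S.decay_v0.gradNorm_le (lin S.base_a) (dec S.decay_a)
  have n2 := lowNorm_mul_le h1 hq S.base_v1.l2 S.decay_v1.gradNorm_le (lin S.base_q) dq'
  have n3 := lowNorm_mul_le h0 (hq.mul hq) S.base_v0.l2 S.decay_v0.gradNorm_le hh1 hh2
  have n4 := lowNorm_mul_le h1 (hq.mul hq) S.base_v1.l2 S.decay_v1.gradNorm_le hh1 hh2
  have n5 := lowNorm_mul_le h0 hq S.base_v0.l2 S.decay_v0.gradNorm_le (lin S.base_q) dq'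
  have n6 := lowNorm_mul_le h0 h1 S.base_v0.l2 S.decay_v0.gradNorm_le (lin S.base_v1)
    (dec S.decay_v1)
  have n7 := lowNorm_mul_le ha hq S.base_a.l2 S.decay_a.gradNorm_le (lin S.base_q) dq'
  have n8 := lowNorm_mul_le h1 h1 S.base_v1.l2 S.decay_v1.gradNorm_le (lin S.base_v1)
    (dec S.decay_v1)
  have n9 := lowNorm_mul_le h0 h0 S.base_v0.l2 S.decay_v0.gradNorm_le (lin S.base_v0)
    (dec S.decay_v0)
  have n10 := lowNorm_mul_le ha ha S.base_a.l2 S.decay_a.gradNorm_le (lin S.base_a)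
    (dec S.decay_a)
  have mP : ∀ {f g : Plane → ℝ}, Reg f → Reg g → Measurable fun ξ : Plane =>
      ENNReal.ofReal ‖ξ‖⁻¹ * ‖prodHat f g ξ‖ₑ := fun hf hg =>
    (by fun_prop : Measurable fun ξ : Plane => ENNReal.ofReal ‖ξ‖⁻¹).mul
      (continuous_fourierInt (integrable_complex
        (integrable_mul_of_memLp hf.memLp hg.memLp))).measurable.enorm
  calc _ ≤ ∫⁻ ξ, ENNReal.ofReal ‖ξ‖⁻¹ * ENNReal.ofReal (divSource a q v0 v1 ξ) :=
        setLIntegral_le_lintegral _ _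
    _ = ∫⁻ ξ, (ENNReal.ofReal ‖ξ‖⁻¹ * ‖prodHat v0 a ξ‖ₑ + (ENNReal.ofReal ‖ξ‖⁻¹ * ‖prodHat v1 q ξ‖ₑ
        + (ENNReal.ofReal ‖ξ‖⁻¹ * ‖prodHat v0 (fun x => q x * q x) ξ‖ₑ
        + (ENNReal.ofReal ‖ξ‖⁻¹ * ‖prodHat v1 (fun x => q x * q x) ξ‖ₑ
        + (2 * (ENNReal.ofReal ‖ξ‖⁻¹ * ‖prodHat v0 q ξ‖ₑ)
        + (ENNReal.ofReal ‖ξ‖⁻¹ * ‖prodHat v0 v1 ξ‖ₑ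
        + (ENNReal.ofReal ‖ξ‖⁻¹ * ‖prodHat a q ξ‖ₑ
        + (ENNReal.ofReal ‖ξ‖⁻¹ * ‖prodHat v1 v1 ξ‖ₑ
        + (ENNReal.ofReal ‖ξ‖⁻¹ * ‖prodHat v0 v0 ξ‖ₑ
        + ENNReal.ofReal ‖ξ‖⁻¹ * ‖prodHat a a ξ‖ₑ))))))))) := by
        congr 1; ext ξ
        unfold divSource
        repeat rw [ENNReal.ofReal_add (by positivity) (by positivity)]
        rw [ENNReal.ofReal_mul (by norm_num), ENNReal.ofReal_ofNat]
        simp only [ofReal_norm]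
        ring
    _ = lowNorm (prodHat v0 a) + (lowNorm (prodHat v1 q)
        + (lowNorm (prodHat v0 fun x => q x * q x) + (lowNorm (prodHat v1 fun x => q x * q x)
        + (2 * lowNorm (prodHat v0 q) + (lowNorm (prodHat v0 v1) + (lowNorm (prodHat a q)
        + (lowNorm (prodHat v1 v1) + (lowNorm (prodHat v0 v0) + lowNorm (prodHat a a))))))))) := by
        rw [lintegral_add_left (mP h0 ha), lintegral_add_left (mP h1 hq),
          lintegral_add_left (mP h0 (hq.mul hq)), lintegral_add_left (mP h1 (hq.mul hq)),
          lintegral_add_left ((mP h0 hq).const_mul 2), lintegral_add_left (mP h0 h1),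
          lintegral_add_left (mP ha hq), lintegral_add_left (mP h1 h1),
          lintegral_add_left (mP h0 h0), lintegral_const_mul _ (mP h0 hq)]
        rfl
    _ ≤ 25600 * (κ * (α * d)) + (25600 * (κ * (α * d)) + (25600 * (κ * (α * d))
        + (25600 * (κ * (α * d)) + (2 * (25600 * (κ * (α * d))) + (25600 * (κ * (α * d))
        + (25600 * (κ * (α * d)) + (25600 * (κ * (α * d)) + (25600 * (κ * (α * d))
        + 25600 * (κ * (α * d)))))))))) := by gcongr
    _ = _ := by ring

omit h1 hc in
lemma lintegral_restSource_le :
    ∫⁻ ξ in lowRegion, ENNReal.ofReal ‖ξ‖⁻¹ * ENNReal.ofReal (restSource a q v0 ξ)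
      ≤ 256000 * (κ * (F + d) ^ 2) := by
  have n1 := S.lowNorm_cubic_le ha hq h0 S.decay_a S.decay_v0 1
  have n2 := S.lowNorm_cubic_le h0 hq ha S.decay_v0 S.decay_a 1
  have n3 := S.lowNorm_quad_le h0 ha S.decay_v0 S.decay_a 1
  have mP : ∀ {f g : Plane → ℝ}, Reg f → Reg g → Measurable fun ξ : Plane =>
      ENNReal.ofReal ‖ξ‖⁻¹ * ‖prodHat f (pd 1 g) ξ‖ₑ := fun hf hg =>
    (by fun_prop : Measurable fun ξ : Plane => ENNReal.ofReal ‖ξ‖⁻¹).mul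
      (continuous_fourierInt (integrable_complex
        (integrable_mul_of_memLp hf.memLp (hg.memLp_pd 1)))).measurable.enorm
  calc _ ≤ ∫⁻ ξ, ENNReal.ofReal ‖ξ‖⁻¹ * ENNReal.ofReal (restSource a q v0 ξ) :=
        setLIntegral_le_lintegral _ _
    _ = ∫⁻ ξ, (2 * (ENNReal.ofReal ‖ξ‖⁻¹ * ‖prodHat (fun x => a x * q x) (pd 1 v0) ξ‖ₑ)
        + (4 * (ENNReal.ofReal ‖ξ‖⁻¹ * ‖prodHat (fun x => v0 x * q x) (pd 1 a) ξ‖ₑ)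
        + 2 * (ENNReal.ofReal ‖ξ‖⁻¹ * ‖prodHat v0 (pd 1 a) ξ‖ₑ))) := by
        congr 1; ext ξ
        unfold restSource
        repeat rw [ENNReal.ofReal_add (by positivity) (by positivity)]
        simp only [ENNReal.ofReal_mul (show (0 : ℝ) ≤ 2 by norm_num),
          ENNReal.ofReal_mul (show (0 : ℝ) ≤ 4 by norm_num), ENNReal.ofReal_ofNat, ofReal_norm]
        ring
    _ = 2 * lowNorm (prodHat (fun x => a x * q x) (pd 1 v0))
        + (4 * lowNorm (prodHat (fun x => v0 x * q x) (pd 1 a))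
        + 2 * lowNorm (prodHat v0 (pd 1 a))) := by
        rw [lintegral_add_left ((mP (ha.mul hq) h0).const_mul 2),
          lintegral_add_left ((mP (h0.mul hq) ha).const_mul 4),
          lintegral_const_mul _ (mP (ha.mul hq) h0), lintegral_const_mul _ (mP (h0.mul hq) ha),
          lintegral_const_mul _ (mP h0 ha)]
        rfl
    _ ≤ 2 * (32000 * (κ * (F + d) ^ 2)) + (4 * (32000 * (κ * (F + d) ^ 2))
        + 2 * (32000 * (κ * (F + d) ^ 2))) := by gcongr
    _ = _ := by ring

end SliceBound
end Slice

/-! ### Norms in time and the low-frequency estimate -/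

lemma timeNorm_mono {p : ℝ≥0∞} {T : ℝ} {f g : ℝ → ℝ≥0∞} (h : ∀ t ∈ Set.Icc 0 T, f t ≤ g t) :
    timeNorm p T f ≤ timeNorm p T g :=
  eLpNorm_mono_enorm_ae ((ae_restrict_iff' measurableSet_Icc).2 (Eventually.of_forall
    fun t ht => by simpa using h t ht))

lemma timeNorm_add_le {T : ℝ} {f g : ℝ → ℝ≥0∞}
    (hf : AEMeasurable f (volume.restrict (Set.Icc 0 T)))
    (hg : AEMeasurable g (volume.restrict (Set.Icc 0 T))) :
    timeNorm 2 T (fun t => f t + g t) ≤ timeNorm 2 T f + timeNorm 2 T g :=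
  eLpNorm_add_le hf.aestronglyMeasurable hg.aestronglyMeasurable (by norm_num)

lemma timeNorm_const_mul {T : ℝ} (c : ℝ≥0∞) {f : ℝ → ℝ≥0∞}
    (hf : AEMeasurable f (volume.restrict (Set.Icc 0 T))) :
    timeNorm 2 T (fun t => c * f t) = c * timeNorm 2 T f := by
  unfold timeNorm
  rw [eLpNorm_two_eq, eLpNorm_two_eq]
  simp_rw [mul_pow]
  rw [lintegral_const_mul'' _ (hf.pow_const 2), ENNReal.mul_rpow_of_nonneg _ _ (by norm_num),
    rpow_half_sq]

lemma lintegral_eq_timeNorm_sq (T : ℝ) (f : ℝ → ℝ≥0∞) :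
    ∫⁻ s in Set.Icc 0 T, f s ^ 2 = timeNorm 2 T f ^ 2 := (eLpNorm_two_sq _ f).symm

/-- The free heat evolution at low frequency, measured in `L¹`. -/
def freeHeat (L : Plane → ℝ≥0∞) (t : ℝ) : ℝ≥0∞ := ∫⁻ ξ in lowRegion, heat 2⁻¹ t 0 ξ * L ξ

lemma measurable_heat_zero : Measurable fun z : ℝ × Plane => heat 2⁻¹ z.1 0 z.2 := by
  have h : Measurable fun z : ℝ × Plane => (z.1, (0 : ℝ), z.2) := by fun_prop
  exact (measurable_heat 2⁻¹).comp h

lemma measurable_freeHeat {L : Plane → ℝ≥0∞} (hL : AEMeasurable L) : Measurable (freeHeat L) := by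
  have e : freeHeat L = fun t => ∫⁻ ξ in lowRegion, heat 2⁻¹ t 0 ξ * hL.mk L ξ := by
    ext t
    refine lintegral_congr_ae (ae_restrict_of_ae ?_)
    filter_upwards [hL.ae_eq_mk] with ξ h
    rw [h]
  rw [e]
  exact Measurable.lintegral_prod_right' (f := fun z : ℝ × Plane => heat 2⁻¹ z.1 0 z.2 * hL.mk L z.2)
    (measurable_heat_zero.mul (hL.measurable_mk.comp measurable_snd))

lemma freeHeat_add {L L' : Plane → ℝ≥0∞} (hL : AEMeasurable L) (t : ℝ) :
    freeHeat (fun ξ => L ξ + L' ξ) t = freeHeat L t + freeHeat L' t := by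
  have hm : AEMeasurable (fun ξ => heat 2⁻¹ t 0 ξ * L ξ) (volume.restrict lowRegion) :=
    (((measurable_heat 2⁻¹).comp
      (by fun_prop : Measurable fun ξ : Plane => (t, (0 : ℝ), ξ))).aemeasurable.mul hL).restrict
  rw [freeHeat, freeHeat, freeHeat, ← lintegral_add_left' hm]
  simp_rw [mul_add]

/-- Minkowski's inequality turns the heat factor into ‖ξ‖⁻¹, which is integrable over `lowRegion`.
It serves for the datum q², whose transform is bounded pointwise by ‖q‖²_{L²}. -/
lemma timeNorm_freeHeat_const_le (T : ℝ) (c : ℝ≥0∞) :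
    timeNorm 2 T (freeHeat fun _ => c) ≤ ENNReal.ofReal (4 * Real.pi) * c := by
  have hk : Measurable (Function.uncurry fun (t : ℝ) (ξ : Plane) => heat 2⁻¹ t 0 ξ) :=
    measurable_heat_zero
  have hk' : Measurable (Function.uncurry fun (t : ℝ) (ξ : Plane) => heat 2⁻¹ t 0 ξ * c) :=
    hk.mul_const c
  refine (eLpNorm_lintegral_le _ _ hk').trans ?_
  calc _ ≤ ∫⁻ ξ in lowRegion, ENNReal.ofReal ‖ξ‖⁻¹ * c := by
        refine lintegral_mono_ae (ae_restrict_of_ae ?_)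
        filter_upwards [ae_plane_ne_zero] with ξ hξ
        have e := timeNorm_const_mul (T := T) c (f := fun t => heat 2⁻¹ t 0 ξ)
          (hk.comp measurable_prodMk_right).aemeasurable
        simp_rw [mul_comm c] at e
        refine (le_of_eq e).trans ?_
        gcongr
        exact eLpNorm_heat_le _ Measure.restrict_le_self _ hξ
    _ ≤ _ := by
        rw [lintegral_mul_const _ (by fun_prop : Measurable fun ξ : Plane => ENNReal.ofReal ‖ξ‖⁻¹)]
        gcongr
        exact lintegral_inv_norm_lowRegion_le

lemma lintegral_Ici_comp_half (f : ℝ → ℝ≥0∞) :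
    ∫⁻ t in Set.Ici 0, f (2⁻¹ * t) = 2 * ∫⁻ t in Set.Ici 0, f t := by
  have e := lintegral_map_equiv (μ := (volume : Measure ℝ)) ((Set.Ici 0).indicator f)
    (Homeomorph.mulLeft₀ (2⁻¹ : ℝ) (by norm_num)).toMeasurableEquiv
  have h2 : Measure.map (Homeomorph.mulLeft₀ (2⁻¹ : ℝ) (by norm_num)).toMeasurableEquiv
      (volume : Measure ℝ) = (2 : ℝ≥0∞) • volume := by
    have := Real.map_volume_mul_left (a := 2⁻¹) (by norm_num)
    simpa using this
  rw [h2, lintegral_smul_measure, lintegral_indicator measurableSet_Ici] at e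
  rw [← lintegral_indicator measurableSet_Ici]
  rw [smul_eq_mul] at e
  rw [e]
  congr 1; ext t
  simp [Set.indicator]

/-- The eigenvalues decay like e^{-‖ξ‖²t/2} while the data norm uses e^{-‖ξ‖²t}; halving the time
costs √2, rounded up to 2. -/
lemma timeNorm_freeHeat_hat_le {ι : Type} [Fintype ι] (T : ℝ) (F : ι → Plane → ℝ) (i : ι) :
    timeNorm 2 T (freeHeat fun ξ => ‖hat (F i) ξ‖ₑ)
      ≤ 2 * eLpNorm (fun t : ℝ => fourierL1 (fun ξ => Real.exp (-(‖ξ‖ ^ 2 * t))) F) 2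
        (volume.restrict (Set.Ici 0)) := by
  set g : ℝ → ℝ≥0∞ := fun t => fourierL1 (fun ξ => Real.exp (-(‖ξ‖ ^ 2 * t))) F with hg
  have h1 : ∀ t ∈ Set.Icc 0 T, freeHeat (fun ξ => ‖hat (F i) ξ‖ₑ) t ≤ g (2⁻¹ * t) := fun t ht => by
    refine (setLIntegral_le_lintegral _ _).trans ?_
    refine lintegral_mono fun ξ => ?_
    refine mul_le_mul' ?_ ?_
    · rw [heat, Set.indicator_of_mem (show t ∈ Set.Ici 0 from ht.1)]
      apply le_of_eq; congr 2; ring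
    · calc ‖hat (F i) ξ‖ₑ = (‖hat (F i) ξ‖ₑ ^ 2) ^ (1 / 2 : ℝ) := (rpow_half_sq _).symm
        _ ≤ _ := by
          gcongr
          exact Finset.single_le_sum (f := fun i => ‖hat (F i) ξ‖ₑ ^ 2) (fun _ _ => zero_le)
            (Finset.mem_univ i)
  refine (timeNorm_mono h1).trans ?_
  calc _ ≤ eLpNorm (fun t => g (2⁻¹ * t)) 2 (volume.restrict (Set.Ici 0)) :=
        eLpNorm_mono_measure _ (Measure.restrict_mono Set.Icc_subset_Ici_self le_rfl)
    _ ≤ _ := by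
        rw [eLpNorm_two_eq, eLpNorm_two_eq, lintegral_Ici_comp_half fun t => g t ^ 2]
        rw [ENNReal.mul_rpow_of_nonneg _ _ (by norm_num)]
        gcongr
        calc (2 : ℝ≥0∞) ^ (1 / 2 : ℝ) ≤ 2 ^ (1 : ℝ) :=
              ENNReal.rpow_le_rpow_of_exponent_le (by norm_num) (by norm_num)
          _ = 2 := ENNReal.rpow_one 2

/-- The Duhamel integral of a source, measured in `L¹` at low frequency. -/
def duhamelLow (T : ℝ) (f : ℝ → Plane → ℝ≥0∞) (t : ℝ) : ℝ≥0∞ :=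
  ∫⁻ z : ℝ × Plane, heat 2⁻¹ t z.1 z.2 * f z.1 z.2
    ∂((volume.restrict (Set.Icc 0 T)).prod (volume.restrict lowRegion))

lemma measurable_heat_mul {f : ℝ → Plane → ℝ≥0∞} (hf : Measurable (Function.uncurry f)) (t : ℝ) :
    Measurable fun z : ℝ × Plane => heat 2⁻¹ t z.1 z.2 * f z.1 z.2 :=
  ((measurable_heat 2⁻¹).comp (by fun_prop : Measurable fun z : ℝ × Plane => (t, z.1, z.2))).mul hf

lemma measurable_duhamelLow (T : ℝ) {f : ℝ → Plane → ℝ≥0∞} (hf : Measurable (Function.uncurry f)) :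
    Measurable (duhamelLow T f) :=
  Measurable.lintegral_prod_right'
    (f := fun z : ℝ × ℝ × Plane => heat 2⁻¹ z.1 z.2.1 z.2.2 * f z.2.1 z.2.2)
    ((measurable_heat 2⁻¹).mul (hf.comp measurable_snd))

lemma duhamelLow_eq (T : ℝ) {f : ℝ → Plane → ℝ≥0∞} (hf : Measurable (Function.uncurry f)) (t : ℝ) :
    duhamelLow T f t = ∫⁻ ξ in lowRegion, ∫⁻ s in Set.Icc 0 T, heat 2⁻¹ t s ξ * f s ξ :=
  lintegral_prod_symm' _ (measurable_heat_mul hf t)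

lemma measurable_lintegral_heat (T : ℝ) {f : ℝ → Plane → ℝ≥0∞}
    (hf : Measurable (Function.uncurry f)) (t : ℝ) :
    Measurable fun ξ => ∫⁻ s in Set.Icc 0 T, heat 2⁻¹ t s ξ * f s ξ :=
  Measurable.lintegral_prod_right' (f := fun z : Plane × ℝ => heat 2⁻¹ t z.2 z.1 * f z.2 z.1)
    ((measurable_heat_mul hf t).comp measurable_swap)

lemma measurable_prodHat_param {f g : ℝ → Plane → ℝ} (hf : Continuous (Function.uncurry f))
    (hg : Continuous (Function.uncurry g)) :
    Measurable (Function.uncurry fun s => prodHat (f s) (g s)) :=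
  measurable_fourierInt_param (f := fun s x => f s x * g s x) (hf.mul hg)

namespace LowSystem
variable {T : ℝ} {a q v0 v1 r0 r1 : ℝ → Plane → ℝ}

lemma measurable_divSource (S : LowSystem T a q v0 v1 r0 r1) :
    Measurable (Function.uncurry fun s ξ =>
      ENNReal.ofReal (divSource (a s) (q s) (v0 s) (v1 s) ξ)) := by
  have ha := S.reg_a.cont
  have hq := S.reg_q.cont
  have h0 := S.reg_v0.cont
  have h1 := S.reg_v1.cont
  have hh := (S.reg_q.mul S.reg_q).cont
  exact ((((((((((measurable_prodHat_param h0 ha).norm.add (measurable_prodHat_param h1 hq).norm).add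
    (measurable_prodHat_param h0 hh).norm).add (measurable_prodHat_param h1 hh).norm).add
    ((measurable_prodHat_param h0 hq).norm.const_mul 2)).add
    (measurable_prodHat_param h0 h1).norm).add (measurable_prodHat_param ha hq).norm).add
    (measurable_prodHat_param h1 h1).norm).add (measurable_prodHat_param h0 h0).norm).add
    (measurable_prodHat_param ha ha).norm).ennreal_ofReal

lemma measurable_restSource (S : LowSystem T a q v0 v1 r0 r1) :
    Measurable (Function.uncurry fun s ξ =>
      ENNReal.ofReal (restSource (a s) (q s) (v0 s) ξ)) := by
  have h0 := S.reg_v0.cont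
  exact ((((measurable_prodHat_param (S.reg_a.mul S.reg_q).cont
    (S.reg_v0.cont_pd 1)).norm.const_mul 2).add
    ((measurable_prodHat_param (S.reg_v0.mul S.reg_q).cont (S.reg_a.cont_pd 1)).norm.const_mul
      4)).add ((measurable_prodHat_param h0 (S.reg_a.cont_pd 1)).norm.const_mul 2)).ennreal_ofReal

/-- The initial data, in frequency. -/
def dataHat (a q v0 v1 : Plane → ℝ) (ξ : Plane) : ℝ≥0∞ :=
  ‖hat a ξ‖ₑ + ‖hat q ξ‖ₑ + (‖hat v1 ξ‖ₑ + ‖hat v0 ξ‖ₑ) + ‖hat (fun x => q x * q x) ξ‖ₑ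

/-- Duhamel's bound is multiplied by |ξ 0|⁻¹, the loss in recovering the unknowns. Both the data and
the sources have a factor |ξ 0| to compensate it, so no singularity on the line ξ₀ = 0 survives. -/
lemma weighted_diagVar_le (S : LowSystem T a q v0 v1 r0 r1) {σ : ℝ} (hσ : σ ^ 2 = 1) {t : ℝ}
    (ht : t ∈ Set.Icc 0 T) :
    ∀ᵐ ξ : Plane, ξ ∈ lowRegion →
      ENNReal.ofReal |ξ 0|⁻¹ * ‖diagVar σ (a t) (q t) (v0 t) (v1 t) ξ‖ₑ
        ≤ heat 2⁻¹ t 0 ξ * dataHat (a 0) (q 0) (v0 0) (v1 0) ξ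
          + ((∫⁻ s in Set.Icc 0 T, heat 2⁻¹ t s ξ *
              (‖ξ‖ₑ * ENNReal.ofReal (divSource (a s) (q s) (v0 s) (v1 s) ξ)))
            + ∫⁻ s in Set.Icc 0 T, heat 2⁻¹ t s ξ *
              ENNReal.ofReal (restSource (a s) (q s) (v0 s) ξ)) := by
  filter_upwards [S.enorm_diagVar_le hσ ht, ae_coord_ne_zero 0,
    ae_mul_hat_comm (S.reg_a.reg 0) (S.reg_q.reg 0) (S.pd_comm 0)] with ξ h hx hc hξ
  have hds : ∀ s, ENNReal.ofReal |ξ 0|⁻¹ * ‖diagSource σ (a s) (q s) (v0 s) (v1 s) ξ‖ₑ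
      ≤ ‖ξ‖ₑ * ENNReal.ofReal (divSource (a s) (q s) (v0 s) (v1 s) ξ)
        + ENNReal.ofReal (restSource (a s) (q s) (v0 s) ξ) := fun s => by
    have := norm_diagSource_le (a := a s) (q := q s) (v0 := v0 s) (v1 := v1 s) hσ hξ hx
    rw [← ofReal_norm, ← ofReal_norm, ← ENNReal.ofReal_mul (by positivity),
      ← ENNReal.ofReal_mul (by positivity)]
    exact (ENNReal.ofReal_le_ofReal this).trans ENNReal.ofReal_add_le
  have hd : ENNReal.ofReal |ξ 0|⁻¹ * ‖diagVar σ (a 0) (q 0) (v0 0) (v1 0) ξ‖ₑ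
      ≤ dataHat (a 0) (q 0) (v0 0) (v1 0) ξ := by
    have := norm_diagVar_le (a := a 0) (q := q 0) (v0 := v0 0) (v1 := v1 0) hσ hξ hx hc
    rw [← ofReal_norm, ← ENNReal.ofReal_mul (by positivity)]
    refine (ENNReal.ofReal_le_ofReal this).trans ?_
    repeat rw [ENNReal.ofReal_add (by positivity) (by positivity)]
    simp only [ofReal_norm, dataHat]
    apply le_of_eq; ring
  have hms : Measurable fun s => heat 2⁻¹ t s ξ *
      (‖ξ‖ₑ * ENNReal.ofReal (divSource (a s) (q s) (v0 s) (v1 s) ξ)) :=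
    ((measurable_heat 2⁻¹).comp (by fun_prop : Measurable fun s : ℝ => (t, s, ξ))).mul
      ((S.measurable_divSource.comp measurable_prodMk_right).const_mul _)
  calc _ ≤ ENNReal.ofReal |ξ 0|⁻¹ * (heat 2⁻¹ t 0 ξ * ‖diagVar σ (a 0) (q 0) (v0 0) (v1 0) ξ‖ₑ
        + ∫⁻ s in Set.Icc 0 T, heat 2⁻¹ t s ξ * ‖diagSource σ (a s) (q s) (v0 s) (v1 s) ξ‖ₑ) := by
        gcongr; exact h hξ
    _ = heat 2⁻¹ t 0 ξ * (ENNReal.ofReal |ξ 0|⁻¹ * ‖diagVar σ (a 0) (q 0) (v0 0) (v1 0) ξ‖ₑ)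
        + ∫⁻ s in Set.Icc 0 T, heat 2⁻¹ t s ξ *
          (ENNReal.ofReal |ξ 0|⁻¹ * ‖diagSource σ (a s) (q s) (v0 s) (v1 s) ξ‖ₑ) := by
        rw [mul_add, mul_left_comm, ← lintegral_const_mul' _ _ ENNReal.ofReal_ne_top]
        simp_rw [mul_left_comm (ENNReal.ofReal |ξ 0|⁻¹)]
    _ ≤ _ := by
        rw [← lintegral_add_left hms]
        refine add_le_add (mul_le_mul' le_rfl hd) (lintegral_mono fun s => ?_)
        rw [← mul_add]
        gcongr
        exact hds s

/-- The low frequency part of the Wiener norms of the decaying unknowns. -/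
def lowPart (a v0 v1 : Plane → ℝ) : ℝ≥0∞ :=
  ∫⁻ ξ in lowRegion, (‖hat v0 ξ‖ₑ + ‖hat v1 ξ‖ₑ + ‖hat a ξ‖ₑ)

lemma lowPart_le (S : LowSystem T a q v0 v1 r0 r1) {t : ℝ} (ht : t ∈ Set.Icc 0 T) :
    lowPart (a t) (v0 t) (v1 t) ≤ 6 * (freeHeat (dataHat (a 0) (q 0) (v0 0) (v1 0)) t
      + (duhamelLow T (fun s ξ => ‖ξ‖ₑ * ENNReal.ofReal (divSource (a s) (q s) (v0 s) (v1 s) ξ)) t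
        + duhamelLow T (fun s ξ => ENNReal.ofReal (restSource (a s) (q s) (v0 s) ξ)) t))
      + 2 * lowNorm (prodHat (q t) (pd 1 (a t))) := by
  set B : Plane → ℝ≥0∞ := fun ξ => heat 2⁻¹ t 0 ξ * dataHat (a 0) (q 0) (v0 0) (v1 0) ξ
    + ((∫⁻ s in Set.Icc 0 T, heat 2⁻¹ t s ξ *
        (‖ξ‖ₑ * ENNReal.ofReal (divSource (a s) (q s) (v0 s) (v1 s) ξ)))
      + ∫⁻ s in Set.Icc 0 T, heat 2⁻¹ t s ξ *
        ENNReal.ofReal (restSource (a s) (q s) (v0 s) ξ)) with hB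
  have m1 : Measurable (Function.uncurry fun s ξ =>
      ‖ξ‖ₑ * ENNReal.ofReal (divSource (a s) (q s) (v0 s) (v1 s) ξ)) :=
    (by fun_prop : Measurable fun z : ℝ × Plane => ‖z.2‖ₑ).mul S.measurable_divSource
  have mI := measurable_lintegral_heat T m1 t
  have mD : AEMeasurable (dataHat (a 0) (q 0) (v0 0) (v1 0)) :=
    ((((aestronglyMeasurable_hat _).enorm.add (aestronglyMeasurable_hat _).enorm).add
      ((aestronglyMeasurable_hat _).enorm.add (aestronglyMeasurable_hat _).enorm)).add
        (aestronglyMeasurable_hat _).enorm)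
  have mH : AEMeasurable (fun ξ => heat 2⁻¹ t 0 ξ * dataHat (a 0) (q 0) (v0 0) (v1 0) ξ)
      (volume.restrict lowRegion) :=
    (((measurable_heat 2⁻¹).comp
      (by fun_prop : Measurable fun ξ : Plane => (t, (0 : ℝ), ξ))).aemeasurable.mul mD).restrict
  have mB : AEMeasurable B (volume.restrict lowRegion) :=
    mH.add (mI.add (measurable_lintegral_heat T S.measurable_restSource t)).aemeasurable
  have iB : ∫⁻ ξ in lowRegion, B ξ = freeHeat (dataHat (a 0) (q 0) (v0 0) (v1 0)) t
      + (duhamelLow T (fun s ξ => ‖ξ‖ₑ * ENNReal.ofReal (divSource (a s) (q s) (v0 s) (v1 s) ξ)) t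
        + duhamelLow T (fun s ξ => ENNReal.ofReal (restSource (a s) (q s) (v0 s) ξ)) t) := by
    rw [lintegral_add_left' mH, lintegral_add_left mI, duhamelLow_eq T m1,
      duhamelLow_eq T S.measurable_restSource]
    rfl
  calc lowPart (a t) (v0 t) (v1 t)
      ≤ ∫⁻ ξ in lowRegion, (6 * B ξ
        + 2 * (ENNReal.ofReal ‖ξ‖⁻¹ * ‖prodHat (q t) (pd 1 (a t)) ξ‖ₑ)) := by
        refine setLIntegral_mono_ae' measurableSet_lowRegion ?_
        filter_upwards [S.weighted_diagVar_le (σ := 1) (by norm_num) ht,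
          S.weighted_diagVar_le (σ := -1) (by norm_num) ht, ae_coord_ne_zero 0,
          ae_div_hat (S.reg_v0.reg t) (S.reg_v1.reg t) (S.div_free t),
          ae_hat_sq (S.reg_q.reg t) (S.pd_comm t)] with ξ hp hm hx hd hsq hξ
        obtain ⟨e0, e1, ea⟩ := diag_recover hξ hx hd hsq
        -- One copy of the bound for each sign of the eigenvalue. Each of the three unknowns is
        -- controlled by this sum, which is the factor 6.
        have hU : ENNReal.ofReal (|ξ 0|⁻¹ * (‖diagVar 1 (a t) (q t) (v0 t) (v1 t) ξ‖
            + ‖diagVar (-1) (a t) (q t) (v0 t) (v1 t) ξ‖)) ≤ 2 * B ξ := by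
          rw [ENNReal.ofReal_mul (by positivity), ENNReal.ofReal_add (by positivity) (by positivity),
            ofReal_norm, ofReal_norm, mul_add, two_mul]
          exact add_le_add (hp hξ) (hm hξ)
        have c0 : ‖hat (v0 t) ξ‖ₑ ≤ 2 * B ξ := by
          rw [← ofReal_norm]; exact (ENNReal.ofReal_le_ofReal e0).trans hU
        have c1 : ‖hat (v1 t) ξ‖ₑ ≤ 2 * B ξ := by
          rw [← ofReal_norm]; exact (ENNReal.ofReal_le_ofReal e1).trans hU
        have ca : ‖hat (a t) ξ‖ₑ ≤ 2 * B ξ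
            + 2 * (ENNReal.ofReal ‖ξ‖⁻¹ * ‖prodHat (q t) (pd 1 (a t)) ξ‖ₑ) := by
          rw [← ofReal_norm]
          refine (ENNReal.ofReal_le_ofReal ea).trans (ENNReal.ofReal_add_le.trans ?_)
          refine add_le_add hU (le_of_eq ?_)
          rw [ENNReal.ofReal_mul (by norm_num), ENNReal.ofReal_mul (by positivity),
            ENNReal.ofReal_ofNat, ofReal_norm]
        calc _ ≤ 2 * B ξ + 2 * B ξ + (2 * B ξ
            + 2 * (ENNReal.ofReal ‖ξ‖⁻¹ * ‖prodHat (q t) (pd 1 (a t)) ξ‖ₑ)) :=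
              add_le_add (add_le_add c0 c1) ca
          _ = _ := by ring
    _ = 6 * (∫⁻ ξ in lowRegion, B ξ) + 2 * ∫⁻ ξ in lowRegion,
          (ENNReal.ofReal ‖ξ‖⁻¹ * ‖prodHat (q t) (pd 1 (a t)) ξ‖ₑ) := by
        rw [lintegral_add_left' (mB.const_mul 6), lintegral_const_mul'' _ mB,
          lintegral_const_mul' _ _ (by norm_num)]
    _ ≤ _ := by
        rw [iB]
        gcongr
        exact setLIntegral_le_lintegral _ _

lemma timeNorm_freeHeat_dataHat_le (S : LowSystem T a q v0 v1 r0 r1) {α : ℝ≥0∞}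
    (hα : eLpNorm (q 0) 2 volume ≤ α) {g w : Fin 2 → Plane → ℝ} (ga : a 0 = g 0) (gq : q 0 = g 1)
    (w0 : v0 0 = w 0) (w1 : v1 0 = w 1) :
    timeNorm 2 T (freeHeat (dataHat (a 0) (q 0) (v0 0) (v1 0)))
      ≤ 4 * (eLpNorm (fun t : ℝ => fourierL1 (fun ξ => Real.exp (-(‖ξ‖ ^ 2 * t))) g) 2
          (volume.restrict (Set.Ici 0))
        + eLpNorm (fun t : ℝ => fourierL1 (fun ξ => Real.exp (-(‖ξ‖ ^ 2 * t))) w) 2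
          (volume.restrict (Set.Ici 0))) + 13 * α ^ 2 := by
  have m : ∀ f : Plane → ℝ, AEMeasurable fun ξ => ‖hat f ξ‖ₑ := fun f =>
    (aestronglyMeasurable_hat f).enorm
  have M : ∀ f : Plane → ℝ, Measurable (freeHeat fun ξ => ‖hat f ξ‖ₑ) := fun f =>
    measurable_freeHeat (m f)
  have e : freeHeat (dataHat (a 0) (q 0) (v0 0) (v1 0)) = fun t =>
      freeHeat (fun ξ => ‖hat (a 0) ξ‖ₑ) t + freeHeat (fun ξ => ‖hat (q 0) ξ‖ₑ) t
      + (freeHeat (fun ξ => ‖hat (v1 0) ξ‖ₑ) t + freeHeat (fun ξ => ‖hat (v0 0) ξ‖ₑ) t)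
      + freeHeat (fun ξ => ‖hat (fun x => q 0 x * q 0 x) ξ‖ₑ) t := by
    ext t
    unfold dataHat
    have m2 : AEMeasurable fun ξ => ‖hat (a 0) ξ‖ₑ + ‖hat (q 0) ξ‖ₑ := (m _).add (m _)
    have m4 : AEMeasurable fun ξ => ‖hat (a 0) ξ‖ₑ + ‖hat (q 0) ξ‖ₑ
        + (‖hat (v1 0) ξ‖ₑ + ‖hat (v0 0) ξ‖ₑ) := m2.add ((m _).add (m _))
    rw [freeHeat_add m4, freeHeat_add m2, freeHeat_add (m (a 0)), freeHeat_add (m (v1 0))]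
  have hq2 : timeNorm 2 T (freeHeat fun ξ => ‖hat (fun x => q 0 x * q 0 x) ξ‖ₑ) ≤ 13 * α ^ 2 := by
    calc _ ≤ timeNorm 2 T (freeHeat fun _ => α ^ 2) := by
          refine timeNorm_mono fun t _ => lintegral_mono_ae (ae_restrict_of_ae ?_)
          filter_upwards [hat_mul_ae (S.reg_q.reg 0) (S.reg_q.reg 0).memLp] with ξ h
          rw [h]
          gcongr
          refine (enorm_fourierInt_mul_le_eLpNorm (S.reg_q.reg 0).memLp (S.reg_q.reg 0).memLp ξ).trans ?_
          rw [pow_two]; gcongr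
      _ ≤ ENNReal.ofReal (4 * Real.pi) * α ^ 2 := timeNorm_freeHeat_const_le T _
      _ ≤ _ := by
          gcongr
          apply ENNReal.ofReal_le_of_le_toReal
          simp only [ENNReal.toReal_ofNat]
          linarith [Real.pi_lt_d2]
  have na := timeNorm_freeHeat_hat_le T g 0
  have nq := timeNorm_freeHeat_hat_le T g 1
  have n0 := timeNorm_freeHeat_hat_le T w 0
  have n1 := timeNorm_freeHeat_hat_le T w 1
  rw [← ga] at na
  rw [← gq] at nq
  rw [← w0] at n0
  rw [← w1] at n1
  rw [e]
  refine (timeNorm_add_le (((M _).add (M _)).add ((M _).add (M _))).aemeasurable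
    (M _).aemeasurable).trans (add_le_add ?_ hq2)
  refine (timeNorm_add_le ((M _).add (M _)).aemeasurable ((M _).add (M _)).aemeasurable).trans ?_
  refine (add_le_add (timeNorm_add_le (M _).aemeasurable (M _).aemeasurable)
    (timeNorm_add_le (M _).aemeasurable (M _).aemeasurable)).trans ?_
  refine (add_le_add (add_le_add na nq) (add_le_add n1 n0)).trans (le_of_eq ?_)
  ring

/-- The estimate of the low frequencies. -/
theorem timeNorm_lowPart_le (S : LowSystem T a q v0 v1 r0 r1) (hT : 0 ≤ T) {κ α X : ℝ≥0∞}
    {d F : ℝ → ℝ≥0∞}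
    (hb : ∀ t ∈ Set.Icc 0 T, SliceBound κ α (d t) (F t) (a t) (q t) (v0 t) (v1 t))
    (hd : AEMeasurable d (volume.restrict (Set.Icc 0 T)))
    (hF : AEMeasurable F (volume.restrict (Set.Icc 0 T)))
    (hα : α ≤ X) (hX : timeNorm 2 T (fun t => F t + d t) ≤ X)
    {g w : Fin 2 → Plane → ℝ} (ga : a 0 = g 0) (gq : q 0 = g 1)
    (w0 : v0 0 = w 0) (w1 : v1 0 = w 1) :
    timeNorm 2 T (fun t => lowPart (a t) (v0 t) (v1 t))
      ≤ 24 * (eLpNorm (fun t : ℝ => fourierL1 (fun ξ => Real.exp (-(‖ξ‖ ^ 2 * t))) g) 2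
          (volume.restrict (Set.Ici 0))
        + eLpNorm (fun t : ℝ => fourierL1 (fun ξ => Real.exp (-(‖ξ‖ ^ 2 * t))) w) 2
          (volume.restrict (Set.Ici 0))) + 10000000 * (κ * X ^ 2) := by
  have S0 := hb 0 ⟨le_rfl, hT⟩
  have hκ : X ^ 2 ≤ κ * X ^ 2 := le_mul_of_one_le_left' S0.one_le
  set E := eLpNorm (fun t : ℝ => fourierL1 (fun ξ => Real.exp (-(‖ξ‖ ^ 2 * t))) g) 2
          (volume.restrict (Set.Ici 0))
        + eLpNorm (fun t : ℝ => fourierL1 (fun ξ => Real.exp (-(‖ξ‖ ^ 2 * t))) w) 2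
          (volume.restrict (Set.Ici 0))
  have hdX : timeNorm 2 T d ≤ X := (timeNorm_mono fun t _ => le_add_self).trans hX
  have t0 : timeNorm 2 T (freeHeat (dataHat (a 0) (q 0) (v0 0) (v1 0)))
      ≤ 4 * E + 13 * (κ * X ^ 2) :=
    (S.timeNorm_freeHeat_dataHat_le (S0.base_q.l2.trans hα) ga gq w0 w1).trans (by gcongr)
  -- The divergence terms are α times a function square integrable in time but carry an extra ‖ξ‖;
  -- maximal regularity recovers that frequency without leaving L² in time.
  have t1 : timeNorm 2 T (duhamelLow T fun s ξ =>
      ‖ξ‖ₑ * ENNReal.ofReal (divSource (a s) (q s) (v0 s) (v1 s) ξ)) ≤ 1126400 * (κ * X ^ 2) := by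
    refine (maximal_regularity T measurableSet_lowRegion (fun ξ h => norm_le_one_of_mem h)
      S.measurable_divSource).trans ?_
    calc _ ≤ 4 * timeNorm 2 T (fun s => 281600 * (κ * α) * d s) := by
          gcongr
          refine timeNorm_mono fun s hs => ?_
          refine ((hb s hs).lintegral_divSource_le (S.reg_a.reg s) (S.reg_q.reg s)
            (S.reg_v0.reg s) (S.reg_v1.reg s) (S.pd_comm s)).trans (le_of_eq ?_)
          ring
      _ ≤ 4 * (281600 * (κ * X) * X) := by rw [timeNorm_const_mul _ hd]; gcongr
      _ = _ := by ring
  -- The remaining terms are products of two functions square integrable in time, hence integrable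
  -- in time, and Minkowski's inequality suffices.
  have t2 : timeNorm 2 T (duhamelLow T fun s ξ =>
      ENNReal.ofReal (restSource (a s) (q s) (v0 s) ξ)) ≤ 256000 * (κ * X ^ 2) := by
    refine (eLpNorm_duhamel_le T lowRegion S.measurable_restSource).trans ?_
    calc _ ≤ ∫⁻ s in Set.Icc 0 T, 256000 * κ * (F s + d s) ^ 2 := by
          refine setLIntegral_mono' measurableSet_Icc fun s hs => ?_
          refine ((hb s hs).lintegral_restSource_le (S.reg_a.reg s) (S.reg_q.reg s)
            (S.reg_v0.reg s)).trans (le_of_eq ?_)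
          ring
      _ = 256000 * κ * timeNorm 2 T (fun t => F t + d t) ^ 2 := by
          have m : AEMeasurable (fun s => (F s + d s) ^ 2) (volume.restrict (Set.Icc 0 T)) :=
            (hF.add hd).pow_const 2
          rw [lintegral_const_mul'' _ m, lintegral_eq_timeNorm_sq]
      _ ≤ 256000 * κ * X ^ 2 := by gcongr
      _ = _ := by ring
  set J := fun t => freeHeat (dataHat (a 0) (q 0) (v0 0) (v1 0)) t
      + (duhamelLow T (fun s ξ => ‖ξ‖ₑ * ENNReal.ofReal (divSource (a s) (q s) (v0 s) (v1 s) ξ)) t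
        + duhamelLow T (fun s ξ => ENNReal.ofReal (restSource (a s) (q s) (v0 s) ξ)) t)
  have mD : AEMeasurable (dataHat (a 0) (q 0) (v0 0) (v1 0)) :=
    ((((aestronglyMeasurable_hat _).enorm.add (aestronglyMeasurable_hat _).enorm).add
      ((aestronglyMeasurable_hat _).enorm.add (aestronglyMeasurable_hat _).enorm)).add
        (aestronglyMeasurable_hat _).enorm)
  have m0 := measurable_freeHeat mD
  have ms : Measurable (Function.uncurry fun s ξ =>
      ‖ξ‖ₑ * ENNReal.ofReal (divSource (a s) (q s) (v0 s) (v1 s) ξ)) :=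
    (by fun_prop : Measurable fun z : ℝ × Plane => ‖z.2‖ₑ).mul S.measurable_divSource
  have m1 := measurable_duhamelLow T ms
  have m2 := measurable_duhamelLow T S.measurable_restSource
  have mJ : Measurable J := m0.add (m1.add m2)
  have tJ : timeNorm 2 T J ≤ 4 * E + 1382413 * (κ * X ^ 2) := by
    refine (timeNorm_add_le m0.aemeasurable (m1.add m2).aemeasurable).trans ?_
    refine (add_le_add t0 ((timeNorm_add_le m1.aemeasurable m2.aemeasurable).trans
      (add_le_add t1 t2))).trans (le_of_eq ?_)
    ring
  calc _ ≤ timeNorm 2 T (fun t => 6 * J t + 51200 * (κ * α) * (F t + d t)) := by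
        refine timeNorm_mono fun t ht => (S.lowPart_le ht).trans ?_
        gcongr 6 * J t + ?_
        calc _ ≤ 2 * (25600 * (κ * (α * (F t + d t)))) := by
              gcongr
              exact (hb t ht).lowNorm_correction_le (S.reg_a.reg t) (S.reg_q.reg t)
          _ = _ := by ring
    _ ≤ 6 * timeNorm 2 T J + 51200 * (κ * α) * timeNorm 2 T (fun t => F t + d t) := by
        refine (timeNorm_add_le (mJ.const_mul 6).aemeasurable
          ((hF.add hd).const_mul _)).trans ?_
        rw [timeNorm_const_mul _ mJ.aemeasurable]
        exact add_le_add le_rfl (timeNorm_const_mul _ (hF.add hd)).le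
    _ ≤ 6 * (4 * E + 1382413 * (κ * X ^ 2)) + 51200 * (κ * X) * X := by gcongr
    _ = 24 * E + 8345678 * (κ * X ^ 2) := by ring
    _ ≤ _ := by gcongr; norm_num

end LowSystem

/-! ### Differential calculus in space and time; bounds valid at every time -/

lemma contDiff_pd {k : ℕ} {f : Plane → ℝ} (hf : ContDiff ℝ (k + 1 : ℕ) f) (i : Fin 2) :
    ContDiff ℝ k (pd i f) :=
  (hf.fderiv_right (m := k) (by push_cast; rfl)).clm_apply contDiff_const

lemma pd_comm {f : Plane → ℝ} (hf : ContDiff ℝ (2 : ℕ) f) (i j : Fin 2) :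
    pd i (pd j f) = pd j (pd i f) := by
  ext x
  have hd : DifferentiableAt ℝ (fderiv ℝ f) x :=
    ((hf.fderiv_right (m := 1) (by norm_num)).differentiable (by norm_num)) x
  have e : ∀ i j, pd i (pd j f) x
      = fderiv ℝ (fderiv ℝ f) x (EuclideanSpace.single i 1) (EuclideanSpace.single j 1) := by
    intro i j
    unfold pd
    rw [fderiv_clm_apply hd (differentiableAt_const _)]
    simp
  rw [e, e]
  exact hf.contDiffAt.isSymmSndFDerivAt (by simp) _ _

lemma iterate_pd_comm (b : ℕ) {f : Plane → ℝ} (hf : ContDiff ℝ (b + 1 : ℕ) f) :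
    (pd 1)^[b] (pd 0 f) = pd 0 ((pd 1)^[b] f) := by
  induction b generalizing f with
  | zero => rfl
  | succ b ih =>
    rw [Function.iterate_succ_apply, Function.iterate_succ_apply,
      pd_comm (hf.of_le (by exact_mod_cast (by omega : 2 ≤ b + 1 + 1))), ih (contDiff_pd hf 1)]

lemma pdMulti_pd_zero (α : ℕ × ℕ) {f : Plane → ℝ} (hf : ContDiff ℝ (α.2 + 1 : ℕ) f) :
    pdMulti α (pd 0 f) = pdMulti (α.1 + 1, α.2) f := by
  unfold pdMulti
  rw [iterate_pd_comm _ hf, Function.iterate_succ_apply]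

/-- Families of `Cᵏ` functions, the derivatives being continuous in all variables. -/
structure Smooth (k : ℕ) (f : ℝ → Plane → ℝ) : Prop where
  contDiff : ∀ t, ContDiff ℝ k (f t)
  cont_pdMulti : ∀ α : ℕ × ℕ, α.1 + α.2 ≤ k →
    Continuous (Function.uncurry fun t => pdMulti α (f t))

/-- The retraction of the time axis onto `[0,T]`. -/
def clamp (T t : ℝ) : ℝ := max 0 (min t T)

lemma continuous_clamp (T : ℝ) : Continuous (clamp T) := by unfold clamp; fun_prop

lemma clamp_mem {T : ℝ} (hT : 0 ≤ T) (t : ℝ) : clamp T t ∈ Set.Icc 0 T :=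
  ⟨le_max_left _ _, max_le hT (min_le_right _ _)⟩

lemma clamp_of_mem {T t : ℝ} (h : t ∈ Set.Icc 0 T) : clamp T t = t := by
  rw [clamp, min_eq_left h.2, max_eq_right h.1]

lemma continuous_comp_clamp {T : ℝ} (hT : 0 ≤ T) {f : ℝ → Plane → ℝ}
    (hf : ContinuousOn (fun z : ℝ × Plane => f z.1 z.2) (Set.Icc 0 T ×ˢ Set.univ)) :
    Continuous (Function.uncurry fun t => f (clamp T t)) :=
  hf.comp_continuous (f := fun z : ℝ × Plane => (clamp T z.1, z.2))
    (((continuous_clamp T).comp continuous_fst).prodMk continuous_snd)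
    fun z => ⟨clamp_mem hT z.1, Set.mem_univ _⟩

lemma SpaceSmooth.smooth {k : ℕ} {T : ℝ} (hT : 0 ≤ T) {f : ℝ → Plane → ℝ} (hf : SpaceSmooth k T f) :
    Smooth k fun t => f (clamp T t) :=
  ⟨fun t => hf.1 _ (clamp_mem hT t), fun α hα =>
    continuous_comp_clamp hT (f := fun t => pdMulti α (f t)) (hf.2 α hα)⟩

namespace Smooth
variable {k : ℕ} {f g : ℝ → Plane → ℝ}

lemma continuous (hf : Smooth k f) : Continuous (Function.uncurry f) :=
  hf.cont_pdMulti (0, 0) (Nat.zero_le _)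

lemma pd (hf : Smooth (k + 1) f) (i : Fin 2) : Smooth k fun t => pd i (f t) := by
  refine ⟨fun t => contDiff_pd (hf.contDiff t) i, fun α hα => ?_⟩
  fin_cases i
  · have : (fun t => pdMulti α (MHD.pd 0 (f t))) = fun t => pdMulti (α.1 + 1, α.2) (f t) := by
      ext1 t
      exact pdMulti_pd_zero α ((hf.contDiff t).of_le (by exact_mod_cast (by omega)))
    simp only [Fin.zero_eta, this]
    exact hf.cont_pdMulti _ (by simp only; omega)
  · exact hf.cont_pdMulti (α.1, α.2 + 1) (by simp only; omega)

lemma differentiable (hf : Smooth (k + 1) f) (t : ℝ) : Differentiable ℝ (f t) :=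
  (hf.contDiff t).differentiable (by simp)

lemma continuous_apply (hf : Smooth k f) (t : ℝ) : Continuous (f t) :=
  hf.continuous.comp (by fun_prop : Continuous fun x : Plane => (t, x))

end Smooth

lemma integrableOn_time {g : ℝ → Plane → ℝ} (hg : Continuous (Function.uncurry g)) (t : ℝ)
    (x : Plane) : IntegrableOn (fun s => g s x) (Set.Ioc 0 t) := by
  have : Continuous fun s => g s x := hg.comp (by fun_prop : Continuous fun s : ℝ => (s, x))
  exact (this.integrableOn_Icc).mono_set Set.Ioc_subset_Icc_self

/-- Integration in time of an evolution equation. -/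
lemma eq_add_integral {T : ℝ} {f g : ℝ → Plane → ℝ} (hf : Continuous (Function.uncurry f))
    (hg : Continuous (Function.uncurry g))
    (h : ∀ t ∈ Set.Ioo 0 T, ∀ x, HasDerivAt (fun s => f s x) (g t x) t) :
    ∀ t ∈ Set.Icc 0 T, ∀ x, f t x = f 0 x + ∫ s in Set.Ioc 0 t, g s x := by
  intro t ht x
  have hfx : Continuous fun s => f s x := hf.comp (by fun_prop : Continuous fun s : ℝ => (s, x))
  have hgx : Continuous fun s => g s x := hg.comp (by fun_prop : Continuous fun s : ℝ => (s, x))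
  have := intervalIntegral.integral_eq_sub_of_hasDerivAt_of_le ht.1 hfx.continuousOn
    (fun s hs => h s ⟨hs.1, hs.2.trans_le ht.2⟩ x) (hgx.intervalIntegrable _ _)
  rw [← intervalIntegral.integral_of_le ht.1, this]
  ring

lemma hasDerivAt_of_eq_add_integral {T : ℝ} {f g : ℝ → Plane → ℝ}
    (hg : Continuous (Function.uncurry g))
    (h : ∀ t ∈ Set.Icc 0 T, ∀ x, f t x = f 0 x + ∫ s in Set.Ioc 0 t, g s x) :
    ∀ t ∈ Set.Ioo 0 T, ∀ x, HasDerivAt (fun s => f s x) (g t x) t := by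
  intro t ht x
  have hgx : Continuous fun s => g s x := hg.comp (by fun_prop : Continuous fun s : ℝ => (s, x))
  have := (intervalIntegral.integral_hasDerivAt_right (hgx.intervalIntegrable 0 t)
    hgx.aestronglyMeasurable.stronglyMeasurableAtFilter hgx.continuousAt).const_add (f 0 x)
  refine this.congr_of_eventuallyEq ?_
  filter_upwards [Ioo_mem_nhds ht.1 ht.2] with s hs
  rw [h s ⟨hs.1.le, hs.2.le⟩ x, intervalIntegral.integral_of_le hs.1.le]

lemma hasDerivAt_line {f : Plane → ℝ} (hf : Differentiable ℝ f) (i : Fin 2) (x : Plane) (y : ℝ) :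
    HasDerivAt (fun y : ℝ => f (x + y • EuclideanSpace.single i 1))
      (pd i f (x + y • EuclideanSpace.single i 1)) y := by
  have h1 : HasDerivAt (fun y : ℝ => x + y • (EuclideanSpace.single i 1 : Plane))
      (EuclideanSpace.single i 1) y := by
    simpa using ((hasDerivAt_id y).smul_const (EuclideanSpace.single i 1 : Plane)).const_add x
  exact (hf _).hasFDerivAt.comp_hasDerivAt y h1

/-- Differentiation in space of an integrated evolution equation. -/
lemma pd_eq_add_integral {T : ℝ} {f g : ℝ → Plane → ℝ} (hf : ∀ t, Differentiable ℝ (f t))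
    (hg : Continuous (Function.uncurry g)) (hgd : ∀ t, Differentiable ℝ (g t)) (i : Fin 2)
    (hgp : Continuous (Function.uncurry fun t => pd i (g t)))
    (h : ∀ t ∈ Set.Icc 0 T, ∀ x, f t x = f 0 x + ∫ s in Set.Ioc 0 t, g s x) :
    ∀ t ∈ Set.Icc 0 T, ∀ x, pd i (f t) x = pd i (f 0) x + ∫ s in Set.Ioc 0 t, pd i (g s) x := by
  intro t ht x
  set e : Plane := EuclideanSpace.single i 1
  have hc : Continuous fun z : ℝ × ℝ => pd i (g z.1) (x + z.2 • e) :=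
    hgp.comp (by fun_prop : Continuous fun z : ℝ × ℝ => (z.1, x + z.2 • e))
  obtain ⟨B, hB⟩ := ((isCompact_Icc (a := (0 : ℝ)) (b := t)).prod
    (isCompact_Icc (a := (-1 : ℝ)) (b := 1))).exists_bound_of_continuousOn hc.continuousOn
  have hm : ∀ y : ℝ, Continuous fun s => g s (x + y • e) := fun y =>
    hg.comp (by fun_prop : Continuous fun s : ℝ => (s, x + y • e))
  have key := (hasDerivAt_integral_of_dominated_loc_of_deriv_le (𝕜 := ℝ)
    (μ := volume.restrict (Set.Ioc 0 t)) (x₀ := 0) (s := Set.Icc (-1) 1)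
    (F := fun y s => g s (x + y • e)) (F' := fun y s => pd i (g s) (x + y • e)) (bound := fun _ => B)
    (Icc_mem_nhds (by norm_num) (by norm_num))
    (Eventually.of_forall fun y => (hm y).aestronglyMeasurable)
    (integrableOn_time hg t _)
    ((hc.comp (by fun_prop : Continuous fun s : ℝ => (s, (0 : ℝ)))).aestronglyMeasurable)
    ((ae_restrict_iff' measurableSet_Ioc).2 (Eventually.of_forall fun s hs y hy =>
      hB (s, y) ⟨⟨hs.1.le, hs.2⟩, hy⟩))
    (integrable_const B)
    (Eventually.of_forall fun s y _ => hasDerivAt_line (hgd s) i x y)).2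
  have k2 := (hasDerivAt_line (hf 0) i x 0).add key
  have k1 := hasDerivAt_line (hf t) i x 0
  have e1 : (fun y : ℝ => f t (x + y • e)) = fun y => f 0 (x + y • e)
      + ∫ s in Set.Ioc 0 t, g s (x + y • e) := by
    ext y; exact h t ht _
  rw [e1] at k1
  have := k1.unique k2
  simpa using this

/-- A bound at almost every time holds on a dense set of times. Pointwise convergence along a
sequence of such times, with Fatou's lemma, carries it to every t, including the end points. -/
lemma eLpNorm_le_of_ae_le {T : ℝ} (hT : 0 < T) {g : ℝ → Plane → ℝ}
    (hg : Continuous (Function.uncurry g)) {K : ℝ≥0∞}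
    (h : ∀ᵐ s ∂(volume.restrict (Set.Icc 0 T)), eLpNorm (g s) 2 volume ≤ K) :
    ∀ t ∈ Set.Icc 0 T, eLpNorm (g t) 2 volume ≤ K := by
  intro t ht
  rw [ae_restrict_iff' measurableSet_Icc] at h
  have hd := (Measure.dense_of_ae h).open_subset_closure_inter (isOpen_Ioo (a := 0) (b := T))
  have htc : t ∈ closure (Set.Ioo 0 T ∩ {s | s ∈ Set.Icc 0 T → eLpNorm (g s) 2 volume ≤ K}) := by
    have := closure_minimal hd isClosed_closure
    rw [closure_Ioo hT.ne] at this
    exact this ht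
  obtain ⟨u, hu, hlim⟩ := mem_closure_iff_seq_limit.1 htc
  have hcont : ∀ s, Continuous (g s) := fun s =>
    hg.comp (by fun_prop : Continuous fun x : Plane => (s, x))
  refine (Lp.eLpNorm_lim_le_liminf_eLpNorm (fun n => (hcont (u n)).aestronglyMeasurable) (g t)
    (Eventually.of_forall fun x => ?_)).trans ?_
  · have : Continuous fun s => g s x := hg.comp (by fun_prop : Continuous fun s : ℝ => (s, x))
    exact (this.tendsto t).comp hlim
  · refine (liminf_le_liminf (Eventually.of_forall fun n =>
      (hu n).2 (Set.Ioo_subset_Icc_self (hu n).1))).trans ?_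
    rw [liminf_const]

lemma eLpNorm_pdMulti_le {ι : Type} [Fintype ι] {n : ℕ} {T : ℝ} (hT : 0 < T)
    {F : ℝ → ι → Plane → ℝ} (hF : ∀ i, Smooth n fun t => F (clamp T t) i) (t : ℝ) (i : ι)
    {α : ℕ × ℕ} (hα : α.1 + α.2 ≤ n) :
    eLpNorm (pdMulti α (F (clamp T t) i)) 2 volume ≤ timeNorm ∞ T fun t => sobolevNorm n (F t) := by
  have h := eLpNorm_le_of_ae_le hT ((hF i).cont_pdMulti α hα)
    (K := timeNorm ∞ T fun t => sobolevNorm n (F t)) ?_ (clamp T t) (clamp_mem hT.le t)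
  · rwa [clamp_of_mem (clamp_mem hT.le t)] at h
  · have hae := ae_le_eLpNormEssSup (μ := volume.restrict (Set.Icc 0 T))
      (f := fun t => sobolevNorm n (F t))
    filter_upwards [hae, ae_restrict_mem measurableSet_Icc] with s hs hm
    rw [clamp_of_mem hm]
    refine (eLpNorm_le_sobolevNorm (F s) i α hα).trans ?_
    rw [timeNorm, eLpNorm_exponent_top]
    simpa using hs

/-- The constant relating the Wiener norm to the Sobolev norm. -/
def wienerConst : ℝ≥0∞ := 1 + cSob * ENNReal.ofReal (2 * Real.pi) * 3

lemma wienerConst_lt_top : wienerConst < ∞ :=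
  ENNReal.add_lt_top.2 ⟨ENNReal.one_lt_top, ENNReal.mul_lt_top
    (ENNReal.mul_lt_top cSob_lt_top ENNReal.ofReal_lt_top) (by norm_num)⟩

section Bounds
variable {f : Plane → ℝ} {M : ℝ≥0∞}

lemma contDiff_iterate_pd (b : ℕ) (i : Fin 2) {m : ℕ} (hf : ContDiff ℝ (m + b : ℕ) f) :
    ContDiff ℝ m ((pd i)^[b] f) := by
  induction b generalizing f with
  | zero => exact hf
  | succ b ih =>
    rw [Function.iterate_succ_apply]
    exact ih (contDiff_pd hf i)

lemma continuous_pdMulti {n : ℕ} (hf : ContDiff ℝ n f) {α : ℕ × ℕ} (hα : α.1 + α.2 ≤ n) :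
    Continuous (pdMulti α f) := by
  have h : ContDiff ℝ (0 : ℕ) (pdMulti α f) := contDiff_iterate_pd α.1 0
    (contDiff_iterate_pd α.2 1 (hf.of_le (by exact_mod_cast (by omega))))
  exact h.continuous

lemma memLp_pdMulti {n : ℕ} (hf : ContDiff ℝ n f) (α : ℕ × ℕ) (hα : α.1 + α.2 ≤ n)
    (hM : M < ∞) (h : eLpNorm (pdMulti α f) 2 volume ≤ M) :
    MemLp (pdMulti α f) 2 (volume : Measure Plane) :=
  ⟨(continuous_pdMulti hf hα).aestronglyMeasurable, h.trans_lt hM⟩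

variable (hf : ContDiff ℝ (2 : ℕ) f) (hM : M < ∞)
  (h : ∀ α : ℕ × ℕ, α.1 + α.2 ≤ 2 → eLpNorm (pdMulti α f) 2 volume ≤ M)
include hf hM h

lemma baseBound_of_sobolev : BaseBound wienerConst M f ∧ Reg f := by
  have m0 : MemLp f 2 (volume : Measure Plane) := memLp_pdMulti hf (0, 0) (by simp) hM (h _ (by simp))
  have b1 : ∀ i, eLpNorm (pd i f) 2 volume ≤ M := fun i => by
    fin_cases i
    exacts [h (1, 0) (by simp), h (0, 1) (by simp)]
  have m1 : ∀ i, MemLp (pd i f) 2 (volume : Measure Plane) := fun i => by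
    fin_cases i
    exacts [memLp_pdMulti hf (1, 0) (by simp) hM (h _ (by simp)),
      memLp_pdMulti hf (0, 1) (by simp) hM (h _ (by simp))]
  have m2 : ∀ i, MemLp (pd i (pd i f)) 2 (volume : Measure Plane) := fun i => by
    fin_cases i
    exacts [memLp_pdMulti hf (2, 0) (by simp) hM (h _ (by simp)),
      memLp_pdMulti hf (0, 2) (by simp) hM (h _ (by simp))]
  have hw : wiener f ≤ wienerConst * M := by
    refine (wiener_le hf m0 m1 m2).trans ?_
    calc _ ≤ cSob * ENNReal.ofReal (2 * Real.pi) * (M + M + M) := by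
          gcongr
          exacts [h (0, 0) (by simp), h (2, 0) (by simp), h (0, 2) (by simp)]
      _ = cSob * ENNReal.ofReal (2 * Real.pi) * 3 * M := by ring
      _ ≤ _ := by gcongr; exact le_add_self
  exact ⟨⟨h (0, 0) (by simp), b1, hw⟩, ⟨hf.of_le (by norm_num), m0, m1,
    hw.trans_lt (ENNReal.mul_lt_top wienerConst_lt_top hM)⟩⟩

end Bounds

lemma regField_of_sobolev {f : ℝ → Plane → ℝ} {M : ℝ≥0∞} (hf : Smooth 2 f) (hM : M < ∞)
    (h : ∀ t, ∀ α : ℕ × ℕ, α.1 + α.2 ≤ 2 → eLpNorm (pdMulti α (f t)) 2 volume ≤ M) : RegField f := by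
  have hb := fun t => baseBound_of_sobolev (hf.contDiff t) hM (h t)
  have hfin : M + wienerConst * M ≠ ∞ :=
    (ENNReal.add_lt_top.2 ⟨hM, ENNReal.mul_lt_top wienerConst_lt_top hM⟩).ne
  refine ⟨hf.continuous, fun i => (hf.pd i).continuous, fun t => (hb t).2,
    (M + wienerConst * M).toNNReal, fun t => ?_⟩
  rw [ENNReal.coe_toNNReal hfin]
  exact ⟨(hb t).1.l2.trans le_self_add, fun i => ((hb t).1.pd i).trans le_self_add,
    (hb t).1.wiener.trans le_add_self⟩

lemma measurable_eLpNorm {g : ℝ → Plane → ℝ} (hg : Continuous (Function.uncurry g)) :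
    Measurable fun t => eLpNorm (g t) 2 volume := by
  have e : (fun t => eLpNorm (g t) 2 volume)
      = fun t => (∫⁻ x, ‖g t x‖ₑ ^ 2) ^ (1 / 2 : ℝ) := by
    ext t; rw [← eLpNorm_enorm, eLpNorm_two_eq]
  rw [e]
  refine Measurable.pow_const ?_ _
  exact Measurable.lintegral_prod_right' (f := fun z : ℝ × Plane => ‖g z.1 z.2‖ₑ ^ 2)
    (hg.measurable.enorm.pow_const 2)

lemma measurable_sobolevNorm {ι : Type} [Fintype ι] {n : ℕ} {F : ℝ → ι → Plane → ℝ}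
    (hF : ∀ i, Smooth n fun t => F t i) : Measurable fun t => sobolevNorm n (F t) := by
  unfold sobolevNorm
  refine Measurable.pow_const ?_ _
  refine Finset.measurable_sum _ fun i _ => Finset.measurable_sum _ fun k hk =>
    Finset.measurable_sum _ fun α hα => (measurable_eLpNorm ((hF i).cont_pdMulti α ?_)).pow_const 2
  rw [Finset.HasAntidiagonal.mem_antidiagonal] at hα
  rw [Finset.mem_range] at hk
  omega

/-! ### Measurability in time of the Wiener norm -/

section Measurability

lemma lintegral_ball_hat_le (n : ℕ) {f : Plane → ℝ} (hf : MemLp f 2 (volume : Measure Plane)) :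
    ∫⁻ ξ in Metric.ball 0 n, ‖hat f ξ‖ₑ
      ≤ volume (Metric.ball (0 : Plane) n) ^ (1 / 2 : ℝ) * ENNReal.ofReal (2 * Real.pi)
        * eLpNorm f 2 volume := by
  have h := lintegral_mul_le_eLpNorm (volume.restrict (Metric.ball (0 : Plane) n))
    (f := fun _ => 1) aemeasurable_const (aemeasurable_hat f).restrict
  simp only [one_mul] at h
  refine h.trans ?_
  rw [mul_assoc, ← eLpNorm_hat hf, eLpNorm_two_eq]
  gcongr
  · simp
  · rw [eLpNorm_enorm]
    exact eLpNorm_mono_measure _ Measure.restrict_le_self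

variable {T : ℝ} {f : ℝ → Plane → ℝ}
  (hf : ∀ t ∈ Set.Icc 0 T, MemLp (f t) 2 (volume : Measure Plane))
  (hc : ∀ t ∈ Set.Icc 0 T, Tendsto (fun s => eLpNorm (fun x => f s x - f t x) 2 volume)
    (𝓝[Set.Icc 0 T] t) (𝓝 0))
include hf hc

/-- On a ball, Cauchy–Schwarz controls the L¹ norm of the transform by the L² norm of the function,
so continuity in time with values in L² is inherited. -/
lemma continuousOn_lintegral_ball_hat (n : ℕ) :
    ContinuousOn (fun t => ∫⁻ ξ in Metric.ball 0 n, ‖hat (f t) ξ‖ₑ) (Set.Icc 0 T) := by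
  intro t ht
  set c : ℝ≥0∞ := volume (Metric.ball (0 : Plane) n) ^ (1 / 2 : ℝ) * ENNReal.ofReal (2 * Real.pi)
  have hcfin : c ≠ ∞ := ENNReal.mul_ne_top
    (ENNReal.rpow_ne_top_of_nonneg (by norm_num) measure_ball_lt_top.ne) ENNReal.ofReal_ne_top
  set N := fun t => ∫⁻ ξ in Metric.ball 0 n, ‖hat (f t) ξ‖ₑ with hN
  set δ := fun s => eLpNorm (fun x => f s x - f t x) 2 volume
  have hδ : Tendsto (fun s => c * δ s) (𝓝[Set.Icc 0 T] t) (𝓝 0) := by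
    simpa using ENNReal.Tendsto.const_mul (hc t ht) (Or.inr hcfin)
  have hfin : N t ≠ ∞ := ((lintegral_ball_hat_le n (hf t ht)).trans_lt
    (ENNReal.mul_lt_top hcfin.lt_top (hf t ht).2)).ne
  have up : ∀ s ∈ Set.Icc 0 T, N s ≤ N t + c * δ s ∧ N t ≤ N s + c * δ s := by
    intro s hs
    have hd : MemLp (fun x => f s x - f t x) 2 (volume : Measure Plane) := (hf s hs).sub (hf t ht)
    have hl := lintegral_ball_hat_le n hd
    have hsub := hat_sub (hf s hs) (hf t ht)
    constructor
    · refine le_trans ?_ (add_le_add le_rfl hl)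
      rw [← lintegral_add_left' (aemeasurable_hat _).restrict]
      refine lintegral_mono_ae (ae_restrict_of_ae ?_)
      filter_upwards [hsub] with ξ h
      rw [h]
      calc ‖hat (f s) ξ‖ₑ = ‖hat (f t) ξ + (hat (f s) ξ - hat (f t) ξ)‖ₑ := by congr 1; ring
        _ ≤ _ := enorm_add_le _ _
    · refine le_trans ?_ (add_le_add le_rfl hl)
      rw [← lintegral_add_left' (aemeasurable_hat _).restrict]
      refine lintegral_mono_ae (ae_restrict_of_ae ?_)
      filter_upwards [hsub] with ξ h
      rw [h, ← enorm_neg (hat (f s) ξ - hat (f t) ξ)]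
      calc ‖hat (f t) ξ‖ₑ = ‖hat (f s) ξ + -(hat (f s) ξ - hat (f t) ξ)‖ₑ := by congr 1; ring
        _ ≤ _ := enorm_add_le _ _
  have l1 : Tendsto (fun s => N t - c * δ s) (𝓝[Set.Icc 0 T] t) (𝓝 (N t)) := by
    simpa using ENNReal.Tendsto.sub tendsto_const_nhds hδ (Or.inl hfin)
  have l2 : Tendsto (fun s => N t + c * δ s) (𝓝[Set.Icc 0 T] t) (𝓝 (N t)) := by
    simpa using tendsto_const_nhds.add hδ
  refine tendsto_of_tendsto_of_tendsto_of_le_of_le' l1 l2 ?_ ?_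
  · filter_upwards [self_mem_nhdsWithin] with s hs
    exact tsub_le_iff_right.2 (up s hs).2
  · filter_upwards [self_mem_nhdsWithin] with s hs
    exact (up s hs).1

/-- The Wiener norm need not be continuous in time, but it is the supremum of the continuous
integrals over balls of integer radius. -/
lemma aemeasurable_wiener :
    AEMeasurable (fun t => wiener (f t)) (volume.restrict (Set.Icc 0 T)) := by
  have e : (fun t => wiener (f t)) = fun t => ⨆ n : ℕ, ∫⁻ ξ in Metric.ball 0 n, ‖hat (f t) ξ‖ₑ := by
    ext t
    have hmono : Monotone fun n : ℕ => Metric.ball (0 : Plane) n := fun m n h =>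
      Metric.ball_subset_ball (by exact_mod_cast h)
    rw [← setLIntegral_iUnion_of_directed _ hmono.directed_le, Metric.iUnion_ball_nat,
      setLIntegral_univ]
    rfl
  rw [e]
  exact AEMeasurable.iSup fun n =>
    (continuousOn_lintegral_ball_hat hf hc n).aemeasurable measurableSet_Icc

end Measurability

lemma wiener_le_fourierL1 {ι : Type} [Fintype ι] (F : ι → Plane → ℝ) (i : ι) :
    wiener (F i) ≤ fourierL1 (fun _ => 1) F := by
  refine lintegral_mono fun ξ => ?_
  rw [ENNReal.ofReal_one, one_mul]
  calc ‖hat (F i) ξ‖ₑ = (‖hat (F i) ξ‖ₑ ^ 2) ^ (1 / 2 : ℝ) := (rpow_half_sq _).symm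
    _ ≤ _ := by
      gcongr
      exact Finset.single_le_sum (f := fun i => ‖hat (F i) ξ‖ₑ ^ 2) (fun _ _ => zero_le)
        (Finset.mem_univ i)

lemma fourierL1_le_wiener {ι : Type} [Fintype ι] (F : ι → Plane → ℝ) :
    fourierL1 (fun _ => 1) F ≤ ∑ i, wiener (F i) := by
  unfold wiener
  rw [← lintegral_finsetSum' _ fun i _ => aemeasurable_hat (F i)]
  refine lintegral_mono fun ξ => ?_
  rw [ENNReal.ofReal_one, one_mul, ← rpow_half_sq (∑ i, ‖hat (F i) ξ‖ₑ)]
  gcongr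
  exact Finset.sum_sq_le_sq_sum_of_nonneg fun _ _ => zero_le

/-- A family of functions which is continuous in `L²` on a compact interval is bounded there. -/
lemma exists_eLpNorm_le {T : ℝ} {f : ℝ → Plane → ℝ}
    (hf : ∀ t ∈ Set.Icc 0 T, MemLp (f t) 2 (volume : Measure Plane))
    (hc : ∀ t ∈ Set.Icc 0 T, Tendsto (fun s => eLpNorm (fun x => f s x - f t x) 2 volume)
      (𝓝[Set.Icc 0 T] t) (𝓝 0)) :
    ∃ M : ℝ≥0, ∀ t ∈ Set.Icc 0 T, eLpNorm (f t) 2 volume ≤ M := by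
  refine isCompact_Icc.induction_on (p := fun S => ∃ M : ℝ≥0, ∀ t ∈ S ∩ Set.Icc 0 T,
    eLpNorm (f t) 2 volume ≤ M) (s := Set.Icc 0 T) ?_ ?_ ?_ ?_ |>.imp fun M h t ht => h t ⟨ht, ht⟩
  · exact ⟨0, by simp⟩
  · exact fun S S' hS ⟨M, h⟩ => ⟨M, fun t ht => h t ⟨hS ht.1, ht.2⟩⟩
  · rintro S S' ⟨M, h⟩ ⟨M', h'⟩
    refine ⟨M + M', fun t ht => ?_⟩
    push_cast
    rcases ht.1 with h1 | h1
    · exact (h t ⟨h1, ht.2⟩).trans le_self_add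
    · exact (h' t ⟨h1, ht.2⟩).trans le_add_self
  · intro t ht
    have h1 : ∀ᶠ s in 𝓝[Set.Icc 0 T] t, eLpNorm (fun x => f s x - f t x) 2 volume < 1 :=
      (hc t ht).eventually (gt_mem_nhds zero_lt_one)
    refine ⟨_, h1, 1 + (eLpNorm (f t) 2 volume).toNNReal, fun s hs => ?_⟩
    rw [ENNReal.coe_add, ENNReal.coe_toNNReal (hf t ht).2.ne]
    calc eLpNorm (f s) 2 volume = eLpNorm ((fun x => f s x - f t x) + f t) 2 volume := by
          congr 1; ext x; simp
      _ ≤ eLpNorm (fun x => f s x - f t x) 2 volume + eLpNorm (f t) 2 volume :=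
          eLpNorm_add_le ((hf s hs.2).sub (hf t ht)).1 (hf t ht).1 (by norm_num)
      _ ≤ _ := by gcongr; exact hs.1.le

/-! ### The velocity equation and the elimination of the pressure -/

/-- The time derivative of `v₁`. -/
def velRate0 (a q v0 v1 p : Plane → ℝ) : Plane → ℝ := fun x =>
  pd 0 (pd 0 v0) x + pd 1 (pd 1 v0) x - pd 0 q x - (v0 x * pd 0 v0 x + v1 x * pd 1 v0 x
    + (pd 0 (fun y => a y * a y) x + pd 1 (fun y => a y * q y) x)) - pd 0 p x

/-- The time derivative of `v₂`. -/
def velRate1 (a q v0 v1 p : Plane → ℝ) : Plane → ℝ := fun x =>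
  pd 0 (pd 0 v1) x + pd 1 (pd 1 v1) x - (pd 0 a x + 2 * pd 1 q x)
    - (v0 x * pd 0 v1 x + v1 x * pd 1 v1 x
    + (pd 0 (fun y => a y * q y) x + pd 1 (fun y => q y * q y) x)) - pd 1 p x

lemma hat_rate {f1 f2 f3 n1 n2 n3 n4 g : Plane → ℝ} (h1 : MemLp f1 2 (volume : Measure Plane))
    (h2 : MemLp f2 2 (volume : Measure Plane)) (h3 : MemLp f3 2 (volume : Measure Plane))
    (m1 : MemLp n1 2 (volume : Measure Plane)) (m2 : MemLp n2 2 (volume : Measure Plane))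
    (m3 : MemLp n3 2 (volume : Measure Plane)) (m4 : MemLp n4 2 (volume : Measure Plane))
    (hg : MemLp g 2 (volume : Measure Plane)) :
    hat (fun x => f1 x + f2 x - f3 x - (n1 x + n2 x + (n3 x + n4 x)) - g x) =ᵐ[volume]
      fun ξ => hat f1 ξ + hat f2 ξ - hat f3 ξ
        - (hat n1 ξ + hat n2 ξ + (hat n3 ξ + hat n4 ξ)) - hat g ξ := by
  have k12 : MemLp (fun x => f1 x + f2 x) 2 (volume : Measure Plane) := h1.add h2
  have k123 : MemLp (fun x => f1 x + f2 x - f3 x) 2 (volume : Measure Plane) := k12.sub h3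
  have l12 : MemLp (fun x => n1 x + n2 x) 2 (volume : Measure Plane) := m1.add m2
  have l34 : MemLp (fun x => n3 x + n4 x) 2 (volume : Measure Plane) := m3.add m4
  have l : MemLp (fun x => n1 x + n2 x + (n3 x + n4 x)) 2 (volume : Measure Plane) := l12.add l34
  have kl : MemLp (fun x => f1 x + f2 x - f3 x - (n1 x + n2 x + (n3 x + n4 x))) 2
    (volume : Measure Plane) := k123.sub l
  filter_upwards [hat_sub kl hg, hat_sub k123 l, hat_sub k12 h3, hat_add h1 h2, hat_add l12 l34,
    hat_add m1 m2, hat_add m3 m4] with ξ e1 e2 e3 e4 e5 e6 e7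
  rw [e1, e2, e3, e4, e5, e6, e7]

lemma hat_pd_pd {f : Plane → ℝ} (hf : Reg f) (hf2 : ContDiff ℝ (2 : ℕ) f)
    (h : ∀ i, MemLp (pd i (pd i f)) 2 (volume : Measure Plane)) (i : Fin 2) :
    hat (pd i (pd i f)) =ᵐ[volume] fun ξ => -(ξ i : ℂ) ^ 2 * hat f ξ := by
  filter_upwards [hat_pd_reg hf i, hat_pd i ((contDiff_pd (k := 1) hf2 i).differentiable (by simp))
    (hf.memLp_pd i) (h i)] with ξ e1 e2
  rw [e2, e1]
  linear_combination (ξ i : ℂ) ^ 2 * hat f ξ * Complex.I_sq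

lemma pd_add {f g : Plane → ℝ} (hf : Differentiable ℝ f) (hg : Differentiable ℝ g) (i : Fin 2)
    (x : Plane) : pd i (fun x => f x + g x) x = pd i f x + pd i g x := by
  unfold pd
  rw [fderiv_fun_add (hf x) (hg x)]
  rfl

lemma pd_neg (f : Plane → ℝ) (i : Fin 2) (x : Plane) : pd i (fun x => -f x) x = -pd i f x := by
  unfold pd
  rw [fderiv_fun_neg]
  rfl

section Slice
variable {a q v0 v1 p : Plane → ℝ}

lemma advect_eq_div {f : Plane → ℝ} (hf : Differentiable ℝ f) (h0 : Differentiable ℝ v0)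
    (h1 : Differentiable ℝ v1) (hdiv : ∀ x, pd 0 v0 x + pd 1 v1 x = 0) (x : Plane) :
    v0 x * pd 0 f x + v1 x * pd 1 f x
      = pd 0 (fun y => v0 y * f y) x + pd 1 (fun y => v1 y * f y) x := by
  rw [pd_mul h0 hf, pd_mul h1 hf]
  linear_combination -f x * hdiv x

/-- The vorticity equation in frequency; the pressure drops out. -/
lemma curl_velRate (ha : Reg a) (hq : Reg q) (h0 : Reg v0) (h1 : Reg v1)
    (hv0 : ContDiff ℝ (2 : ℕ) v0) (hv1 : ContDiff ℝ (2 : ℕ) v1)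
    (h02 : ∀ i, MemLp (pd i (pd i v0)) 2 (volume : Measure Plane))
    (h12 : ∀ i, MemLp (pd i (pd i v1)) 2 (volume : Measure Plane))
    (hp : ContDiff ℝ (2 : ℕ) p) (hp1 : ∀ i, MemLp (pd i p) 2 (volume : Measure Plane))
    (hp2 : MemLp (pd 0 (pd 1 p)) 2 (volume : Measure Plane)) (hcomm : pd 1 a = pd 0 q)
    (hdiv : ∀ x, pd 0 v0 x + pd 1 v1 x = 0) :
    ∀ᵐ ξ : Plane, (ξ 0 : ℂ) * hat (velRate1 a q v0 v1 p) ξ - ξ 1 * hat (velRate0 a q v0 v1 p) ξ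
    = -(‖ξ‖ : ℂ) ^ 2 * (ξ 0 * hat v1 ξ - ξ 1 * hat v0 ξ) - Complex.I * (‖ξ‖ : ℂ) ^ 2 * hat a ξ
      - Complex.I * (curlSource a q v0 v1 ξ + ξ 0 * ξ 1 * prodHat q q ξ) := by
  have e0 : velRate0 a q v0 v1 p = fun x => pd 0 (pd 0 v0) x + pd 1 (pd 1 v0) x - pd 0 q x
      - (pd 0 (fun y => v0 y * v0 y) x + pd 1 (fun y => v0 y * v1 y) x
      + (pd 0 (fun y => a y * a y) x + pd 1 (fun y => a y * q y) x)) - pd 0 p x := by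
    have e : (fun y => v0 y * v1 y) = fun y => v1 y * v0 y := by ext y; exact mul_comm _ _
    ext x
    simp only [velRate0, e, advect_eq_div h0.differentiable h0.differentiable h1.differentiable hdiv]
  have e1 : velRate1 a q v0 v1 p = fun x => pd 0 (pd 0 v1) x + pd 1 (pd 1 v1) x
      - (pd 0 a x + 2 * pd 1 q x)
      - (pd 0 (fun y => v0 y * v1 y) x + pd 1 (fun y => v1 y * v1 y) x
      + (pd 0 (fun y => a y * q y) x + pd 1 (fun y => q y * q y) x)) - pd 1 p x := by
    ext x
    simp only [velRate1, advect_eq_div h1.differentiable h0.differentiable h1.differentiable hdiv]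
  have m2 : MemLp (fun x => 2 * pd 1 q x) 2 (volume : Measure Plane) := (hq.memLp_pd 1).const_mul 2
  have m3 : MemLp (fun x => pd 0 a x + 2 * pd 1 q x) 2 (volume : Measure Plane) :=
    (ha.memLp_pd 0).add m2
  have dp : ∀ i, Differentiable ℝ (pd i p) := fun i =>
    (contDiff_pd (k := 1) hp i).differentiable (by simp)
  have hp2' : MemLp (pd 1 (pd 0 p)) 2 (volume : Measure Plane) := by rwa [pd_comm hp]
  have E0 := hat_rate (h02 0) (h02 1) (hq.memLp_pd 0) ((h0.mul h0).memLp_pd 0)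
    ((h0.mul h1).memLp_pd 1) ((ha.mul ha).memLp_pd 0) ((ha.mul hq).memLp_pd 1) (hp1 0)
  have E1 := hat_rate (h12 0) (h12 1) m3 ((h0.mul h1).memLp_pd 0)
    ((h1.mul h1).memLp_pd 1) ((ha.mul hq).memLp_pd 0) ((hq.mul hq).memLp_pd 1) (hp1 1)
  rw [← e0] at E0
  rw [← e1] at E1
  have hpp := hat_pd 0 (dp 1) (hp1 1) hp2
  rw [pd_comm hp] at hpp
  filter_upwards [E0, E1, hat_pd_pd h0 hv0 h02 0, hat_pd_pd h0 hv0 h02 1, hat_pd_pd h1 hv1 h12 0,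
    hat_pd_pd h1 hv1 h12 1, hat_pd_reg hq 0, hat_add (ha.memLp_pd 0) m2,
    hat_const_mul 2 (hq.memLp_pd 1), hat_pd_reg ha 0, hat_pd_reg hq 1, hat_pd_mul h0 h0 0,
    hat_pd_mul h0 h1 1, hat_pd_mul ha ha 0, hat_pd_mul ha hq 1, hat_pd_mul h0 h1 0,
    hat_pd_mul h1 h1 1, hat_pd_mul ha hq 0, hat_pd_mul hq hq 1, hpp,
    hat_pd 1 (dp 0) (hp1 0) hp2', ae_mul_hat_comm ha hq hcomm] with ξ
    E0 E1 b1 b2 b3 b4 b5 b6 b7 b8 b9 c1 c2 c3 c4 c5 c6 c7 c8 p1 p2 hx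
  rw [E0, E1, b1, b2, b3, b4, b5, b6, b7, b8, b9, c1, c2, c3, c4, c5, c6, c7, c8]
  rw [p1] at p2
  -- Equality of the mixed second derivatives of p, read in frequency: the pressure is curl free and
  -- cancels.
  have p3 : (ξ 0 : ℂ) * hat (pd 1 p) ξ = ξ 1 * hat (pd 0 p) ξ := by
    rw [mul_assoc, mul_assoc] at p2
    exact mul_left_cancel₀ Complex.I_ne_zero p2
  have hn : (‖ξ‖ : ℂ) ^ 2 = (ξ 0 : ℂ) ^ 2 + (ξ 1 : ℂ) ^ 2 := by
    exact_mod_cast norm_sq_plane ξ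
  rw [hn, curlSource]
  push_cast
  -- The curl of the linear ψ terms is iξ₀²â + iξ₀ξ₁q̂; the relation ξ₀q̂ = ξ₁â completes it to
  -- i‖ξ‖²â.
  linear_combination (-1) * p3 + Complex.I * ξ 1 * hx

end Slice

/-! ### Evolution of ∂₁ψ and of (∂₂ψ)² -/

/-- Globally defined fields which satisfy the system on `[0,T]`. -/
structure GlobalSolution (T : ℝ) (ψ v0 v1 p : ℝ → Plane → ℝ) : Prop where
  smooth_psi : Smooth 3 ψ
  smooth_v0 : Smooth 3 v0
  smooth_v1 : Smooth 3 v1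
  smooth_p : Smooth 2 p
  reg_a : RegField fun t => pd 0 (ψ t)
  reg_q : RegField fun t => pd 1 (ψ t)
  reg_v0 : RegField v0
  reg_v1 : RegField v1
  l2_v0 : ∀ i, L2Field fun t => pd i (pd i (v0 t))
  l2_v1 : ∀ i, L2Field fun t => pd i (pd i (v1 t))
  l2_p : ∀ i, L2Field fun t => pd i (p t)
  memLp_p : ∀ t, MemLp (pd 0 (pd 1 (p t))) 2 (volume : Measure Plane)
  div_free : ∀ t x, pd 0 (v0 t) x + pd 1 (v1 t) x = 0
  eq_psi : ∀ t ∈ Set.Ioo 0 T, ∀ x, HasDerivAt (fun s => ψ s x)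
    (-(v0 t x * pd 0 (ψ t) x + v1 t x * pd 1 (ψ t) x + v1 t x)) t
  eq_v0 : ∀ t ∈ Set.Ioo 0 T, ∀ x, HasDerivAt (fun s => v0 s x)
    (velRate0 (pd 0 (ψ t)) (pd 1 (ψ t)) (v0 t) (v1 t) (p t) x) t
  eq_v1 : ∀ t ∈ Set.Ioo 0 T, ∀ x, HasDerivAt (fun s => v1 s x)
    (velRate1 (pd 0 (ψ t)) (pd 1 (ψ t)) (v0 t) (v1 t) (p t) x) t

namespace GlobalSolution
variable {T : ℝ} {ψ v0 v1 p : ℝ → Plane → ℝ}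

/-- Mixed derivatives in time and space are not assumed to exist. The equation for ψ is therefore
integrated in time first, and the space derivative is taken under the integral. -/
lemma pd_psi_eq (S : GlobalSolution T ψ v0 v1 p) (i : Fin 2) : ∀ t ∈ Set.Icc 0 T, ∀ x,
    pd i (ψ t) x = pd i (ψ 0) x + ∫ s in Set.Ioc 0 t,
      -(pd i (fun y => v0 s y * pd 0 (ψ s) y) x + pd i (fun y => v1 s y * pd 1 (ψ s) y) x
        + pd i (v1 s) x) := by
  have r1 := S.reg_v0.mul S.reg_a
  have r2 := S.reg_v1.mul S.reg_q
  have hd1 := fun t => (r1.reg t).differentiable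
  have hd2 := fun t => (r2.reg t).differentiable
  have hd3 := fun t => (S.reg_v1.reg t).differentiable
  have e : ∀ s, pd i (fun x => -(v0 s x * pd 0 (ψ s) x + v1 s x * pd 1 (ψ s) x + v1 s x))
      = fun x => -(pd i (fun y => v0 s y * pd 0 (ψ s) y) x
        + pd i (fun y => v1 s y * pd 1 (ψ s) y) x + pd i (v1 s) x) := fun s => by
    ext x
    have hd12 : Differentiable ℝ fun x => v0 s x * pd 0 (ψ s) x + v1 s x * pd 1 (ψ s) x :=
      (hd1 s).add (hd2 s)
    rw [pd_neg, pd_add hd12 (hd3 s), pd_add (hd1 s) (hd2 s)]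
  have hg : Continuous (Function.uncurry fun s x =>
      -(v0 s x * pd 0 (ψ s) x + v1 s x * pd 1 (ψ s) x + v1 s x)) :=
    ((r1.cont.add r2.cont).add S.reg_v1.cont).neg
  have hgp : Continuous (Function.uncurry fun s => pd i
      (fun x => -(v0 s x * pd 0 (ψ s) x + v1 s x * pd 1 (ψ s) x + v1 s x))) := by
    simp_rw [e]
    exact (((r1.cont_pd i).add (r2.cont_pd i)).add (S.reg_v1.cont_pd i)).neg
  have h := pd_eq_add_integral (fun t => S.smooth_psi.differentiable t) hg
    (fun t => (((hd1 t).add (hd2 t)).add (hd3 t)).neg) i hgp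
    (eq_add_integral S.smooth_psi.continuous hg S.eq_psi)
  simpa only [e] using h

/-- The product 2q∂ₜq is rearranged so that no term relies on the decay of q. Transport of q² is put
in divergence form, up to terms with ∂₁q = ∂₂a, and the linear term -2q∂₂v₂ becomes 2q∂₁v₁ =
2∂₁(v₁q) - 2v₁∂₂a. Both moves use div v = 0, which accounts for the two multiples of it at the end.
-/
lemma sq_eq (S : GlobalSolution T ψ v0 v1 p) : ∀ t ∈ Set.Icc 0 T, ∀ x,
    pd 1 (ψ t) x * pd 1 (ψ t) x = pd 1 (ψ 0) x * pd 1 (ψ 0) x + ∫ s in Set.Ioc 0 t,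
      rateH (pd 0 (ψ s)) (pd 1 (ψ s)) (v0 s) (v1 s) x := by
  have r1 := S.reg_v0.mul S.reg_a
  have r2 := S.reg_v1.mul S.reg_q
  have hg : Continuous (Function.uncurry fun s x =>
      -(pd 1 (fun y => v0 s y * pd 0 (ψ s) y) x + pd 1 (fun y => v1 s y * pd 1 (ψ s) y) x
        + pd 1 (v1 s) x)) :=
    (((r1.cont_pd 1).add (r2.cont_pd 1)).add (S.reg_v1.cont_pd 1)).neg
  have hq := hasDerivAt_of_eq_add_integral (f := fun t => pd 1 (ψ t)) hg (S.pd_psi_eq 1)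
  refine eq_add_integral (f := fun t x => pd 1 (ψ t) x * pd 1 (ψ t) x)
    (S.reg_q.mul S.reg_q).cont (L2Field_rateH S.reg_a S.reg_q S.reg_v0 S.reg_v1).cont ?_
  intro t ht x
  have h := (hq t ht x).mul (hq t ht x)
  refine h.congr_deriv ?_
  have da := (S.reg_a.reg t).differentiable
  have dq := (S.reg_q.reg t).differentiable
  have d0 := (S.reg_v0.reg t).differentiable
  have d1 := (S.reg_v1.reg t).differentiable
  have hc : pd 0 (pd 1 (ψ t)) = pd 1 (pd 0 (ψ t)) :=
    pd_comm ((S.smooth_psi.contDiff t).of_le (by norm_num)) 0 1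
  have dqq : Differentiable ℝ fun y => pd 1 (ψ t) y * pd 1 (ψ t) y := dq.mul dq
  simp only [rateH]
  rw [pd_mul d0 dqq, pd_mul d1 dqq, pd_mul dq dq, pd_mul dq dq, pd_mul d0 dq,
    pd_mul d0 da, pd_mul d1 dq, hc]
  have hdiv := S.div_free t x
  linear_combination (-(pd 1 (ψ t) x * pd 1 (ψ t) x) - 2 * pd 1 (ψ t) x) * hdiv

lemma lowSystem (S : GlobalSolution T ψ v0 v1 p) :
    LowSystem T (fun t => pd 0 (ψ t)) (fun t => pd 1 (ψ t)) v0 v1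
      (fun t => velRate0 (pd 0 (ψ t)) (pd 1 (ψ t)) (v0 t) (v1 t) (p t))
      (fun t => velRate1 (pd 0 (ψ t)) (pd 1 (ψ t)) (v0 t) (v1 t) (p t)) := by
  have hc : ∀ t, pd 1 (pd 0 (ψ t)) = pd 0 (pd 1 (ψ t)) := fun t =>
    pd_comm ((S.smooth_psi.contDiff t).of_le (by norm_num)) 1 0
  have l0 : L2Field fun t => velRate0 (pd 0 (ψ t)) (pd 1 (ψ t)) (v0 t) (v1 t) (p t) :=
    ((((S.l2_v0 0).add (S.l2_v0 1)).sub (S.reg_q.toL2_pd 0)).sub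
      (((S.reg_v0.mul_L2 (S.reg_v0.toL2_pd 0)).add (S.reg_v1.mul_L2 (S.reg_v0.toL2_pd 1))).add
        (((S.reg_a.mul S.reg_a).toL2_pd 0).add ((S.reg_a.mul S.reg_q).toL2_pd 1)))).sub (S.l2_p 0)
  have l1 : L2Field fun t => velRate1 (pd 0 (ψ t)) (pd 1 (ψ t)) (v0 t) (v1 t) (p t) :=
    ((((S.l2_v1 0).add (S.l2_v1 1)).sub ((S.reg_a.toL2_pd 0).add
      ((S.reg_q.toL2_pd 1).const_mul 2))).sub
      (((S.reg_v0.mul_L2 (S.reg_v1.toL2_pd 0)).add (S.reg_v1.mul_L2 (S.reg_v1.toL2_pd 1))).add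
        (((S.reg_a.mul S.reg_q).toL2_pd 0).add ((S.reg_q.mul S.reg_q).toL2_pd 1)))).sub (S.l2_p 1)
  exact
  { reg_a := S.reg_a
    reg_q := S.reg_q
    reg_v0 := S.reg_v0
    reg_v1 := S.reg_v1
    l2_r0 := l0
    l2_r1 := l1
    pd_comm := hc
    div_free := S.div_free
    ev_a := S.pd_psi_eq 0
    ev_h := S.sq_eq
    ev_v0 := eq_add_integral S.reg_v0.cont l0.cont S.eq_v0
    ev_v1 := eq_add_integral S.reg_v1.cont l1.cont S.eq_v1
    curl := fun s _ => curl_velRate (S.reg_a.reg s) (S.reg_q.reg s) (S.reg_v0.reg s)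
      (S.reg_v1.reg s) ((S.smooth_v0.contDiff s).of_le (by norm_num))
      ((S.smooth_v1.contDiff s).of_le (by norm_num)) (fun i => (S.l2_v0 i).memLp s)
      (fun i => (S.l2_v1 i).memLp s) (S.smooth_p.contDiff s) (fun i => (S.l2_p i).memLp s)
      (S.memLp_p s) (hc s) (S.div_free s) }

end GlobalSolution

/-! ### From the solution on [0,T] to globally defined fields -/

lemma Smooth.of_le {k m : ℕ} {f : ℝ → Plane → ℝ} (hf : Smooth k f) (h : m ≤ k) : Smooth m f :=
  ⟨fun t => (hf.contDiff t).of_le (by exact_mod_cast h), fun α hα => hf.cont_pdMulti α (hα.trans h)⟩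

lemma hasDerivAt_clamp {T t d : ℝ} {f : ℝ → ℝ} (ht : t ∈ Set.Ioo 0 T) (h : HasDerivAt f d t) :
    HasDerivAt (fun s => f (clamp T s)) d t := by
  refine h.congr_of_eventuallyEq ?_
  filter_upwards [Ioo_mem_nhds ht.1 ht.2] with s hs
  rw [clamp_of_mem (Set.Ioo_subset_Icc_self hs)]

lemma ContSobolev.memLp {ι : Type} [Fintype ι] {n : ℕ} {T : ℝ} {F : ℝ → ι → Plane → ℝ}
    (h : ContSobolev n T F) (i : ι) (hc : ∀ t ∈ Set.Icc 0 T, Continuous (F t i)) :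
    ∀ t ∈ Set.Icc 0 T, MemLp (F t i) 2 (volume : Measure Plane) := fun t ht =>
  ⟨(hc t ht).aestronglyMeasurable,
    (eLpNorm_le_sobolevNorm (F t) i (0, 0) (Nat.zero_le _)).trans_lt (h t ht).1⟩

lemma ContSobolev.tendsto {ι : Type} [Fintype ι] {n : ℕ} {T : ℝ} {F : ℝ → ι → Plane → ℝ}
    (h : ContSobolev n T F) (i : ι) : ∀ t ∈ Set.Icc 0 T,
    Tendsto (fun s => eLpNorm (fun x => F s i x - F t i x) 2 volume) (𝓝[Set.Icc 0 T] t) (𝓝 0) :=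
  fun t ht => tendsto_of_tendsto_of_tendsto_of_le_of_le tendsto_const_nhds (h t ht).2
    (fun _ => zero_le) fun s =>
      eLpNorm_le_sobolevNorm (fun i x => F s i x - F t i x) i (0, 0) (Nat.zero_le _)

/-- Only one summand has to be measurable; the price is a factor 2. In the application the other
summand is the low-frequency part, whose measurability in time is thus not needed. -/
lemma timeNorm_add_le_two_mul {T : ℝ} (f : ℝ → ℝ≥0∞) {g : ℝ → ℝ≥0∞}
    (hg : AEMeasurable g (volume.restrict (Set.Icc 0 T))) :
    timeNorm 2 T (fun t => f t + g t) ≤ 2 * (timeNorm 2 T f + timeNorm 2 T g) := by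
  have h : ∀ t, (f t + g t) ^ 2 ≤ 4 * (f t ^ 2 + g t ^ 2) := fun t => by
    rcases le_total (f t) (g t) with h | h
    · calc (f t + g t) ^ 2 ≤ (g t + g t) ^ 2 := by gcongr
        _ = 4 * g t ^ 2 := by ring
        _ ≤ _ := by gcongr; exact le_add_self
    · calc (f t + g t) ^ 2 ≤ (f t + f t) ^ 2 := by gcongr
        _ = 4 * f t ^ 2 := by ring
        _ ≤ _ := mul_le_mul' le_rfl le_self_add
  rw [← rpow_half_sq (2 * _), timeNorm, eLpNorm_two_eq]
  gcongr
  calc _ ≤ ∫⁻ t in Set.Icc 0 T, 4 * (f t ^ 2 + g t ^ 2) := lintegral_mono h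
    _ = 4 * (timeNorm 2 T f ^ 2 + timeNorm 2 T g ^ 2) := by
      rw [lintegral_const_mul' _ _ (by norm_num), lintegral_add_right' _ (hg.pow_const 2),
        lintegral_eq_timeNorm_sq, lintegral_eq_timeNorm_sq]
    _ ≤ 4 * (timeNorm 2 T f ^ 2 + timeNorm 2 T g ^ 2
        + 2 * timeNorm 2 T f * timeNorm 2 T g) := mul_le_mul' le_rfl le_self_add
    _ = _ := by ring

section Solution
variable {T : ℝ} {ψ₀ : Plane → ℝ} {v₀ : Fin 2 → Plane → ℝ} {ψ : ℝ → Plane → ℝ}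
  {v : ℝ → Fin 2 → Plane → ℝ} {p : ℝ → Plane → ℝ}

lemma IsSolution.eLpNorm_psi_le (hs : IsSolution T ψ₀ v₀ ψ v p) (hT : 0 < T) (i : Fin 2) (t : ℝ)
    (α : ℕ × ℕ) (hα : α.1 + α.2 ≤ 2) :
    eLpNorm (pdMulti α (pd i (ψ (clamp T t)))) 2 volume ≤ A1 T ψ v :=
  (eLpNorm_pdMulti_le (F := fun t => grad (ψ t)) hT
    (fun i => (hs.smooth_psi.smooth hT.le).pd i) t i hα).trans
    (le_add_self.trans (le_self_add.trans le_self_add))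

lemma IsSolution.eLpNorm_v_le (hs : IsSolution T ψ₀ v₀ ψ v p) (hT : 0 < T) (i : Fin 2) (t : ℝ)
    (α : ℕ × ℕ) (hα : α.1 + α.2 ≤ 2) :
    eLpNorm (pdMulti α (v (clamp T t) i)) 2 volume ≤ A1 T ψ v :=
  (eLpNorm_pdMulti_le (F := v) hT
    (fun i => ((hs.smooth_v i).smooth hT.le).of_le (by norm_num)) t i hα).trans
    (le_self_add.trans (le_self_add.trans le_self_add))

lemma IsSolution.l2Field_pd_pd_v (hs : IsSolution T ψ₀ v₀ ψ v p) (hT : 0 < T)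
    (hA : A1 T ψ v < ∞) (j i : Fin 2) : L2Field fun t => pd i (pd i (v (clamp T t) j)) := by
  refine ⟨((((hs.smooth_v j).smooth hT.le).pd i).pd i).continuous, (A1 T ψ v).toNNReal, fun t => ?_⟩
  rw [ENNReal.coe_toNNReal hA.ne]
  fin_cases i
  exacts [hs.eLpNorm_v_le hT j t (2, 0) (by simp), hs.eLpNorm_v_le hT j t (0, 2) (by simp)]

lemma IsSolution.globalSolution (hs : IsSolution T ψ₀ v₀ ψ v p) (hm : MemE2 T ψ v p) (hT : 0 < T)
    (hA : A1 T ψ v < ∞) :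
    GlobalSolution T (fun t => ψ (clamp T t)) (fun t => v (clamp T t) 0)
      (fun t => v (clamp T t) 1) (fun t => p (clamp T t)) where
  smooth_psi := hs.smooth_psi.smooth hT.le
  smooth_v0 := (hs.smooth_v 0).smooth hT.le
  smooth_v1 := (hs.smooth_v 1).smooth hT.le
  smooth_p := hs.smooth_p.smooth hT.le
  reg_a := regField_of_sobolev ((hs.smooth_psi.smooth hT.le).pd 0) hA (hs.eLpNorm_psi_le hT 0)
  reg_q := regField_of_sobolev ((hs.smooth_psi.smooth hT.le).pd 1) hA (hs.eLpNorm_psi_le hT 1)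
  reg_v0 := regField_of_sobolev (((hs.smooth_v 0).smooth hT.le).of_le (by norm_num)) hA
    (hs.eLpNorm_v_le hT 0)
  reg_v1 := regField_of_sobolev (((hs.smooth_v 1).smooth hT.le).of_le (by norm_num)) hA
    (hs.eLpNorm_v_le hT 1)
  l2_v0 := hs.l2Field_pd_pd_v hT hA 0
  l2_v1 := hs.l2Field_pd_pd_v hT hA 1
  -- The bound on ∇p is qualitative, from compactness of [0,T]; it never enters the constants, since
  -- the pressure disappears from the vorticity equation.
  l2_p i := by
    obtain ⟨M, hM⟩ := exists_eLpNorm_le (f := fun t => pd i (p t))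
      (hm.cont_grad_p.memLp i fun t ht => continuous_pd ((hs.smooth_p.1 t ht).of_le (by norm_num)) i)
      (hm.cont_grad_p.tendsto i)
    exact ⟨((hs.smooth_p.smooth hT.le).pd i).continuous, M, fun t => hM _ (clamp_mem hT.le t)⟩
  memLp_p t := memLp_pdMulti (n := 1) (contDiff_pd (k := 1) (hs.smooth_p.1 _ (clamp_mem hT.le t)) 1)
    (1, 0) (by simp) (hm.cont_grad_p _ (clamp_mem hT.le t)).1
    (eLpNorm_le_sobolevNorm (grad (p (clamp T t))) 1 (1, 0) (by simp))
  div_free t x := by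
    have := hs.div_free _ (clamp_mem hT.le t) x
    rwa [divergence, Fin.sum_univ_two] at this
  eq_psi t ht x := by
    obtain ⟨d, hd, e⟩ := hs.eq_psi t ht x
    rw [clamp_of_mem (Set.Ioo_subset_Icc_self ht)]
    refine (hasDerivAt_clamp ht hd).congr_deriv ?_
    rw [advect, Fin.sum_univ_two] at e
    linear_combination e
  eq_v0 t ht x := by
    obtain ⟨d, hd, e⟩ := hs.eq_v1 t ht x
    rw [clamp_of_mem (Set.Ioo_subset_Icc_self ht)]
    refine (hasDerivAt_clamp ht hd).congr_deriv ?_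
    rw [advect, laplace, divergence, Fin.sum_univ_two, Fin.sum_univ_two, Fin.sum_univ_two] at e
    rw [velRate0]
    linear_combination e
  eq_v1 t ht x := by
    obtain ⟨d, hd, e⟩ := hs.eq_v2 t ht x
    rw [clamp_of_mem (Set.Ioo_subset_Icc_self ht)]
    refine (hasDerivAt_clamp ht hd).congr_deriv ?_
    rw [advect, laplace, laplace, divergence, Fin.sum_univ_two, Fin.sum_univ_two, Fin.sum_univ_two,
      Fin.sum_univ_two] at e
    have hc : (fun y => pd 1 (ψ t) y * pd 0 (ψ t) y) = fun y => pd 0 (ψ t) y * pd 1 (ψ t) y := by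
      ext y; exact mul_comm _ _
    rw [hc] at e
    rw [velRate1]
    linear_combination e

/-! ### Combination of the low and high frequencies -/

/-- The square integrable Sobolev norms. -/
def decayNorm (ψ : ℝ → Plane → ℝ) (v : ℝ → Fin 2 → Plane → ℝ) (t : ℝ) : ℝ≥0∞ :=
  sobolevNorm 2 (gradVec (v t)) + sobolevNorm 1 (grad (pd 0 (ψ t)))

/-- The Wiener norms of the decaying unknowns. -/
def wienerNorm (ψ : ℝ → Plane → ℝ) (v : ℝ → Fin 2 → Plane → ℝ) (t : ℝ) : ℝ≥0∞ :=
  wiener (v t 0) + wiener (v t 1) + wiener (pd 0 (ψ t))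

lemma aemeasurable_of_clamp {T : ℝ} {f : ℝ → ℝ≥0∞}
    (hf : Measurable fun t => f (clamp T t)) :
    AEMeasurable f (volume.restrict (Set.Icc 0 T)) :=
  ⟨_, hf, (ae_restrict_iff' measurableSet_Icc).2 (Eventually.of_forall fun t ht => by
    simp only [clamp_of_mem ht])⟩

lemma IsSolution.aemeasurable_sobolevNorm_v (hs : IsSolution T ψ₀ v₀ ψ v p) (hT : 0 < T) :
    AEMeasurable (fun t => sobolevNorm 2 (gradVec (v t))) (volume.restrict (Set.Icc 0 T)) :=
  aemeasurable_of_clamp (measurable_sobolevNorm (F := fun t => gradVec (v (clamp T t)))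
    fun ij => ((hs.smooth_v ij.2).smooth hT.le).pd ij.1)

lemma IsSolution.aemeasurable_sobolevNorm_psi (hs : IsSolution T ψ₀ v₀ ψ v p) (hT : 0 < T) :
    AEMeasurable (fun t => sobolevNorm 1 (grad (pd 0 (ψ t)))) (volume.restrict (Set.Icc 0 T)) :=
  aemeasurable_of_clamp (measurable_sobolevNorm (F := fun t => grad (pd 0 (ψ (clamp T t))))
    fun i => ((hs.smooth_psi.smooth hT.le).pd 0).pd i)

lemma IsSolution.aemeasurable_decayNorm (hs : IsSolution T ψ₀ v₀ ψ v p) (hT : 0 < T) :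
    AEMeasurable (decayNorm ψ v) (volume.restrict (Set.Icc 0 T)) :=
  (hs.aemeasurable_sobolevNorm_v hT).add (hs.aemeasurable_sobolevNorm_psi hT)

lemma IsSolution.timeNorm_decayNorm_le (hs : IsSolution T ψ₀ v₀ ψ v p) (hT : 0 < T) :
    timeNorm 2 T (decayNorm ψ v) ≤ A1 T ψ v := by
  refine (timeNorm_add_le (hs.aemeasurable_sobolevNorm_v hT)
    (hs.aemeasurable_sobolevNorm_psi hT)).trans ?_
  unfold A1
  exact add_le_add le_add_self le_rfl

lemma IsSolution.aemeasurable_wiener_v (hs : IsSolution T ψ₀ v₀ ψ v p) (hm : MemE2 T ψ v p)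
    (i : Fin 2) : AEMeasurable (fun t => wiener (v t i)) (volume.restrict (Set.Icc 0 T)) :=
  aemeasurable_wiener (hm.cont_v.memLp i fun t ht => ((hs.smooth_v i).1 t ht).continuous)
    (hm.cont_v.tendsto i)

lemma IsSolution.aemeasurable_wiener_psi (hs : IsSolution T ψ₀ v₀ ψ v p) (hm : MemE2 T ψ v p) :
    AEMeasurable (fun t => wiener (pd 0 (ψ t))) (volume.restrict (Set.Icc 0 T)) :=
  aemeasurable_wiener (f := fun t => pd 0 (ψ t)) (hm.cont_grad_psi.memLp 0 fun t ht =>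
    continuous_pd ((hs.smooth_psi.1 t ht).of_le (by norm_num)) 0) (hm.cont_grad_psi.tendsto 0)

lemma IsSolution.aemeasurable_wienerNorm (hs : IsSolution T ψ₀ v₀ ψ v p) (hm : MemE2 T ψ v p) :
    AEMeasurable (wienerNorm ψ v) (volume.restrict (Set.Icc 0 T)) :=
  ((hs.aemeasurable_wiener_v hm 0).add (hs.aemeasurable_wiener_v hm 1)).add
    (hs.aemeasurable_wiener_psi hm)

lemma IsSolution.timeNorm_wienerNorm_le (hs : IsSolution T ψ₀ v₀ ψ v p) (hm : MemE2 T ψ v p) :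
    timeNorm 2 T (wienerNorm ψ v) ≤ 2 * A2 T ψ v := by
  have h0 := hs.aemeasurable_wiener_v hm 0
  have h1 := hs.aemeasurable_wiener_v hm 1
  have ha := hs.aemeasurable_wiener_psi hm
  have nv : ∀ i, timeNorm 2 T (fun t => wiener (v t i))
      ≤ timeNorm 2 T (fun t => fourierL1 (fun _ => 1) (v t)) := fun i =>
    timeNorm_mono fun t _ => wiener_le_fourierL1 (v t) i
  have na : timeNorm 2 T (fun t => wiener (pd 0 (ψ t)))
      ≤ timeNorm 2 T (fun t => fourierL1 (fun _ => 1) fun _ : Unit => pd 0 (ψ t)) :=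
    timeNorm_mono fun t _ => wiener_le_fourierL1 (fun _ : Unit => pd 0 (ψ t)) ()
  refine (timeNorm_add_le (h0.add h1) ha).trans ?_
  refine (add_le_add (timeNorm_add_le h0 h1) le_rfl).trans ?_
  rw [A2, two_mul, add_add_add_comm]
  exact add_le_add (add_le_add (nv 0) (nv 1)) (na.trans le_self_add)

lemma A2_le_timeNorm_wienerNorm (T : ℝ) (ψ : ℝ → Plane → ℝ) (v : ℝ → Fin 2 → Plane → ℝ) :
    A2 T ψ v ≤ 2 * timeNorm 2 T (wienerNorm ψ v) := by
  rw [A2, two_mul]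
  refine add_le_add (timeNorm_mono fun t _ => ?_) (timeNorm_mono fun t _ => ?_)
  · refine (fourierL1_le_wiener (v t)).trans ?_
    rw [Fin.sum_univ_two]
    exact le_self_add
  · refine (fourierL1_le_wiener fun _ : Unit => pd 0 (ψ t)).trans ?_
    simp only [Finset.univ_unique, Finset.sum_const, Finset.card_singleton, one_smul]
    exact le_add_self

lemma decayBound_v (ψ : ℝ → Plane → ℝ) (v : ℝ → Fin 2 → Plane → ℝ) (t : ℝ) (i : Fin 2) :
    DecayBound (decayNorm ψ v t) (wienerNorm ψ v t) (v t i) := by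
  refine ⟨fun j => (eLpNorm_le_sobolevNorm (gradVec (v t)) (j, i) (0, 0) (by simp)).trans
    le_self_add, ?_⟩
  fin_cases i
  exacts [le_self_add.trans le_self_add, le_add_self.trans le_self_add]

lemma decayBound_psi (ψ : ℝ → Plane → ℝ) (v : ℝ → Fin 2 → Plane → ℝ) (t : ℝ) :
    DecayBound (decayNorm ψ v t) (wienerNorm ψ v t) (pd 0 (ψ t)) :=
  ⟨fun i => (eLpNorm_le_sobolevNorm (grad (pd 0 (ψ t))) i (0, 0) (by simp)).trans le_add_self,
    le_add_self⟩

lemma IsSolution.sliceBound (hs : IsSolution T ψ₀ v₀ ψ v p) (hT : 0 < T) (hA : A1 T ψ v ≤ 1)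
    (t : ℝ) : SliceBound wienerConst (A1 T ψ v) (decayNorm ψ v (clamp T t))
      (wienerNorm ψ v (clamp T t)) (pd 0 (ψ (clamp T t))) (pd 1 (ψ (clamp T t)))
      (v (clamp T t) 0) (v (clamp T t) 1) where
  one_le := le_self_add
  le_one := hA
  base_a := (baseBound_of_sobolev (((hs.smooth_psi.smooth hT.le).pd 0).contDiff t)
    (hA.trans_lt ENNReal.one_lt_top) (hs.eLpNorm_psi_le hT 0 t)).1
  base_q := (baseBound_of_sobolev (((hs.smooth_psi.smooth hT.le).pd 1).contDiff t)
    (hA.trans_lt ENNReal.one_lt_top) (hs.eLpNorm_psi_le hT 1 t)).1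
  base_v0 := (baseBound_of_sobolev ((((hs.smooth_v 0).smooth hT.le).of_le (by norm_num)).contDiff t)
    (hA.trans_lt ENNReal.one_lt_top) (hs.eLpNorm_v_le hT 0 t)).1
  base_v1 := (baseBound_of_sobolev ((((hs.smooth_v 1).smooth hT.le).of_le (by norm_num)).contDiff t)
    (hA.trans_lt ENNReal.one_lt_top) (hs.eLpNorm_v_le hT 1 t)).1
  decay_a := decayBound_psi ψ v _
  decay_v0 := decayBound_v ψ v _ 0
  decay_v1 := decayBound_v ψ v _ 1

/-- The constant in the estimate of the high frequencies. -/
def highConst : ℝ≥0∞ := cHigh * ENNReal.ofReal (2 * Real.pi) * 12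

lemma highConst_lt_top : highConst < ∞ :=
  ENNReal.mul_lt_top (ENNReal.mul_lt_top cHigh_lt_top ENNReal.ofReal_lt_top) (by norm_num)

lemma wiener_le_low_add {f : Plane → ℝ} {d : ℝ≥0∞} (hf : ContDiff ℝ (2 : ℕ) f) (hr : Reg f)
    (h2 : ∀ i, MemLp (pd i (pd i f)) 2 (volume : Measure Plane))
    (b1 : ∀ i, eLpNorm (pd i f) 2 volume ≤ d) (b2 : ∀ i, eLpNorm (pd i (pd i f)) 2 volume ≤ d) :
    wiener f ≤ (∫⁻ ξ in lowRegion, ‖hat f ξ‖ₑ) + cHigh * ENNReal.ofReal (2 * Real.pi) * 4 * d := by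
  rw [wiener, ← lintegral_add_compl _ measurableSet_lowRegion]
  gcongr
  refine (lintegral_high_le hf hr h2).trans ?_
  calc _ ≤ cHigh * ENNReal.ofReal (2 * Real.pi) * (d + d + (d + d)) := by
        unfold gradNorm
        gcongr
        exacts [b1 0, b1 1, b2 0, b2 1]
    _ = _ := by ring

lemma IsSolution.wienerNorm_le (hs : IsSolution T ψ₀ v₀ ψ v p) (hm : MemE2 T ψ v p) (hT : 0 < T)
    (hA : A1 T ψ v < ∞) (t : ℝ) : wienerNorm ψ v (clamp T t)
      ≤ LowSystem.lowPart (pd 0 (ψ (clamp T t))) (v (clamp T t) 0) (v (clamp T t) 1)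
        + highConst * decayNorm ψ v (clamp T t) := by
  have S := hs.globalSolution hm hT hA
  have sv : ∀ i j, eLpNorm (pd j (pd j (v (clamp T t) i))) 2 volume
      ≤ decayNorm ψ v (clamp T t) := fun i j => by
    refine le_trans ?_ le_self_add
    fin_cases j
    exacts [eLpNorm_le_sobolevNorm (gradVec (v (clamp T t))) (0, i) (1, 0) (by simp),
      eLpNorm_le_sobolevNorm (gradVec (v (clamp T t))) (1, i) (0, 1) (by simp)]
  have sa : ∀ j, eLpNorm (pd j (pd j (pd 0 (ψ (clamp T t))))) 2 volume
      ≤ decayNorm ψ v (clamp T t) := fun j => by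
    refine le_trans ?_ le_add_self
    fin_cases j
    exacts [eLpNorm_le_sobolevNorm (grad (pd 0 (ψ (clamp T t)))) 0 (1, 0) (by simp),
      eLpNorm_le_sobolevNorm (grad (pd 0 (ψ (clamp T t)))) 1 (0, 1) (by simp)]
  have ma : ∀ j, MemLp (pd j (pd j (pd 0 (ψ (clamp T t))))) 2 (volume : Measure Plane) := fun j => by
    refine ⟨((S.smooth_psi.pd 0).pd j |>.pd j).continuous_apply t |>.aestronglyMeasurable, ?_⟩
    refine lt_of_le_of_lt ?_ hA
    fin_cases j
    exacts [hs.eLpNorm_psi_le hT 0 t (2, 0) (by simp), hs.eLpNorm_psi_le hT 0 t (0, 2) (by simp)]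
  have w0 := wiener_le_low_add ((S.smooth_v0.contDiff t).of_le (by norm_num)) (S.reg_v0.reg t)
    (fun i => (S.l2_v0 i).memLp t) (decayBound_v ψ v (clamp T t) 0).pd (sv 0)
  have w1 := wiener_le_low_add ((S.smooth_v1.contDiff t).of_le (by norm_num)) (S.reg_v1.reg t)
    (fun i => (S.l2_v1 i).memLp t) (decayBound_v ψ v (clamp T t) 1).pd (sv 1)
  have wa := wiener_le_low_add ((S.smooth_psi.pd 0).contDiff t) (S.reg_a.reg t) ma
    (decayBound_psi ψ v (clamp T t)).pd sa
  have e : LowSystem.lowPart (pd 0 (ψ (clamp T t))) (v (clamp T t) 0) (v (clamp T t) 1)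
      = (∫⁻ ξ in lowRegion, ‖hat (v (clamp T t) 0) ξ‖ₑ)
        + (∫⁻ ξ in lowRegion, ‖hat (v (clamp T t) 1) ξ‖ₑ)
        + ∫⁻ ξ in lowRegion, ‖hat (pd 0 (ψ (clamp T t))) ξ‖ₑ := by
    have m : AEMeasurable (fun ξ => ‖hat (v (clamp T t) 0) ξ‖ₑ + ‖hat (v (clamp T t) 1) ξ‖ₑ)
        (volume.restrict lowRegion) := ((aemeasurable_hat _).add (aemeasurable_hat _)).restrict
    rw [LowSystem.lowPart, lintegral_add_left' m, lintegral_add_left' (aemeasurable_hat _).restrict]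
  rw [e]
  refine (add_le_add (add_le_add w0 w1) wa).trans (le_of_eq ?_)
  unfold highConst
  ring

/-- The estimate for small solutions. -/
theorem IsSolution.A2_le (hs : IsSolution T ψ₀ v₀ ψ v p) (hm : MemE2 T ψ v p) (hT : 0 < T)
    (hA : A1 T ψ v ≤ 1) :
    A2 T ψ v ≤ 96 * A20 ψ₀ v₀ + 4 * highConst * A1 T ψ v
      + 160000000 * wienerConst * AT T ψ v ^ 2 := by
  have hA' : A1 T ψ v < ∞ := hA.trans_lt ENNReal.one_lt_top
  have S := (hs.globalSolution hm hT hA').lowSystem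
  have hd := hs.aemeasurable_decayNorm hT
  have hF := hs.aemeasurable_wienerNorm hm
  have hX : timeNorm 2 T (fun t => wienerNorm ψ v t + decayNorm ψ v t) ≤ 2 * AT T ψ v := by
    refine (timeNorm_add_le hF hd).trans ?_
    rw [AT, mul_add, add_comm (2 * A1 T ψ v)]
    refine add_le_add (hs.timeNorm_wienerNorm_le hm) ((hs.timeNorm_decayNorm_le hT).trans ?_)
    rw [two_mul]
    exact le_self_add
  have c0 : clamp T 0 = 0 := clamp_of_mem ⟨le_rfl, hT.le⟩
  have low := S.timeNorm_lowPart_le hT.le (κ := wienerConst) (α := A1 T ψ v) (X := 2 * AT T ψ v)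
    (d := decayNorm ψ v) (F := wienerNorm ψ v)
    (fun t ht => by
      have := hs.sliceBound hT hA t
      rwa [clamp_of_mem ht] at this ⊢)
    hd hF (by rw [two_mul]; exact le_self_add.trans le_self_add) hX (g := grad ψ₀) (w := v₀)
    (by rw [c0, hs.init_psi]; rfl) (by rw [c0, hs.init_psi]; rfl) (by rw [c0, hs.init_v])
    (by rw [c0, hs.init_v])
  refine (A2_le_timeNorm_wienerNorm T ψ v).trans ?_
  -- The Wiener norm is split into its low-frequency part and a part bounded by the square
  -- integrable derivatives; the latter produces the term linear in A₁.
  calc _ ≤ 2 * timeNorm 2 T (fun t => LowSystem.lowPart (pd 0 (ψ (clamp T t))) (v (clamp T t) 0)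
        (v (clamp T t) 1) + highConst * decayNorm ψ v t) := by
        gcongr
        refine timeNorm_mono fun t ht => ?_
        have := hs.wienerNorm_le hm hT hA' t
        rwa [clamp_of_mem ht] at this ⊢
    _ ≤ 2 * (2 * (timeNorm 2 T (fun t => LowSystem.lowPart (pd 0 (ψ (clamp T t)))
        (v (clamp T t) 0) (v (clamp T t) 1)) + highConst * timeNorm 2 T (decayNorm ψ v))) := by
        gcongr
        refine (timeNorm_add_le_two_mul _ (hd.const_mul _)).trans ?_
        rw [timeNorm_const_mul _ hd]
    _ ≤ 2 * (2 * (24 * A20 ψ₀ v₀ + 10000000 * (wienerConst * (2 * AT T ψ v) ^ 2)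
        + highConst * A1 T ψ v)) := by
        gcongr
        · exact low
        · exact hs.timeNorm_decayNorm_le hT
    _ = _ := by ring

end Solution

end MHD
end

theorem mainTheorem3 :
    ∃ C : ℝ≥0, 0 < C ∧ ∀ T : ℝ, 0 < T →
      ∀ (ψ₀ : MHD.Plane → ℝ) (v₀ : Fin 2 → MHD.Plane → ℝ)
        (ψ : ℝ → MHD.Plane → ℝ) (v : ℝ → Fin 2 → MHD.Plane → ℝ) (p : ℝ → MHD.Plane → ℝ),
        MHD.IsSolution T ψ₀ v₀ ψ v p → MHD.MemE2 T ψ v p →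
          MHD.A2 T ψ v
            ≤ C * MHD.A20 ψ₀ v₀ + C * MHD.A1 T ψ v + C * MHD.AT T ψ v ^ 2 := by
  set K : ℝ≥0∞ := 96 + 4 * MHD.highConst + 160000000 * MHD.wienerConst with hK
  have hKfin : K ≠ ∞ := ENNReal.add_ne_top.2 ⟨ENNReal.add_ne_top.2 ⟨by norm_num,
    ENNReal.mul_ne_top (by norm_num) MHD.highConst_lt_top.ne⟩,
    ENNReal.mul_ne_top (by norm_num) MHD.wienerConst_lt_top.ne⟩
  have hK1 : 1 ≤ K := by
    rw [hK, add_assoc]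
    exact le_trans (by norm_num) le_self_add
  refine ⟨K.toNNReal, ENNReal.toNNReal_pos (zero_lt_one.trans_le hK1).ne' hKfin, ?_⟩
  intro T hT ψ₀ v₀ ψ v p hs hm
  rw [ENNReal.coe_toNNReal hKfin]
  -- Smallness of A₁ is needed only for the cubic terms and for finiteness. When A₁ ≥ 1, also A_T ≥
  -- 1, and A₂ ≤ A_T ≤ A_T² already gives the claim.
  rcases le_total (MHD.A1 T ψ v) 1 with hA | hA
  · refine (hs.A2_le hm hT hA).trans ?_
    gcongr
    · exact le_self_add.trans le_self_add
    · exact le_add_self.trans le_self_add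
    · exact le_add_self
  · have h1 : 1 ≤ MHD.AT T ψ v := hA.trans le_self_add
    calc MHD.A2 T ψ v ≤ MHD.AT T ψ v := le_add_self
      _ = 1 * (1 * MHD.AT T ψ v) := by rw [one_mul, one_mul]
      _ ≤ K * (MHD.AT T ψ v * MHD.AT T ψ v) := by gcongr
      _ = K * MHD.AT T ψ v ^ 2 := by rw [pow_two]
      _ ≤ _ := le_add_self
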